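/- Let $X$ be a compact complex manifold of dimension $3$ with a nowhere vanishing holomorphic $(3,0)$-form $\Omega$, let $E\to X$ be a holomorphic vector bundle, let $\alpha'>0$, and let $\Phi_0$ be a closed smooth real $(2,2)$-form on $X$. For a Hermitian metric $\omega=i\,\omega_{\bar kj}dz^j\wedge d\bar z^k$ on $X$ put $\|\Omega\|_\omega=|\Omega_{123}|\,(\det\omega_{\bar kj})^{-1/2}$ where $\Omega=\Omega_{123}\,dz^1\wedge dz^2\wedge dz^3$. Let $R=i\,R_{\bar kj}dz^j\wedge d\bar z^k$ and $F=i\,F_{\bar kj}dz^j\wedge d\bar z^k$ be the curvatures of the Chern connections of $\omega$ on $T^{1,0}X$ and of a Hermitian metric $H$ on $E$, with $R_{\bar kj}=[D_j,D_{\bar k}]$, $F_{\bar kj}=[D_j,D_{\bar k}]$, and let $\Lambda F=\omega^{j\bar k}F_{\bar kj}$. The Anomaly flow for $(X,E)$ is $$\partial_t(\|\Omega\|_\omega\omega^2)=i\partial\bar\partial\omega+\alpha'\big(\mathrm{Tr}(R\wedge R)-\mathrm{Tr}(F\wedge F)\big),\qquad H^{-1}\partial_tH=-\Lambda F,\tag{1}$$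 and the Anomaly flow for $X$ is $$\partial_t(\|\Omega\|_\omega\omega^2)=i\partial\bar\partial\omega+\alpha'\big(\mathrm{Tr}(R\wedge R)-\Phi_0\big).\tag{2}$$ A real $(2,2)$-form $\Psi$ is called positive if $\Psi\wedge i\eta\wedge\bar\eta$ is a positive $(3,3)$-form for every nonzero $(1,0)$-form $\eta$. All metrics and forms are smooth. (a) The map $\omega\mapsto\Psi=\|\Omega\|_\omega\omega^2$ is a bijection from the Hermitian metrics on $X$ onto the positive $(2,2)$-forms on $X$, and in each holomorphic chart the value of $\omega$ at a point is a smooth function of the point and of the value of $\Psi$ there. Equation (2) is the flow of a unique vector field on the space of Hermitian metrics $\omega$ (with values in the smooth real $(1,1)$-forms), and equivalently of a unique vector field on the space of positive $(2,2)$-forms $\Psi$ (with values in the smooth real $(2,2)$-forms): a smooth curve of metrics satisfies (2) at a time $t$ if and only if its velocity at time $t$ is the value of the vector field. Similarly, (1) is the flow of a unique vector field on the space of pairs $(\omega,H)$, and of a unique vector field on the space of pairs $(\Psi,H)$. These vector fields are local: in local coordinates and local trivializations the value of the vector field at a point is a smooth function of the point and of the underlying metrics (respectively of $\Psi$ and $H$)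 and their derivatives up to order two at that point. (b) The right-hand sides of (2) and of the first equation of (1) are closed forms. If $\omega(t)$, or $(\omega(t),H(t))$, is a smooth solution of (2), or of (1), on a time interval $[0,T)$, $0<T\le\infty$, and the initial metric $\omega_0=\omega(0)$ satisfies $d(\|\Omega\|_{\omega_0}\omega_0^2)=0$, then $d(\|\Omega\|_{\omega(t)}\omega(t)^2)=0$ for all $t\in[0,T)$. (c) Let $(\omega(t),H(t))$ be a smooth solution of (1) on $[0,\infty)$ with $d(\|\Omega\|_{\omega_0}\omega_0^2)=0$. If it converges as $t\to\infty$ (in $C^2$, in particular if it converges in $C^\infty$) to a pair $(\omega_\infty,H_\infty)$ of Hermitian metrics on $X$ and $E$, then this pair satisfies the Strominger system $$F_\infty\wedge\omega_\infty^2=0,\quad F_\infty^{2,0}=F_\infty^{0,2}=0,\quad i\partial\bar\partial\omega_\infty=\alpha'\big(\mathrm{Tr}(F_\infty\wedge F_\infty)-\mathrm{Tr}(R_\infty\wedge R_\infty)\big),\quad d(\|\Omega\|_{\omega_\infty}\omega_\infty^2)=0.$$ Similarly, if $\omega(t)$ is a smooth solution of (2) on $[0,\infty)$ with $d(\|\Omega\|_{\omega_0}\omega_0^2)=0$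 that converges as $t\to\infty$ in $C^2$ to a Hermitian metric $\omega_\infty$, then $$i\partial\bar\partial\omega_\infty=-\alpha'\big(\mathrm{Tr}(R_\infty\wedge R_\infty)-\Phi_0\big),\qquad d(\|\Omega\|_{\omega_\infty}\omega_\infty^2)=0.$$ -/

import Mathlib

open scoped Manifold ContDiff Bundle Topology ComplexConjugate ComplexOrder

noncomputable section

namespace AnomalyFlow

/-! ### Forms on `ℂ³` with complex values, of real degree `k` -/

/-- The model space `ℂ³`. -/
abbrev C3 : Type := Fin 3 → ℂ

/-- Complex-valued alternating real `k`-forms on the real vector space `ℂ³`. -/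
abbrev Alt (k : ℕ) : Type := C3 [⋀^Fin k]→L[ℝ] ℂ

/-- The standard complex basis `∂/∂x_j` of `ℂ³`. -/
def bas (j : Fin 3) : C3 := Pi.single j 1

/-- Multiplication by `i` on `ℂ³`, as a real linear map. -/
def mulI : C3 →L[ℝ] C3 :=
  LinearMap.toContinuousLinearMap
    { toFun := fun v => Complex.I • v
      map_add' := fun u v => smul_add _ u v
      map_smul' := fun c v => smul_comm _ c v }

/-- The multilinear map `v ↦ a (v₁, …, v_k) b (v_{k+1}, …, v_{k+l})`. -/
def tensorMul {k l : ℕ} (a : Alt k) (b : Alt l) :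
    ContinuousMultilinearMap ℝ (fun _ : Fin (k + l) => C3) ℂ where
  toMultilinearMap :=
    (LinearMap.mul' ℝ ℂ).compMultilinearMap
      ((MultilinearMap.domCoprod a.toMultilinearMap b.toMultilinearMap).domDomCongr finSumFinEquiv)
  cont := by
    have h : Continuous fun v : Fin (k + l) → C3 =>
        a (fun i => v (Fin.castAdd l i)) * b (fun i => v (Fin.natAdd k i)) := by
      refine (a.cont.comp ?_).mul (b.cont.comp ?_) <;>
        exact continuous_pi fun i => continuous_apply _
    exact h

theorem tensorMul_apply {k l : ℕ} (a : Alt k) (b : Alt l) (v : Fin (k + l) → C3) :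
    tensorMul a b v = a (fun i => v (Fin.castAdd l i)) * b (fun i => v (Fin.natAdd k i)) :=
  rfl

/-- The exterior product
`(a ∧ b)(v) = (1 / (k! l!)) ∑_σ sgn(σ) a (v_σ₁, …, v_σk) b (v_σ(k+1), …, v_σ(k+l))`. -/
def wedge {k l : ℕ} (a : Alt k) (b : Alt l) : Alt (k + l) :=
  ((k.factorial * l.factorial : ℝ)⁻¹) • ContinuousMultilinearMap.alternatization (tensorMul a b)

/-- A form is real if it takes real values on real tangent vectors. -/
def IsReal {k : ℕ} (a : Alt k) : Prop := ∀ v, (a v).im = 0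

/-- A `k`-form, `k = p + q`, is of type `(p, q)`. -/
def IsOfType {k : ℕ} (p q : ℕ) (a : Alt k) : Prop :=
  ∀ (c : ℂ) (v : Fin k → C3), a (fun i => c • v i) = c ^ p * conj c ^ q * a v

/-- The coefficient `a_{k̄j}` in the expansion `i a_{k̄j} dz^j ∧ dz̄^k` of the `(1,1)`-part of a
`2`-form, that is `-i a(∂/∂z_j, ∂/∂z̄_k)` with the complex bilinear extension of `a`. -/
def coeff11 (a : Alt 2) (k j : Fin 3) : ℂ :=
  -Complex.I * ((1 / 4 : ℂ) *
    (a ![bas j, bas k] + Complex.I * a ![bas j, mulI (bas k)]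
      - Complex.I * a ![mulI (bas j), bas k] + a ![mulI (bas j), mulI (bas k)]))

/-- The `(2,0)`-part of a `2`-form. -/
def part20 (a : Alt 2) (u v : C3) : ℂ :=
  (1 / 4 : ℂ) * (a ![u, v] - Complex.I * a ![mulI u, v] - Complex.I * a ![u, mulI v]
    - a ![mulI u, mulI v])

/-- The `(0,2)`-part of a `2`-form. -/
def part02 (a : Alt 2) (u v : C3) : ℂ :=
  (1 / 4 : ℂ) * (a ![u, v] + Complex.I * a ![mulI u, v] + Complex.I * a ![u, mulI v]
    - a ![mulI u, mulI v])

/-- The matrix `(ω_{k̄j})` of `ω = i ω_{k̄j} dz^j ∧ dz̄^k`, with row `k` and column `j`. -/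
def gram (a : Alt 2) : Matrix (Fin 3) (Fin 3) ℂ := Matrix.of fun k j => coeff11 a k j

/-- Real forms of type `(p, q)`. -/
def IsRealOfType {k : ℕ} (p q : ℕ) (a : Alt k) : Prop := IsReal a ∧ IsOfType p q a

/-- Positive real `(1,1)`-forms: `a(v, iv) > 0` for all `v ≠ 0`, that is `(a_{k̄j})` is a
positive definite Hermitian matrix. -/
def IsPos11 (a : Alt 2) : Prop :=
  IsRealOfType 1 1 a ∧ ∀ v : C3, v ≠ 0 → 0 < (a ![v, mulI v]).re

/-- The `1`-form given by a complex linear functional. -/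
def form10 (η : C3 →L[ℂ] ℂ) : Alt 1 :=
  ContinuousAlternatingMap.ofSubsingleton ℝ C3 ℂ (0 : Fin 1) (η.restrictScalars ℝ)

/-- The conjugate of the `1`-form given by a complex linear functional. -/
def form01 (η : C3 →L[ℂ] ℂ) : Alt 1 :=
  ContinuousAlternatingMap.ofSubsingleton ℝ C3 ℂ (0 : Fin 1)
    ((Complex.conjCLE : ℂ →L[ℝ] ℂ).comp (η.restrictScalars ℝ))

/-- The oriented real basis `(∂/∂x₁, ∂/∂y₁, ∂/∂x₂, ∂/∂y₂, ∂/∂x₃, ∂/∂y₃)` of `ℂ³`. -/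
def realFrame : Fin 6 → C3 :=
  ![bas 0, mulI (bas 0), bas 1, mulI (bas 1), bas 2, mulI (bas 2)]

/-- Positive real `(2,2)`-forms `Ψ` on `ℂ³`: `Ψ ∧ iη ∧ η̄` is a positive `(3,3)`-form for every
nonzero `(1,0)`-form `η`. -/
def IsPos22 (a : Alt 4) : Prop :=
  IsRealOfType 2 2 a ∧ ∀ η : C3 →L[ℂ] ℂ, η ≠ 0 →
    0 < (wedge a (Complex.I • wedge (form10 η) (form01 η)) realFrame).re

/-- The norm `‖Ω‖_ω = |Ω(∂₁, ∂₂, ∂₃)| (det ω_{k̄j})^{-1/2}` of a `(3,0)`-form. -/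
def normOmega (O : Alt 3) (a : Alt 2) : ℝ :=
  ‖O bas‖ / Real.sqrt (gram a).det.re

/-- The `4`-form `‖Ω‖_ω ω²`. -/
def psi (O : Alt 3) (a : Alt 2) : Alt 4 := normOmega O a • wedge a a

/-! ### Differential operators on forms on open subsets of `ℂ³` -/

/-- `∂ a = ∑_j dz^j ∧ ∂a/∂z_j`. -/
def del {k : ℕ} (a : C3 → Alt k) (z : C3) : Alt (k + 1) :=
  .alternatizeUncurryFin
    ((1 / 2 : ℂ) • (fderiv ℝ a z - Complex.I • (fderiv ℝ a z).comp mulI))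

/-- `∂̄ a = ∑_j dz̄^j ∧ ∂a/∂z̄_j`. -/
def dbar {k : ℕ} (a : C3 → Alt k) (z : C3) : Alt (k + 1) :=
  .alternatizeUncurryFin
    ((1 / 2 : ℂ) • (fderiv ℝ a z + Complex.I • (fderiv ℝ a z).comp mulI))

/-- The connection form `H⁻¹ ∂H` of the Chern connection of a Hermitian matrix function
`H = (H_{ᾱβ})` (row `α`, column `β`) in a holomorphic frame. -/
def chernConn {r : ℕ} (H : C3 → Fin r → Fin r → ℂ) (a b : Fin r) (z : C3) : Alt 1 :=
  ∑ c, (Matrix.of (H z))⁻¹ a c •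
    del (fun y => ContinuousAlternatingMap.constOfIsEmpty ℝ C3 (Fin 0) (H y c b)) z

/-- The curvature form `F = i (dA + A ∧ A) = i F_{k̄j} dz^j ∧ dz̄^k` of the Chern connection `A`,
with `[D_j, D_k̄] = F_{k̄j}`. -/
def chernCurv {r : ℕ} (H : C3 → Fin r → Fin r → ℂ) (a b : Fin r) (z : C3) : Alt 2 :=
  Complex.I • (extDeriv (chernConn H a b) z
    + ∑ c, wedge (chernConn H a c z) (chernConn H c b z))

/-- The curvature form `R` of the Chern connection of the Hermitian metric `ω` on the holomorphic
tangent bundle, in the coordinate frame. -/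
def metricCurv (w : C3 → Alt 2) (a b : Fin 3) (z : C3) : Alt 2 :=
  chernCurv (fun y k j => gram (w y) k j) a b z

/-- `Tr (F ∧ F)`. -/
def trSq {r : ℕ} (F : Fin r → Fin r → C3 → Alt 2) (z : C3) : Alt 4 :=
  ∑ a, ∑ b, wedge (F a b z) (F b a z)

/-- `(Λ F)^a_b = ω^{jk̄} F_{k̄j}^a_b`, with `(ω^{jk̄})` the inverse of `(ω_{k̄j})`. -/
def contract {r : ℕ} (w : Alt 2) (F : Fin r → Fin r → Alt 2) : Matrix (Fin r) (Fin r) ℂ :=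
  Matrix.of fun a b => ∑ j, ∑ k, (gram w)⁻¹ j k * coeff11 (F a b) k j

/-- The right-hand side `i∂∂̄ω + α' (Tr R ∧ R - Φ)`. -/
def rhsX (α : ℝ) (Φ : C3 → Alt 4) (w : C3 → Alt 2) (z : C3) : Alt 4 :=
  Complex.I • del (dbar w) z + α • (trSq (metricCurv w) z - Φ z)

/-- The right-hand side `i∂∂̄ω + α' (Tr R ∧ R - Tr F ∧ F)`. -/
def rhsXE {r : ℕ} (α : ℝ) (w : C3 → Alt 2) (H : C3 → Fin r → Fin r → ℂ) (z : C3) : Alt 4 :=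
  Complex.I • del (dbar w) z + α • (trSq (metricCurv w) z - trSq (chernCurv H) z)

/-! ### Forms on a complex threefold -/

section Threefold

variable (X : Type*) [TopologicalSpace X] [ChartedSpace C3 X]

/-- Complex-valued differential `k`-forms on `X` (no regularity). -/
abbrev DForm (k : ℕ) : Type _ := ∀ x : X, TangentSpace 𝓘(ℝ, C3) x [⋀^Fin k]→L[ℝ] ℂ

variable {X}

/-- The value of a form at a point, as a form on `ℂ³`; the tangent space at `x` is `ℂ³` by means of
the preferred chart at `x`, which is holomorphic. -/
def DForm.at {k : ℕ} (a : DForm X k) (x : X) : Alt k := a x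

/-- The expression of a form in a chart `e`: its pull-back by `e⁻¹`. -/
def rep {k : ℕ} (e : OpenPartialHomeomorph X C3) (a : DForm X k) (z : C3) : Alt k :=
  (a (e.symm z)).compContinuousLinearMap (mfderiv 𝓘(ℝ, C3) 𝓘(ℝ, C3) e.symm z)

/-- Smooth forms. -/
def IsSmoothForm {k : ℕ} (a : DForm X k) : Prop :=
  ∀ e ∈ atlas C3 X, ContDiffOn ℝ ∞ (rep e a) e.target

/-- Closed forms: `dα = 0`. -/
def IsClosedForm {k : ℕ} (a : DForm X k) : Prop :=
  ∀ e ∈ atlas C3 X, ∀ z ∈ e.target, extDeriv (rep e a) z = 0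

/-- Nowhere vanishing holomorphic `(3,0)`-forms: in each chart `f dz¹ ∧ dz² ∧ dz³` with `f`
holomorphic and nowhere zero. -/
def IsHolomorphicVolume (O : DForm X 3) : Prop :=
  (∀ x, IsOfType 3 0 (DForm.at O x)) ∧
  ∀ e ∈ atlas C3 X, DifferentiableOn ℂ (fun z => rep e O z bas) e.target ∧
    ∀ z ∈ e.target, rep e O z bas ≠ 0

variable (X)

/-- Smooth real `k`-forms of type `(p, q)` on `X`. -/
structure RealForm (k p q : ℕ) where
  form : DForm X k
  smooth : IsSmoothForm form
  type : ∀ x, IsRealOfType p q (DForm.at form x)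

/-- Hermitian metrics on `X`, given by their positive `(1,1)`-forms `ω`. -/
structure Metric where
  form : DForm X 2
  smooth : IsSmoothForm form
  pos : ∀ x, IsPos11 (DForm.at form x)

/-- Smooth positive `(2,2)`-forms on `X`. -/
structure PosForm where
  form : DForm X 4
  smooth : IsSmoothForm form
  pos : ∀ x, IsPos22 (DForm.at form x)

variable {X}

/-- The form `Ψ = ‖Ω‖_ω ω²` on `X`. -/
def Psi (O : DForm X 3) (w : DForm X 2) : DForm X 4 :=
  fun x => psi (DForm.at O x) (DForm.at w x)

/-- Curves of forms that are smooth on `J × X`. -/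
def IsSmoothCurve {k : ℕ} (J : Set ℝ) (a : ℝ → DForm X k) : Prop :=
  ∀ e ∈ atlas C3 X, ContDiffOn ℝ ∞ (fun p : ℝ × C3 => rep e (a p.1) p.2) (J ×ˢ e.target)

/-- The derivative in time, at `t`, of a curve of forms on the time interval `J` is `b`. -/
def HasVelocity {k : ℕ} (J : Set ℝ) (a : ℝ → DForm X k) (t : ℝ) (b : DForm X k) : Prop :=
  ∀ e ∈ atlas C3 X, ∀ z ∈ e.target, derivWithin (fun s => rep e (a s) z) J t = rep e b z

end Threefold

/-! ### Hermitian metrics on a holomorphic vector bundle -/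

section Bundle

variable {X : Type*} [TopologicalSpace X] [ChartedSpace C3 X] {r : ℕ}
  {V : X → Type*} [∀ x, AddCommGroup (V x)] [∀ x, Module ℂ (V x)]
  [∀ x, TopologicalSpace (V x)] [TopologicalSpace (Bundle.TotalSpace (Fin r → ℂ) V)]

/-- Sesquilinear forms on the fibres, conjugate linear in the first variable (no regularity). -/
abbrev SesqForm (V : X → Type*) [∀ x, AddCommGroup (V x)] [∀ x, Module ℂ (V x)] : Type _ :=
  ∀ x, V x →ₗ⋆[ℂ] V x →ₗ[ℂ] ℂ

/-- The part of the chart `e` over which the trivialization `τ` is defined. -/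
def dom (e : OpenPartialHomeomorph X C3)
    (τ : Bundle.Trivialization (Fin r → ℂ) (π (Fin r → ℂ) V)) : Set C3 :=
  e.target ∩ e.symm ⁻¹' τ.baseSet

/-- The matrix `(H_{ᾱβ})` of a sesquilinear form in the frame of the trivialization `τ`, as a
function of the coordinates of the chart `e`. -/
def hrep (e : OpenPartialHomeomorph X C3)
    (τ : Bundle.Trivialization (Fin r → ℂ) (π (Fin r → ℂ) V))
    (H : SesqForm V) (z : C3) (a b : Fin r) : ℂ :=
  H (e.symm z) (τ.symm (e.symm z) (Pi.single a 1)) (τ.symm (e.symm z) (Pi.single b 1))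

variable [FiberBundle (Fin r → ℂ) V]

/-- Smooth sesquilinear forms. -/
def IsSmoothSesq (r : ℕ) {V : X → Type*} [∀ x, AddCommGroup (V x)] [∀ x, Module ℂ (V x)]
    [∀ x, TopologicalSpace (V x)] [TopologicalSpace (Bundle.TotalSpace (Fin r → ℂ) V)]
    [FiberBundle (Fin r → ℂ) V] (H : SesqForm V) : Prop :=
  ∀ e ∈ atlas C3 X, ∀ τ : Bundle.Trivialization (Fin r → ℂ) (π (Fin r → ℂ) V),
    MemTrivializationAtlas τ → ContDiffOn ℝ ∞ (hrep e τ H) (dom e τ)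

variable (r V) in
/-- Smooth Hermitian forms on `V`. -/
structure HermForm where
  form : SesqForm V
  smooth : IsSmoothSesq r form
  herm : ∀ x u v, conj (form x u v) = form x v u

variable (r V) in
/-- Smooth Hermitian metrics on `V`. -/
structure HermMetric where
  form : SesqForm V
  smooth : IsSmoothSesq r form
  herm : ∀ x u v, conj (form x u v) = form x v u
  pos : ∀ x v, v ≠ 0 → 0 < (form x v v).re

/-- Curves of sesquilinear forms that are smooth on `J × X`. -/
def IsSmoothSesqCurve (r : ℕ) {V : X → Type*} [∀ x, AddCommGroup (V x)] [∀ x, Module ℂ (V x)]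
    [∀ x, TopologicalSpace (V x)] [TopologicalSpace (Bundle.TotalSpace (Fin r → ℂ) V)]
    [FiberBundle (Fin r → ℂ) V] (J : Set ℝ) (H : ℝ → SesqForm V) : Prop :=
  ∀ e ∈ atlas C3 X, ∀ τ : Bundle.Trivialization (Fin r → ℂ) (π (Fin r → ℂ) V),
    MemTrivializationAtlas τ →
      ContDiffOn ℝ ∞ (fun p : ℝ × C3 => hrep e τ (H p.1) p.2) (J ×ˢ dom e τ)

/-- The derivative in time, at `t`, of a curve of sesquilinear forms on `J` is `K`. -/
def HasSesqVelocity (r : ℕ) {V : X → Type*} [∀ x, AddCommGroup (V x)] [∀ x, Module ℂ (V x)]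
    [∀ x, TopologicalSpace (V x)] [TopologicalSpace (Bundle.TotalSpace (Fin r → ℂ) V)]
    [FiberBundle (Fin r → ℂ) V] (J : Set ℝ) (H : ℝ → SesqForm V) (t : ℝ)
    (K : SesqForm V) : Prop :=
  ∀ e ∈ atlas C3 X, ∀ τ : Bundle.Trivialization (Fin r → ℂ) (π (Fin r → ℂ) V),
    MemTrivializationAtlas τ → ∀ z ∈ dom e τ,
      derivWithin (fun s => hrep e τ (H s) z) J t = hrep e τ K z

/-! ### The flows -/

/-- The time interval `[0, T)`, where `T = ∞` is allowed. -/
def timeInterval (T : EReal) : Set ℝ := {t | 0 ≤ t ∧ (t : EReal) < T}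

/-- The curve `ω(t)` satisfies `∂_t (‖Ω‖_ω ω²) = i∂∂̄ω + α' (Tr R ∧ R - Φ)` at time `t`. -/
def FlowEqX (O : DForm X 3) (α : ℝ) (Φ : DForm X 4) (J : Set ℝ) (w : ℝ → DForm X 2)
    (t : ℝ) : Prop :=
  ∀ e ∈ atlas C3 X, ∀ z ∈ e.target,
    derivWithin (fun s => rep e (Psi O (w s)) z) J t = rhsX α (rep e Φ) (rep e (w t)) z

/-- The curve `(ω(t), H(t))` satisfies `∂_t (‖Ω‖_ω ω²) = i∂∂̄ω + α' (Tr R ∧ R - Tr F ∧ F)` and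
`H⁻¹ ∂_t H = -Λ F` at time `t`. -/
def FlowEqXE (r : ℕ) {V : X → Type*} [∀ x, AddCommGroup (V x)] [∀ x, Module ℂ (V x)]
    [∀ x, TopologicalSpace (V x)] [TopologicalSpace (Bundle.TotalSpace (Fin r → ℂ) V)]
    [FiberBundle (Fin r → ℂ) V] (O : DForm X 3) (α : ℝ) (J : Set ℝ) (w : ℝ → DForm X 2)
    (H : ℝ → SesqForm V) (t : ℝ) : Prop :=
  ∀ e ∈ atlas C3 X, ∀ τ : Bundle.Trivialization (Fin r → ℂ) (π (Fin r → ℂ) V),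
    MemTrivializationAtlas τ → ∀ z ∈ dom e τ,
      derivWithin (fun s => rep e (Psi O (w s)) z) J t
          = rhsXE α (rep e (w t)) (hrep e τ (H t)) z ∧
      (Matrix.of (hrep e τ (H t) z))⁻¹
          * Matrix.of (derivWithin (fun s => hrep e τ (H s) z) J t)
        = -contract (rep e (w t) z) (fun a b => chernCurv (hrep e τ (H t)) a b z)

/-- Smooth solutions on the time interval `J ∋ 0` of the flow on `X`, starting at `ω₀`. -/
structure IsSolutionX (O : DForm X 3) (α : ℝ) (Φ : DForm X 4) (J : Set ℝ) (w₀ : Metric X)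
    (w : ℝ → Metric X) : Prop where
  smooth : IsSmoothCurve J fun s => (w s).form
  init : w 0 = w₀
  eq : ∀ t ∈ J, FlowEqX O α Φ J (fun s => (w s).form) t

/-- Smooth solutions on the time interval `J ∋ 0` of the flow on `(X, V)`, starting at
`(ω₀, H₀)`. -/
structure IsSolutionXE (O : DForm X 3) (α : ℝ) (J : Set ℝ) (w₀ : Metric X) (H₀ : HermMetric r V)
    (w : ℝ → Metric X) (H : ℝ → HermMetric r V) : Prop where
  smooth : IsSmoothCurve J fun s => (w s).form
  smooth' : IsSmoothSesqCurve r J fun s => (H s).form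
  init : w 0 = w₀
  init' : H 0 = H₀
  eq : ∀ t ∈ J, FlowEqXE r O α J (fun s => (w s).form) (fun s => (H s).form) t

/-! ### Vector fields and locality -/

/-- Jets of order two. -/
abbrev Jet2 (A : Type*) [NormedAddCommGroup A] [NormedSpace ℝ A] : Type _ :=
  A × (C3 →L[ℝ] A) × (C3 →L[ℝ] C3 →L[ℝ] A)

/-- The value and the first two derivatives of a function at a point. -/
def jet2 {A : Type*} [NormedAddCommGroup A] [NormedSpace ℝ A] (f : C3 → A) (z : C3) : Jet2 A :=
  (f z, fderiv ℝ f z, fderiv ℝ (fderiv ℝ f) z)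

/-- In a coordinate domain `D`, the output at a point is a smooth function of the point, of the
input and of its derivatives up to order two at that point; the values of the input lie in `S`. -/
def IsLocalExpr {ι A B : Type*} [NormedAddCommGroup A] [NormedSpace ℝ A]
    [NormedAddCommGroup B] [NormedSpace ℝ B] (D : Set C3) (S : Set A)
    (input : ι → C3 → A) (output : ι → C3 → B) : Prop :=
  ∃ L : C3 × Jet2 A → B, ContDiffOn ℝ ∞ L {p | p.1 ∈ D ∧ p.2.1 ∈ S} ∧
    ∀ i, ∀ z ∈ D, output i z = L (z, jet2 (input i) z)

/-- The positive definite Hermitian matrices. -/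
def posMatrices (r : ℕ) : Set (Fin r → Fin r → ℂ) := {h | (Matrix.of h).PosDef}

/-- The flow on `X` is the flow of the vector field `v` on the space of metrics: a smooth curve
`ω(t)` satisfies the flow equation at time `t` exactly if `∂_t ω = v(ω)` at time `t`. -/
def IsFlowFieldX (O : DForm X 3) (α : ℝ) (Φ : DForm X 4) (v : Metric X → RealForm X 2 1 1) :
    Prop :=
  ∀ (T : EReal) (w : ℝ → Metric X), IsSmoothCurve (timeInterval T) (fun s => (w s).form) →
    ∀ t ∈ timeInterval T,
      (FlowEqX O α Φ (timeInterval T) (fun s => (w s).form) t ↔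
        HasVelocity (timeInterval T) (fun s => (w s).form) t (v (w t)).form)

/-- The flow on `X` is the flow of the vector field `v` on the space of positive `(2,2)`-forms
`Ψ = ‖Ω‖_ω ω²`. -/
def IsFormFlowFieldX (O : DForm X 3) (α : ℝ) (Φ : DForm X 4)
    (v : PosForm X → RealForm X 4 2 2) : Prop :=
  ∀ (T : EReal) (w : ℝ → Metric X) (P : ℝ → PosForm X),
    IsSmoothCurve (timeInterval T) (fun s => (w s).form) →
    (∀ s ∈ timeInterval T, (P s).form = Psi O (w s).form) →
    ∀ t ∈ timeInterval T,
      (FlowEqX O α Φ (timeInterval T) (fun s => (w s).form) t ↔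
        HasVelocity (timeInterval T) (fun s => (P s).form) t (v (P t)).form)

/-- The flow on `(X, V)` is the flow of the vector field `v` on the space of pairs of metrics. -/
def IsFlowFieldXE (O : DForm X 3) (α : ℝ)
    (v : Metric X × HermMetric r V → RealForm X 2 1 1 × HermForm r V) : Prop :=
  ∀ (T : EReal) (w : ℝ → Metric X) (H : ℝ → HermMetric r V),
    IsSmoothCurve (timeInterval T) (fun s => (w s).form) →
    IsSmoothSesqCurve r (timeInterval T) (fun s => (H s).form) →
    ∀ t ∈ timeInterval T,
      (FlowEqXE r O α (timeInterval T) (fun s => (w s).form) (fun s => (H s).form) t ↔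
        HasVelocity (timeInterval T) (fun s => (w s).form) t (v (w t, H t)).1.form ∧
        HasSesqVelocity r (timeInterval T) (fun s => (H s).form) t (v (w t, H t)).2.form)

/-- The flow on `(X, V)` is the flow of the vector field `v` on the space of pairs of a positive
`(2,2)`-form `Ψ = ‖Ω‖_ω ω²` and a metric on `V`. -/
def IsFormFlowFieldXE (O : DForm X 3) (α : ℝ)
    (v : PosForm X × HermMetric r V → RealForm X 4 2 2 × HermForm r V) : Prop :=
  ∀ (T : EReal) (w : ℝ → Metric X) (P : ℝ → PosForm X) (H : ℝ → HermMetric r V),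
    IsSmoothCurve (timeInterval T) (fun s => (w s).form) →
    IsSmoothSesqCurve r (timeInterval T) (fun s => (H s).form) →
    (∀ s ∈ timeInterval T, (P s).form = Psi O (w s).form) →
    ∀ t ∈ timeInterval T,
      (FlowEqXE r O α (timeInterval T) (fun s => (w s).form) (fun s => (H s).form) t ↔
        HasVelocity (timeInterval T) (fun s => (P s).form) t (v (P t, H t)).1.form ∧
        HasSesqVelocity r (timeInterval T) (fun s => (H s).form) t (v (P t, H t)).2.form)

/-- A vector field on the space of metrics that is given by local expressions. -/
def IsLocalFieldX (v : Metric X → RealForm X 2 1 1) : Prop :=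
  ∀ e ∈ atlas C3 X, IsLocalExpr e.target {a : Alt 2 | IsPos11 a}
    (fun w : Metric X => rep e w.form) (fun w => rep e (v w).form)

/-- A vector field on the space of positive `(2,2)`-forms that is given by local expressions. -/
def IsLocalFormFieldX (v : PosForm X → RealForm X 4 2 2) : Prop :=
  ∀ e ∈ atlas C3 X, IsLocalExpr e.target {a : Alt 4 | IsPos22 a}
    (fun P : PosForm X => rep e P.form) (fun P => rep e (v P).form)

/-- A vector field on the space of pairs of metrics that is given by local expressions. -/
def IsLocalFieldXE (v : Metric X × HermMetric r V → RealForm X 2 1 1 × HermForm r V) : Prop :=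
  ∀ e ∈ atlas C3 X, ∀ τ : Bundle.Trivialization (Fin r → ℂ) (π (Fin r → ℂ) V),
    MemTrivializationAtlas τ →
      IsLocalExpr (dom e τ) ({a : Alt 2 | IsPos11 a} ×ˢ posMatrices r)
        (fun (m : Metric X × HermMetric r V) z => (rep e m.1.form z, hrep e τ m.2.form z))
        (fun m z => (rep e (v m).1.form z, hrep e τ (v m).2.form z))

/-- A vector field on the space of pairs of a positive `(2,2)`-form and a metric on `V` that is
given by local expressions. -/
def IsLocalFormFieldXE (v : PosForm X × HermMetric r V → RealForm X 4 2 2 × HermForm r V) :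
    Prop :=
  ∀ e ∈ atlas C3 X, ∀ τ : Bundle.Trivialization (Fin r → ℂ) (π (Fin r → ℂ) V),
    MemTrivializationAtlas τ →
      IsLocalExpr (dom e τ) ({a : Alt 4 | IsPos22 a} ×ˢ posMatrices r)
        (fun (m : PosForm X × HermMetric r V) z => (rep e m.1.form z, hrep e τ m.2.form z))
        (fun m z => (rep e (v m).1.form z, hrep e τ (v m).2.form z))

/-! ### Convergence and stationary equations -/

/-- Locally uniform convergence on `D`, as `t → ∞`, with the derivatives up to order two. -/
def TendstoC2 {A : Type*} [NormedAddCommGroup A] [NormedSpace ℝ A] (f : ℝ → C3 → A) (g : C3 → A)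
    (D : Set C3) : Prop :=
  ∀ m ≤ 2, TendstoLocallyUniformlyOn (fun t => iteratedFDeriv ℝ m (f t)) (iteratedFDeriv ℝ m g)
    Filter.atTop D

/-- Convergence of metrics on `X`. -/
def MetricTendsto (w : ℝ → Metric X) (w' : Metric X) : Prop :=
  ∀ e ∈ atlas C3 X, TendstoC2 (fun t => rep e (w t).form) (rep e w'.form) e.target

/-- Convergence of metrics on `V`. -/
def HermMetricTendsto (H : ℝ → HermMetric r V) (H' : HermMetric r V) : Prop :=
  ∀ e ∈ atlas C3 X, ∀ τ : Bundle.Trivialization (Fin r → ℂ) (π (Fin r → ℂ) V),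
    MemTrivializationAtlas τ →
      TendstoC2 (fun t => hrep e τ (H t).form) (hrep e τ H'.form) (dom e τ)

/-- The Strominger system. -/
structure IsStrominger (O : DForm X 3) (α : ℝ) (w : Metric X) (H : HermMetric r V) : Prop where
  yangMills : ∀ e ∈ atlas C3 X, ∀ τ : Bundle.Trivialization (Fin r → ℂ) (π (Fin r → ℂ) V),
    MemTrivializationAtlas τ → ∀ z ∈ dom e τ, ∀ a b,
      wedge (chernCurv (hrep e τ H.form) a b z) (wedge (rep e w.form z) (rep e w.form z)) = 0
  type : ∀ e ∈ atlas C3 X, ∀ τ : Bundle.Trivialization (Fin r → ℂ) (π (Fin r → ℂ) V),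
    MemTrivializationAtlas τ → ∀ z ∈ dom e τ, ∀ a b u v,
      part20 (chernCurv (hrep e τ H.form) a b z) u v = 0 ∧
      part02 (chernCurv (hrep e τ H.form) a b z) u v = 0
  anomaly : ∀ e ∈ atlas C3 X, ∀ τ : Bundle.Trivialization (Fin r → ℂ) (π (Fin r → ℂ) V),
    MemTrivializationAtlas τ → ∀ z ∈ dom e τ,
      Complex.I • del (dbar (rep e w.form)) z
        = α • (trSq (chernCurv (hrep e τ H.form)) z - trSq (metricCurv (rep e w.form)) z)
  balanced : IsClosedForm (Psi O w.form)

/-- The stationary system on `X`. -/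
structure IsStationaryX (O : DForm X 3) (α : ℝ) (Φ : DForm X 4) (w : Metric X) : Prop where
  anomaly : ∀ e ∈ atlas C3 X, ∀ z ∈ e.target,
    Complex.I • del (dbar (rep e w.form)) z
      = -(α • (trSq (metricCurv (rep e w.form)) z - rep e Φ z))
  balanced : IsClosedForm (Psi O w.form)

end Bundle

end AnomalyFlow

end

open AnomalyFlow

namespace AnomalyFlow

/-! ### Alternating sums and explicit formulas for the exterior product -/

section Alternating

/-! Everything rests on linear algebra at a point. A form of type (1,1) on `ℂ³` is a 3×3 matrix `g`;
a form `Ψ` of type (2,2) is determined by the matrix `dual Ψ` of the pairings `Ψ ∧ i dz^j ∧ dz̄^k`,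
and positivity of either form is positive definiteness of its matrix. For `n = |Ω₁₂₃|` the form
`‖Ω‖_ω ω²` has matrix `16 n (det g)^{-1/2} adj g`. In size three `adj (adj g) = det g • g`, so the
square root disappears on inversion: `g = n⁻² adj (dual Ψ / 16)`. The inverse is therefore quadratic
in `Ψ` (`psiInv_psiN`, `psiN_psiInv`). Naturality under holomorphic coordinate changes (`psi_pullC`)
makes it a bijection on the manifold.

The right-hand sides are real of type (2,2) and transform as forms. For `i∂∂̄ω` this follows from
the identity `i∂∂̄ω = -½ d((dω)∘i)`, valid in type (1,1). For the curvature, `F` comes from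
`∂̄(H⁻¹∂H)`, which is conjugated by a holomorphic change of frame (`curvM_gauge`), so traces are
invariant and `ΛF` is an endomorphism. The local expressions glue to global forms, and the
derivative of the inverse map applied to the right-hand side is the velocity of `ω`. All expressions
are smooth in 2-jets, which is locality. For uniqueness, compactness of `X` keeps the lines `ω + tv`
and `H + tK` positive for small `t`, so every tangent vector is the velocity of a curve of metrics,
and two fields with the same flow agree.

The right-hand sides are closed: `∂∂̄ω = d∂̄ω` because `∂̄² = 0`, and `Tr F∧F` can be computed near
a point in a holomorphic frame whose connection form vanishes at that point, where `dF = 0`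
(`IsMetricOn.extDeriv_trSq`). Time and space derivatives commute, so the components of `d(‖Ω‖_ω ω²)`
have zero time derivative and the balanced condition persists.

If a solution converges in `C²`, its velocity, a continuous function of the 2-jet, converges too; by
the mean value inequality a convergent curve with convergent velocity has limiting velocity zero
(`eq_zero_of_tendsto_velocity`). Hence both right-hand sides vanish in the limit. `ΛF = 0` is
equivalent, up to the factor `16 det ω`, to the vanishing of `F ∧ ω²`, and the Chern curvature has
type (1,1) in any case. -/

/-- The signed sum of a function over the permutations of its arguments. -/
noncomputable def altSum {E : Type*} (n : ℕ) (f : (Fin n → E) → ℂ) (v : Fin n → E) : ℂ :=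
  ∑ σ : Equiv.Perm (Fin n), Equiv.Perm.sign σ • f (v ∘ σ)

theorem altSum_comp_perm {E : Type*} {n : ℕ} (f : (Fin n → E) → ℂ) (v : Fin n → E)
    (τ : Equiv.Perm (Fin n)) :
    altSum n f (v ∘ τ) = Equiv.Perm.sign τ • altSum n f v := by
  unfold altSum
  rw [Finset.smul_sum]
  refine Fintype.sum_equiv (Equiv.mulLeft τ) _ _ fun σ => ?_
  rw [Equiv.coe_mulLeft, smul_smul, Equiv.Perm.sign_mul, ← mul_assoc, Int.units_mul_self, one_mul]
  rfl

theorem altSum_of_comp_perm {E : Type*} {n : ℕ} (f : (Fin n → E) → ℂ) (v : Fin n → E)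
    (τ : Equiv.Perm (Fin n)) :
    altSum n (fun w => f (w ∘ τ)) v = Equiv.Perm.sign τ • altSum n f v := by
  unfold altSum
  rw [Finset.smul_sum]
  refine Fintype.sum_equiv (Equiv.mulRight τ) _ _ fun σ => ?_
  rw [Equiv.coe_mulRight, smul_smul, Equiv.Perm.sign_mul, mul_comm, mul_assoc,
    Int.units_mul_self, mul_one]
  rfl

theorem altSum_const_mul {E : Type*} {n : ℕ} (c : ℂ) (f : (Fin n → E) → ℂ) (v : Fin n → E) :
    altSum n (fun w => c * f w) v = c * altSum n f v := by
  simp [altSum, Finset.mul_sum, mul_smul_comm]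

theorem altSum_alternating {k : ℕ} (a : Alt k) (v : Fin k → C3) :
    altSum k (fun w => a w) v = k.factorial * a v := by
  have h : ∀ σ : Equiv.Perm (Fin k), Equiv.Perm.sign σ • a (v ∘ σ) = a v := fun σ => by
    have := a.toAlternatingMap.map_perm v σ
    change Equiv.Perm.sign σ • a.toAlternatingMap (v ∘ σ) = a.toAlternatingMap v
    rw [this, smul_smul, Int.units_mul_self, one_smul]
  simp [altSum, h, Fintype.card_perm]

/-- Laplace expansion along the first argument: a permutation of `n + 1` letters is the image `p` of
`0` together with a permutation of the rest, as in `Equiv.Perm.decomposeFin`. -/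
theorem altSum_succ {E : Type*} {n : ℕ} (f : (Fin (n + 1) → E) → ℂ) (v : Fin (n + 1) → E) :
    altSum (n + 1) f v = ∑ p : Fin (n + 1),
      (-1 : ℂ) ^ (p : ℕ) * altSum n (fun w => f (Fin.cons (v p) w)) (p.removeNth v) := by
  conv_lhs => unfold altSum
  rw [Finset.univ_perm_fin_succ, ← Finset.univ_product_univ]
  simp only [Finset.sum_map, Equiv.toEmbedding_apply, Finset.sum_product]
  refine Finset.sum_congr rfl fun p _ => Fin.cases ?_ (fun i => ?_) p
  · simp only [Fin.val_zero, pow_zero, one_mul, altSum, Equiv.Perm.decomposeFin.symm_sign, if_true]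
    refine Finset.sum_congr rfl fun σ _ => ?_
    congr 2
    funext j
    refine Fin.cases ?_ (fun j => ?_) j
    · simp
    · simp [Equiv.Perm.decomposeFin_symm_apply_succ, Fin.tail]
  -- `decomposeFin` uses the transposition of `0` and `p`, which leaves the other arguments in an
  -- order that differs from `removeNth` by `i.cycleRange`. The sign of this cycle and the sign of
  -- the transposition make up `(-1)^p`.
  · have h1 : ((-1 : ℂ) ^ ((i.succ : Fin (n + 1)) : ℕ)) =
        -((Equiv.Perm.sign i.cycleRange : ℤ) : ℂ) := by
      simp [Fin.sign_cycleRange, pow_succ]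
    have h2 := altSum_comp_perm (fun w => f (Fin.cons (v i.succ) w)) (i.succ.removeNth v)
      i.cycleRange
    rw [h1, neg_mul]
    have h3 : ((Equiv.Perm.sign i.cycleRange : ℤ) : ℂ) *
        altSum n (fun w => f (Fin.cons (v i.succ) w)) (i.succ.removeNth v) =
        altSum n (fun w => f (Fin.cons (v i.succ) w)) (i.succ.removeNth v ∘ i.cycleRange) := by
      rw [h2, Units.smul_def, zsmul_eq_mul]
    rw [h3, altSum, ← Finset.sum_neg_distrib]
    refine Finset.sum_congr rfl fun σ _ => ?_
    rw [Equiv.Perm.decomposeFin.symm_sign, if_neg (Fin.succ_ne_zero i), neg_one_mul,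
      Units.neg_smul]
    congr 3
    funext j
    refine Fin.cases ?_ (fun j => ?_) j
    · simp
    · simp [Equiv.Perm.decomposeFin_symm_apply_succ, Fin.removeNth, Fin.succAbove_cycleRange]

/-- This and the next four expansions unroll `altSum_succ` on explicit lists of vectors, so that
exterior products become polynomials in finitely many components. -/
theorem altSum_two {E : Type*} (f : (Fin 2 → E) → ℂ) (v₀ v₁ : E) :
    altSum 2 f ![v₀, v₁] = f ![v₀, v₁] - f ![v₁, v₀] := by
  have h : altSum 2 f ![v₀, v₁] = ∑ p : Fin 2, (-1 : ℂ) ^ (p : ℕ) *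
      altSum 1 (fun w => f (Fin.cons (![v₀, v₁] p) w)) (p.removeNth ![v₀, v₁]) :=
    altSum_succ (n := 1) f _
  have r : ∀ (x : E) (w : Fin 1 → E), altSum 1 (fun w => f (Fin.cons x w)) w = f ![x, w 0] := by
    intro x w
    simp only [altSum, Finset.univ_unique, Finset.sum_singleton]
    have : (Fin.cons x (w ∘ (default : Equiv.Perm (Fin 1))) : Fin 2 → E) = ![x, w 0] := by
      funext i; fin_cases i <;> rfl
    rw [this]
    simp
  rw [h, Fin.sum_univ_two, r, r]
  have r0 : (Fin.removeNth (0 : Fin 2) ![v₀, v₁]) 0 = v₁ := rfl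
  have r1 : (Fin.removeNth (1 : Fin 2) ![v₀, v₁]) 0 = v₀ := rfl
  rw [r0, r1]
  simp
  ring

theorem altSum_three {E : Type*} (f : (Fin 3 → E) → ℂ) (v₀ v₁ v₂ : E) :
    altSum 3 f ![v₀, v₁, v₂] =
      altSum 2 (fun w => f ![v₀, w 0, w 1]) ![v₁, v₂]
      - altSum 2 (fun w => f ![v₁, w 0, w 1]) ![v₀, v₂]
      + altSum 2 (fun w => f ![v₂, w 0, w 1]) ![v₀, v₁] := by
  have h : altSum 3 f ![v₀, v₁, v₂] = ∑ p : Fin 3, (-1 : ℂ) ^ (p : ℕ) *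
      altSum 2 (fun w => f (Fin.cons (![v₀, v₁, v₂] p) w)) (p.removeNth ![v₀, v₁, v₂]) :=
    altSum_succ (n := 2) f _
  have c : ∀ (x : E) (w : Fin 2 → E), (Fin.cons x w : Fin 3 → E) = ![x, w 0, w 1] := by
    intro x w; funext i; fin_cases i <;> rfl
  have r0 : Fin.removeNth (0 : Fin 3) ![v₀, v₁, v₂] = ![v₁, v₂] := by
    funext i; fin_cases i <;> rfl
  have r1 : Fin.removeNth (1 : Fin 3) ![v₀, v₁, v₂] = ![v₀, v₂] := by
    funext i; fin_cases i <;> rfl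
  have r2 : Fin.removeNth (2 : Fin 3) ![v₀, v₁, v₂] = ![v₀, v₁] := by
    funext i; fin_cases i <;> rfl
  rw [h, Fin.sum_univ_three, r0, r1, r2]
  simp only [c]
  simp
  ring

theorem altSum_four {E : Type*} (f : (Fin 4 → E) → ℂ) (v₀ v₁ v₂ v₃ : E) :
    altSum 4 f ![v₀, v₁, v₂, v₃] =
      altSum 3 (fun w => f ![v₀, w 0, w 1, w 2]) ![v₁, v₂, v₃]
      - altSum 3 (fun w => f ![v₁, w 0, w 1, w 2]) ![v₀, v₂, v₃]
      + altSum 3 (fun w => f ![v₂, w 0, w 1, w 2]) ![v₀, v₁, v₃]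
      - altSum 3 (fun w => f ![v₃, w 0, w 1, w 2]) ![v₀, v₁, v₂] := by
  have h : altSum 4 f ![v₀, v₁, v₂, v₃] = ∑ p : Fin 4, (-1 : ℂ) ^ (p : ℕ) *
      altSum 3 (fun w => f (Fin.cons (![v₀, v₁, v₂, v₃] p) w)) (p.removeNth ![v₀, v₁, v₂, v₃]) :=
    altSum_succ (n := 3) f _
  have c : ∀ (x : E) (w : Fin 3 → E), (Fin.cons x w : Fin 4 → E) = ![x, w 0, w 1, w 2] := by
    intro x w; funext i; fin_cases i <;> rfl
  have r0 : Fin.removeNth (0 : Fin 4) ![v₀, v₁, v₂, v₃] = ![v₁, v₂, v₃] := by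
    funext i; fin_cases i <;> rfl
  have r1 : Fin.removeNth (1 : Fin 4) ![v₀, v₁, v₂, v₃] = ![v₀, v₂, v₃] := by
    funext i; fin_cases i <;> rfl
  have r2 : Fin.removeNth (2 : Fin 4) ![v₀, v₁, v₂, v₃] = ![v₀, v₁, v₃] := by
    funext i; fin_cases i <;> rfl
  have r3 : Fin.removeNth (3 : Fin 4) ![v₀, v₁, v₂, v₃] = ![v₀, v₁, v₂] := by
    funext i; fin_cases i <;> rfl
  rw [h, Fin.sum_univ_four, r0, r1, r2, r3]
  simp only [c]
  simp
  ring

theorem altSum_five {E : Type*} (f : (Fin 5 → E) → ℂ) (v₀ v₁ v₂ v₃ v₄ : E) :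
    altSum 5 f ![v₀, v₁, v₂, v₃, v₄] =
      altSum 4 (fun w => f ![v₀, w 0, w 1, w 2, w 3]) ![v₁, v₂, v₃, v₄]
      - altSum 4 (fun w => f ![v₁, w 0, w 1, w 2, w 3]) ![v₀, v₂, v₃, v₄]
      + altSum 4 (fun w => f ![v₂, w 0, w 1, w 2, w 3]) ![v₀, v₁, v₃, v₄]
      - altSum 4 (fun w => f ![v₃, w 0, w 1, w 2, w 3]) ![v₀, v₁, v₂, v₄]
      + altSum 4 (fun w => f ![v₄, w 0, w 1, w 2, w 3]) ![v₀, v₁, v₂, v₃] := by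
  have h : altSum 5 f ![v₀, v₁, v₂, v₃, v₄] = ∑ p : Fin 5, (-1 : ℂ) ^ (p : ℕ) *
      altSum 4 (fun w => f (Fin.cons (![v₀, v₁, v₂, v₃, v₄] p) w)) (p.removeNth ![v₀, v₁, v₂, v₃, v₄]) :=
    altSum_succ (n := 4) f _
  have c : ∀ (x : E) (w : Fin 4 → E), (Fin.cons x w : Fin 5 → E) = ![x, w 0, w 1, w 2, w 3] := by
    intro x w; funext i; fin_cases i <;> rfl
  have r0 : Fin.removeNth (0 : Fin 5) ![v₀, v₁, v₂, v₃, v₄] = ![v₁, v₂, v₃, v₄] := by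
    funext i; fin_cases i <;> rfl
  have r1 : Fin.removeNth (1 : Fin 5) ![v₀, v₁, v₂, v₃, v₄] = ![v₀, v₂, v₃, v₄] := by
    funext i; fin_cases i <;> rfl
  have r2 : Fin.removeNth (2 : Fin 5) ![v₀, v₁, v₂, v₃, v₄] = ![v₀, v₁, v₃, v₄] := by
    funext i; fin_cases i <;> rfl
  have r3 : Fin.removeNth (3 : Fin 5) ![v₀, v₁, v₂, v₃, v₄] = ![v₀, v₁, v₂, v₄] := by
    funext i; fin_cases i <;> rfl
  have r4 : Fin.removeNth (4 : Fin 5) ![v₀, v₁, v₂, v₃, v₄] = ![v₀, v₁, v₂, v₃] := by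
    funext i; fin_cases i <;> rfl
  rw [h, Fin.sum_univ_five, r0, r1, r2, r3, r4]
  simp only [c]
  simp
  ring

theorem altSum_six {E : Type*} (f : (Fin 6 → E) → ℂ) (v₀ v₁ v₂ v₃ v₄ v₅ : E) :
    altSum 6 f ![v₀, v₁, v₂, v₃, v₄, v₅] =
      altSum 5 (fun w => f ![v₀, w 0, w 1, w 2, w 3, w 4]) ![v₁, v₂, v₃, v₄, v₅]
      - altSum 5 (fun w => f ![v₁, w 0, w 1, w 2, w 3, w 4]) ![v₀, v₂, v₃, v₄, v₅]
      + altSum 5 (fun w => f ![v₂, w 0, w 1, w 2, w 3, w 4]) ![v₀, v₁, v₃, v₄, v₅]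
      - altSum 5 (fun w => f ![v₃, w 0, w 1, w 2, w 3, w 4]) ![v₀, v₁, v₂, v₄, v₅]
      + altSum 5 (fun w => f ![v₄, w 0, w 1, w 2, w 3, w 4]) ![v₀, v₁, v₂, v₃, v₅]
      - altSum 5 (fun w => f ![v₅, w 0, w 1, w 2, w 3, w 4]) ![v₀, v₁, v₂, v₃, v₄] := by
  have h : altSum 6 f ![v₀, v₁, v₂, v₃, v₄, v₅] = ∑ p : Fin 6, (-1 : ℂ) ^ (p : ℕ) *
      altSum 5 (fun w => f (Fin.cons (![v₀, v₁, v₂, v₃, v₄, v₅] p) w)) (p.removeNth ![v₀, v₁, v₂, v₃, v₄, v₅]) :=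
    altSum_succ (n := 5) f _
  have c : ∀ (x : E) (w : Fin 5 → E), (Fin.cons x w : Fin 6 → E) = ![x, w 0, w 1, w 2, w 3, w 4] := by
    intro x w; funext i; fin_cases i <;> rfl
  have r0 : Fin.removeNth (0 : Fin 6) ![v₀, v₁, v₂, v₃, v₄, v₅] = ![v₁, v₂, v₃, v₄, v₅] := by
    funext i; fin_cases i <;> rfl
  have r1 : Fin.removeNth (1 : Fin 6) ![v₀, v₁, v₂, v₃, v₄, v₅] = ![v₀, v₂, v₃, v₄, v₅] := by
    funext i; fin_cases i <;> rfl
  have r2 : Fin.removeNth (2 : Fin 6) ![v₀, v₁, v₂, v₃, v₄, v₅] = ![v₀, v₁, v₃, v₄, v₅] := by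
    funext i; fin_cases i <;> rfl
  have r3 : Fin.removeNth (3 : Fin 6) ![v₀, v₁, v₂, v₃, v₄, v₅] = ![v₀, v₁, v₂, v₄, v₅] := by
    funext i; fin_cases i <;> rfl
  have r4 : Fin.removeNth (4 : Fin 6) ![v₀, v₁, v₂, v₃, v₄, v₅] = ![v₀, v₁, v₂, v₃, v₅] := by
    funext i; fin_cases i <;> rfl
  have r5 : Fin.removeNth (5 : Fin 6) ![v₀, v₁, v₂, v₃, v₄, v₅] = ![v₀, v₁, v₂, v₃, v₄] := by
    funext i; fin_cases i <;> rfl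
  rw [h, Fin.sum_univ_six, r0, r1, r2, r3, r4, r5]
  simp only [c]
  simp
  ring

theorem wedge_eq_altSum {k l : ℕ} (a : Alt k) (b : Alt l) (v : Fin (k + l) → C3) :
    wedge a b v = ((k.factorial * l.factorial : ℝ)⁻¹ : ℝ) *
      altSum (k + l)
        (fun w => a (fun i => w (Fin.castAdd l i)) * b (fun i => w (Fin.natAdd k i))) v := by
  rw [wedge, ContinuousAlternatingMap.smul_apply,
    ContinuousMultilinearMap.alternatization_apply_apply, Complex.real_smul]
  rfl

theorem Alt.swap (a : Alt 2) (u v : C3) : a ![v, u] = -a ![u, v] := by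
  have h := a.toAlternatingMap.map_swap ![u, v] (show (0 : Fin 2) ≠ 1 by decide)
  have e : (![u, v] ∘ Equiv.swap (0 : Fin 2) 1) = ![v, u] := by
    funext i; fin_cases i <;> rfl
  rw [e] at h
  exact h

theorem wedge_one_one (a b : Alt 1) (u v : C3) :
    (wedge a b : Alt 2) ![u, v] = a ![u] * b ![v] - a ![v] * b ![u] := by
  have key : wedge a b ![u, v] = _ := wedge_eq_altSum a b ![u, v]
  refine key.trans ?_
  have e : (fun w : Fin (1 + 1) → C3 => a (fun i => w (Fin.castAdd 1 i)) *
      b (fun i => w (Fin.natAdd 1 i))) = fun w => a ![w 0] * b ![w 1] := by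
    funext w
    congr 2 <;> funext i <;> fin_cases i <;> rfl
  rw [e]
  have := altSum_two (fun w : Fin 2 → C3 => a ![w 0] * b ![w 1]) u v
  refine (congrArg _ this).trans ?_
  simp

/-- The 24 permutations fall into six shuffles, each occurring four times because of the
antisymmetry of the two factors; the prefactor `1 / (2! 2!)` cancels this. -/
theorem wedge_two_two (a b : Alt 2) (v₀ v₁ v₂ v₃ : C3) :
    (wedge a b : Alt 4) ![v₀, v₁, v₂, v₃] =
      a ![v₀, v₁] * b ![v₂, v₃] - a ![v₀, v₂] * b ![v₁, v₃] + a ![v₀, v₃] * b ![v₁, v₂]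
      + a ![v₁, v₂] * b ![v₀, v₃] - a ![v₁, v₃] * b ![v₀, v₂] + a ![v₂, v₃] * b ![v₀, v₁] := by
  have key : wedge a b ![v₀, v₁, v₂, v₃] = _ := wedge_eq_altSum a b ![v₀, v₁, v₂, v₃]
  refine key.trans ?_
  have e : (fun w : Fin (2 + 2) → C3 => a (fun i => w (Fin.castAdd 2 i)) *
      b (fun i => w (Fin.natAdd 2 i))) = fun w => a ![w 0, w 1] * b ![w 2, w 3] := by
    funext w
    congr 2 <;> funext i <;> fin_cases i <;> rfl
  rw [e]
  have h1 := altSum_four (fun w : Fin 4 → C3 => a ![w 0, w 1] * b ![w 2, w 3]) v₀ v₁ v₂ v₃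
  refine (congrArg _ h1).trans ?_
  simp only [altSum_three, altSum_two]
  simp only [Matrix.cons_val]
  rw [Alt.swap a v₀ v₁, Alt.swap a v₀ v₂, Alt.swap a v₀ v₃, Alt.swap a v₁ v₂,
    Alt.swap a v₁ v₃, Alt.swap a v₂ v₃, Alt.swap b v₀ v₁, Alt.swap b v₀ v₂, Alt.swap b v₀ v₃,
    Alt.swap b v₁ v₂, Alt.swap b v₁ v₃, Alt.swap b v₂ v₃]
  norm_num [Nat.factorial]
  ring

/-- The exterior product of a `2`-form and a `4`-form, evaluated at six vectors. -/
theorem wedge_two_four (a : Alt 2) (b : Alt 4) (v₀ v₁ v₂ v₃ v₄ v₅ : C3) :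
    (wedge a b : Alt 6) ![v₀, v₁, v₂, v₃, v₄, v₅] =
      a ![v₀, v₁] * b ![v₂, v₃, v₄, v₅] - a ![v₀, v₂] * b ![v₁, v₃, v₄, v₅]
      + a ![v₀, v₃] * b ![v₁, v₂, v₄, v₅] - a ![v₀, v₄] * b ![v₁, v₂, v₃, v₅]
      + a ![v₀, v₅] * b ![v₁, v₂, v₃, v₄] + a ![v₁, v₂] * b ![v₀, v₃, v₄, v₅]
      - a ![v₁, v₃] * b ![v₀, v₂, v₄, v₅] + a ![v₁, v₄] * b ![v₀, v₂, v₃, v₅]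
      - a ![v₁, v₅] * b ![v₀, v₂, v₃, v₄] + a ![v₂, v₃] * b ![v₀, v₁, v₄, v₅]
      - a ![v₂, v₄] * b ![v₀, v₁, v₃, v₅] + a ![v₂, v₅] * b ![v₀, v₁, v₃, v₄]
      + a ![v₃, v₄] * b ![v₀, v₁, v₂, v₅] - a ![v₃, v₅] * b ![v₀, v₁, v₂, v₄]
      + a ![v₄, v₅] * b ![v₀, v₁, v₂, v₃] := by
  have key : wedge a b ![v₀, v₁, v₂, v₃, v₄, v₅] = _ :=
    wedge_eq_altSum a b ![v₀, v₁, v₂, v₃, v₄, v₅]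
  refine key.trans ?_
  have e : (fun w : Fin (2 + 4) → C3 => a (fun i => w (Fin.castAdd 4 i)) *
      b (fun i => w (Fin.natAdd 2 i))) = fun w => a ![w 0, w 1] * b ![w 2, w 3, w 4, w 5] := by
    funext w
    congr 2 <;> funext i <;> fin_cases i <;> rfl
  rw [e]
  have h1 := altSum_six (fun w : Fin 6 → C3 => a ![w 0, w 1] *
    b ![w 2, w 3, w 4, w 5]) v₀ v₁ v₂ v₃ v₄ v₅
  refine (congrArg _ h1).trans ?_
  -- Once two vectors are fixed in the `2`-form, the remaining sum over `4!` permutations of an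
  -- alternating form collapses to the factor 24, which avoids expanding all 720 terms.
  have h3 : ∀ x p q₀ q₁ q₂ q₃ : C3,
      altSum 4 (fun w : Fin 4 → C3 => a ![x, p] * b ![w 0, w 1, w 2, w 3]) ![q₀, q₁, q₂, q₃] =
      24 * (a ![x, p] * b ![q₀, q₁, q₂, q₃]) := by
    intro x p q₀ q₁ q₂ q₃
    rw [altSum_const_mul]
    have : (fun w : Fin 4 → C3 => b ![w 0, w 1, w 2, w 3]) = fun w => b w := by
      funext w; congr 1; funext i; fin_cases i <;> rfl
    rw [this, altSum_alternating]
    simp [Nat.factorial]; ring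
  simp only [altSum_five, Matrix.cons_val, h3]
  rw [Alt.swap a v₀ v₁, Alt.swap a v₀ v₂, Alt.swap a v₀ v₃, Alt.swap a v₀ v₄, Alt.swap a v₀ v₅,
    Alt.swap a v₁ v₂, Alt.swap a v₁ v₃, Alt.swap a v₁ v₄, Alt.swap a v₁ v₅, Alt.swap a v₂ v₃,
    Alt.swap a v₂ v₄, Alt.swap a v₂ v₅, Alt.swap a v₃ v₄, Alt.swap a v₃ v₅, Alt.swap a v₄ v₅]
  norm_num [Nat.factorial]
  ring

/-- Moving a block of two slots past a block of four is an even permutation. -/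
theorem wedge_four_two (a : Alt 4) (b : Alt 2) :
    (wedge a b : Alt 6) = (wedge b a : Alt 6) := by
  ext v
  have k1 : wedge a b v = _ := wedge_eq_altSum a b v
  have k2 : wedge b a v = _ := wedge_eq_altSum b a v
  refine k1.trans (Eq.trans ?_ k2.symm)
  -- The block exchange is the rotation by four places; written as a square of `finRotate 6 ^ 2` its
  -- sign is visibly one.
  have s : Equiv.Perm.sign (finRotate 6 ^ 2) = 1 := by simp [sign_finRotate]
  have := altSum_of_comp_perm (fun w : Fin 6 → C3 => b ![w 0, w 1] *
    a ![w 2, w 3, w 4, w 5]) v ((finRotate 6 ^ 2) ^ 2)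
  rw [map_pow, s, one_pow, one_smul] at this
  have e1 : (fun w : Fin (4 + 2) → C3 => a (fun i => w (Fin.castAdd 2 i)) *
      b (fun i => w (Fin.natAdd 4 i))) = fun w : Fin 6 → C3 =>
        b ![(w ∘ ⇑((finRotate 6 ^ 2) ^ 2)) 0, (w ∘ ⇑((finRotate 6 ^ 2) ^ 2)) 1] *
    a ![(w ∘ ⇑((finRotate 6 ^ 2) ^ 2)) 2, (w ∘ ⇑((finRotate 6 ^ 2) ^ 2)) 3,
        (w ∘ ⇑((finRotate 6 ^ 2) ^ 2)) 4, (w ∘ ⇑((finRotate 6 ^ 2) ^ 2)) 5] := by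
    funext w
    rw [mul_comm]
    congr 2 <;> funext i <;> fin_cases i <;> rfl
  have e2 : (fun w : Fin (2 + 4) → C3 => b (fun i => w (Fin.castAdd 4 i)) *
      a (fun i => w (Fin.natAdd 2 i))) = fun w => b ![w 0, w 1] * a ![w 2, w 3, w 4, w 5] := by
    funext w
    congr 2 <;> funext i <;> fin_cases i <;> rfl
  rw [e1, e2]
  congr 1
  norm_num [mul_comm]

end Alternating

section LinearAlgebra

/-! ### Bilinearity, pull-back, conjugation and types of exterior products -/

theorem altSum_add {E : Type*} {n : ℕ} (f g : (Fin n → E) → ℂ) (v : Fin n → E) :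
    altSum n (fun w => f w + g w) v = altSum n f v + altSum n g v := by
  simp [altSum, Finset.sum_add_distrib]

theorem wedge_add_left {k l : ℕ} (a a' : Alt k) (b : Alt l) :
    wedge (a + a') b = wedge a b + wedge a' b := by
  ext v
  simp only [wedge_eq_altSum, ContinuousAlternatingMap.add_apply, add_mul, altSum_add, mul_add]

theorem wedge_add_right {k l : ℕ} (a : Alt k) (b b' : Alt l) :
    wedge a (b + b') = wedge a b + wedge a b' := by
  ext v
  simp only [wedge_eq_altSum, ContinuousAlternatingMap.add_apply, mul_add, altSum_add]

theorem wedge_smul_left {k l : ℕ} (c : ℂ) (a : Alt k) (b : Alt l) :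
    wedge (c • a) b = c • wedge a b := by
  ext v
  simp only [wedge_eq_altSum, ContinuousAlternatingMap.smul_apply, smul_eq_mul, mul_assoc,
    altSum_const_mul]
  ring

theorem wedge_smul_right {k l : ℕ} (c : ℂ) (a : Alt k) (b : Alt l) :
    wedge a (c • b) = c • wedge a b := by
  ext v
  simp only [wedge_eq_altSum, ContinuousAlternatingMap.smul_apply, smul_eq_mul,
    mul_left_comm _ c, altSum_const_mul]

/-- The exterior product as a complex bilinear map. -/
noncomputable def wedgeBilin (k l : ℕ) : Alt k →ₗ[ℂ] Alt l →ₗ[ℂ] Alt (k + l) :=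
  LinearMap.mk₂ ℂ wedge wedge_add_left wedge_smul_left wedge_add_right wedge_smul_right

theorem wedge_sum_right {k l : ℕ} {ι : Type*} (s : Finset ι) (a : Alt k) (b : ι → Alt l) :
    wedge a (∑ i ∈ s, b i) = ∑ i ∈ s, wedge a (b i) :=
  map_sum (wedgeBilin k l a) b s

theorem wedge_zero_left {k l : ℕ} (b : Alt l) : wedge (0 : Alt k) b = 0 :=
  LinearMap.map_zero₂ (wedgeBilin k l) b

theorem wedge_zero_right {k l : ℕ} (a : Alt k) : wedge a (0 : Alt l) = 0 :=
  map_zero (wedgeBilin k l a)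

theorem wedge_comp {k l : ℕ} (a : Alt k) (b : Alt l) (f : C3 →L[ℝ] C3) :
    (wedge a b).compContinuousLinearMap f =
      wedge (a.compContinuousLinearMap f) (b.compContinuousLinearMap f) := by
  ext v
  rw [ContinuousAlternatingMap.compContinuousLinearMap_apply, wedge_eq_altSum, wedge_eq_altSum]
  rfl

/-- The complex conjugate of a form. -/
noncomputable def altConj {k : ℕ} (a : Alt k) : Alt k :=
  (Complex.conjCLE : ℂ →L[ℝ] ℂ).compContinuousAlternatingMap a

@[simp] theorem altConj_apply {k : ℕ} (a : Alt k) (v : Fin k → C3) :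
    altConj a v = conj (a v) := rfl

/-- Reality as a fixed point condition, so that it follows formally from compatibility of
conjugation with products. -/
theorem isReal_iff_altConj {k : ℕ} {a : Alt k} : IsReal a ↔ altConj a = a := by
  refine ⟨fun h => ?_, fun h v => ?_⟩
  · ext v
    exact Complex.conj_eq_iff_im.2 (h v)
  · exact Complex.conj_eq_iff_im.1 (by rw [← altConj_apply, h])

theorem altConj_wedge {k l : ℕ} (a : Alt k) (b : Alt l) :
    altConj (wedge a b) = wedge (altConj a) (altConj b) := by
  ext v
  rw [altConj_apply, wedge_eq_altSum, wedge_eq_altSum, map_mul, Complex.conj_ofReal, altSum,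
    altSum, map_sum]
  congr 1
  refine Finset.sum_congr rfl fun σ _ => ?_
  simp [Units.smul_def]

theorem IsReal.wedge {k l : ℕ} {a : Alt k} {b : Alt l} (ha : IsReal a) (hb : IsReal b) :
    IsReal (wedge a b) := by
  rw [isReal_iff_altConj] at *
  rw [altConj_wedge, ha, hb]

theorem IsOfType.wedge {k l p q p' q' : ℕ} {a : Alt k} {b : Alt l} (ha : IsOfType p q a)
    (hb : IsOfType p' q' b) : IsOfType (p + p') (q + q') (wedge a b) := by
  intro c v
  rw [wedge_eq_altSum, wedge_eq_altSum]
  have : altSum (k + l) (fun w => a (fun i => w (Fin.castAdd l i)) * b (fun i => w (Fin.natAdd k i)))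
      (fun i => c • v i) = altSum (k + l) (fun w => (c ^ (p + p') * conj c ^ (q + q')) *
        (a (fun i => w (Fin.castAdd l i)) * b (fun i => w (Fin.natAdd k i)))) v := by
    unfold altSum
    refine Finset.sum_congr rfl fun σ _ => ?_
    congr 1
    have h1 := ha c (fun i => (v ∘ σ) (Fin.castAdd l i))
    have h2 := hb c (fun i => (v ∘ σ) (Fin.natAdd k i))
    refine (congrArg₂ (· * ·) h1 h2).trans ?_
    ring
  rw [this, altSum_const_mul]
  ring

/-- Real forms of type `(p, q)` as a real subspace. -/
def realOfType (k p q : ℕ) : Submodule ℝ (Alt k) where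
  carrier := {a | IsRealOfType p q a}
  zero_mem' := ⟨fun v => by simp, fun c v => by simp⟩
  add_mem' := fun {a b} ha hb => ⟨fun v => by
    rw [ContinuousAlternatingMap.add_apply, Complex.add_im, ha.1, hb.1, add_zero], fun c v => by
    rw [ContinuousAlternatingMap.add_apply, ContinuousAlternatingMap.add_apply, ha.2, hb.2,
      mul_add]⟩
  smul_mem' := fun r a ha => ⟨fun v => by
    rw [ContinuousAlternatingMap.smul_apply, Complex.smul_im, ha.1, smul_zero], fun c v => by
    rw [ContinuousAlternatingMap.smul_apply, ContinuousAlternatingMap.smul_apply, ha.2,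
      Complex.real_smul, Complex.real_smul]; ring⟩

theorem IsRealOfType.wedge_two_two {a b : Alt 2} (ha : IsRealOfType 1 1 a)
    (hb : IsRealOfType 1 1 b) : IsRealOfType 2 2 (wedge a b : Alt 4) :=
  ⟨ha.1.wedge hb.1, ha.2.wedge hb.2⟩

/-! ### The real basis of `ℂ³` -/

/-- The oriented real basis of `ℂ³`. -/
noncomputable def realBasis : Module.Basis (Fin 6) ℝ C3 :=
  (Pi.basis fun _ : Fin 3 => Complex.basisOneI).reindex
    ((Equiv.sigmaEquivProd (Fin 3) (Fin 2)).trans finProdFinEquiv)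

@[simp] theorem mulI_apply (v : C3) : mulI v = Complex.I • v := rfl

theorem realBasis_apply (i : Fin 6) : realBasis i = realFrame i := by
  have h : ∀ j : Fin 3, ∀ b : Fin 2, realBasis (finProdFinEquiv (j, b)) =
      Pi.single j (Complex.basisOneI b) := fun j b => by
    simp [realBasis, Pi.basis_apply]
  have hs : ∀ j : Fin 3, mulI (bas j) = Pi.single j Complex.I := fun j => by
    rw [mulI_apply, bas, ← Pi.single_smul, smul_eq_mul, mul_one]
  fin_cases i
  · exact (h 0 0).trans (by simp [realFrame, bas])
  · exact (h 0 1).trans (by simp [realFrame, hs])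
  · exact (h 1 0).trans (by simp [realFrame, bas])
  · exact (h 1 1).trans (by simp [realFrame, hs])
  · exact (h 2 0).trans (by simp [realFrame, bas])
  · exact (h 2 1).trans (by simp [realFrame, hs])

/-- An alternating form that vanishes on increasing sequences of basis vectors is zero. -/
theorem alt_eq_zero_of_strictMono {k : ℕ} (a : Alt k)
    (h : ∀ s : Fin k → Fin 6, StrictMono s → a (realFrame ∘ s) = 0) : a = 0 := by
  have key : a.toAlternatingMap = 0 := by
    refine Module.Basis.ext_alternating realBasis fun s hs => ?_
    -- An injective sequence of indices becomes strictly increasing after sorting, which only costs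
    -- a sign.
    have hm : StrictMono (s ∘ Tuple.sort s) :=
      (Tuple.monotone_sort s).strictMono_of_injective (hs.comp (Tuple.sort s).injective)
    have e := a.toAlternatingMap.map_perm (fun i => realBasis (s i)) (Tuple.sort s)
    have e' : (fun i => realBasis (s i)) ∘ Tuple.sort s = realFrame ∘ (s ∘ Tuple.sort s) := by
      funext i
      simp [realBasis_apply]
    rw [e'] at e
    have z : a.toAlternatingMap (realFrame ∘ (s ∘ Tuple.sort s)) = 0 := h _ hm
    rw [z] at e
    have := (smul_eq_zero_iff_eq (Equiv.Perm.sign (Tuple.sort s))).1 e.symm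
    simpa using this
  ext v
  exact congrArg (fun f : C3 [⋀^Fin k]→ₗ[ℝ] ℂ => f v) key

/-- The only strictly increasing self-map of `Fin 6` is the identity, so a top degree form is
determined by one value. -/
theorem alt_six_eq_zero {a : Alt 6} (h : a realFrame = 0) : a = 0 := by
  refine alt_eq_zero_of_strictMono a fun s hs => ?_
  have : s = id := by
    have hb : Function.Bijective s := Finite.injective_iff_bijective.1 hs.injective
    have := Subsingleton.elim (hs.orderIsoOfSurjective s hb.2) (OrderIso.refl _)
    funext i
    exact congrArg (fun f : Fin 6 ≃o Fin 6 => f i) this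
  rw [this]
  exact h

/-- Evaluation on sequences of basis vectors. -/
noncomputable def altEval (k : ℕ) : Alt k →ₗ[ℝ] ((Fin k → Fin 6) → ℂ) where
  toFun a s := a (realFrame ∘ s)
  map_add' _ _ := rfl
  map_smul' _ _ := rfl

theorem altEval_injective (k : ℕ) : Function.Injective (altEval k) := by
  refine (injective_iff_map_eq_zero _).2 fun a ha => ?_
  exact alt_eq_zero_of_strictMono a fun s _ => congrFun ha s

instance (k : ℕ) : FiniteDimensional ℝ (Alt k) :=
  FiniteDimensional.of_injective (altEval k) (altEval_injective k)

/-- A map into a space of alternating forms is smooth if its values on all vectors are. -/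
theorem contDiffOn_alt {D : Type*} [NormedAddCommGroup D] [NormedSpace ℝ D] {k : ℕ}
    {n : WithTop ℕ∞} {f : D → Alt k} {s : Set D}
    (h : ∀ v, ContDiffOn ℝ n (fun x => f x v) s) : ContDiffOn ℝ n f s := by
  -- Evaluation on basis vectors is injective and linear; a linear left inverse is continuous by
  -- finite dimensionality and recovers the form from its values.
  obtain ⟨g, hg⟩ := (altEval k).exists_leftInverse_of_injective
    (LinearMap.ker_eq_bot.2 (altEval_injective k))
  have e : f = fun x => LinearMap.toContinuousLinearMap g (altEval k (f x)) := by
    funext x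
    exact (congrArg (fun F : Alt k →ₗ[ℝ] Alt k => F (f x)) hg).symm
  rw [e]
  refine (LinearMap.toContinuousLinearMap g).contDiff.comp_contDiffOn (contDiffOn_pi.2 fun s => ?_)
  exact h _

theorem ContDiffOn.alt_apply {D : Type*} [NormedAddCommGroup D] [NormedSpace ℝ D] {k : ℕ}
    {n : WithTop ℕ∞} {f : D → Alt k} {s : Set D} (h : ContDiffOn ℝ n f s) (v : Fin k → C3) :
    ContDiffOn ℝ n (fun x => f x v) s :=
  (ContinuousAlternatingMap.apply ℝ C3 ℂ v).contDiff.comp_contDiffOn h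

theorem ContDiffOn.wedge {D : Type*} [NormedAddCommGroup D] [NormedSpace ℝ D] {k l : ℕ}
    {n : WithTop ℕ∞} {f : D → Alt k} {g : D → Alt l} {s : Set D} (hf : ContDiffOn ℝ n f s)
    (hg : ContDiffOn ℝ n g s) : ContDiffOn ℝ n (fun x => wedge (f x) (g x)) s := by
  refine contDiffOn_alt fun v => ?_
  simp only [wedge_eq_altSum, altSum, Units.smul_def, zsmul_eq_mul]
  refine contDiffOn_const.mul (ContDiffOn.sum fun σ _ => contDiffOn_const.mul ?_)
  exact (ContDiffOn.alt_apply hf _).mul (ContDiffOn.alt_apply hg _)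

end LinearAlgebra

section TypeOneOne

open Matrix

/-! ### Forms of type `(1,1)` -/

/-- The form `i dz^j ∧ dz̄^k`. -/
noncomputable def dzdzbar (j k : Fin 3) : Alt 2 :=
  Complex.I • wedge (form10 (ContinuousLinearMap.proj j)) (form01 (ContinuousLinearMap.proj k))

theorem form10_apply (η : C3 →L[ℂ] ℂ) (u : C3) : form10 η ![u] = η u := rfl

theorem form01_apply (η : C3 →L[ℂ] ℂ) (u : C3) : form01 η ![u] = conj (η u) := rfl

theorem dzdzbar_apply (j k : Fin 3) (u v : C3) :
    dzdzbar j k ![u, v] = Complex.I * (u j * conj (v k) - v j * conj (u k)) := by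
  have := wedge_one_one (form10 (ContinuousLinearMap.proj j)) (form01 (ContinuousLinearMap.proj k))
    u v
  exact congrArg (Complex.I * ·) this

/-- The form `i g_{k̄j} dz^j ∧ dz̄^k`. -/
noncomputable def form11 (g : Matrix (Fin 3) (Fin 3) ℂ) : Alt 2 :=
  ∑ k, ∑ j, g k j • dzdzbar j k

theorem form11_apply (g : Matrix (Fin 3) (Fin 3) ℂ) (u v : C3) :
    form11 g ![u, v] = Complex.I * (star v ⬝ᵥ g *ᵥ u - star u ⬝ᵥ g *ᵥ v) := by
  simp only [form11, ContinuousAlternatingMap.sum_apply, ContinuousAlternatingMap.smul_apply,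
    dzdzbar_apply]
  simp only [dotProduct, mulVec, Pi.star_apply, Fin.sum_univ_three, smul_eq_mul,
    Complex.star_def]
  ring

theorem star_dotProduct_mulVec_single (g : Matrix (Fin 3) (Fin 3) ℂ) (k j : Fin 3) (c d : ℂ) :
    star (c • bas k) ⬝ᵥ g *ᵥ (d • bas j) = conj c * d * g k j := by
  rw [bas, bas, mulVec_smul, mulVec_single_one, star_smul, smul_dotProduct, dotProduct_smul,
    ← Pi.single_star, star_one, single_one_dotProduct]
  simp [Matrix.col, mul_assoc]

/-- With `form11_type` and `IsOfType.eq_form11` this identifies forms of type (1,1) with 3×3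
matrices. -/
theorem coeff11_form11 (g : Matrix (Fin 3) (Fin 3) ℂ) (k j : Fin 3) :
    coeff11 (form11 g) k j = g k j := by
  have e := star_dotProduct_mulVec_single g
  have h1 : ∀ c d : ℂ, form11 g ![c • bas j, d • bas k] =
      Complex.I * (conj d * c * g k j - conj c * d * g j k) := fun c d => by
    rw [form11_apply, e, e]
  have h2 : ∀ d : ℂ, form11 g ![bas j, d • bas k] =
      Complex.I * (conj d * g k j - d * g j k) := fun d => by
    have := h1 1 d
    simpa using this
  have h3 : ∀ c : ℂ, form11 g ![c • bas j, bas k] =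
      Complex.I * (c * g k j - conj c * g j k) := fun c => by
    have := h1 c 1
    simpa using this
  have h4 : form11 g ![bas j, bas k] = Complex.I * (g k j - g j k) := by
    have := h1 1 1
    simpa using this
  rw [coeff11]
  simp only [mulI_apply, h1, h2, h3, h4, Complex.conj_I]
  linear_combination (-(1 / 4) * ((g k j - g j k) -
    (3 * g k j + g j k) * (Complex.I ^ 2 - 1))) * Complex.I_sq

theorem gram_form11 (g : Matrix (Fin 3) (Fin 3) ℂ) : gram (form11 g) = g := by
  ext k j
  exact coeff11_form11 g k j

theorem Alt.cons_neg {k : ℕ} (a : Alt (k + 1)) (u : C3) (v : Fin k → C3) :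
    a (Fin.cons (-u) v) = -a (Fin.cons u v) := by
  have := a.toAlternatingMap.toMultilinearMap.cons_smul v (-1) u
  simpa using this

/-- Scaling by `c = i` multiplies a form of type (1,1) by `i · (-i) = 1`. -/
theorem IsOfType.mulI_mulI {a : Alt 2} (h : IsOfType 1 1 a) (u v : C3) :
    a ![mulI u, mulI v] = a ![u, v] := by
  have h1 := h Complex.I ![u, v]
  have e : (fun i => Complex.I • (![u, v] : Fin 2 → C3) i) = ![mulI u, mulI v] := by
    funext i; fin_cases i <;> rfl
  rw [e] at h1
  simpa using h1

theorem mulI_sq (u : C3) : mulI (mulI u) = -u := by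
  rw [mulI_apply, mulI_apply, smul_smul, Complex.I_mul_I, neg_one_smul]

theorem IsOfType.mulI_left {a : Alt 2} (h : IsOfType 1 1 a) (u v : C3) :
    a ![mulI u, v] = -a ![u, mulI v] := by
  have h1 := h.mulI_mulI u (mulI v)
  rw [mulI_sq, Alt.swap a (-v)] at h1
  have h2 : a ![-v, mulI u] = - a ![v, mulI u] := Alt.cons_neg a v ![mulI u]
  rw [h2, neg_neg, Alt.swap a (mulI u) v] at h1
  rw [← h1, neg_neg]

theorem exists_realFrame (p : Fin 6) :
    ∃ j, realFrame p = bas j ∨ realFrame p = mulI (bas j) := by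
  fin_cases p
  · exact ⟨0, Or.inl rfl⟩
  · exact ⟨0, Or.inr rfl⟩
  · exact ⟨1, Or.inl rfl⟩
  · exact ⟨1, Or.inr rfl⟩
  · exact ⟨2, Or.inl rfl⟩
  · exact ⟨2, Or.inr rfl⟩

theorem coeff11_sub (a b : Alt 2) (k j : Fin 3) :
    coeff11 (a - b) k j = coeff11 a k j - coeff11 b k j := by
  simp only [coeff11, ContinuousAlternatingMap.sub_apply]
  ring

/-- Invariance under `i` reduces `b` to the values `x = b(e_j, e_k)` and `y = b(e_j, i e_k)`. The
coefficients with indices `(k, j)` and `(j, k)` are multiples of `x + iy` and `-x + iy`, so both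
values vanish. -/
theorem IsOfType.eq_zero {b : Alt 2} (h : IsOfType 1 1 b) (hb : ∀ k j, coeff11 b k j = 0) :
    b = 0 := by
  have key : ∀ j k, b ![bas j, bas k] = 0 ∧ b ![bas j, mulI (bas k)] = 0 := by
    intro j k
    have h1 : ∀ j k, b ![bas j, bas k] + Complex.I * b ![bas j, mulI (bas k)] = 0 := by
      intro j k
      have := hb k j
      rw [coeff11, h.mulI_mulI, h.mulI_left] at this
      linear_combination (2 * Complex.I) * this +
        (b ![bas j, bas k] + Complex.I * b ![bas j, mulI (bas k)]) * Complex.I_sq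
    have h2 := h1 k j
    rw [Alt.swap b (bas j) (bas k), Alt.swap b (mulI (bas j)) (bas k), h.mulI_left, neg_neg] at h2
    have h3 := h1 j k
    have h4 : Complex.I * b ![bas j, mulI (bas k)] = 0 := by linear_combination (h2 + h3) / 2
    refine ⟨by linear_combination (h3 - h2) / 2, ?_⟩
    simpa using h4
  refine alt_eq_zero_of_strictMono b fun s _ => ?_
  have e : realFrame ∘ s = ![realFrame (s 0), realFrame (s 1)] := by
    funext i; fin_cases i <;> rfl
  rw [e]
  obtain ⟨j, hj | hj⟩ := exists_realFrame (s 0) <;> obtain ⟨k, hk | hk⟩ := exists_realFrame (s 1) <;>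
    rw [hj, hk]
  · exact (key j k).1
  · exact (key j k).2
  · rw [h.mulI_left, (key j k).2, neg_zero]
  · rw [h.mulI_mulI, (key j k).1]

theorem IsOfType.sub {k p q : ℕ} {a b : Alt k} (ha : IsOfType p q a) (hb : IsOfType p q b) :
    IsOfType p q (a - b) := fun c v => by
  rw [ContinuousAlternatingMap.sub_apply, ContinuousAlternatingMap.sub_apply, ha, hb, mul_sub]

theorem eq_pair {k : Type*} (v : Fin 2 → k) : v = ![v 0, v 1] := by
  funext i; fin_cases i <;> rfl

theorem form11_type (g : Matrix (Fin 3) (Fin 3) ℂ) : IsOfType 1 1 (form11 g) := by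
  intro c v
  have e : (fun i => c • v i) = ![c • v 0, c • v 1] := by
    funext i; fin_cases i <;> rfl
  rw [e]
  conv_rhs => rw [eq_pair v]
  rw [form11_apply, form11_apply]
  simp only [star_smul, smul_dotProduct, mulVec_smul, dotProduct_smul, smul_eq_mul,
    Complex.star_def, pow_one]
  ring

theorem IsOfType.eq_form11 {a : Alt 2} (h : IsOfType 1 1 a) : a = form11 (gram a) := by
  refine sub_eq_zero.1 (IsOfType.eq_zero (h.sub (form11_type _)) fun k j => ?_)
  rw [coeff11_sub, coeff11_form11]
  exact sub_self _

theorem form11_isReal {g : Matrix (Fin 3) (Fin 3) ℂ} (hg : g.IsHermitian) :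
    IsReal (form11 g) := by
  intro v
  rw [eq_pair v, form11_apply]
  have : star (star (v 1) ⬝ᵥ g *ᵥ v 0) = star (v 0) ⬝ᵥ g *ᵥ v 1 := by
    rw [star_dotProduct, star_mulVec, hg.eq, star_star, dotProduct_comm, dotProduct_mulVec,
      dotProduct_comm]
  rw [← this, Complex.star_def]
  simp

theorem IsReal.gram_isHermitian {a : Alt 2} (h : IsReal a) (h' : IsOfType 1 1 a) :
    (gram a).IsHermitian := by
  have hc := isReal_iff_altConj.1 h
  have hcv : ∀ v, conj (a v) = a v := fun v => by rw [← altConj_apply, hc]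
  ext k j
  rw [conjTranspose_apply]
  simp only [gram, of_apply, coeff11, Complex.star_def, map_mul, map_add, map_sub, hcv, map_neg,
    Complex.conj_I, map_div₀, map_one, h'.mulI_mulI, h'.mulI_left]
  rw [Alt.swap a (bas j) (bas k), Alt.swap a (mulI (bas j)) (bas k), h'.mulI_left]
  rw [show (conj (4 : ℂ)) = 4 from Complex.conj_ofNat 4]
  ring

theorem form11_mulI_self (g : Matrix (Fin 3) (Fin 3) ℂ) (v : C3) :
    form11 g ![v, mulI v] = 2 * (star v ⬝ᵥ g *ᵥ v) := by
  rw [form11_apply, mulI_apply, star_smul, smul_dotProduct, mulVec_smul, dotProduct_smul,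
    Complex.star_def, Complex.conj_I, smul_eq_mul, smul_eq_mul]
  linear_combination (-2 * (star v ⬝ᵥ g *ᵥ v)) * Complex.I_sq

/-- By `form11_mulI_self` the value on `(v, iv)` is twice the Hermitian quadratic form of the
matrix. Reality of the form need not be listed on the right, since a positive definite matrix is
Hermitian. -/
theorem isPos11_iff {a : Alt 2} :
    IsPos11 a ↔ IsOfType 1 1 a ∧ (gram a).PosDef := by
  constructor
  · rintro ⟨⟨h1, h2⟩, h3⟩
    refine ⟨h2, posDef_iff_dotProduct_mulVec.2 ⟨h1.gram_isHermitian h2, fun {v} hv => ?_⟩⟩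
    have h4 := h3 v hv
    have h5 := h1 ![v, mulI v]
    rw [h2.eq_form11, form11_mulI_self] at h4 h5
    rw [Complex.lt_def]
    refine ⟨?_, ?_⟩
    · simpa using h4
    · simpa [eq_comm] using h5
  · rintro ⟨h1, h2⟩
    have h3 : IsReal a := by
      rw [h1.eq_form11]; exact form11_isReal h2.1
    refine ⟨⟨h3, h1⟩, fun v hv => ?_⟩
    rw [h1.eq_form11, form11_mulI_self]
    have := (Complex.lt_def.1 (h2.dotProduct_mulVec_pos hv)).1
    simpa using this

theorem isPos11_form11 {g : Matrix (Fin 3) (Fin 3) ℂ} (hg : g.PosDef) : IsPos11 (form11 g) :=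
  isPos11_iff.2 ⟨form11_type g, by rwa [gram_form11]⟩

/-- The matrix of a complex linear endomorphism of `ℂ³`. -/
noncomputable def jac (T : C3 →L[ℂ] C3) : Matrix (Fin 3) (Fin 3) ℂ :=
  LinearMap.toMatrix' (T : C3 →ₗ[ℂ] C3)

theorem jac_mulVec (T : C3 →L[ℂ] C3) (v : C3) : jac T *ᵥ v = T v :=
  LinearMap.toMatrix'_mulVec _ _

/-- The pull-back of a form by a complex linear map. -/
noncomputable abbrev pullC {k : ℕ} (T : C3 →L[ℂ] C3) (a : Alt k) : Alt k :=
  a.compContinuousLinearMap (T.restrictScalars ℝ)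

theorem pullC_pair (T : C3 →L[ℂ] C3) (a : Alt 2) (u v : C3) :
    pullC T a ![u, v] = a ![T u, T v] := by
  rw [pullC, ContinuousAlternatingMap.compContinuousLinearMap_apply]
  congr 1
  funext i; fin_cases i <;> rfl

/-- A complex linear change of variables acts on the matrix by congruence with the Jacobian. -/
theorem pullC_form11 (T : C3 →L[ℂ] C3) (g : Matrix (Fin 3) (Fin 3) ℂ) :
    pullC T (form11 g) = form11 ((jac T)ᴴ * g * jac T) := by
  ext v
  rw [eq_pair v, pullC_pair, form11_apply, form11_apply]
  have : ∀ u v : C3, star (T u) ⬝ᵥ g *ᵥ T v = star u ⬝ᵥ ((jac T)ᴴ * g * jac T) *ᵥ v := by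
    intro u v
    rw [← jac_mulVec, ← jac_mulVec, star_mulVec, ← mulVec_mulVec, ← mulVec_mulVec,
      ← dotProduct_mulVec]
  rw [this, this]

theorem IsOfType.pullC {k p q : ℕ} {a : Alt k} (h : IsOfType p q a) (T : C3 →L[ℂ] C3) :
    IsOfType p q (pullC T a) := by
  intro c v
  have := h c (fun i => T (v i))
  rw [ContinuousAlternatingMap.compContinuousLinearMap_apply,
    ContinuousAlternatingMap.compContinuousLinearMap_apply]
  refine Eq.trans ?_ this
  congr 1
  funext i
  exact T.map_smul c (v i)

theorem IsReal.comp {k : ℕ} {a : Alt k} (h : IsReal a) (f : C3 →L[ℝ] C3) :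
    IsReal (a.compContinuousLinearMap f) := fun v => h _

theorem gram_pullC (T : C3 →L[ℂ] C3) {a : Alt 2} (h : IsOfType 1 1 a) :
    gram (pullC T a) = (jac T)ᴴ * gram a * jac T := by
  conv_lhs => rw [h.eq_form11, pullC_form11, gram_form11]

/-! ### Forms of type `(3,0)` -/

/-- Type (3,0) is defined by the scaling law `c³` for simultaneous scaling of all vectors; complex
linearity in a single slot has to be extracted from it by polarization. -/
theorem IsOfType.map_three_mulI {O : Alt 3} (h : IsOfType 3 0 O) (u v w : C3) :
    O ![mulI u, v, w] = Complex.I * O ![u, v, w] := by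
  have hadd1 : ∀ u u' v w : C3, O ![u + u', v, w] = O ![u, v, w] + O ![u', v, w] :=
    fun u u' v w => O.toAlternatingMap.toMultilinearMap.cons_add ![v, w] u u'
  have hsm1 : ∀ (r : ℝ) (u v w : C3), O ![r • u, v, w] = r * O ![u, v, w] :=
    fun r u v w => O.toAlternatingMap.toMultilinearMap.cons_smul ![v, w] r u
  have sw12 : ∀ u v w : C3, O ![v, u, w] = -O ![u, v, w] := fun u v w => by
    have h := O.toAlternatingMap.map_swap ![u, v, w] (show (0 : Fin 3) ≠ 1 by decide)
    have e : (![u, v, w] ∘ Equiv.swap (0 : Fin 3) 1) = ![v, u, w] := by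
      funext i; fin_cases i <;> rfl
    rw [e] at h
    exact h
  have sw13 : ∀ u v w : C3, O ![w, v, u] = -O ![u, v, w] := fun u v w => by
    have h := O.toAlternatingMap.map_swap ![u, v, w] (show (0 : Fin 3) ≠ 2 by decide)
    have e : (![u, v, w] ∘ Equiv.swap (0 : Fin 3) 2) = ![w, v, u] := by
      funext i; fin_cases i <;> rfl
    rw [e] at h
    exact h
  have hadd2 : ∀ u v v' w : C3, O ![u, v + v', w] = O ![u, v, w] + O ![u, v', w] :=
    fun u v v' w => by rw [sw12, hadd1, sw12 v, sw12 v']; ring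
  have hadd3 : ∀ u v w w' : C3, O ![u, v, w + w'] = O ![u, v, w] + O ![u, v, w'] :=
    fun u v w w' => by rw [sw13, hadd1, sw13 w, sw13 w']; ring
  have hsm2 : ∀ (r : ℝ) (u v w : C3), O ![u, r • v, w] = r * O ![u, v, w] :=
    fun r u v w => by rw [sw12, hsm1, sw12 v]; ring
  have hsm3 : ∀ (r : ℝ) (u v w : C3), O ![u, v, r • w] = r * O ![u, v, w] :=
    fun r u v w => by rw [sw13, hsm1, sw13 w]; ring
  have hc : ∀ (r : ℝ) (u v w : C3), O ![u + r • mulI u, v + r • mulI v, w + r • mulI w] =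
      (1 + r * Complex.I) ^ 3 * O ![u, v, w] := by
    intro r u v w
    have h1 := h (1 + r * Complex.I) ![u, v, w]
    rw [pow_zero, mul_one] at h1
    rw [← h1]
    congr 1
    have e : ∀ u : C3, u + r • mulI u = (1 + (r : ℂ) * Complex.I) • u := fun u => by
      rw [add_smul, one_smul, mul_smul]; rfl
    funext i; fin_cases i
    · exact e u
    · exact e v
    · exact e w
  have hsum : ∀ u v w : C3, O ![mulI u, v, w] + O ![u, mulI v, w] + O ![u, v, mulI w] =
      3 * Complex.I * O ![u, v, w] := by
    intro u v w
    have p1 := hc 1 u v w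
    have m1 := hc (-1) u v w
    have p2 := hc 2 u v w
    have m2 := hc (-2) u v w
    simp only [hadd1, hadd2, hadd3, hsm1, hsm2, hsm3] at p1 m1 p2 m2
    push_cast at p1 m1 p2 m2
    -- This is the coefficient of `r` in the cubic identity `hc`: the odd parts at `r = ±1` and `r =
    -- ±2` are combined so that the cubic term cancels.
    linear_combination (2 / 3) * (p1 - m1) - (1 / 12) * (p2 - m2)
  have nn1 : ∀ u v w : C3, O ![-u, v, w] = -O ![u, v, w] := fun u v w => by
    have := hsm1 (-1) u v w
    simpa using this
  have nn2 : ∀ u v w : C3, O ![u, -v, w] = -O ![u, v, w] := fun u v w => by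
    have := hsm2 (-1) u v w
    simpa using this
  have nn3 : ∀ u v w : C3, O ![u, v, -w] = -O ![u, v, w] := fun u v w => by
    have := hsm3 (-1) u v w
    simpa using this
  have e000 := hsum u v w
  have e100 := hsum (mulI u) v w
  have e010 := hsum u (mulI v) w
  have e001 := hsum u v (mulI w)
  have e110 := hsum (mulI u) (mulI v) w
  have e101 := hsum (mulI u) v (mulI w)
  have e011 := hsum u (mulI v) (mulI w)
  have e111 := hsum (mulI u) (mulI v) (mulI w)
  simp only [mulI_sq, nn1, nn2, nn3] at e000 e100 e010 e001 e110 e101 e011 e111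
  have hI := Complex.I_sq
  clear hc hsum hsm1 hsm2 hsm3 hadd1 hadd2 hadd3 sw12 sw13 nn1 nn2 nn3 h
  generalize O ![mulI u, mulI v, mulI w] = A111 at *
  generalize O ![mulI u, mulI v, w] = A110 at *
  generalize O ![mulI u, v, mulI w] = A101 at *
  generalize O ![mulI u, v, w] = A100 at *
  generalize O ![u, mulI v, mulI w] = A011 at *
  generalize O ![u, mulI v, w] = A010 at *
  generalize O ![u, v, mulI w] = A001 at *
  generalize O ![u, v, w] = A000 at *
  generalize Complex.I = I at *
  grind

end TypeOneOne

section TypeTwoTwo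

attribute [local irreducible] wedge

open Matrix

/-! ### Forms of type `(2,2)` and the associated Hermitian matrix -/

theorem bas_apply (j k : Fin 3) : bas j k = if k = j then 1 else 0 := Pi.single_apply _ _ _

/-- The matrix `M` of a `4`-form `Ψ`, with `Ψ ∧ i dz^j ∧ dz̄^k = M_{jk}` times the unit form. -/
noncomputable def dual (a : Alt 4) : Matrix (Fin 3) (Fin 3) ℂ :=
  Matrix.of fun j k => (wedge a (dzdzbar j k) : Alt 6) realFrame

theorem form11_bas_bas (g : Matrix (Fin 3) (Fin 3) ℂ) (p q : Fin 3) :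
    form11 g ![bas p, bas q] = Complex.I * (g q p - g p q) := by
  have e := star_dotProduct_mulVec_single g
  have h1 := e q p 1 1
  have h2 := e p q 1 1
  simp only [one_smul, map_one, one_mul] at h1 h2
  rw [form11_apply, h1, h2]

theorem form11_mulI_mulI (g : Matrix (Fin 3) (Fin 3) ℂ) (p q : Fin 3) :
    form11 g ![mulI (bas p), mulI (bas q)] = Complex.I * (g q p - g p q) := by
  rw [(form11_type g).mulI_mulI, form11_bas_bas]

theorem form11_bas_mulI (g : Matrix (Fin 3) (Fin 3) ℂ) (p q : Fin 3) :
    form11 g ![bas p, mulI (bas q)] = g q p + g p q := by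
  have e := star_dotProduct_mulVec_single g
  have h1 := e q p Complex.I 1
  have h2 := e p q 1 Complex.I
  simp only [one_smul, map_one, one_mul, mul_one, Complex.conj_I] at h1 h2
  rw [form11_apply, mulI_apply, h1, h2]
  linear_combination (-g q p - g p q) * Complex.I_sq

theorem form11_mulI_bas (g : Matrix (Fin 3) (Fin 3) ℂ) (p q : Fin 3) :
    form11 g ![mulI (bas p), bas q] = -(g q p + g p q) := by
  rw [(form11_type g).mulI_left, form11_bas_mulI]

theorem form11_single (j k : Fin 3) : form11 (Matrix.single k j 1) = dzdzbar j k := by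
  ext v
  rw [eq_pair v, form11_apply, dzdzbar_apply]
  simp only [dotProduct, mulVec, Fin.sum_univ_three, Pi.star_apply]
  fin_cases j <;> fin_cases k <;> simp <;> ring

/-- The exterior product of a `4`-form and `i h_{k̄j} dz^j ∧ dz̄^k`, in terms of components. -/
theorem wedge_form11_realFrame (a : Alt 4) (h : Matrix (Fin 3) (Fin 3) ℂ) :
    (wedge a (form11 h) : Alt 6) realFrame =
      2 * h 0 0 * a ![bas 1, mulI (bas 1), bas 2, mulI (bas 2)]
      + 2 * h 1 1 * a ![bas 0, mulI (bas 0), bas 2, mulI (bas 2)]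
      + 2 * h 2 2 * a ![bas 0, mulI (bas 0), bas 1, mulI (bas 1)]
      - Complex.I * (h 1 0 - h 0 1) * (a ![mulI (bas 0), mulI (bas 1), bas 2, mulI (bas 2)]
          + a ![bas 0, bas 1, bas 2, mulI (bas 2)])
      + (h 1 0 + h 0 1) * (a ![mulI (bas 0), bas 1, bas 2, mulI (bas 2)]
          - a ![bas 0, mulI (bas 1), bas 2, mulI (bas 2)])
      - Complex.I * (h 2 0 - h 0 2) * (a ![mulI (bas 0), bas 1, mulI (bas 1), mulI (bas 2)]
          + a ![bas 0, bas 1, mulI (bas 1), bas 2])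
      + (h 2 0 + h 0 2) * (a ![mulI (bas 0), bas 1, mulI (bas 1), bas 2]
          - a ![bas 0, bas 1, mulI (bas 1), mulI (bas 2)])
      - Complex.I * (h 2 1 - h 1 2) * (a ![bas 0, mulI (bas 0), mulI (bas 1), mulI (bas 2)]
          + a ![bas 0, mulI (bas 0), bas 1, bas 2])
      + (h 2 1 + h 1 2) * (a ![bas 0, mulI (bas 0), mulI (bas 1), bas 2]
          - a ![bas 0, mulI (bas 0), bas 1, mulI (bas 2)]) := by
  rw [wedge_four_two, realFrame, wedge_two_four]
  simp only [form11_bas_bas, form11_bas_mulI, form11_mulI_mulI, form11_mulI_bas]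
  ring

theorem dual_apply (a : Alt 4) (j k : Fin 3) :
    dual a j k = (wedge a (form11 (Matrix.single k j 1)) : Alt 6) realFrame := by
  rw [form11_single]; rfl

theorem wedge_form11_eq_sum (a : Alt 4) (h : Matrix (Fin 3) (Fin 3) ℂ) :
    (wedge a (form11 h) : Alt 6) realFrame = ∑ k, ∑ j, h k j * dual a j k := by
  rw [form11, wedge_sum_right, ContinuousAlternatingMap.sum_apply]
  refine Finset.sum_congr rfl fun k _ => ?_
  rw [wedge_sum_right, ContinuousAlternatingMap.sum_apply]
  refine Finset.sum_congr rfl fun j _ => ?_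
  rw [wedge_smul_right]
  rfl

/-- The constant is `16 = 2 · 8`: a cofactor arises twice in `ω ∧ ω`, and each of the three factors
`i dz ∧ dz̄` takes the value 2 on `(∂/∂x, ∂/∂y)`. -/
theorem dual_wedge_self (g : Matrix (Fin 3) (Fin 3) ℂ) :
    dual (wedge (form11 g) (form11 g) : Alt 4) = (16 : ℂ) • g.adjugate := by
  have hI := Complex.I_sq
  rw [adjugate_fin_three]
  ext j k
  rw [dual_apply, wedge_form11_realFrame]
  simp only [wedge_two_two, form11_bas_bas, form11_bas_mulI, form11_mulI_mulI, form11_mulI_bas]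
  fin_cases j <;> fin_cases k <;> simp <;> grind

theorem dual_smul (c : ℂ) (a : Alt 4) : dual (c • a) = c • dual a := by
  ext j k
  simp only [dual, of_apply, wedge_smul_left, Matrix.smul_apply]
  rfl

theorem dual_add (a b : Alt 4) : dual (a + b) = dual a + dual b := by
  ext j k
  simp only [dual, of_apply, wedge_add_left, Matrix.add_apply]
  rfl

theorem altConj_dzdzbar (j k : Fin 3) : altConj (dzdzbar j k) = dzdzbar k j := by
  ext v
  rw [eq_pair v, altConj_apply, dzdzbar_apply, dzdzbar_apply]
  simp
  ring

theorem IsReal.dual_isHermitian {a : Alt 4} (h : IsReal a) : (dual a).IsHermitian := by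
  ext j k
  rw [conjTranspose_apply, dual, of_apply, of_apply, Complex.star_def, ← altConj_apply,
    altConj_wedge, altConj_dzdzbar, isReal_iff_altConj.1 h]

/-- `iη ∧ η̄` has a matrix of rank one, which is why testing positivity on such forms amounts to
evaluating a Hermitian form. -/
theorem wedge_form10_form01 (η : C3 →L[ℂ] ℂ) :
    Complex.I • (wedge (form10 η) (form01 η) : Alt 2) =
      form11 (Matrix.of fun k j => η (bas j) * conj (η (bas k))) := by
  have hη : ∀ u : C3, η u = ∑ j, u j * η (bas j) := fun u => by
    conv_lhs => rw [pi_eq_sum_univ' u, map_sum]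
    refine Finset.sum_congr rfl fun j _ => ?_
    rw [map_smul, smul_eq_mul, bas]
  ext v
  rw [eq_pair v, form11_apply, ContinuousAlternatingMap.smul_apply, wedge_one_one, form10_apply,
    form10_apply, form01_apply, form01_apply, hη (v 0), hη (v 1)]
  simp only [dotProduct, mulVec, Fin.sum_univ_three, of_apply, Pi.star_apply, map_add, map_mul,
    smul_eq_mul, Complex.star_def]
  ring

theorem dual_quadratic (a : Alt 4) (η : C3 →L[ℂ] ℂ) :
    wedge a (Complex.I • wedge (form10 η) (form01 η)) realFrame =
      star (fun j => conj (η (bas j))) ⬝ᵥ dual a *ᵥ fun j => conj (η (bas j)) := by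
  have : wedge a (Complex.I • wedge (form10 η) (form01 η)) realFrame =
      (wedge a (form11 (Matrix.of fun k j => η (bas j) * conj (η (bas k)))) : Alt 6) realFrame :=
    congrArg (fun b : Alt 2 => (wedge a b : Alt 6) realFrame) (wedge_form10_form01 η)
  refine this.trans ?_
  rw [wedge_form11_eq_sum]
  simp only [dotProduct, mulVec, Fin.sum_univ_three, of_apply, Pi.star_apply, Complex.star_def,
    Complex.conj_conj]
  ring

theorem isPos22_iff {a : Alt 4} :
    IsPos22 a ↔ IsRealOfType 2 2 a ∧ (dual a).PosDef := by
  constructor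
  · rintro ⟨h1, h2⟩
    refine ⟨h1, posDef_iff_dotProduct_mulVec.2 ⟨h1.1.dual_isHermitian, fun {x} hx => ?_⟩⟩
    -- The covector with components `conj x_j`, for which the quadratic form in `dual_quadratic` is
    -- evaluated at `x`.
    let η : C3 →L[ℂ] ℂ := ∑ j, conj (x j) • ContinuousLinearMap.proj j
    have hη : ∀ j, η (bas j) = conj (x j) := fun j => by
      simp [η, bas_apply]
    have hx' : x = fun j => conj (η (bas j)) := by
      funext j; rw [hη, Complex.conj_conj]
    have hη0 : η ≠ 0 := by
      rintro h0
      apply hx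
      rw [hx', h0]
      funext j
      simp
    have h3 := h2 η hη0
    have h3' : 0 < (star x ⬝ᵥ dual a *ᵥ x).re := by
      have h4 := congrArg Complex.re (dual_quadratic a η)
      rw [← hx'] at h4
      exact lt_of_lt_of_eq h3 h4
    refine Complex.lt_def.2 ⟨h3', ?_⟩
    exact (h1.1.dual_isHermitian.im_star_dotProduct_mulVec_self x).symm
  · rintro ⟨h1, h2⟩
    refine ⟨h1, fun η hη => ?_⟩
    refine lt_of_lt_of_eq ?_ (congrArg Complex.re (dual_quadratic a η)).symm
    refine (Complex.lt_def.1 (h2.dotProduct_mulVec_pos fun h0 => hη ?_)).1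
    have h5 : ∀ j, η (bas j) = 0 := fun j => by
      have := congrFun h0 j
      simpa using this
    ext u
    rw [pi_eq_sum_univ' u, map_sum]
    refine Finset.sum_eq_zero fun j _ => ?_
    rw [map_smul]
    rw [← bas, h5, smul_zero]

theorem Alt.cycle_four (a : Alt 4) (w x y z : C3) : a ![w, x, y, z] = -a ![z, w, x, y] := by
  have h := a.toAlternatingMap.map_perm ![z, w, x, y] (finRotate 4)
  have e : (![z, w, x, y] ∘ finRotate 4) = ![w, x, y, z] := by
    funext i; fin_cases i <;> rfl
  rw [e, sign_finRotate, show ((-1 : ℤˣ) ^ 3) = -1 from rfl, Units.neg_smul, one_smul] at h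
  exact h

theorem Alt.swap_four (a : Alt 4) (w x y z : C3) : a ![x, w, y, z] = -a ![w, x, y, z] := by
  have h := a.toAlternatingMap.map_swap ![w, x, y, z] (show (0 : Fin 4) ≠ 1 by decide)
  have e : (![w, x, y, z] ∘ Equiv.swap (0 : Fin 4) 1) = ![x, w, y, z] := by
    funext i; fin_cases i <;> rfl
  rw [e] at h
  exact h

/-- Multiplying all four vectors by `i` changes nothing in type (2,2), and it sends the pair `(u,
iu)` to `(iu, -u)`, which is the same bivector. Hence `i` can be applied to the other two vectors
alone. -/
theorem IsOfType.mulI_four {a : Alt 4} (h : IsOfType 2 2 a) (u x y : C3) :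
    a ![u, mulI u, mulI x, mulI y] = a ![u, mulI u, x, y] := by
  have h1 := h Complex.I ![u, mulI u, x, y]
  have e : (fun i => Complex.I • (![u, mulI u, x, y] : Fin 4 → C3) i) =
      ![mulI u, mulI (mulI u), mulI x, mulI y] := by
    funext i; fin_cases i <;> rfl
  have c : Complex.I ^ 2 * conj Complex.I ^ 2 = 1 := by simp
  rw [e, c, one_mul, mulI_sq, Alt.swap_four] at h1
  have h2 : a ![-u, mulI u, mulI x, mulI y] = - a ![u, mulI u, mulI x, mulI y] :=
    Alt.cons_neg a u ![mulI u, mulI x, mulI y]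
  rw [← h1, h2, neg_neg]

theorem strictMono_four (a b c d : Fin 6) (h1 : a < b) (h2 : b < c) (h3 : c < d) :
    (a, b, c, d) ∈ ([(0, 1, 2, 3), (0, 1, 2, 4), (0, 1, 2, 5), (0, 1, 3, 4), (0, 1, 3, 5),
      (0, 1, 4, 5), (0, 2, 3, 4), (0, 2, 3, 5), (0, 2, 4, 5), (0, 3, 4, 5), (1, 2, 3, 4),
      (1, 2, 3, 5), (1, 2, 4, 5), (1, 3, 4, 5), (2, 3, 4, 5)] : List (Fin 6 × Fin 6 × Fin 6 × Fin 6)) := by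
  revert a b c d
  decide

theorem IsOfType.mulI_four' {a : Alt 4} (h : IsOfType 2 2 a) (u x y : C3) :
    a ![u, mulI u, mulI x, y] = -a ![u, mulI u, x, mulI y] := by
  have h1 := h.mulI_four u x (mulI y)
  have h2 : a ![-y, u, mulI u, mulI x] = - a ![y, u, mulI u, mulI x] :=
    Alt.cons_neg a y ![u, mulI u, mulI x]
  rw [mulI_sq, Alt.cycle_four, h2, neg_neg, ← neg_neg (a ![y, u, mulI u, mulI x]),
    ← Alt.cycle_four] at h1
  rw [← h1, neg_neg]

/-- A form of type `(2,2)` is determined by its matrix. -/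
theorem IsOfType.eq_zero_of_dual {a : Alt 4} (h : IsOfType 2 2 a) (h0 : dual a = 0) : a = 0 := by
  have hI := Complex.I_sq
  have key : ∀ j k, (AnomalyFlow.wedge a (form11 (Matrix.single k j 1)) : Alt 6) realFrame = 0 :=
    -- The nine entries of the matrix give nine equations. By invariance under `i` there are also
    -- nine independent components: three with two complete pairs `(e, ie)`, and two for each choice
    -- of a single complete pair.
    fun j k => by rw [← dual_apply, h0]; rfl
  simp only [wedge_form11_realFrame] at key
  have k00 := key 0 0
  have k11 := key 1 1
  have k22 := key 2 2
  have k01 := key 0 1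
  have k10 := key 1 0
  have k02 := key 0 2
  have k20 := key 2 0
  have k12 := key 1 2
  have k21 := key 2 1
  -- Four of the six frame vectors always contain a complete pair `(e_j, i e_j)`; the even
  -- permutations `cyc1` and `cyc2` bring such a pair to the front, where `mulI_four` applies.
  have cyc2 : ∀ w x y z : C3, a ![w, x, y, z] = a ![y, z, w, x] := fun w x y z => by
    rw [Alt.cycle_four a w x y z, Alt.cycle_four a z w x y, neg_neg]
  have cyc1 : ∀ w x y z : C3, a ![w, x, y, z] = a ![x, y, w, z] := fun w x y z => by
    have h := a.toAlternatingMap.map_perm ![w, x, y, z] (Equiv.swap 0 1 * Equiv.swap 1 2)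
    have e : (![w, x, y, z] ∘ (Equiv.swap (0 : Fin 4) 1 * Equiv.swap 1 2 : Equiv.Perm (Fin 4))) =
        ![x, y, w, z] := by
      funext i; fin_cases i <;> rfl
    have sg : Equiv.Perm.sign (Equiv.swap (0 : Fin 4) 1 * Equiv.swap 1 2) = 1 := by
      rw [Equiv.Perm.sign_mul, Equiv.Perm.sign_swap (by decide), Equiv.Perm.sign_swap (by decide)]
      rfl
    rw [e, sg, one_smul] at h
    exact h.symm
  simp only [cyc1 (bas 0) (bas 1) (mulI (bas 1)), cyc1 (mulI (bas 0)) (bas 1) (mulI (bas 1)),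
    cyc2 (bas 0) (bas 1) (bas 2), cyc2 (bas 0) (mulI (bas 1)) (bas 2),
    cyc2 (mulI (bas 0)) (bas 1) (bas 2), cyc2 (mulI (bas 0)) (mulI (bas 1)) (bas 2),
    h.mulI_four, h.mulI_four'] at k00 k11 k22 k01 k10 k02 k20 k12 k21
  simp [-mulI_apply] at k00 k11 k22 k01 k10 k02 k20 k12 k21
  refine alt_eq_zero_of_strictMono a fun s hs => ?_
  have e : realFrame ∘ s = ![realFrame (s 0), realFrame (s 1), realFrame (s 2),
      realFrame (s 3)] := by
    funext i; fin_cases i <;> rfl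
  rw [e]
  have hmem := strictMono_four (s 0) (s 1) (s 2) (s 3) (hs (by decide)) (hs (by decide))
    (hs (by decide))
  generalize s 0 = p0 at *
  generalize s 1 = p1 at *
  generalize s 2 = p2 at *
  generalize s 3 = p3 at *
  have f0 : realFrame 0 = bas 0 := rfl
  have f1 : realFrame 1 = mulI (bas 0) := rfl
  have f2 : realFrame 2 = bas 1 := rfl
  have f3 : realFrame 3 = mulI (bas 1) := rfl
  have f4 : realFrame 4 = bas 2 := rfl
  have f5 : realFrame 5 = mulI (bas 2) := rfl
  clear key hs e
  simp only [List.mem_cons, Prod.mk.injEq, List.not_mem_nil, or_false] at hmem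
  rcases hmem with ⟨rfl, rfl, rfl, rfl⟩ | ⟨rfl, rfl, rfl, rfl⟩ | ⟨rfl, rfl, rfl, rfl⟩ |
    ⟨rfl, rfl, rfl, rfl⟩ | ⟨rfl, rfl, rfl, rfl⟩ | ⟨rfl, rfl, rfl, rfl⟩ | ⟨rfl, rfl, rfl, rfl⟩ |
    ⟨rfl, rfl, rfl, rfl⟩ | ⟨rfl, rfl, rfl, rfl⟩ | ⟨rfl, rfl, rfl, rfl⟩ | ⟨rfl, rfl, rfl, rfl⟩ |
    ⟨rfl, rfl, rfl, rfl⟩ | ⟨rfl, rfl, rfl, rfl⟩ | ⟨rfl, rfl, rfl, rfl⟩ | ⟨rfl, rfl, rfl, rfl⟩ <;>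
  simp only [f0, f1, f2, f3, f4, f5, cyc1 (bas 0) (bas 1) (mulI (bas 1)),
    cyc1 (mulI (bas 0)) (bas 1) (mulI (bas 1)),
    cyc2 (bas 0) (bas 1) (bas 2), cyc2 (bas 0) (mulI (bas 1)) (bas 2),
    cyc2 (mulI (bas 0)) (bas 1) (bas 2), cyc2 (mulI (bas 0)) (mulI (bas 1)) (bas 2),
    h.mulI_four, h.mulI_four'] <;> clear cyc1 cyc2 h h0 f0 f1 f2 f3 f4 f5 <;> grind

end TypeTwoTwo

section PsiMap

open Matrix

attribute [local irreducible] wedge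

/-! ### The map `ω ↦ ‖Ω‖_ω ω²` and its inverse -/

/-- The form `n (det ω_{k̄j})^{-1/2} ω²`. -/
noncomputable def psiN (n : ℝ) (a : Alt 2) : Alt 4 :=
  (n / Real.sqrt (gram a).det.re) • wedge a a

theorem psi_eq_psiN (O : Alt 3) (a : Alt 2) : psi O a = psiN ‖O bas‖ a := rfl

/-- The inverse of `ω ↦ n (det ω_{k̄j})^{-1/2} ω²`. -/
noncomputable def psiInv (n : ℝ) (b : Alt 4) : Alt 2 :=
  form11 (((n : ℂ) ^ 2)⁻¹ • ((16 : ℂ)⁻¹ • dual b).adjugate)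

/-- The adjugate is the inverse times the determinant, both positive. -/
theorem posDef_adjugate {g : Matrix (Fin 3) (Fin 3) ℂ} (hg : g.PosDef) : g.adjugate.PosDef := by
  have h : g.adjugate = g.det • g⁻¹ := by
    rw [inv_def, smul_smul, Ring.mul_inverse_cancel _ ((isUnit_iff_isUnit_det g).1 hg.isUnit),
      one_smul]
  rw [h]
  exact hg.inv.smul hg.det_pos

theorem PosDef.det_eq_re {g : Matrix (Fin 3) (Fin 3) ℂ} (hg : g.PosDef) :
    g.det = (g.det.re : ℂ) ∧ 0 < g.det.re := by
  have := Complex.lt_def.1 hg.det_pos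
  exact ⟨Complex.ext rfl this.2.symm, this.1⟩

theorem adjugate_smul_three (c : ℂ) (g : Matrix (Fin 3) (Fin 3) ℂ) :
    (c • g).adjugate = c ^ 2 • g.adjugate := by
  rw [adjugate_smul]; rfl

theorem adjugate_adjugate_three (g : Matrix (Fin 3) (Fin 3) ℂ) :
    g.adjugate.adjugate = g.det • g := by
  rw [adjugate_adjugate g (by simp)]
  simp

theorem dual_psiN {n : ℝ} {a : Alt 2} (ha : IsOfType 1 1 a) :
    dual (psiN n a) = (((n / Real.sqrt (gram a).det.re : ℝ) : ℂ) * 16) • (gram a).adjugate := by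
  have h : psiN n a = ((n / Real.sqrt (gram a).det.re : ℝ) : ℂ) • (wedge a a : Alt 4) := by
    ext v; simp [psiN]
  rw [h, dual_smul, mul_smul]
  conv_lhs => rw [ha.eq_form11]
  rw [dual_wedge_self, gram_form11]

theorem isRealOfType_psiN (n : ℝ) {a : Alt 2} (ha : IsRealOfType 1 1 a) :
    IsRealOfType 2 2 (psiN n a) :=
  (realOfType 4 2 2).smul_mem _ (ha.wedge_two_two ha)

theorem isPos22_psiN {n : ℝ} (hn : 0 < n) {a : Alt 2} (ha : IsPos11 a) : IsPos22 (psiN n a) := by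
  obtain ⟨h1, h2⟩ := isPos11_iff.1 ha
  refine isPos22_iff.2 ⟨isRealOfType_psiN n ha.1, ?_⟩
  rw [dual_psiN h1]
  obtain ⟨h3, h4⟩ := PosDef.det_eq_re h2
  refine (posDef_adjugate h2).smul ?_
  have : (0 : ℝ) < n / Real.sqrt (gram a).det.re * 16 := by positivity
  exact_mod_cast this

/-- With `g = gram a`, a sixteenth of the matrix of `psiN n a` is `n (det g)^{-1/2} adj g`. Its
adjugate is `n² (det g)⁻¹ adj (adj g) = n² g`. -/
theorem psiInv_psiN {n : ℝ} (hn : 0 < n) {a : Alt 2} (ha : IsPos11 a) :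
    psiInv n (psiN n a) = a := by
  obtain ⟨h1, h2⟩ := isPos11_iff.1 ha
  obtain ⟨h3, h4⟩ := PosDef.det_eq_re h2
  rw [psiInv, dual_psiN h1]
  conv_rhs => rw [h1.eq_form11]
  congr 1
  rw [smul_smul, adjugate_smul_three, adjugate_adjugate_three, smul_smul, smul_smul]
  conv_rhs => rw [← one_smul ℂ (gram a)]
  congr 1
  have hs : (Real.sqrt (gram a).det.re : ℂ) ^ 2 = (gram a).det := by
    rw [h3]
    exact_mod_cast Real.sq_sqrt h4.le
  have hs0 : (Real.sqrt (gram a).det.re : ℂ) ≠ 0 := by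
    exact_mod_cast (Real.sqrt_pos.2 h4).ne'
  have hn0 : (n : ℂ) ≠ 0 := by exact_mod_cast hn.ne'
  push_cast
  generalize (Real.sqrt (gram a).det.re : ℂ) = s at *
  rw [← hs]
  field_simp

theorem inv_sixteen_pos : (0 : ℂ) < 16⁻¹ := by
  have : (0 : ℂ) < ((16⁻¹ : ℝ) : ℂ) := by
    rw [Complex.zero_lt_real]; norm_num
  simpa using this

theorem gram_psiInv (n : ℝ) (b : Alt 4) :
    gram (psiInv n b) = ((n : ℂ) ^ 2)⁻¹ • ((16 : ℂ)⁻¹ • dual b).adjugate := gram_form11 _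

theorem isPos11_psiInv {n : ℝ} (hn : 0 < n) {b : Alt 4} (hb : IsPos22 b) :
    IsPos11 (psiInv n b) := by
  refine isPos11_form11 ((posDef_adjugate ((isPos22_iff.1 hb).2.smul ?_)).smul ?_)
  · exact inv_sixteen_pos
  · have : (0 : ℝ) < (n ^ 2)⁻¹ := by positivity
    exact_mod_cast this

theorem IsOfType.eq_of_dual {a b : Alt 4} (ha : IsOfType 2 2 a) (hb : IsOfType 2 2 b)
    (h : dual a = dual b) : a = b := by
  refine sub_eq_zero.1 ((ha.sub hb).eq_zero_of_dual ?_)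
  have : a = (a - b) + b := by abel
  rw [this, dual_add] at h
  simpa using h

/-- Let `N` be a sixteenth of the matrix of `b`. Then `g = n⁻² adj N` has determinant `(det N /
n³)²`, a perfect square, and `n (det g)^{-1/2} adj g` simplifies to `N`. A form of type (2,2) is
determined by its matrix. -/
theorem psiN_psiInv {n : ℝ} (hn : 0 < n) {b : Alt 4} (hb : IsPos22 b) :
    psiN n (psiInv n b) = b := by
  obtain ⟨h1, h2⟩ := isPos22_iff.1 hb
  have hp := isPos11_psiInv hn hb
  refine IsOfType.eq_of_dual (isPos22_psiN hn hp).1.2 h1.2 ?_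
  rw [dual_psiN hp.1.2, gram_psiInv]
  have hN : ((16 : ℂ)⁻¹ • dual b).PosDef := h2.smul inv_sixteen_pos
  obtain ⟨h3, h4⟩ := PosDef.det_eq_re hN
  have hb' : dual b = (16 : ℂ) • ((16 : ℂ)⁻¹ • dual b) := by
    rw [smul_smul]; norm_num
  conv_rhs => rw [hb']
  generalize ((16 : ℂ)⁻¹ • dual b) = N at *
  rw [det_smul, det_adjugate, adjugate_smul_three, adjugate_adjugate_three, smul_smul, smul_smul]
  congr 1
  generalize N.det.re = d at *
  rw [h3]
  have hn0 : (n : ℂ) ≠ 0 := by exact_mod_cast hn.ne'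
  have hd0 : (d : ℂ) ≠ 0 := by exact_mod_cast h4.ne'
  have hd : ((((n : ℂ) ^ 2)⁻¹ ^ Fintype.card (Fin 3)) * (d : ℂ) ^ (Fintype.card (Fin 3) - 1)) =
      (((d / n ^ 3) ^ 2 : ℝ) : ℂ) := by
    simp only [Fintype.card_fin]
    push_cast
    field_simp
  -- The root is `d / n³` itself because `n` and `d = det N` are positive.
  rw [hd, Complex.ofReal_re, Real.sqrt_sq (by positivity)]
  push_cast
  field_simp

/-- A transposition moves the chosen slot to the first one, where `map_three_mulI` applies. -/
theorem IsOfType.map_update_mulI {O : Alt 3} (h : IsOfType 3 0 O) (w : Fin 3 → C3) (i : Fin 3)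
    (u : C3) : O (Function.update w i (mulI u)) = Complex.I * O (Function.update w i u) := by
  have e : ∀ w : Fin 3 → C3, w = ![w 0, w 1, w 2] := fun w => by
    funext i; fin_cases i <;> rfl
  have sw : ∀ (w : Fin 3 → C3) (i : Fin 3), i ≠ 0 → O w = -O (w ∘ Equiv.swap 0 i) := by
    intro w i hi
    have := O.toAlternatingMap.map_swap w hi.symm
    exact (neg_eq_iff_eq_neg.2 this).symm
  have h0 : ∀ (w : Fin 3 → C3) (u : C3),
      O (Function.update w 0 (mulI u)) = Complex.I * O (Function.update w 0 u) := by
    intro w u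
    rw [e (Function.update w 0 (mulI u)), e (Function.update w 0 u)]
    exact h.map_three_mulI u (w 1) (w 2)
  by_cases hi : i = 0
  · rw [hi]; exact h0 w u
  · rw [sw _ i hi, sw (Function.update w i u) i hi]
    have : ∀ x : C3, Function.update w i x ∘ Equiv.swap 0 i =
        Function.update (w ∘ Equiv.swap 0 i) 0 x := by
      intro x
      rw [Function.update_comp_equiv]
      simp
    rw [this, this, h0]
    ring

/-- A form of type `(3,0)` as a complex alternating map. -/
noncomputable def complexAlt {O : Alt 3} (h : IsOfType 3 0 O) : C3 [⋀^Fin 3]→ₗ[ℂ] ℂ where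
  toFun := O
  map_update_add' := by
    intro inst w i x y
    cases Subsingleton.elim inst (instDecidableEqFin 3)
    exact O.toAlternatingMap.map_update_add w i x y
  map_update_smul' := by
    intro inst w i c x
    cases Subsingleton.elim inst (instDecidableEqFin 3)
    have hr : ∀ (r : ℝ) (x : C3), O (Function.update w i (r • x)) =
        r * O (Function.update w i x) := fun r x =>
      O.toAlternatingMap.map_update_smul w i r x
    have hc : c • x = c.re • x + c.im • mulI x := by
      conv_lhs => rw [← Complex.re_add_im c]
      rw [add_smul, mul_smul]; rfl
    have ha := O.toAlternatingMap.map_update_add w i (c.re • x) (c.im • mulI x)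
    rw [hc]
    refine ha.trans ?_
    refine (congrArg₂ (· + ·) (hr _ _) (hr _ _)).trans ?_
    rw [h.map_update_mulI, smul_eq_mul]
    conv_rhs => rw [← Complex.re_add_im c]
    ring
  map_eq_zero_of_eq' := fun w i j hij hne => O.toAlternatingMap.map_eq_zero_of_eq w hij hne

/-- A (3,0)-form is a complex alternating map of top degree, hence a multiple of the determinant. -/
theorem pullC_bas {O : Alt 3} (h : IsOfType 3 0 O) (T : C3 →L[ℂ] C3) :
    pullC T O bas = (jac T).det * O bas := by
  have h1 := congrArg (fun f => f fun i => T (bas i))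
    ((complexAlt h).eq_smul_basis_det (Pi.basisFun ℂ (Fin 3)))
  have h2 : (complexAlt h) (Pi.basisFun ℂ (Fin 3)) = O bas := by
    change O _ = O _
    congr 1
    funext i
    simp [bas]
  have h3 : (Pi.basisFun ℂ (Fin 3)).det (fun i => T (bas i)) = (jac T).det := by
    rw [Module.Basis.det_apply]
    congr 1
  rw [h2] at h1
  refine Eq.trans (h1 : O (fun i => T (bas i)) = _) ?_
  rw [AlternatingMap.smul_apply, h3, smul_eq_mul, mul_comm]

/-- `‖Ω‖_ω` does not depend on coordinates: `|Ω₁₂₃|` is multiplied by `|det J|` and `det ω` by `|det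
J|²`. Wedge products commute with pull-back. -/
theorem psi_pullC {O : Alt 3} (hO : IsOfType 3 0 O) {a : Alt 2} (ha : IsPos11 a) (T : C3 →L[ℂ] C3)
    (hT : (jac T).det ≠ 0) : psi (pullC T O) (pullC T a) = pullC T (psi O a) := by
  obtain ⟨h1, h2⟩ := isPos11_iff.1 ha
  obtain ⟨h3, h4⟩ := PosDef.det_eq_re h2
  have e1 : normOmega (pullC T O) (pullC T a) = normOmega O a := by
    rw [normOmega, normOmega, pullC_bas hO, gram_pullC T h1, det_mul, det_mul,
      det_conjTranspose, norm_mul]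
    have : (star (jac T).det * (gram a).det * (jac T).det).re =
        ‖(jac T).det‖ ^ 2 * (gram a).det.re := by
      rw [mul_right_comm, Complex.star_def, mul_comm (conj _), Complex.mul_conj, h3,
        ← Complex.ofReal_mul, Complex.ofReal_re, Complex.normSq_eq_norm_sq, Complex.ofReal_re]
    rw [this, Real.sqrt_mul (by positivity), Real.sqrt_sq (norm_nonneg _)]
    have := norm_pos_iff.2 hT
    field_simp
  have e2 : (wedge (pullC T a) (pullC T a) : Alt 4) = pullC T (wedge a a : Alt 4) :=
    (wedge_comp a a _).symm
  rw [psi, psi, e1, e2]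
  rfl

theorem contDiffOn_coeff11 {D : Type*} [NormedAddCommGroup D] [NormedSpace ℝ D]
    {n : WithTop ℕ∞} {f : D → Alt 2} {s : Set D} (hf : ContDiffOn ℝ n f s) (k j : Fin 3) :
    ContDiffOn ℝ n (fun x => coeff11 (f x) k j) s := by
  unfold coeff11
  have := fun v => ContDiffOn.alt_apply hf v
  exact contDiffOn_const.mul (contDiffOn_const.mul ((((this _).add (contDiffOn_const.mul
    (this _))).sub (contDiffOn_const.mul (this _))).add (this _)))

theorem contDiffOn_det {D : Type*} [NormedAddCommGroup D] [NormedSpace ℝ D] {r : ℕ}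
    {n : WithTop ℕ∞} {f : D → Matrix (Fin r) (Fin r) ℂ} {s : Set D}
    (hf : ∀ i j, ContDiffOn ℝ n (fun x => f x i j) s) :
    ContDiffOn ℝ n (fun x => (f x).det) s := by
  simp only [det_apply, Units.smul_def, zsmul_eq_mul]
  refine ContDiffOn.sum fun σ _ => contDiffOn_const.mul ?_
  exact contDiffOn_prod fun i _ => hf _ _

theorem contDiffOn_adjugate {D : Type*} [NormedAddCommGroup D] [NormedSpace ℝ D] {r : ℕ}
    {n : WithTop ℕ∞} {f : D → Matrix (Fin r) (Fin r) ℂ} {s : Set D}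
    (hf : ∀ i j, ContDiffOn ℝ n (fun x => f x i j) s) (i j : Fin r) :
    ContDiffOn ℝ n (fun x => (f x).adjugate i j) s := by
  simp only [adjugate_apply]
  refine contDiffOn_det fun k l => ?_
  by_cases h : k = j
  · subst h
    simp only [updateRow_self]
    exact contDiffOn_const
  · simp only [updateRow_ne h]
    exact hf k l

theorem contDiffOn_form11 {D : Type*} [NormedAddCommGroup D] [NormedSpace ℝ D]
    {n : WithTop ℕ∞} {f : D → Matrix (Fin 3) (Fin 3) ℂ} {s : Set D}
    (hf : ∀ i j, ContDiffOn ℝ n (fun x => f x i j) s) :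
    ContDiffOn ℝ n (fun x => form11 (f x)) s := by
  unfold form11
  exact ContDiffOn.sum fun k _ => ContDiffOn.sum fun j _ => (hf k j).smul contDiffOn_const

theorem contDiffOn_psiN {D : Type*} [NormedAddCommGroup D] [NormedSpace ℝ D]
    {m : WithTop ℕ∞} {n : D → ℝ} {f : D → Alt 2} {s : Set D} (hn : ContDiffOn ℝ m n s)
    (hf : ContDiffOn ℝ m f s) (hd : ∀ x ∈ s, 0 < (gram (f x)).det.re) :
    ContDiffOn ℝ m (fun x => psiN (n x) (f x)) s := by
  have h1 : ContDiffOn ℝ m (fun x => (gram (f x)).det.re) s :=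
    Complex.reCLM.contDiff.comp_contDiffOn (contDiffOn_det fun i j => contDiffOn_coeff11 hf i j)
  refine ContDiffOn.smul (hn.div (h1.sqrt fun x hx => (hd x hx).ne') fun x hx =>
    (Real.sqrt_pos.2 (hd x hx)).ne') (ContDiffOn.wedge hf hf)

/-- No square root occurs in the inverse, so nothing is asked of `f` beyond smoothness. In
particular `psiInv 1` is smooth on the whole space of `4`-forms. -/
theorem contDiffOn_psiInv {D : Type*} [NormedAddCommGroup D] [NormedSpace ℝ D]
    {m : WithTop ℕ∞} {n : D → ℝ} {f : D → Alt 4} {s : Set D} (hn : ContDiffOn ℝ m n s)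
    (hf : ContDiffOn ℝ m f s) (hd : ∀ x ∈ s, n x ≠ 0) :
    ContDiffOn ℝ m (fun x => psiInv (n x) (f x)) s := by
  refine contDiffOn_form11 fun i j => ?_
  have h1 : ContDiffOn ℝ m (fun x => (n x : ℂ)) s := Complex.ofRealCLM.contDiff.comp_contDiffOn hn
  refine ContDiffOn.mul ((h1.pow 2).inv fun x hx => ?_) (contDiffOn_adjugate (fun k l => ?_) i j)
  · exact pow_ne_zero 2 (by exact_mod_cast hd x hx)
  · exact contDiffOn_const.mul (ContDiffOn.alt_apply (ContDiffOn.wedge hf contDiffOn_const) _)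

end PsiMap

section Calculus

open ContinuousAlternatingMap Filter

/-! ### The operators `∂`, `∂̄` and `i∂∂̄` -/

section Generic

variable {A B : Type*} [NormedAddCommGroup A] [NormedSpace ℝ A] [NormedAddCommGroup B]
  [NormedSpace ℝ B]

theorem fderiv_clm_comp (L : A →L[ℝ] B) {f : C3 → A} {z : C3} (hf : DifferentiableAt ℝ f z) :
    fderiv ℝ (fun y => L (f y)) z = L.comp (fderiv ℝ f z) :=
  (L.hasFDerivAt.comp z hf.hasFDerivAt).fderiv

theorem differentiableAt_clm_comp (L : A →L[ℝ] B) {f : C3 → A} {z : C3}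
    (hf : DifferentiableAt ℝ f z) : DifferentiableAt ℝ (fun y => L (f y)) z :=
  (L.hasFDerivAt.comp z hf.hasFDerivAt).differentiableAt

theorem contDiffAt_clm_comp (L : A →L[ℝ] B) {n : WithTop ℕ∞} {f : C3 → A} {z : C3}
    (hf : ContDiffAt ℝ n f z) : ContDiffAt ℝ n (fun y => L (f y)) z :=
  L.contDiff.contDiffAt.comp z hf

theorem contDiffAt_clm_fderiv (L : (C3 →L[ℝ] A) →L[ℝ] B) {n : WithTop ℕ∞} {f : C3 → A} {z : C3}
    (hf : ContDiffAt ℝ (n + 1) f z) : ContDiffAt ℝ n (fun y => L (fderiv ℝ f y)) z :=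
  contDiffAt_clm_comp L (hf.fderiv_right le_rfl)

end Generic

/-- The complex antilinear part of a real linear map. -/
noncomputable def antilinPart (A : Type*) [NormedAddCommGroup A] [NormedSpace ℝ A]
    [NormedSpace ℂ A] [SMulCommClass ℝ ℂ A] : (C3 →L[ℝ] A) →L[ℝ] (C3 →L[ℝ] A) :=
  (1 / 2 : ℂ) • (ContinuousLinearMap.id ℝ (C3 →L[ℝ] A)
      + Complex.I • (ContinuousLinearMap.compL ℝ C3 C3 A).flip mulI)

/-- The complex linear part of a real linear map. -/
noncomputable def linPart (A : Type*) [NormedAddCommGroup A] [NormedSpace ℝ A]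
    [NormedSpace ℂ A] [SMulCommClass ℝ ℂ A] : (C3 →L[ℝ] A) →L[ℝ] (C3 →L[ℝ] A) :=
  (1 / 2 : ℂ) • (ContinuousLinearMap.id ℝ (C3 →L[ℝ] A)
      - Complex.I • (ContinuousLinearMap.compL ℝ C3 C3 A).flip mulI)

/-- The algebraic part of `∂̄`. -/
noncomputable def dbarL (k : ℕ) : (C3 →L[ℝ] Alt k) →L[ℝ] Alt (k + 1) :=
  (alternatizeUncurryFinCLM ℝ C3 ℂ).comp (antilinPart (Alt k))

/-- The algebraic part of `∂`. -/
noncomputable def delL (k : ℕ) : (C3 →L[ℝ] Alt k) →L[ℝ] Alt (k + 1) :=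
  (alternatizeUncurryFinCLM ℝ C3 ℂ).comp (linPart (Alt k))

variable {k : ℕ}

theorem dbar_eq_dbarL (a : C3 → Alt k) (z : C3) : dbar a z = dbarL k (fderiv ℝ a z) := rfl

theorem del_eq_delL (a : C3 → Alt k) (z : C3) : del a z = delL k (fderiv ℝ a z) := rfl

theorem delL_apply (L : C3 →L[ℝ] Alt k) (v : Fin (k + 1) → C3) :
    delL k L v = ∑ i : Fin (k + 1), (-1) ^ (i : ℕ) • ((1 / 2 : ℂ) *
      (L (v i) (i.removeNth v) - Complex.I * L (mulI (v i)) (i.removeNth v))) :=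
  alternatizeUncurryFin_apply _ v

theorem dbarL_apply (L : C3 →L[ℝ] Alt k) (v : Fin (k + 1) → C3) :
    dbarL k L v = ∑ i : Fin (k + 1), (-1) ^ (i : ℕ) • ((1 / 2 : ℂ) *
      (L (v i) (i.removeNth v) + Complex.I * L (mulI (v i)) (i.removeNth v))) :=
  alternatizeUncurryFin_apply _ v

theorem delL_add_dbarL (L : C3 →L[ℝ] Alt k) :
    delL k L + dbarL k L = alternatizeUncurryFinCLM ℝ C3 ℂ L := by
  ext v
  rw [ContinuousAlternatingMap.add_apply, delL_apply, dbarL_apply, alternatizeUncurryFinCLM_apply,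
    alternatizeUncurryFin_apply, ← Finset.sum_add_distrib]
  refine Finset.sum_congr rfl fun i _ => ?_
  rw [← smul_add]
  congr 1
  ring

theorem del_add_dbar (a : C3 → Alt k) (z : C3) : del a z + dbar a z = extDeriv a z :=
  delL_add_dbarL _

theorem differentiableAt_fderiv {A : Type*} [NormedAddCommGroup A] [NormedSpace ℝ A] {f : C3 → A}
    {z : C3} (hf : ContDiffAt ℝ 2 f z) : DifferentiableAt ℝ (fderiv ℝ f) z :=
  (hf.fderiv_right (m := 1) (by norm_num)).differentiableAt (by norm_num)

theorem fderiv_dbar {a : C3 → Alt k} {z : C3} (ha : ContDiffAt ℝ 2 a z) :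
    fderiv ℝ (dbar a) z = (dbarL k).comp (fderiv ℝ (fderiv ℝ a) z) :=
  fderiv_clm_comp (dbarL k) (differentiableAt_fderiv ha)

theorem del_dbar {a : C3 → Alt k} {z : C3} (ha : ContDiffAt ℝ 2 a z) :
    del (dbar a) z = delL (k + 1) ((dbarL k).comp (fderiv ℝ (fderiv ℝ a) z)) := by
  rw [del_eq_delL, fderiv_dbar ha]

/-- This is `∂̄² = 0` in terms of the second derivative `B`: taking antilinear parts in both
variables preserves symmetry, and the alternation of a symmetric bilinear map vanishes. -/
theorem dbarL_dbarL {B : C3 →L[ℝ] C3 →L[ℝ] Alt k} (hB : ∀ u v, B u v = B v u) :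
    dbarL (k + 1) ((dbarL k).comp B) = 0 := by
  set P := antilinPart (Alt k) with hP
  have hPa : ∀ L u, P L u = (1 / 2 : ℂ) • (L u + Complex.I • L (mulI u)) := fun L u => rfl
  -- The antilinear part of `B` in both variables.
  set S : C3 →L[ℝ] C3 →L[ℝ] Alt k := antilinPart (C3 →L[ℝ] Alt k) (P.comp B) with hS
  have hSa : ∀ u, S u = (1 / 2 : ℂ) • (P (B u) + Complex.I • P (B (mulI u))) := fun u => rfl
  have e : dbarL (k + 1) ((dbarL k).comp B) =
      alternatizeUncurryFin ((alternatizeUncurryFinCLM ℝ C3 ℂ).comp S) := by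
    change alternatizeUncurryFin _ = _
    congr 1
    ext u : 1
    have h1 : ((alternatizeUncurryFinCLM ℝ C3 ℂ).comp S) u =
        alternatizeUncurryFin ((1 / 2 : ℂ) • (P (B u) + Complex.I • P (B (mulI u)))) := rfl
    rw [h1, alternatizeUncurryFin_smul, alternatizeUncurryFin_add, alternatizeUncurryFin_smul]
    rfl
  rw [e]
  refine alternatizeUncurryFin_alternatizeUncurryFinCLM_comp_of_symmetric fun x y => ?_
  simp only [hSa, hPa, _root_.smul_apply, _root_.add_apply, hB y, hB (mulI y)]
  module

theorem isSymm_fderiv_fderiv {A : Type*} [NormedAddCommGroup A] [NormedSpace ℝ A] {f : C3 → A}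
    {z : C3} (hf : ContDiffAt ℝ 2 f z) (u v : C3) :
    fderiv ℝ (fderiv ℝ f) z u v = fderiv ℝ (fderiv ℝ f) z v u :=
  (hf.isSymmSndFDerivAt (by simp)) u v

/-- Since `d = ∂ + ∂̄` and `∂̄² = 0`. Thus `∂∂̄` is exact, which gives closedness below. -/
theorem del_dbar_eq_extDeriv {a : C3 → Alt k} {z : C3} (ha : ContDiffAt ℝ 2 a z) :
    del (dbar a) z = extDeriv (dbar a) z := by
  rw [← del_add_dbar, left_eq_add, dbar_eq_dbarL, fderiv_dbar ha]
  exact dbarL_dbarL (isSymm_fderiv_fderiv ha)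

theorem contDiffAt_dbar {n : WithTop ℕ∞} {a : C3 → Alt k} {z : C3} (ha : ContDiffAt ℝ (n + 1) a z) :
    ContDiffAt ℝ n (dbar a) z :=
  contDiffAt_clm_fderiv (dbarL k) ha

theorem extDeriv_del_dbar {a : C3 → Alt k} {z : C3} (ha : ContDiffAt ℝ 3 a z) :
    extDeriv (fun y => Complex.I • del (dbar a) y) z = 0 := by
  have h1 : (fun y => Complex.I • del (dbar a) y) =ᶠ[𝓝 z]
      extDeriv (fun y => Complex.I • dbar a y) := by
    filter_upwards [ha.eventually (by simp)] with y hy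
    rw [del_dbar_eq_extDeriv (hy.of_le (by norm_num)), extDeriv, extDeriv,
      ← alternatizeUncurryFin_smul]
    congr 1
    exact (fderiv_const_smul ((contDiffAt_dbar (n := 2) hy).differentiableAt (by norm_num)) _).symm
  rw [h1.extDeriv_eq]
  have h2 : ContDiffAt ℝ 2 (fun y => Complex.I • dbar a y) z :=
    (contDiffAt_dbar (n := 2) ha).const_smul _
  exact extDeriv_extDeriv_apply h2 (by simp)

/-! ### Behaviour under holomorphic maps -/

theorem fderiv_alt_apply {a : C3 → Alt k} {z : C3} (ha : DifferentiableAt ℝ a z) (u : C3)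
    (v : Fin k → C3) : fderiv ℝ a z u v = fderiv ℝ (fun y => a y v) z u :=
  (DFunLike.congr_fun (fderiv_clm_comp (ContinuousAlternatingMap.apply ℝ C3 ℂ v) ha) u).symm

theorem differentiableAt_alt_apply {a : C3 → Alt k} {z : C3} (ha : DifferentiableAt ℝ a z)
    (v : Fin k → C3) : DifferentiableAt ℝ (fun y => a y v) z :=
  differentiableAt_clm_comp (ContinuousAlternatingMap.apply ℝ C3 ℂ v) ha

/-- The type condition is linear with constant coefficients and survives differentiation. -/
theorem fderiv_isOfType {a : C3 → Alt k} {z : C3} {p q : ℕ} (ha : DifferentiableAt ℝ a z)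
    (h : ∀ᶠ y in 𝓝 z, IsOfType p q (a y)) (u : C3) : IsOfType p q (fderiv ℝ a z u) := by
  intro c v
  rw [fderiv_alt_apply ha, fderiv_alt_apply ha]
  have e : (fun y => a y fun i => c • v i) =ᶠ[𝓝 z] fun y => (c ^ p * conj c ^ q) • a y v := by
    filter_upwards [h] with y hy
    exact hy c v
  rw [e.fderiv_eq, fderiv_fun_const_smul (differentiableAt_alt_apply ha v)]
  rfl

theorem fderiv_isReal {a : C3 → Alt k} {z : C3} (ha : DifferentiableAt ℝ a z)
    (h : ∀ᶠ y in 𝓝 z, IsReal (a y)) (u : C3) : IsReal (fderiv ℝ a z u) := by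
  intro v
  rw [fderiv_alt_apply ha]
  have e : (fun y => Complex.imCLM (a y v)) =ᶠ[𝓝 z] fun y => 0 := by
    filter_upwards [h] with y hy
    exact hy v
  have h1 := e.fderiv_eq (𝕜 := ℝ)
  have h2 := fderiv_clm_comp Complex.imCLM (differentiableAt_alt_apply ha v)
  have h3 := DFunLike.congr_fun (h2.symm.trans h1) u
  simpa using h3

/-- In each term of the alternation the direction enters through `L - i L∘i`, which is complex
linear, so it supplies one more factor `c`; the remaining slots scale by the type of `L u`. -/
theorem isOfType_delL {p q : ℕ} {L : C3 →L[ℝ] Alt k} (h : ∀ u, IsOfType p q (L u)) :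
    IsOfType (p + 1) q (delL k L) := by
  intro c v
  rw [delL_apply, delL_apply, Finset.mul_sum]
  refine Finset.sum_congr rfl fun i _ => ?_
  have e : ∀ u, L u (i.removeNth fun j => c • v j) = c ^ p * conj c ^ q * L u (i.removeNth v) :=
    fun u => h u c _
  have hc : ∀ (x : C3), c • x = c.re • x + c.im • mulI x := fun x => by
    conv_lhs => rw [← Complex.re_add_im c]
    rw [add_smul, mul_smul]; rfl
  have e1 : mulI (c • v i) = c.re • mulI (v i) - c.im • v i := by
    rw [hc, map_add, map_smul, map_smul, mulI_sq]
    module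
  rw [e, e, e1, hc, map_add, map_sub, map_smul, map_smul, map_smul, map_smul]
  simp only [ContinuousAlternatingMap.add_apply, ContinuousAlternatingMap.sub_apply,
    ContinuousAlternatingMap.smul_apply, Complex.real_smul, pow_succ, mul_smul_comm]
  congr 1
  generalize L (v i) (i.removeNth v) = x
  generalize L (mulI (v i)) (i.removeNth v) = y
  conv_rhs => rw [mul_assoc (c ^ p) c, mul_comm c]
  have hc : c = c.re + c.im * Complex.I := (Complex.re_add_im c).symm
  generalize c ^ p = s
  generalize conj c ^ q = t
  generalize c.re = re at *
  generalize c.im = im at *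
  subst hc
  linear_combination (s * t / 2 * im * y) * Complex.I_sq

/-- As for `isOfType_delL`, with the antilinear combination `L + i L∘i` contributing a factor `conj
c`. -/
theorem isOfType_dbarL {p q : ℕ} {L : C3 →L[ℝ] Alt k} (h : ∀ u, IsOfType p q (L u)) :
    IsOfType p (q + 1) (dbarL k L) := by
  intro c v
  rw [dbarL_apply, dbarL_apply, Finset.mul_sum]
  refine Finset.sum_congr rfl fun i _ => ?_
  have e : ∀ u, L u (i.removeNth fun j => c • v j) = c ^ p * conj c ^ q * L u (i.removeNth v) :=
    fun u => h u c _
  have hc : ∀ (x : C3), c • x = c.re • x + c.im • mulI x := fun x => by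
    conv_lhs => rw [← Complex.re_add_im c]
    rw [add_smul, mul_smul]; rfl
  have e1 : mulI (c • v i) = c.re • mulI (v i) - c.im • v i := by
    rw [hc, map_add, map_smul, map_smul, mulI_sq]
    module
  rw [e, e, e1, hc, map_add, map_sub, map_smul, map_smul, map_smul, map_smul]
  simp only [ContinuousAlternatingMap.add_apply, ContinuousAlternatingMap.sub_apply,
    ContinuousAlternatingMap.smul_apply, Complex.real_smul, pow_succ, mul_smul_comm]
  congr 1
  generalize L (v i) (i.removeNth v) = x
  generalize L (mulI (v i)) (i.removeNth v) = y
  have hc : conj c = c.re - c.im * Complex.I := by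
    conv_lhs => rw [← Complex.re_add_im c]
    rw [map_add, map_mul, Complex.conj_ofReal, Complex.conj_ofReal, Complex.conj_I]
    ring
  rw [hc]
  generalize c ^ p = s
  generalize ((c.re : ℂ) - c.im * Complex.I) ^ q = t
  linear_combination (s * t / 2 * c.im * y) * Complex.I_sq

theorem isOfType_del_dbar {a : C3 → Alt k} {z : C3} {p q : ℕ} (ha : ContDiffAt ℝ 2 a z)
    (h : ∀ᶠ y in 𝓝 z, IsOfType p q (a y)) : IsOfType (p + 1) (q + 1) (del (dbar a) z) := by
  have h2 : ∀ᶠ y in 𝓝 z, IsOfType p (q + 1) (dbar a y) := by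
    filter_upwards [h.eventually_nhds, ha.eventually (by simp)] with y hy hy'
    exact isOfType_dbarL fun u => fderiv_isOfType (hy'.differentiableAt (by norm_num)) hy u
  exact isOfType_delL fun u =>
    fderiv_isOfType ((contDiffAt_dbar (n := 1) ha).differentiableAt (by norm_num)) h2 u

/-- The form `a (i v₁, …, i v_k)`. -/
noncomputable def compI (a : Alt k) : Alt k := a.compContinuousLinearMap mulI

/-- A form of type (1,1) does not notice `i` applied to both its arguments, so `i` in the direction
of differentiation may be replaced by `i` in all three slots. This expresses `∂̄` through `d` and
`compI`, both well behaved under holomorphic maps. -/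
theorem dbarL_of_type {L : C3 →L[ℝ] Alt 2} (h : ∀ u, IsOfType 1 1 (L u)) :
    dbarL 2 L = (1 / 2 : ℂ) • (alternatizeUncurryFin L
      + Complex.I • compI (alternatizeUncurryFin L)) := by
  ext v
  rw [dbarL_apply, ContinuousAlternatingMap.smul_apply, ContinuousAlternatingMap.add_apply,
    ContinuousAlternatingMap.smul_apply, compI,
    ContinuousAlternatingMap.compContinuousLinearMap_apply, alternatizeUncurryFin_apply,
    alternatizeUncurryFin_apply, Finset.smul_sum, ← Finset.sum_add_distrib, Finset.smul_sum]
  refine Finset.sum_congr rfl fun i _ => ?_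
  have e : L (mulI (v i)) (i.removeNth (mulI ∘ v)) = L (mulI (v i)) (i.removeNth v) := by
    have := h (mulI (v i)) Complex.I (i.removeNth v)
    simp only [pow_one, Complex.conj_I, mul_neg, Complex.I_mul_I, neg_neg, one_mul] at this
    exact this
  change _ = (1 / 2 : ℂ) • (_ + Complex.I • (_ • L (mulI (v i)) (i.removeNth (mulI ∘ v))))
  rw [e, smul_comm Complex.I, ← smul_add, smul_comm (1 / 2 : ℂ)]
  rfl

theorem dbar_of_type {w : C3 → Alt 2} {z : C3} (hw : DifferentiableAt ℝ w z)
    (h : ∀ᶠ y in 𝓝 z, IsOfType 1 1 (w y)) :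
    dbar w z = (1 / 2 : ℂ) • (extDeriv w z + Complex.I • compI (extDeriv w z)) :=
  dbarL_of_type fun u => fderiv_isOfType hw h u

theorem differentiableAt_compI {a : C3 → Alt k} {z : C3} (ha : DifferentiableAt ℝ a z) :
    DifferentiableAt ℝ (fun y => compI (a y)) z :=
  differentiableAt_clm_comp
    (compContinuousLinearMapCLM mulI : (C3 [⋀^Fin k]→L[ℝ] ℂ) →L[ℝ] (C3 [⋀^Fin k]→L[ℝ] ℂ)) ha

theorem contDiffAt_extDeriv {n : WithTop ℕ∞} {a : C3 → Alt k} {z : C3}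
    (ha : ContDiffAt ℝ (n + 1) a z) : ContDiffAt ℝ n (extDeriv a) z :=
  contDiffAt_clm_fderiv (alternatizeUncurryFinCLM ℝ C3 ℂ) ha

/-- `i∂∂̄ω = -½ d ((dω) ∘ i)` for `ω` of type `(1,1)`. -/
theorem del_dbar_of_type {w : C3 → Alt 2} {z : C3} (hw : ContDiffAt ℝ 2 w z)
    (h : ∀ᶠ y in 𝓝 z, IsOfType 1 1 (w y)) :
    Complex.I • del (dbar w) z = (-(1 / 2) : ℝ) • extDeriv (fun y => compI (extDeriv w y)) z := by
  rw [del_dbar_eq_extDeriv hw]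
  have e : dbar w =ᶠ[𝓝 z] fun y =>
      (1 / 2 : ℂ) • (extDeriv w y + Complex.I • compI (extDeriv w y)) := by
    filter_upwards [h.eventually_nhds, hw.eventually (by simp)] with y hy hy'
    exact dbar_of_type (hy'.differentiableAt (by norm_num)) hy
  have d1 : DifferentiableAt ℝ (extDeriv w) z :=
    (contDiffAt_extDeriv (n := 1) hw).differentiableAt (by norm_num)
  have d2 : DifferentiableAt ℝ (fun y => compI (extDeriv w y)) z :=
    differentiableAt_compI d1
  have hD := ((d1.hasFDerivAt.add (d2.hasFDerivAt.const_smul Complex.I)).const_smul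
    (1 / 2 : ℂ)).fderiv
  rw [e.extDeriv_eq, extDeriv]
  refine (congrArg (fun L => Complex.I • alternatizeUncurryFin L) hD).trans ?_
  rw [alternatizeUncurryFin_smul, alternatizeUncurryFin_add, alternatizeUncurryFin_smul]
  -- Since `d² = 0`, only the term with `compI` remains; its coefficient is `i · ½ · i = -½`.
  have e2 : alternatizeUncurryFin (fderiv ℝ (extDeriv w) z) = 0 :=
    extDeriv_extDeriv_apply hw (by simp)
  rw [e2, zero_add, smul_smul, smul_smul]
  ext v
  simp only [ContinuousAlternatingMap.smul_apply, smul_eq_mul, Complex.real_smul, extDeriv]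
  push_cast
  linear_combination (1 / 2 * (alternatizeUncurryFin (fderiv ℝ (fun y => compI (alternatizeUncurryFin (fderiv ℝ w y))) z) v)) * Complex.I_sq

theorem isReal_extDeriv {a : C3 → Alt k} {z : C3} (ha : DifferentiableAt ℝ a z)
    (h : ∀ᶠ y in 𝓝 z, IsReal (a y)) : IsReal (extDeriv a z) := by
  intro v
  rw [extDeriv, alternatizeUncurryFin_apply, Complex.im_sum]
  refine Finset.sum_eq_zero fun i _ => ?_
  have := fderiv_isReal ha h (v i) (i.removeNth v)
  rcases neg_one_pow_eq_or ℤ (i : ℕ) with h' | h' <;> simp [h', this]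

/-- Reality is visible in `-½ d((dω)∘i)`, a real operator; the type is visible in `∂∂̄`. -/
theorem isRealOfType_del_dbar {w : C3 → Alt 2} {z : C3} (hw : ContDiffAt ℝ 2 w z)
    (h : ∀ᶠ y in 𝓝 z, IsRealOfType 1 1 (w y)) :
    IsRealOfType 2 2 (Complex.I • del (dbar w) z : Alt 4) := by
  constructor
  · rw [del_dbar_of_type hw (h.mono fun _ h => h.2)]
    have d1 : DifferentiableAt ℝ (extDeriv w) z :=
      (contDiffAt_extDeriv (n := 1) hw).differentiableAt (by norm_num)
    have d2 : DifferentiableAt ℝ (fun y => compI (extDeriv w y)) z :=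
      differentiableAt_compI d1
    have : IsReal (extDeriv (fun y => compI (extDeriv w y)) z) := by
      refine isReal_extDeriv d2 ?_
      filter_upwards [h.eventually_nhds, hw.eventually (by simp)] with y hy hy' v
      exact isReal_extDeriv (hy'.differentiableAt (by norm_num)) (hy.mono fun _ h => h.1) _
    intro v
    have := this v
    simp only [ContinuousAlternatingMap.smul_apply, Complex.real_smul, Complex.im_ofReal_mul, this,
      mul_zero]
  · have := isOfType_del_dbar hw (h.mono fun _ h => h.2)
    intro c v
    have := this c v
    simp only [ContinuousAlternatingMap.smul_apply, smul_eq_mul, this]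
    ring

/-- Complex differentiability at a point near which `T` is holomorphic. -/
theorem compI_pullC (T : C3 →L[ℂ] C3) (a : Alt k) : compI (pullC T a) = pullC T (compI a) := by
  ext v
  simp only [compI, ContinuousAlternatingMap.compContinuousLinearMap_apply]
  congr 1
  funext i
  simp [mulI_apply]

/-- The pull-back of a form on an open subset of `ℂ³` by a holomorphic map. -/
theorem del_dbar_pullback {T : C3 → C3} {w w' : C3 → Alt 2} {z : C3}
    (hT : ContDiffAt ℂ ω T z) (hw : ContDiffAt ℝ 2 w z) (hw' : ContDiffAt ℝ 2 w' (T z))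
    (hty : ∀ᶠ y in 𝓝 (T z), IsOfType 1 1 (w' y))
    (he : ∀ᶠ y in 𝓝 z, w y = pullC (fderiv ℂ T y) (w' (T y))) :
    (Complex.I • del (dbar w) z : Alt 4) =
      pullC (fderiv ℂ T z) (Complex.I • del (dbar w') (T z) : Alt 4) := by
  have hTr : ContDiffAt ℝ ω T z := hT.restrict_scalars ℝ
  have hf : ∀ᶠ y in 𝓝 z, fderiv ℝ T y = (fderiv ℂ T y).restrictScalars ℝ := by
    filter_upwards [hT.eventually (by simp)] with y hy
    exact (hy.differentiableAt (by simp)).fderiv_restrictScalars ℝ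
  have hTc : ContinuousAt T z := hT.continuousAt
  have he' : w =ᶠ[𝓝 z] fun y => (w' (T y)).compContinuousLinearMap (fderiv ℝ T y) := by
    filter_upwards [he, hf] with y h1 h2
    rw [h1, h2]
  have hd : ∀ᶠ y in 𝓝 z, extDeriv w y = pullC (fderiv ℂ T y) (extDeriv w' (T y)) := by
    filter_upwards [he'.eventuallyEq_nhds, hf, hTr.eventually (by simp),
      hTc.eventually (hw'.eventually (by simp))] with y h1 h2 h3 h4
    rw [h1.extDeriv_eq, extDeriv_pullback (r := ω) (h4.differentiableAt (by norm_num)) h3 (by simp),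
      h2]
  have d1 : DifferentiableAt ℝ (fun y => compI (extDeriv w' y)) (T z) :=
    differentiableAt_compI
      ((contDiffAt_extDeriv (n := 1) hw').differentiableAt (by norm_num))
  -- Pull-back by `T` commutes with `d`, and with `compI` because the derivative of `T` is complex
  -- linear. The formula of `del_dbar_of_type` then transfers from `w'` to `w`.
  have hc : (fun y => compI (extDeriv w y)) =ᶠ[𝓝 z] fun y =>
      (compI (extDeriv w' (T y))).compContinuousLinearMap (fderiv ℝ T y) := by
    filter_upwards [hd, hf] with y h1 h2
    rw [h1, h2, compI_pullC]
  rw [del_dbar_of_type hw' hty, del_dbar_of_type hw]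
  · rw [hc.extDeriv_eq, extDeriv_pullback (r := ω) d1 hTr (by simp), hf.self_of_nhds]
    rfl
  · filter_upwards [he, hTc.eventually hty] with y h1 h2
    rw [h1]
    exact h2.pullC _

end Calculus

section Wirtinger

open Filter

/-! ### Wirtinger derivatives -/

/-- The derivative `½ (D_u f + ε i D_{iu} f)`; it is `∂_u f` for `ε = -1` and `∂̄_u f` for
`ε = 1`. -/
noncomputable def dEps (ε : ℂ) (f : C3 → ℂ) (z u : C3) : ℂ :=
  (1 / 2 : ℂ) * (fderiv ℝ f z u + ε * Complex.I * fderiv ℝ f z (mulI u))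

variable {ε δ : ℂ} {f g : C3 → ℂ} {z : C3}

theorem dEps_add_neg (f : C3 → ℂ) (z u : C3) : dEps 1 f z u + dEps (-1) f z u = fderiv ℝ f z u := by
  unfold dEps; ring

theorem dEps_mul (hf : DifferentiableAt ℝ f z) (hg : DifferentiableAt ℝ g z) (u : C3) :
    dEps ε (fun y => f y * g y) z u = dEps ε f z u * g z + f z * dEps ε g z u := by
  unfold dEps
  rw [fderiv_fun_mul hf hg]
  simp only [_root_.add_apply, _root_.smul_apply, smul_eq_mul]
  ring

theorem dEps_add (hf : DifferentiableAt ℝ f z) (hg : DifferentiableAt ℝ g z) (u : C3) :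
    dEps ε (fun y => f y + g y) z u = dEps ε f z u + dEps ε g z u := by
  unfold dEps
  rw [fderiv_fun_add hf hg]
  simp only [_root_.add_apply]
  ring

theorem dEps_const (c : ℂ) (u : C3) : dEps ε (fun _ => c) z u = 0 := by
  simp [dEps]

theorem dEps_sum {ι : Type*} (s : Finset ι) {f : ι → C3 → ℂ}
    (hf : ∀ i ∈ s, DifferentiableAt ℝ (f i) z) (u : C3) :
    dEps ε (fun y => ∑ i ∈ s, f i y) z u = ∑ i ∈ s, dEps ε (f i) z u := by
  unfold dEps
  rw [fderiv_fun_sum hf]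
  simp only [_root_.sum_apply, Finset.mul_sum, ← Finset.sum_add_distrib]

theorem dEps_congr (h : f =ᶠ[𝓝 z] g) (u : C3) : dEps ε f z u = dEps ε g z u := by
  unfold dEps
  rw [h.fderiv_eq]

/-- A complex linear derivative commutes with `i`, so a holomorphic substitution does not mix `∂`
and `∂̄`. -/
theorem dEps_comp {T : C3 → C3} {f : C3 → ℂ} (hT : DifferentiableAt ℂ T z)
    (hf : DifferentiableAt ℝ f (T z)) (u : C3) :
    dEps ε (fun y => f (T y)) z u = dEps ε f (T z) (fderiv ℂ T z u) := by
  unfold dEps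
  have h := (hf.hasFDerivAt.comp z (hT.hasFDerivAt.restrictScalars ℝ)).fderiv
  change (1 / 2 : ℂ) * (fderiv ℝ (f ∘ T) z u + _ * fderiv ℝ (f ∘ T) z _) = _
  rw [h]
  simp [mulI_apply]

theorem dEps_neg_one_of_holomorphic (hf : DifferentiableAt ℂ f z) (u : C3) :
    dEps (-1) f z u = fderiv ℂ f z u := by
  unfold dEps
  rw [hf.fderiv_restrictScalars ℝ]
  simp only [ContinuousLinearMap.coe_restrictScalars', mulI_apply, map_smul, smul_eq_mul]
  linear_combination (-1 / 2 * fderiv ℂ f z u) * Complex.I_sq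

theorem dEps_one_of_holomorphic (hf : DifferentiableAt ℂ f z) (u : C3) :
    dEps 1 f z u = 0 := by
  unfold dEps
  rw [hf.fderiv_restrictScalars ℝ]
  simp only [ContinuousLinearMap.coe_restrictScalars', mulI_apply, map_smul, smul_eq_mul]
  linear_combination (1 / 2 * fderiv ℂ f z u) * Complex.I_sq

theorem dEps_conj (hf : DifferentiableAt ℝ f z) (u : C3) :
    dEps ε (fun y => conj (f y)) z u = conj (dEps (-conj ε) f z u) := by
  unfold dEps
  have h := fderiv_clm_comp (Complex.conjCLE : ℂ →L[ℝ] ℂ) hf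
  have e : fderiv ℝ (fun y => conj (f y)) z =
    (Complex.conjCLE : ℂ →L[ℝ] ℂ).comp (fderiv ℝ f z) := h
  rw [e]
  have h2 : conj (1 / 2 : ℂ) = 1 / 2 := by
    rw [map_div₀, map_one, map_ofNat]
  simp only [ContinuousLinearMap.comp_apply, map_mul, map_add, map_neg, h2, Complex.conj_I,
    Complex.conj_conj, ContinuousLinearEquiv.coe_coe, Complex.conjCLE_apply]
  ring

theorem fderiv_fderiv_apply (hf : ContDiffAt ℝ 2 f z) (u v : C3) :
    fderiv ℝ (fun y => fderiv ℝ f y v) z u = fderiv ℝ (fderiv ℝ f) z u v :=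
  DFunLike.congr_fun (fderiv_clm_comp (ContinuousLinearMap.apply ℝ ℂ v)
    (differentiableAt_fderiv hf)) u

theorem differentiableAt_fderiv_apply (hf : ContDiffAt ℝ 2 f z) (v : C3) :
    DifferentiableAt ℝ (fun y => fderiv ℝ f y v) z :=
  differentiableAt_clm_comp (ContinuousLinearMap.apply ℝ ℂ v) (differentiableAt_fderiv hf)

theorem dEps_dEps (hf : ContDiffAt ℝ 2 f z) (u v : C3) :
    dEps ε (fun y => dEps δ f y v) z u = (1 / 4 : ℂ) * (fderiv ℝ (fderiv ℝ f) z u v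
      + δ * Complex.I * fderiv ℝ (fderiv ℝ f) z u (mulI v)
      + ε * Complex.I * fderiv ℝ (fderiv ℝ f) z (mulI u) v
      - ε * δ * fderiv ℝ (fderiv ℝ f) z (mulI u) (mulI v)) := by
  have h : ∀ w, fderiv ℝ (fun y => dEps δ f y v) z w = (1 / 2 : ℂ) *
      (fderiv ℝ (fderiv ℝ f) z w v + δ * Complex.I * fderiv ℝ (fderiv ℝ f) z w (mulI v)) := by
    intro w
    unfold dEps
    have h1 := differentiableAt_fderiv_apply hf v
    have h2 := differentiableAt_fderiv_apply hf (mulI v)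
    rw [fderiv_const_mul (h1.fun_add (h2.const_mul _)), fderiv_fun_add h1 (h2.const_mul _),
      fderiv_const_mul h2]
    simp only [_root_.smul_apply, _root_.add_apply, smul_eq_mul, fderiv_fderiv_apply hf]
  rw [dEps, h, h]
  linear_combination (1 / 4 * ε * δ * fderiv ℝ (fderiv ℝ f) z (mulI u) (mulI v)) * Complex.I_sq

/-- Symmetry of the second derivative, for any pair of Wirtinger operators. -/
theorem dEps_comm (hf : ContDiffAt ℝ 2 f z) (u v : C3) :
    dEps ε (fun y => dEps δ f y v) z u = dEps δ (fun y => dEps ε f y u) z v := by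
  rw [dEps_dEps hf, dEps_dEps hf, isSymm_fderiv_fderiv hf u, isSymm_fderiv_fderiv hf u,
    isSymm_fderiv_fderiv hf (mulI u), isSymm_fderiv_fderiv hf (mulI u)]
  ring

theorem contDiffOn_dEps {U : Set C3} (hU : IsOpen U) (hf : ContDiffOn ℝ ∞ f U) (v : C3) :
    ContDiffOn ℝ ∞ (fun y => dEps ε f y v) U := by
  have h : ContDiffOn ℝ ∞ (fderiv ℝ f) U := hf.fderiv_of_isOpen hU (by simp)
  have h1 := fun w => h.clm_apply (contDiffOn_const (c := w))
  exact contDiffOn_const.mul ((h1 _).add (contDiffOn_const.mul (h1 _)))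

theorem dEps_smul_right (c : ℂ) (u : C3) :
    dEps (-1) f z (c • u) = c * dEps (-1) f z u ∧ dEps 1 f z (c • u) = conj c * dEps 1 f z u := by
  have hc : ∀ (x : C3), c • x = c.re • x + c.im • mulI x := fun x => by
    conv_lhs => rw [← Complex.re_add_im c]
    rw [add_smul, mul_smul]; rfl
  have e1 : mulI (c • u) = c.re • mulI u - c.im • u := by
    rw [hc, map_add, map_smul, map_smul, mulI_sq]
    module
  have hcc : conj c = c.re - c.im * Complex.I := by
    conv_lhs => rw [← Complex.re_add_im c]
    rw [map_add, map_mul, Complex.conj_ofReal, Complex.conj_ofReal, Complex.conj_I]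
    ring
  have hc' : c = c.re + c.im * Complex.I := (Complex.re_add_im c).symm
  unfold dEps
  rw [e1, hc, hcc, map_add, map_sub, map_smul, map_smul, map_smul, map_smul]
  simp only [Complex.real_smul]
  constructor
  · conv_rhs => rw [hc']
    linear_combination (fderiv ℝ f z (mulI u) * c.im / 2) * Complex.I_sq
  · linear_combination (fderiv ℝ f z (mulI u) * c.im / 2) * Complex.I_sq

theorem dEps_add_right (u v : C3) : dEps ε f z (u + v) = dEps ε f z u + dEps ε f z v := by
  unfold dEps
  rw [map_add, map_add, map_add]
  ring

end Wirtinger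

/-! ### Chern connection and curvature as matrices, and their gauge transformations -/

section MatrixCalculus

open Matrix Filter

variable {r : ℕ} {ε : ℂ} {M N : C3 → Matrix (Fin r) (Fin r) ℂ} {z : C3} {U : Set C3}

/-- Entrywise Wirtinger derivative. -/
noncomputable def dM (ε : ℂ) (M : C3 → Matrix (Fin r) (Fin r) ℂ) (z u : C3) :
    Matrix (Fin r) (Fin r) ℂ :=
  of fun a b => dEps ε (fun y => M y a b) z u

theorem dM_mul (hM : ∀ a b, DifferentiableAt ℝ (fun y => M y a b) z)
    (hN : ∀ a b, DifferentiableAt ℝ (fun y => N y a b) z) (u : C3) :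
    dM ε (fun y => M y * N y) z u = dM ε M z u * N z + M z * dM ε N z u := by
  ext a b
  simp only [dM, of_apply, mul_apply, Matrix.add_apply]
  rw [dEps_sum _ fun c _ => (hM a c).fun_mul (hN c b), ← Finset.sum_add_distrib]
  exact Finset.sum_congr rfl fun c _ => dEps_mul (hM a c) (hN c b) u

theorem dM_add (hM : ∀ a b, DifferentiableAt ℝ (fun y => M y a b) z)
    (hN : ∀ a b, DifferentiableAt ℝ (fun y => N y a b) z) (u : C3) :
    dM ε (fun y => M y + N y) z u = dM ε M z u + dM ε N z u := by
  ext a b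
  exact dEps_add (hM a b) (hN a b) u

theorem dM_congr (h : M =ᶠ[𝓝 z] N) (u : C3) : dM ε M z u = dM ε N z u := by
  ext a b
  refine dEps_congr ?_ u
  filter_upwards [h] with y hy
  rw [hy]

theorem dM_one_of_holomorphic (hM : ∀ a b, DifferentiableAt ℂ (fun y => M y a b) z) (u : C3) :
    dM 1 M z u = 0 := by
  ext a b
  exact dEps_one_of_holomorphic (hM a b) u

theorem dM_comp {T : C3 → C3} (hT : DifferentiableAt ℂ T z)
    (hM : ∀ a b, DifferentiableAt ℝ (fun y => M y a b) (T z)) (u : C3) :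
    dM ε (fun y => M (T y)) z u = dM ε M (T z) (fderiv ℂ T z u) := by
  ext a b
  exact dEps_comp hT (hM a b) u

theorem dM_conjTranspose (hM : ∀ a b, DifferentiableAt ℝ (fun y => M y a b) z) (u : C3) :
    dM ε (fun y => (M y)ᴴ) z u = (dM (-conj ε) M z u)ᴴ := by
  ext a b
  exact dEps_conj (hM b a) u

theorem contDiffOn_matrix_mul {D : Type*} [NormedAddCommGroup D] [NormedSpace ℝ D] {s : Set D}
    {n : WithTop ℕ∞} {M N : D → Matrix (Fin r) (Fin r) ℂ}
    (hM : ∀ a b, ContDiffOn ℝ n (fun y => M y a b) s)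
    (hN : ∀ a b, ContDiffOn ℝ n (fun y => N y a b) s) (a b : Fin r) :
    ContDiffOn ℝ n (fun y => (M y * N y) a b) s := by
  simp only [mul_apply]
  exact ContDiffOn.sum fun c _ => (hM a c).mul (hN c b)

theorem inv_apply_eq (A : Matrix (Fin r) (Fin r) ℂ) (a b : Fin r) :
    A⁻¹ a b = A.det⁻¹ * A.adjugate a b := by
  rw [inv_def, Ring.inverse_eq_inv']; rfl

theorem contDiffOn_matrix_inv {D : Type*} [NormedAddCommGroup D] [NormedSpace ℝ D] {s : Set D}
    {n : WithTop ℕ∞} {M : D → Matrix (Fin r) (Fin r) ℂ}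
    (hM : ∀ a b, ContDiffOn ℝ n (fun y => M y a b) s) (hd : ∀ y ∈ s, (M y).det ≠ 0) (a b : Fin r) :
    ContDiffOn ℝ n (fun y => (M y)⁻¹ a b) s := by
  simp only [inv_apply_eq]
  exact ((contDiffOn_det hM).inv hd).mul (contDiffOn_adjugate hM a b)

theorem contDiffOn_dM (hU : IsOpen U) (hM : ∀ a b, ContDiffOn ℝ ∞ (fun y => M y a b) U) (u : C3)
    (a b : Fin r) : ContDiffOn ℝ ∞ (fun y => dM ε M y u a b) U :=
  contDiffOn_dEps hU (hM a b) u

theorem differentiableAt_of_contDiffOn (hU : IsOpen U) (hz : z ∈ U)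
    (hM : ∀ a b, ContDiffOn ℝ ∞ (fun y => M y a b) U) (a b : Fin r) :
    DifferentiableAt ℝ (fun y => M y a b) z :=
  ((hM a b).contDiffAt (hU.mem_nhds hz)).differentiableAt (by simp)

theorem contDiffAt_two_of_contDiffOn (hU : IsOpen U) (hz : z ∈ U)
    (hM : ∀ a b, ContDiffOn ℝ ∞ (fun y => M y a b) U) (a b : Fin r) :
    ContDiffAt ℝ 2 (fun y => M y a b) z :=
  ((hM a b).contDiffAt (hU.mem_nhds hz)).of_le (by norm_cast)

/-- The value of the Chern connection `H⁻¹ ∂_v H` as a matrix. -/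
noncomputable def connM (M : C3 → Matrix (Fin r) (Fin r) ℂ) (v y : C3) :
    Matrix (Fin r) (Fin r) ℂ :=
  (M y)⁻¹ * dM (-1) M y v

/-- The matrix `∂̄_u (H⁻¹ ∂_v H)`. -/
noncomputable def curvM (M : C3 → Matrix (Fin r) (Fin r) ℂ) (z u v : C3) :
    Matrix (Fin r) (Fin r) ℂ :=
  dM 1 (connM M v) z u

theorem contDiffOn_connM (hU : IsOpen U) (hM : ∀ a b, ContDiffOn ℝ ∞ (fun y => M y a b) U)
    (hd : ∀ y ∈ U, (M y).det ≠ 0) (v : C3) (a b : Fin r) :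
    ContDiffOn ℝ ∞ (fun y => connM M v y a b) U :=
  contDiffOn_matrix_mul (contDiffOn_matrix_inv hM hd) (contDiffOn_dM hU hM v) a b

/-- Differentiating the identity `∂M = M A` for `A = M⁻¹∂M` by the product rule avoids
differentiating the inverse. -/
theorem dM_connM (hU : IsOpen U) (hz : z ∈ U) (hM : ∀ a b, ContDiffOn ℝ ∞ (fun y => M y a b) U)
    (hd : ∀ y ∈ U, (M y).det ≠ 0) (u v : C3) :
    M z * dM ε (connM M v) z u =
      dM ε (fun y => dM (-1) M y v) z u - dM ε M z u * connM M v z := by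
  have h : (fun y => dM (-1) M y v) =ᶠ[𝓝 z] fun y => M y * connM M v y := by
    filter_upwards [hU.mem_nhds hz] with y hy
    rw [connM, ← Matrix.mul_assoc, mul_nonsing_inv _ (isUnit_iff_ne_zero.2 (hd y hy)),
      Matrix.one_mul]
  rw [dM_congr h, dM_mul (differentiableAt_of_contDiffOn hU hz hM)
    (differentiableAt_of_contDiffOn hU hz (contDiffOn_connM hU hM hd v))]
  abel

/-- Only the value, the first derivatives and one mixed second derivative of `M` occur; the jet
expression of the curvature is read off from this. -/
theorem mul_curvM (hU : IsOpen U) (hz : z ∈ U) (hM : ∀ a b, ContDiffOn ℝ ∞ (fun y => M y a b) U)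
    (hd : ∀ y ∈ U, (M y).det ≠ 0) (u v : C3) :
    M z * curvM M z u v =
      dM 1 (fun y => dM (-1) M y v) z u - dM 1 M z u * (M z)⁻¹ * dM (-1) M z v := by
  rw [curvM, dM_connM hU hz hM hd, connM, Matrix.mul_assoc]

theorem eq_inv_mul_of_mul_eq {A B C : Matrix (Fin r) (Fin r) ℂ} (hd : A.det ≠ 0)
    (h : A * B = C) : B = A⁻¹ * C := by
  rw [← h, ← Matrix.mul_assoc, nonsing_inv_mul _ (isUnit_iff_ne_zero.2 hd), Matrix.one_mul]

theorem mul_left_cancel_of_det_ne_zero {A B C : Matrix (Fin r) (Fin r) ℂ} (hd : A.det ≠ 0)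
    (h : A * B = A * C) : B = C := by
  rw [eq_inv_mul_of_mul_eq hd h, ← Matrix.mul_assoc,
    nonsing_inv_mul _ (isUnit_iff_ne_zero.2 hd), Matrix.one_mul]

/-- The (2,0)-part of `dA + A ∧ A` vanishes for `A = M⁻¹∂M`: after multiplication by `M`, the second
derivatives cancel by symmetry and the quadratic terms cancel each other. -/
theorem dM_neg_one_connM (hU : IsOpen U) (hz : z ∈ U)
    (hM : ∀ a b, ContDiffOn ℝ ∞ (fun y => M y a b) U)
    (hd : ∀ y ∈ U, (M y).det ≠ 0) (u v : C3) :
    dM (-1) (connM M v) z u - dM (-1) (connM M u) z v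
      + (connM M u z * connM M v z - connM M v z * connM M u z) = 0 := by
  refine mul_left_cancel_of_det_ne_zero (hd z hz) ?_
  have hs : dM (-1) (fun y => dM (-1) M y v) z u = dM (-1) (fun y => dM (-1) M y u) z v := by
    ext a b
    exact dEps_comm (contDiffAt_two_of_contDiffOn hU hz hM a b) u v
  have hc : ∀ w, M z * connM M w z = dM (-1) M z w := fun w => by
    rw [connM, ← Matrix.mul_assoc, mul_nonsing_inv _ (isUnit_iff_ne_zero.2 (hd z hz)),
      Matrix.one_mul]
  rw [mul_add, mul_sub, dM_connM hU hz hM hd, dM_connM hU hz hM hd, mul_sub, ← Matrix.mul_assoc,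
    ← Matrix.mul_assoc, hc, hc, hs]
  simp

/-! ### Change of frame and of coordinates -/

theorem dM_fderiv_apply {T : C3 → C3} (hT : ContDiffAt ℂ ω T z) (w : C3) (i : Fin 3) :
    DifferentiableAt ℂ (fun y => fderiv ℂ T y w i) z := by
  have h : DifferentiableAt ℂ (fderiv ℂ T) z :=
    (hT.fderiv_right (m := 1) le_top).differentiableAt (by norm_num)
  exact differentiableAt_pi.1 (h.clm_apply (differentiableAt_const w)) i

theorem connM_smul (c : ℂ) (v y : C3) : connM M (c • v) y = c • connM M v y := by
  have : dM (-1) M y (c • v) = c • dM (-1) M y v := by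
    ext a b
    exact (dEps_smul_right c v).1
  rw [connM, this, Matrix.mul_smul, connM]

theorem connM_add (u v y : C3) : connM M (u + v) y = connM M u y + connM M v y := by
  have : dM (-1) M y (u + v) = dM (-1) M y u + dM (-1) M y v := by
    ext a b
    exact dEps_add_right u v
  rw [connM, this, Matrix.mul_add, connM, connM]

/-- Separates the direction from the base point, so that the connection can be differentiated along
a direction that itself varies with the point. -/
theorem connM_eq_sum (v y : C3) : connM M v y = ∑ i, v i • connM M (bas i) y := by
  have hv : v = ∑ i, v i • bas i := by
    ext j
    simp [bas, Finset.sum_apply, Pi.single_apply]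
  conv_lhs => rw [hv]
  let φ : C3 →ₗ[ℂ] Matrix (Fin r) (Fin r) ℂ :=
    { toFun := fun v => connM M v y
      map_add' := fun u v => connM_add u v y
      map_smul' := fun c v => connM_smul c v y }
  change φ _ = ∑ i, v i • φ (bas i)
  rw [map_sum]
  simp only [map_smul]

theorem curvM_smul_left (c : ℂ) (u v : C3) : curvM M z (c • u) v = conj c • curvM M z u v := by
  ext a b
  exact (dEps_smul_right c u).2

theorem curvM_smul_right (hU : IsOpen U) (hz : z ∈ U)
    (hM : ∀ a b, ContDiffOn ℝ ∞ (fun y => M y a b) U)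
    (hd : ∀ y ∈ U, (M y).det ≠ 0) (c : ℂ) (u v : C3) :
    curvM M z u (c • v) = c • curvM M z u v := by
  ext a b
  change dEps 1 (fun y => connM M (c • v) y a b) z u = c * dEps 1 (fun y => connM M v y a b) z u
  have h := differentiableAt_of_contDiffOn hU hz (contDiffOn_connM hU hM hd v) a b
  have e : (fun y => connM M (c • v) y a b) = fun y => c * connM M v y a b := by
    funext y
    rw [connM_smul]; rfl
  rw [e, dEps_mul (differentiableAt_const c) h, dEps_const]
  ring

variable {N' : C3 → Matrix (Fin r) (Fin r) ℂ} {g : C3 → Matrix (Fin r) (Fin r) ℂ} {T : C3 → C3}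

/-- For holomorphic `g` the factor `g*` is antiholomorphic and `∂` passes over it. -/
theorem dM_neg_one_gauge (hT : DifferentiableAt ℂ T z)
    (hM : ∀ a b, DifferentiableAt ℝ (fun y => M y a b) (T z))
    (hg : ∀ a b, DifferentiableAt ℂ (fun y => g y a b) z)
    (he : N =ᶠ[𝓝 z] fun y => (g y)ᴴ * M (T y) * g y) (v : C3) :
    dM (-1) N z v = (g z)ᴴ * (dM (-1) M (T z) (fderiv ℂ T z v) * g z
      + M (T z) * dM (-1) g z v) := by
  have hgr : ∀ a b, DifferentiableAt ℝ (fun y => g y a b) z := fun a b =>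
    (hg a b).restrictScalars ℝ
  have hgc : ∀ a b, DifferentiableAt ℝ (fun y => (g y)ᴴ a b) z := fun a b =>
    differentiableAt_clm_comp (Complex.conjCLE : ℂ →L[ℝ] ℂ) (hgr b a)
  have hMT : ∀ a b, DifferentiableAt ℝ (fun y => M (T y) a b) z := fun a b =>
    (hM a b).comp z (hT.restrictScalars ℝ)
  have hgM : ∀ a b, DifferentiableAt ℝ (fun y => ((g y)ᴴ * M (T y)) a b) z := fun a b => by
    simp only [mul_apply]
    exact DifferentiableAt.fun_sum fun c _ => (hgc a c).mul (hMT c b)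
  have h1 : dM (-1) (fun y => (g y)ᴴ) z v = 0 := by
    rw [dM_conjTranspose hgr]
    simp [dM_one_of_holomorphic hg]
  rw [dM_congr he, dM_mul hgM hgr, dM_mul hgc hMT, h1, dM_comp hT hM]
  simp only [Matrix.zero_mul, zero_add, Matrix.mul_assoc, mul_add]

/-- The transformation law `A' = g⁻¹ (T^*A) g + g⁻¹ ∂g`, checked after multiplication by `N`. -/
theorem connM_gauge (hT : DifferentiableAt ℂ T z)
    (hM : ∀ a b, DifferentiableAt ℝ (fun y => M y a b) (T z))
    (hg : ∀ a b, DifferentiableAt ℂ (fun y => g y a b) z)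
    (hMd : (M (T z)).det ≠ 0) (hgd : (g z).det ≠ 0)
    (he : N =ᶠ[𝓝 z] fun y => (g y)ᴴ * M (T y) * g y) (v : C3) :
    connM N v z = (g z)⁻¹ * (connM M (fderiv ℂ T z v) (T z) * g z + dM (-1) g z v) := by
  have hN : N z = (g z)ᴴ * M (T z) * g z := he.self_of_nhds
  have hNd : (N z).det ≠ 0 := by
    rw [hN, det_mul, det_mul, det_conjTranspose]
    exact mul_ne_zero (mul_ne_zero (star_ne_zero.2 hgd) hMd) hgd
  rw [connM]
  refine (eq_inv_mul_of_mul_eq hNd ?_).symm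
  rw [dM_neg_one_gauge hT hM hg he, hN]
  have e1 : g z * (g z)⁻¹ = 1 := mul_nonsing_inv _ (isUnit_iff_ne_zero.2 hgd)
  have e2 : M (T z) * (M (T z))⁻¹ = 1 := mul_nonsing_inv _ (isUnit_iff_ne_zero.2 hMd)
  calc (g z)ᴴ * M (T z) * g z * ((g z)⁻¹ * (connM M (fderiv ℂ T z v) (T z) * g z + dM (-1) g z v))
      = (g z)ᴴ * M (T z) * (g z * (g z)⁻¹) * (connM M (fderiv ℂ T z v) (T z) * g z
        + dM (-1) g z v) := by simp only [Matrix.mul_assoc]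
    _ = (g z)ᴴ * ((M (T z) * (M (T z))⁻¹) * dM (-1) M (T z) (fderiv ℂ T z v) * g z
        + M (T z) * dM (-1) g z v) := by
      rw [e1, Matrix.mul_one, connM]
      simp only [Matrix.mul_assoc, mul_add]
    _ = _ := by rw [e2, Matrix.one_mul]

theorem differentiableAt_inv_of_holomorphic
    (hg : ∀ a b, DifferentiableAt ℂ (fun y => g y a b) z) (hgd : (g z).det ≠ 0) (a b : Fin r) :
    DifferentiableAt ℂ (fun y => (g y)⁻¹ a b) z := by
  have hdet : ∀ {g : C3 → Matrix (Fin r) (Fin r) ℂ},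
      (∀ a b, DifferentiableAt ℂ (fun y => g y a b) z) →
      DifferentiableAt ℂ (fun y => (g y).det) z := by
    intro g hg
    simp only [det_apply, Units.smul_def, zsmul_eq_mul]
    exact DifferentiableAt.fun_sum fun σ _ => (differentiableAt_const _).mul
      (HasFDerivAt.finsetProd fun i _ => (hg _ _).hasFDerivAt).differentiableAt
  simp only [inv_apply_eq, adjugate_apply]
  refine ((hdet hg).inv hgd).mul (hdet fun k l => ?_)
  by_cases h : k = b
  · subst h
    simp only [updateRow_self]
    exact differentiableAt_const _
  · simp only [updateRow_ne h]
    exact hg k l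

/-- Apply `∂̄` to the law for the connection. The matrices `g⁻¹`, `g`, `∂g` and the derivative of
`T` are holomorphic, so only the derivative of the pulled-back connection survives, conjugated by
`g`. -/
theorem curvM_gauge {U : Set C3} (hT : ∀ᶠ y in 𝓝 z, ContDiffAt ℂ ω T y)
    (hU : IsOpen U) (hz : T z ∈ U) (hM : ∀ a b, ContDiffOn ℝ ∞ (fun y => M y a b) U)
    (hd : ∀ y ∈ U, (M y).det ≠ 0)
    (hg : ∀ᶠ y in 𝓝 z, ∀ a b, ContDiffAt ℂ ω (fun y => g y a b) y)
    (hgd : ∀ᶠ y in 𝓝 z, (g y).det ≠ 0)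
    (he : N =ᶠ[𝓝 z] fun y => (g y)ᴴ * M (T y) * g y) (u v : C3) :
    curvM N z u v = (g z)⁻¹ * curvM M (T z) (fderiv ℂ T z u) (fderiv ℂ T z v) * g z := by
  have hT0 := hT.self_of_nhds
  have hTd : DifferentiableAt ℂ T z := hT0.differentiableAt (by simp)
  have hg0 : ∀ a b, DifferentiableAt ℂ (fun y => g y a b) z := fun a b =>
    (hg.self_of_nhds a b).differentiableAt (by simp)
  have hgi := differentiableAt_inv_of_holomorphic hg0 hgd.self_of_nhds
  have hcon : ∀ᶠ y in 𝓝 z, connM N v y = (g y)⁻¹ *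
      (connM M (fderiv ℂ T y v) (T y) * g y + dM (-1) g y v) := by
    filter_upwards [hT, hg, hgd, he.eventuallyEq_nhds,
      hT0.continuousAt.eventually (hU.mem_nhds hz)] with y h1 h2 h3 h4 h5
    exact connM_gauge (h1.differentiableAt (by simp))
      (differentiableAt_of_contDiffOn hU h5 hM)
      (fun a b => (h2 a b).differentiableAt (by simp)) (hd _ h5) h3 h4 v
  have hcg : ∀ a b, DifferentiableAt ℂ (fun y => dM (-1) g y v a b) z := by
    intro a b
    have h1 : (fun y => dM (-1) g y v a b) =ᶠ[𝓝 z] fun y => fderiv ℂ (fun y => g y a b) y v := by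
      filter_upwards [hg] with y hy
      exact dEps_neg_one_of_holomorphic ((hy a b).differentiableAt (by simp)) v
    refine DifferentiableAt.congr_of_eventuallyEq ?_ h1
    have h2 : DifferentiableAt ℂ (fderiv ℂ fun y => g y a b) z :=
      ((hg.self_of_nhds a b).fderiv_right (m := 1) le_top).differentiableAt (by norm_num)
    exact h2.clm_apply (differentiableAt_const v)
  have hre : ∀ {m : C3 → Matrix (Fin r) (Fin r) ℂ},
      (∀ a b, DifferentiableAt ℂ (fun y => m y a b) z) →
      ∀ a b, DifferentiableAt ℝ (fun y => m y a b) z := fun h a b => (h a b).restrictScalars ℝ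
  have hB : ∀ i a b, DifferentiableAt ℝ (fun y => connM M (bas i) (T y) a b) z := fun i a b =>
    (differentiableAt_of_contDiffOn hU hz (contDiffOn_connM hU hM hd (bas i)) a b).comp z
      (hTd.restrictScalars ℝ)
  have hA : ∀ a b, DifferentiableAt ℝ (fun y => connM M (fderiv ℂ T y v) (T y) a b) z := by
    intro a b
    simp only [connM_eq_sum (fderiv ℂ T _ v), Matrix.sum_apply, Matrix.smul_apply, smul_eq_mul]
    exact DifferentiableAt.fun_sum fun i _ =>
      ((dM_fderiv_apply hT0 v i).restrictScalars ℝ).fun_mul (hB i a b)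
  -- The direction `T'(y) v` depends on `y`, but holomorphically; expanding it in the basis shows
  -- that `∂̄` treats it as constant.
  have hAd : dM 1 (fun y => connM M (fderiv ℂ T y v) (T y)) z u =
      curvM M (T z) (fderiv ℂ T z u) (fderiv ℂ T z v) := by
    rw [curvM, ← dM_comp hTd (differentiableAt_of_contDiffOn hU hz
      (contDiffOn_connM hU hM hd _))]
    ext a b
    simp only [dM, of_apply]
    simp only [connM_eq_sum (fderiv ℂ T _ v), Matrix.sum_apply, Matrix.smul_apply, smul_eq_mul]
    rw [dEps_sum _ fun i _ => ((dM_fderiv_apply hT0 v i).restrictScalars ℝ).fun_mul (hB i a b),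
      dEps_sum _ fun i _ => (differentiableAt_const _).fun_mul (hB i a b)]
    refine Finset.sum_congr rfl fun i _ => ?_
    rw [dEps_mul ((dM_fderiv_apply hT0 v i).restrictScalars ℝ) (hB i a b),
      dEps_mul (differentiableAt_const _) (hB i a b), dEps_const,
      dEps_one_of_holomorphic (dM_fderiv_apply hT0 v i)]
  have hAg : ∀ a b, DifferentiableAt ℝ
      (fun y => (connM M (fderiv ℂ T y v) (T y) * g y) a b) z := fun a b => by
    simp only [mul_apply]
    exact DifferentiableAt.fun_sum fun c _ => (hA a c).mul (hre hg0 c b)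
  have hs : ∀ a b, DifferentiableAt ℝ (fun y => (connM M (fderiv ℂ T y v) (T y) * g y
      + dM (-1) g y v) a b) z := fun a b => (hAg a b).fun_add (hre hcg a b)
  rw [curvM, dM_congr hcon, dM_mul (hre hgi) hs,
    dM_add hAg (hre hcg), dM_mul hA (hre hg0), dM_one_of_holomorphic hgi,
    dM_one_of_holomorphic hg0, dM_one_of_holomorphic hcg, hAd]
  simp only [Matrix.zero_mul, zero_add, Matrix.mul_zero, add_zero, Matrix.mul_assoc]

/-- For Hermitian `M` the adjoint exchanges `∂` and `∂̄`; in `∂̄∂M - ∂̄M M⁻¹ ∂M` this exchanges the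
two directions. -/
theorem curvM_conjTranspose (hU : IsOpen U) (hz : z ∈ U)
    (hM : ∀ a b, ContDiffOn ℝ ∞ (fun y => M y a b) U)
    (hp : ∀ y ∈ U, (M y).PosDef) (u v : C3) :
    (M z * curvM M z u v)ᴴ = M z * curvM M z v u := by
  have hd : ∀ y ∈ U, (M y).det ≠ 0 := fun y hy => (hp y hy).det_pos.ne'
  have hh : ∀ y ∈ U, (M y)ᴴ = M y := fun y hy => (hp y hy).1
  have h1 : ∀ y ∈ U, ∀ ε w, (dM ε M y w)ᴴ = dM (-conj ε) M y w := by
    intro y hy ε w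
    have e : (fun y => (M y)ᴴ) =ᶠ[𝓝 y] M := by
      filter_upwards [hU.mem_nhds hy] with x hx using hh x hx
    rw [← dM_congr e, dM_conjTranspose (differentiableAt_of_contDiffOn hU hy hM)]
    simp
  have h2 : (dM 1 (fun y => dM (-1) M y v) z u)ᴴ = dM 1 (fun y => dM (-1) M y u) z v := by
    have e : (fun y => (dM 1 M y v)ᴴ) =ᶠ[𝓝 z] fun y => dM (-1) M y v := by
      filter_upwards [hU.mem_nhds hz] with x hx
      rw [h1 x hx]
      simp
    rw [← dM_congr e, dM_conjTranspose (differentiableAt_of_contDiffOn hU hz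
      (contDiffOn_dM hU hM v)), conjTranspose_conjTranspose]
    ext a b
    simp only [map_one]
    exact dEps_comm (contDiffAt_two_of_contDiffOn hU hz hM a b) u v
  rw [mul_curvM hU hz hM hd, mul_curvM hU hz hM hd, conjTranspose_sub, conjTranspose_mul,
    conjTranspose_mul, h2, h1 z hz, h1 z hz, conjTranspose_nonsing_inv, hh z hz]
  simp [Matrix.mul_assoc]

end MatrixCalculus

/-! ### Curvature forms of Chern connections, their type, reality and transformation -/

section Curvature

open Matrix Filter

attribute [local irreducible] wedge

variable {r : ℕ} {H H' : C3 → Fin r → Fin r → ℂ} {z : C3} {U : Set C3}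

/-- `H` is a smooth family of positive definite Hermitian matrices on the open set `U`. -/
structure IsMetricOn (U : Set C3) (H : C3 → Fin r → Fin r → ℂ) : Prop where
  isOpen : IsOpen U
  smooth : ContDiffOn ℝ ∞ H U
  posDef : ∀ y ∈ U, (of (H y)).PosDef

theorem IsMetricOn.entries (h : IsMetricOn U H) (a b : Fin r) :
    ContDiffOn ℝ ∞ (fun y => of (H y) a b) U :=
  contDiffOn_pi.1 (contDiffOn_pi.1 h.smooth a) b

theorem IsMetricOn.det_ne_zero (h : IsMetricOn U H) : ∀ y ∈ U, (of (H y)).det ≠ 0 :=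
  fun y hy => (h.posDef y hy).det_pos.ne'

/-- The matrix of the curvature on a pair of tangent vectors. -/
noncomputable def curvF (H : C3 → Fin r → Fin r → ℂ) (z u v : C3) : Matrix (Fin r) (Fin r) ℂ :=
  Complex.I • (curvM (fun y => of (H y)) z u v - curvM (fun y => of (H y)) z v u)

theorem del_constOfIsEmpty (f : C3 → ℂ) (z : C3) (w : Fin 1 → C3) :
    (del (fun y => ContinuousAlternatingMap.constOfIsEmpty ℝ C3 (Fin 0) (f y)) z : Alt 1) w =
      dEps (-1) f z (w 0) := by
  have hf : fderiv ℝ (fun y => ContinuousAlternatingMap.constOfIsEmpty ℝ C3 (Fin 0) (f y)) z =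
      (ContinuousAlternatingMap.constOfIsEmptyLIE ℝ C3 ℂ (Fin 0) : ℂ →L[ℝ] Alt 0).comp
        (fderiv ℝ f z) :=
    (ContinuousAlternatingMap.constOfIsEmptyLIE ℝ C3 ℂ (Fin 0)).toContinuousLinearEquiv.comp_fderiv
  rw [del_eq_delL, delL_apply, hf]
  simp only [Fin.sum_univ_succ, Finset.univ_eq_empty, Finset.sum_empty, add_zero, Fin.val_zero,
    pow_zero, one_smul, dEps]
  have e : ∀ (x : ℂ) (v : Fin 0 → C3),
      (ContinuousAlternatingMap.constOfIsEmptyLIE ℝ C3 ℂ (Fin 0) : ℂ →L[ℝ] Alt 0) x v = x :=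
    fun x v => rfl
  rw [ContinuousLinearMap.comp_apply, ContinuousLinearMap.comp_apply]
  have e1 := e (fderiv ℝ f z (w 0)) (Fin.removeNth 0 w)
  have e2 := e (fderiv ℝ f z (mulI (w 0))) (Fin.removeNth 0 w)
  refine (congrArg₂ (fun x y => (1 / 2 : ℂ) * (x - Complex.I * y)) e1 e2).trans ?_
  ring

theorem chernConn_apply (H : C3 → Fin r → Fin r → ℂ) (a b : Fin r) (z : C3) (w : Fin 1 → C3) :
    chernConn H a b z w = connM (fun y => of (H y)) (w 0) z a b := by
  rw [chernConn, ContinuousAlternatingMap.sum_apply, connM, mul_apply]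
  refine Finset.sum_congr rfl fun c _ => ?_
  rw [ContinuousAlternatingMap.smul_apply, del_constOfIsEmpty]
  rfl

theorem IsMetricOn.contDiffOn_chernConn (h : IsMetricOn U H) (a b : Fin r) :
    ContDiffOn ℝ ∞ (chernConn H a b) U := by
  refine contDiffOn_alt fun v => ?_
  simp only [chernConn_apply]
  exact contDiffOn_connM h.isOpen h.entries h.det_ne_zero _ a b

/-- Split `d` into `∂ + ∂̄`: the `∂`-part of `dA` cancels `A ∧ A` by `dM_neg_one_connM`, and `∂̄A`
remains. -/
theorem IsMetricOn.chernCurv_apply (h : IsMetricOn U H) (hz : z ∈ U) (a b : Fin r) (u v : C3) :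
    chernCurv H a b z ![u, v] = curvF H z u v a b := by
  have h1 : DifferentiableAt ℝ (chernConn H a b) z :=
    ((h.contDiffOn_chernConn a b).contDiffAt (h.isOpen.mem_nhds hz)).differentiableAt (by simp)
  have h2 : extDeriv (chernConn H a b) z ![u, v] =
      fderiv ℝ (fun y => connM (fun y => of (H y)) v y a b) z u -
        fderiv ℝ (fun y => connM (fun y => of (H y)) u y a b) z v := by
    rw [extDeriv_apply h1]
    simp only [Fin.sum_univ_two, chernConn_apply]
    simp [Fin.removeNth, Fin.succAbove, sub_eq_add_neg]
  have h3 : (∑ c, wedge (chernConn H a c z) (chernConn H c b z) : Alt 2) ![u, v] =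
      (connM (fun y => of (H y)) u z * connM (fun y => of (H y)) v z
        - connM (fun y => of (H y)) v z * connM (fun y => of (H y)) u z) a b := by
    rw [ContinuousAlternatingMap.sum_apply, Matrix.sub_apply, mul_apply, mul_apply,
      ← Finset.sum_sub_distrib]
    refine Finset.sum_congr rfl fun c _ => ?_
    rw [wedge_one_one]
    simp only [chernConn_apply]
    rfl
  have h4 := congrArg (fun m => m a b)
    (dM_neg_one_connM h.isOpen hz h.entries h.det_ne_zero u v)
  have key : chernCurv H a b z ![u, v] = Complex.I * (extDeriv (chernConn H a b) z ![u, v] +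
      (∑ c, wedge (chernConn H a c z) (chernConn H c b z) : Alt 2) ![u, v]) := rfl
  rw [key, h2, h3, ← dEps_add_neg, ← dEps_add_neg]
  simp only [curvF, curvM, dM, Matrix.smul_apply, Matrix.sub_apply, Matrix.add_apply, of_apply,
    smul_eq_mul, Matrix.zero_apply] at h4 ⊢
  linear_combination Complex.I * h4

theorem IsMetricOn.curvM_smul_right (h : IsMetricOn U H) (hz : z ∈ U) (c : ℂ) (u v : C3) :
    curvM (fun y => of (H y)) z u (c • v) = c • curvM (fun y => of (H y)) z u v :=
  AnomalyFlow.curvM_smul_right h.isOpen hz h.entries h.det_ne_zero c u v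

/-- `∂̄_u (H⁻¹ ∂_v H)` is antilinear in `u` and linear in `v`. The vanishing of the (2,0)- and
(0,2)-parts in the Strominger system therefore holds for every Hermitian metric. -/
theorem IsMetricOn.chernCurv_type (h : IsMetricOn U H) (hz : z ∈ U) (a b : Fin r) :
    IsOfType 1 1 (chernCurv H a b z) := by
  intro c v
  have e : (fun i => c • v i) = ![c • v 0, c • v 1] := by
    funext i; fin_cases i <;> rfl
  rw [e, eq_pair v, h.chernCurv_apply hz, h.chernCurv_apply hz]
  simp only [curvF, h.curvM_smul_right hz, curvM_smul_left, Matrix.smul_apply, Matrix.sub_apply,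
    smul_eq_mul, cons_val_zero, cons_val_one]
  ring

theorem IsMetricOn.coeff11_chernCurv (h : IsMetricOn U H) (hz : z ∈ U) (a b : Fin r)
    (k j : Fin 3) :
    coeff11 (chernCurv H a b z) k j = -curvM (fun y => of (H y)) z (bas k) (bas j) a b := by
  simp only [coeff11, h.chernCurv_apply hz, curvF, mulI_apply, h.curvM_smul_right hz,
    curvM_smul_left, Matrix.smul_apply, Matrix.sub_apply, smul_eq_mul, Complex.conj_I]
  generalize curvM (fun y => of (H y)) z (bas k) (bas j) a b = x
  generalize curvM (fun y => of (H y)) z (bas j) (bas k) a b = y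
  have := Complex.I_sq
  have h3 : Complex.I ^ 4 = 1 := Complex.I_pow_four
  ring_nf
  rw [h3, this]
  ring

theorem Alt.pair_neg_right (a : Alt 2) (u v : C3) : a ![u, -v] = -a ![u, v] := by
  rw [Alt.swap a (-v) u, Alt.swap a v u]
  congr 1
  exact Alt.cons_neg a v ![u]

theorem part20_eq_zero {a : Alt 2} (h : IsOfType 1 1 a) (u v : C3) : part20 a u v = 0 := by
  have h1 := h.mulI_mulI u v
  have h2 := h.mulI_mulI u (mulI v)
  rw [mulI_sq] at h2
  have h3 : a ![mulI u, -v] = -a ![mulI u, v] := Alt.pair_neg_right a _ _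
  rw [part20]
  rw [h3] at h2
  linear_combination (-1 / 4) * h1 + (Complex.I / 4) * h2

theorem part02_eq_zero {a : Alt 2} (h : IsOfType 1 1 a) (u v : C3) : part02 a u v = 0 := by
  have h1 := h.mulI_mulI u v
  have h2 := h.mulI_mulI u (mulI v)
  rw [mulI_sq] at h2
  have h3 : a ![mulI u, -v] = -a ![mulI u, v] := Alt.pair_neg_right a _ _
  rw [part02]
  rw [h3] at h2
  linear_combination (-1 / 4) * h1 - (Complex.I / 4) * h2

/-! ### The form `Tr (F ∧ F)` -/

theorem trSq_apply (F : Fin r → Fin r → C3 → Alt 2) (G : C3 → C3 → Matrix (Fin r) (Fin r) ℂ)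
    (h : ∀ a b u v, F a b z ![u, v] = G u v a b) (v₀ v₁ v₂ v₃ : C3) :
    trSq F z ![v₀, v₁, v₂, v₃] = (G v₀ v₁ * G v₂ v₃).trace - (G v₀ v₂ * G v₁ v₃).trace
      + (G v₀ v₃ * G v₁ v₂).trace + (G v₁ v₂ * G v₀ v₃).trace - (G v₁ v₃ * G v₀ v₂).trace
      + (G v₂ v₃ * G v₀ v₁).trace := by
  have e : trSq F z ![v₀, v₁, v₂, v₃] = ∑ a, ∑ b, (wedge (F a b z) (F b a z) : Alt 4)
      ![v₀, v₁, v₂, v₃] := by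
    rw [trSq, ContinuousAlternatingMap.sum_apply]
    exact Finset.sum_congr rfl fun a _ => ContinuousAlternatingMap.sum_apply _ _
  rw [e]
  simp only [wedge_two_two, h, trace, diag, mul_apply, Finset.sum_add_distrib,
    Finset.sum_sub_distrib]

theorem eq_quad {k : Type*} (v : Fin 4 → k) : v = ![v 0, v 1, v 2, v 3] := by
  funext i; fin_cases i <;> rfl

/-- Holomorphic change of frame `g` and of coordinates `T` near `z`. -/
structure IsGauge (z : C3) (T : C3 → C3) (g : C3 → Matrix (Fin r) (Fin r) ℂ)
    (H H' : C3 → Fin r → Fin r → ℂ) : Prop where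
  hT : ∀ᶠ y in 𝓝 z, ContDiffAt ℂ ω T y
  hg : ∀ᶠ y in 𝓝 z, ∀ a b, ContDiffAt ℂ ω (fun y => g y a b) y
  hd : ∀ᶠ y in 𝓝 z, (g y).det ≠ 0
  he : ∀ᶠ y in 𝓝 z, of (H' y) = (g y)ᴴ * of (H (T y)) * g y

variable {T : C3 → C3} {g : C3 → Matrix (Fin r) (Fin r) ℂ} {U' : Set C3}

theorem IsGauge.curvM_eq (h : IsGauge z T g H H') (hH : IsMetricOn U H) (hz : T z ∈ U) (u v : C3) :
    curvM (fun y => of (H' y)) z u v =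
      (g z)⁻¹ * curvM (fun y => of (H y)) (T z) (fderiv ℂ T z u) (fderiv ℂ T z v) * g z :=
  curvM_gauge (M := fun y => of (H y)) h.hT hH.isOpen hz hH.entries hH.det_ne_zero h.hg h.hd h.he
    u v

theorem IsGauge.curvF_eq (h : IsGauge z T g H H') (hH : IsMetricOn U H) (hz : T z ∈ U) (u v : C3) :
    curvF H' z u v = (g z)⁻¹ * curvF H (T z) (fderiv ℂ T z u) (fderiv ℂ T z v) * g z := by
  rw [curvF, h.curvM_eq hH hz, h.curvM_eq hH hz, curvF]
  simp only [Matrix.mul_smul, Matrix.smul_mul, Matrix.mul_sub, Matrix.sub_mul]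

theorem trace_conj {A B g : Matrix (Fin r) (Fin r) ℂ} (hg : g.det ≠ 0) :
    ((g⁻¹ * A * g) * (g⁻¹ * B * g)).trace = (A * B).trace := by
  have e : g * g⁻¹ = 1 := mul_nonsing_inv _ (isUnit_iff_ne_zero.2 hg)
  calc ((g⁻¹ * A * g) * (g⁻¹ * B * g)).trace = (g⁻¹ * (A * (g * g⁻¹) * B * g)).trace := by
        simp only [Matrix.mul_assoc]
    _ = _ := by
      rw [trace_mul_comm, Matrix.mul_assoc, e, Matrix.mul_one, Matrix.mul_one]

/-- Conjugation by `g` drops out of the traces and the coordinate change acts by pull-back. -/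
theorem IsGauge.trSq_eq (h : IsGauge z T g H H') (hH : IsMetricOn U H) (hz : T z ∈ U)
    (hH' : IsMetricOn U' H') (hz' : z ∈ U') :
    trSq (chernCurv H') z = pullC (fderiv ℂ T z) (trSq (chernCurv H) (T z)) := by
  ext v
  have e : pullC (fderiv ℂ T z) (trSq (chernCurv H) (T z)) v = trSq (chernCurv H) (T z)
      ![fderiv ℂ T z (v 0), fderiv ℂ T z (v 1), fderiv ℂ T z (v 2), fderiv ℂ T z (v 3)] := by
    rw [ContinuousAlternatingMap.compContinuousLinearMap_apply]
    congr 1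
    exact eq_quad _
  rw [e, trSq_apply _ _ fun a b => hH.chernCurv_apply hz a b]
  conv_lhs => rw [eq_quad v]
  rw [trSq_apply _ _ fun a b => hH'.chernCurv_apply hz' a b]
  simp only [h.curvF_eq hH hz, trace_conj h.hd.self_of_nhds]

/-- The two terms of the curvature are exchanged up to sign by the adjoint, and the factor `i`
compensates: on real vectors, `F` is self-adjoint for the inner product `H`. -/
theorem IsMetricOn.curvF_hermitian (h : IsMetricOn U H) (hz : z ∈ U) (u v : C3) :
    (of (H z) * curvF H z u v)ᴴ = of (H z) * curvF H z u v := by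
  have h1 := fun u v => curvM_conjTranspose h.isOpen hz h.entries h.posDef u v
  simp only [curvF, Matrix.mul_smul, Matrix.mul_sub, conjTranspose_smul, conjTranspose_sub, h1]
  rw [Complex.star_def, Complex.conj_I, neg_smul, ← smul_neg, neg_sub]

/-- If `A` and `B` are self-adjoint for `h`, the adjoint of `AB` is conjugate to `BA`, which has the
same trace. -/
theorem trace_mul_im {h A B : Matrix (Fin r) (Fin r) ℂ} (hh : hᴴ = h) (hd : h.det ≠ 0)
    (hA : (h * A)ᴴ = h * A) (hB : (h * B)ᴴ = h * B) : ((A * B).trace).im = 0 := by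
  have e : h⁻¹ * h = 1 := nonsing_inv_mul _ (isUnit_iff_ne_zero.2 hd)
  have eA : A = h⁻¹ * (h * A) := by rw [← Matrix.mul_assoc, e, Matrix.one_mul]
  have eB : B = h⁻¹ * (h * B) := by rw [← Matrix.mul_assoc, e, Matrix.one_mul]
  have : star (A * B).trace = (A * B).trace := by
    rw [← trace_conjTranspose, eA, eB]
    generalize h * A = a at *
    generalize h * B = b at *
    rw [conjTranspose_mul, conjTranspose_mul, conjTranspose_mul, conjTranspose_nonsing_inv, hh,
      hA, hB, trace_mul_comm, ← Matrix.mul_assoc, trace_mul_comm]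
    congr 1
    simp only [Matrix.mul_assoc]
  exact Complex.conj_eq_iff_im.1 this

theorem IsMetricOn.isRealOfType_trSq (h : IsMetricOn U H) (hz : z ∈ U) :
    IsRealOfType 2 2 (trSq (chernCurv H) z) := by
  constructor
  · intro v
    rw [eq_quad v, trSq_apply _ _ fun a b => h.chernCurv_apply hz a b]
    have := fun u v u' v' => trace_mul_im (h.posDef z hz).1 (h.det_ne_zero z hz)
      (h.curvF_hermitian hz u v) (h.curvF_hermitian hz u' v')
    simp [this]
  · have : ∀ a b, IsOfType 2 2 (wedge (chernCurv H a b z) (chernCurv H b a z) : Alt 4) :=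
      fun a b => (h.chernCurv_type hz a b).wedge (h.chernCurv_type hz b a)
    intro c v
    have e : ∀ v, trSq (chernCurv H) z v = ∑ a, ∑ b,
        (wedge (chernCurv H a b z) (chernCurv H b a z) : Alt 4) v := by
      intro v
      rw [trSq, ContinuousAlternatingMap.sum_apply]
      exact Finset.sum_congr rfl fun a _ => ContinuousAlternatingMap.sum_apply _ _
    rw [e, e, Finset.mul_sum]
    refine Finset.sum_congr rfl fun a _ => ?_
    rw [Finset.mul_sum]
    exact Finset.sum_congr rfl fun b _ => this a b c v

/-! ### The contraction `Λ F` -/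

theorem contract_apply (w : Alt 2) (F : Fin r → Fin r → Alt 2) (a b : Fin r) :
    contract w F a b = ((gram w)⁻¹ * gram (F a b)).trace := by
  simp only [contract, of_apply, trace, diag, mul_apply]
  rfl

/-- Under a simultaneous congruence `w⁻¹ f` is conjugated by `J`, so `Λ` is independent of
coordinates. -/
theorem trace_congr_conj {w f J : Matrix (Fin 3) (Fin 3) ℂ} (hJ : J.det ≠ 0) :
    ((Jᴴ * w * J)⁻¹ * (Jᴴ * f * J)).trace = (w⁻¹ * f).trace := by
  have hJ' : Jᴴ.det ≠ 0 := by rw [det_conjTranspose]; exact star_ne_zero.2 hJ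
  have e1 : J * J⁻¹ = 1 := mul_nonsing_inv _ (isUnit_iff_ne_zero.2 hJ)
  have e2 : Jᴴ⁻¹ * Jᴴ = 1 := nonsing_inv_mul _ (isUnit_iff_ne_zero.2 hJ')
  rw [Matrix.mul_inv_rev, Matrix.mul_inv_rev]
  calc (J⁻¹ * (w⁻¹ * Jᴴ⁻¹) * (Jᴴ * f * J)).trace
      = (J⁻¹ * (w⁻¹ * (Jᴴ⁻¹ * Jᴴ) * f * J)).trace := by simp only [Matrix.mul_assoc]
    _ = _ := by
      rw [e2, Matrix.mul_one, trace_mul_comm, Matrix.mul_assoc, e1, Matrix.mul_one]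

theorem IsMetricOn.contract_eq (h : IsMetricOn U H) (hz : z ∈ U) (w : Alt 2) :
    contract w (fun a b => chernCurv H a b z) =
      -∑ j, ∑ k, (gram w)⁻¹ j k • curvM (fun y => of (H y)) z (bas k) (bas j) := by
  ext a b
  rw [contract, of_apply, Matrix.neg_apply, Matrix.sum_apply, ← Finset.sum_neg_distrib]
  refine Finset.sum_congr rfl fun j _ => ?_
  rw [Matrix.sum_apply, ← Finset.sum_neg_distrib]
  refine Finset.sum_congr rfl fun k _ => ?_
  rw [h.coeff11_chernCurv hz, Matrix.smul_apply, smul_eq_mul, mul_neg]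

/-- The change of frame conjugates the endomorphism indices, the change of coordinates acts by
congruence on both `ω` and the form indices of `F`; the latter is invisible by `trace_congr_conj`.
-/
theorem IsGauge.contract_eq (h : IsGauge z T g H H') (hH : IsMetricOn U H) (hz : T z ∈ U)
    (hH' : IsMetricOn U' H') (hz' : z ∈ U') {w : Alt 2} (hw : IsOfType 1 1 w)
    (hJ : (jac (fderiv ℂ T z)).det ≠ 0) :
    contract (pullC (fderiv ℂ T z) w) (fun a b => chernCurv H' a b z) =
      (g z)⁻¹ * contract w (fun a b => chernCurv H a b (T z)) * g z := by
  have hF : ∀ a b, chernCurv H' a b z = ∑ c, ∑ d, ((g z)⁻¹ a c * g z d b) •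
      pullC (fderiv ℂ T z) (chernCurv H c d (T z)) := by
    intro a b
    ext v
    rw [eq_pair v, hH'.chernCurv_apply hz', h.curvF_eq hH hz, ContinuousAlternatingMap.sum_apply]
    simp only [ContinuousAlternatingMap.sum_apply, ContinuousAlternatingMap.smul_apply,
      pullC_pair, hH.chernCurv_apply hz, smul_eq_mul]
    simp only [mul_apply, Finset.sum_mul]
    rw [Finset.sum_comm]
    refine Finset.sum_congr rfl fun c _ => Finset.sum_congr rfl fun d _ => ?_
    ring
  have hcoef : ∀ a b k j, coeff11 (chernCurv H' a b z) k j = ∑ c, ∑ d, ((g z)⁻¹ a c * g z d b) *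
      coeff11 (pullC (fderiv ℂ T z) (chernCurv H c d (T z))) k j := by
    intro a b k j
    rw [hF]
    unfold coeff11
    simp only [ContinuousAlternatingMap.sum_apply, ContinuousAlternatingMap.smul_apply,
      smul_eq_mul, Finset.mul_sum, ← Finset.sum_add_distrib, ← Finset.sum_sub_distrib]
    refine Finset.sum_congr rfl fun c _ => Finset.sum_congr rfl fun d _ => ?_
    ring
  have hc : ∀ c d, contract w (fun a b => chernCurv H a b (T z)) c d =
      ∑ j, ∑ k, (gram (pullC (fderiv ℂ T z) w))⁻¹ j k *
        coeff11 (pullC (fderiv ℂ T z) (chernCurv H c d (T z))) k j := by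
    intro c d
    have e1 := contract_apply w (fun a b => chernCurv H a b (T z)) c d
    rw [e1, ← trace_congr_conj hJ, ← gram_pullC _ hw, ← gram_pullC _ (hH.chernCurv_type hz c d)]
    simp only [trace, diag, mul_apply]
    rfl
  ext a b
  rw [contract, of_apply]
  simp only [mul_apply, Finset.sum_mul, hc, hcoef, Finset.mul_sum]
  have swap : ∀ f : Fin 3 → Fin 3 → Fin r → Fin r → ℂ, ∑ j, ∑ k, ∑ c, ∑ d, f j k c d =
      ∑ d, ∑ c, ∑ j, ∑ k, f j k c d := by
    intro f
    calc _ = ∑ j, ∑ k, ∑ d, ∑ c, f j k c d :=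
          Finset.sum_congr rfl fun j _ => Finset.sum_congr rfl fun k _ => Finset.sum_comm
      _ = ∑ j, ∑ d, ∑ k, ∑ c, f j k c d := Finset.sum_congr rfl fun j _ => Finset.sum_comm
      _ = ∑ d, ∑ j, ∑ k, ∑ c, f j k c d := Finset.sum_comm
      _ = ∑ d, ∑ j, ∑ c, ∑ k, f j k c d :=
          Finset.sum_congr rfl fun d _ => Finset.sum_congr rfl fun j _ => Finset.sum_comm
      _ = _ := Finset.sum_congr rfl fun d _ => Finset.sum_comm
  rw [swap]
  refine Finset.sum_congr rfl fun d _ => Finset.sum_congr rfl fun c _ =>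
    Finset.sum_congr rfl fun j _ => Finset.sum_congr rfl fun k _ => ?_
  ring

/-- The adjoint exchanges the two directions in `H ∂̄(H⁻¹∂H)` and the indices of `ω⁻¹`, so the
double sum is permuted. This makes `-H ΛF` a Hermitian form, hence a tangent vector to the space of
metrics. -/
theorem IsMetricOn.mul_contract_hermitian (h : IsMetricOn U H) (hz : z ∈ U) {w : Alt 2}
    (hw : (gram w).IsHermitian) :
    (of (H z) * contract w (fun a b => chernCurv H a b z))ᴴ =
      of (H z) * contract w (fun a b => chernCurv H a b z) := by
  have h1 := fun u v => curvM_conjTranspose h.isOpen hz h.entries h.posDef u v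
  have h2 : ∀ j k, star ((gram w)⁻¹ j k) = (gram w)⁻¹ k j := fun j k =>
    congrFun (congrFun hw.inv k) j
  rw [h.contract_eq hz, Matrix.mul_neg, conjTranspose_neg]
  congr 1
  simp only [Finset.mul_sum, Matrix.mul_smul, conjTranspose_sum, conjTranspose_smul, h1, h2]
  rw [Finset.sum_comm]

/-- `F ∧ ω² = 16 (det ω) Λ F` on the real frame. -/
theorem wedge_wedge_self {F w : Alt 2} (hF : IsOfType 1 1 F) (hw : IsOfType 1 1 w)
    (hd : (gram w).det ≠ 0) (h : ((gram w)⁻¹ * gram F).trace = 0) :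
    (wedge F (wedge w w : Alt 4) : Alt 6) = 0 := by
  refine alt_six_eq_zero ?_
  have e : (wedge F (wedge w w : Alt 4) : Alt 6) = (wedge (wedge w w : Alt 4) F : Alt 6) :=
    (wedge_four_two _ _).symm
  refine (congrFun (congrArg _ e) realFrame).trans ?_
  have e1 : dual (wedge w w : Alt 4) = (16 : ℂ) • (gram w).adjugate := by
    conv_lhs => rw [hw.eq_form11]
    exact dual_wedge_self _
  -- The value on the real frame pairs the matrix of `F` with that of `ω²`, which is `16 det ω`
  -- times `ω⁻¹`.
  rw [hF.eq_form11, wedge_form11_eq_sum, e1]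
  have e2 : (gram w).adjugate = (gram w).det • (gram w)⁻¹ := by
    rw [inv_def, smul_smul, Ring.mul_inverse_cancel _ (isUnit_iff_ne_zero.2 hd), one_smul]
  rw [e2]
  have e3 : ∑ k, ∑ j, gram F k j * ((16 : ℂ) • (gram w).det • (gram w)⁻¹) j k =
      16 * (gram w).det * ((gram w)⁻¹ * gram F).trace := by
    simp only [trace, diag, mul_apply, Finset.mul_sum, Matrix.smul_apply, smul_eq_mul]
    rw [Finset.sum_comm]
    refine Finset.sum_congr rfl fun j _ => Finset.sum_congr rfl fun k _ => ?_
    ring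
  rw [e3, h, mul_zero]

end Curvature

section ChernWeil

open Matrix Filter ContinuousAlternatingMap

attribute [local irreducible] wedge

variable {r : ℕ} {H H' : C3 → Fin r → Fin r → ℂ} {z : C3} {U : Set C3}

/-! ### `Tr (F ∧ F)` is closed -/

section Generic

variable {A B C : Type*} [NormedAddCommGroup A] [NormedSpace ℝ A] [NormedAddCommGroup B]
  [NormedSpace ℝ B] [NormedAddCommGroup C] [NormedSpace ℝ C]

theorem fderiv_bilinear (L : A →L[ℝ] B →L[ℝ] C) {f : C3 → A} {g : C3 → B} {z : C3}
    (hf : DifferentiableAt ℝ f z) (hg : DifferentiableAt ℝ g z) (u : C3) :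
    fderiv ℝ (fun y => L (f y) (g y)) z u = L (f z) (fderiv ℝ g z u) + L (fderiv ℝ f z u) (g z) := by
  rw [(L.hasFDerivAt_of_bilinear hf.hasFDerivAt hg.hasFDerivAt).fderiv]
  rfl

theorem differentiableAt_bilinear (L : A →L[ℝ] B →L[ℝ] C) {f : C3 → A} {g : C3 → B} {z : C3}
    (hf : DifferentiableAt ℝ f z) (hg : DifferentiableAt ℝ g z) :
    DifferentiableAt ℝ (fun y => L (f y) (g y)) z :=
  (L.hasFDerivAt_of_bilinear hf.hasFDerivAt hg.hasFDerivAt).differentiableAt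

/-- A bilinear map between finite dimensional spaces as a continuous bilinear map. -/
noncomputable def bilinCLM [FiniteDimensional ℝ A] [FiniteDimensional ℝ B]
    (L : A →ₗ[ℝ] B →ₗ[ℝ] C) : A →L[ℝ] B →L[ℝ] C :=
  LinearMap.toContinuousLinearMap
    ((LinearMap.toContinuousLinearMap : (B →ₗ[ℝ] C) ≃ₗ[ℝ] B →L[ℝ] C).toLinearMap ∘ₗ L)

end Generic

theorem real_smul_eq {k : ℕ} (c : ℝ) (a : Alt k) : c • a = (c : ℂ) • a := by
  ext v
  simp

theorem alternatize_zero (k : ℕ) :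
    alternatizeUncurryFin (0 : C3 →L[ℝ] Alt k) = (0 : Alt (k + 1)) := by
  ext v
  rw [alternatizeUncurryFin_apply]
  exact Finset.sum_eq_zero fun i _ => smul_zero _

theorem alternatize_sub {k : ℕ} (L L' : C3 →L[ℝ] Alt k) : alternatizeUncurryFin (L - L') =
    alternatizeUncurryFin L - alternatizeUncurryFin L' := by
  have h : L = (L - L') + L' := by abel
  conv_rhs => rw [h, alternatizeUncurryFin_add]
  abel

theorem alternatize_sum {k : ℕ} {ι : Type*} (s : Finset ι) (L : ι → C3 →L[ℝ] Alt k) :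
    alternatizeUncurryFin (∑ i ∈ s, L i) = ∑ i ∈ s, alternatizeUncurryFin (L i) := by
  classical
  induction s using Finset.induction_on with
  | empty => simp only [Finset.sum_empty, alternatize_zero]
  | insert i s hi ih => rw [Finset.sum_insert hi, Finset.sum_insert hi,
      alternatizeUncurryFin_add, ih]

/-- The exterior product as a continuous bilinear map. -/
noncomputable def wedgeCLM (k l : ℕ) : Alt k →L[ℝ] Alt l →L[ℝ] Alt (k + l) :=
  bilinCLM (LinearMap.mk₂ ℝ wedge wedge_add_left
    (fun c a b => by rw [real_smul_eq, real_smul_eq, wedge_smul_left]) wedge_add_right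
    (fun c a b => by rw [real_smul_eq, real_smul_eq, wedge_smul_right]))

theorem fderiv_wedge {k l : ℕ} {a : C3 → Alt k} {b : C3 → Alt l} (ha : DifferentiableAt ℝ a z)
    (hb : DifferentiableAt ℝ b z) (u : C3) :
    fderiv ℝ (fun y => (wedge (a y) (b y) : Alt (k + l))) z u =
      wedge (a z) (fderiv ℝ b z u) + wedge (fderiv ℝ a z u) (b z) :=
  fderiv_bilinear (wedgeCLM k l) ha hb u

theorem differentiableAt_wedge {k l : ℕ} {a : C3 → Alt k} {b : C3 → Alt l}
    (ha : DifferentiableAt ℝ a z) (hb : DifferentiableAt ℝ b z) :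
    DifferentiableAt ℝ (fun y => (wedge (a y) (b y) : Alt (k + l))) z :=
  differentiableAt_bilinear (wedgeCLM k l) ha hb

theorem wedge_comm_two (a b : Alt 2) : (wedge a b : Alt 4) = wedge b a := by
  ext v
  rw [eq_quad v, wedge_two_two, wedge_two_two]
  ring

/-- The alternation of `u ↦ f ∧ L(u)` is `f` wedged with the alternation of `L`, since `f` has even
degree. -/
theorem alternatize_wedge_eq_zero (f : Alt 2) {L : C3 →L[ℝ] Alt 2} {K : C3 →L[ℝ] Alt 4}
    (hL : alternatizeUncurryFin L = 0) (hK : ∀ u, K u = wedge f (L u)) :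
    alternatizeUncurryFin K = 0 := by
  have h3 : ∀ x y z : C3, L x ![y, z] - L y ![x, z] + L z ![x, y] = 0 := by
    intro x y z
    have h := DFunLike.congr_fun hL ![x, y, z]
    rw [alternatizeUncurryFin_apply, Fin.sum_univ_three] at h
    have e0 : (0 : Fin 3).removeNth ![x, y, z] = ![y, z] := by
      funext i; fin_cases i <;> rfl
    have e1 : (1 : Fin 3).removeNth ![x, y, z] = ![x, z] := by
      funext i; fin_cases i <;> rfl
    have e2 : (2 : Fin 3).removeNth ![x, y, z] = ![x, y] := by
      funext i; fin_cases i <;> rfl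
    rw [e0, e1, e2] at h
    simp at h
    linear_combination h
  ext v
  rw [alternatizeUncurryFin_apply, Fin.sum_univ_five]
  have e0 : (0 : Fin 5).removeNth v = ![v 1, v 2, v 3, v 4] := by
    funext i; fin_cases i <;> rfl
  have e1 : (1 : Fin 5).removeNth v = ![v 0, v 2, v 3, v 4] := by
    funext i; fin_cases i <;> rfl
  have e2 : (2 : Fin 5).removeNth v = ![v 0, v 1, v 3, v 4] := by
    funext i; fin_cases i <;> rfl
  have e3 : (3 : Fin 5).removeNth v = ![v 0, v 1, v 2, v 4] := by
    funext i; fin_cases i <;> rfl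
  have e4 : (4 : Fin 5).removeNth v = ![v 0, v 1, v 2, v 3] := by
    funext i; fin_cases i <;> rfl
  rw [e0, e1, e2, e3, e4]
  simp only [hK, wedge_two_two]
  have p0 : ((0 : Fin 5) : ℕ) = 0 := rfl
  have p1 : ((1 : Fin 5) : ℕ) = 1 := rfl
  have p2 : ((2 : Fin 5) : ℕ) = 2 := rfl
  have p3 : ((3 : Fin 5) : ℕ) = 3 := rfl
  have p4 : ((4 : Fin 5) : ℕ) = 4 := rfl
  simp only [p0, p1, p2, p3, p4, pow_zero, pow_one, one_smul, neg_smul, zsmul_eq_mul, Int.cast_pow,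
    Int.cast_neg, Int.cast_one]
  refine Eq.trans ?_ (rfl : (0 : ℂ) = _)
  -- One term for each of the ten ways to give two of the five vectors to `f`, with the sign of the
  -- shuffle.
  linear_combination f ![v 0, v 1] * h3 (v 2) (v 3) (v 4) - f ![v 0, v 2] * h3 (v 1) (v 3) (v 4)
    + f ![v 0, v 3] * h3 (v 1) (v 2) (v 4) - f ![v 0, v 4] * h3 (v 1) (v 2) (v 3)
    + f ![v 1, v 2] * h3 (v 0) (v 3) (v 4) - f ![v 1, v 3] * h3 (v 0) (v 2) (v 4)
    + f ![v 1, v 4] * h3 (v 0) (v 2) (v 3) + f ![v 2, v 3] * h3 (v 0) (v 1) (v 4)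
    - f ![v 2, v 4] * h3 (v 0) (v 1) (v 3) + f ![v 3, v 4] * h3 (v 0) (v 1) (v 2)

/-- Leibniz rule; commutativity of the product of `2`-forms brings both terms to the shape of
`alternatize_wedge_eq_zero`. -/
theorem extDeriv_wedge_eq_zero {a b : C3 → Alt 2} (ha : DifferentiableAt ℝ a z)
    (hb : DifferentiableAt ℝ b z) (ha' : extDeriv a z = 0) (hb' : extDeriv b z = 0) :
    extDeriv (fun y => (wedge (a y) (b y) : Alt 4)) z = 0 := by
  let K₁ : C3 →L[ℝ] Alt 4 := (wedgeCLM 2 2 (a z)).comp (fderiv ℝ b z)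
  let K₂ : C3 →L[ℝ] Alt 4 := (wedgeCLM 2 2 (b z)).comp (fderiv ℝ a z)
  have e : fderiv ℝ (fun y => (wedge (a y) (b y) : Alt 4)) z = K₁ + K₂ := by
    ext u : 1
    refine (fderiv_wedge ha hb u).trans ?_
    rw [wedge_comm_two (fderiv ℝ a z u)]
    rfl
  rw [extDeriv, e, alternatizeUncurryFin_add,
    alternatize_wedge_eq_zero (a z) hb' fun u => rfl,
    alternatize_wedge_eq_zero (b z) ha' fun u => rfl, add_zero]

theorem extDeriv_sum {k : ℕ} {ι : Type*} (s : Finset ι) {f : ι → C3 → Alt k}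
    (hf : ∀ i ∈ s, DifferentiableAt ℝ (f i) z) :
    extDeriv (fun y => ∑ i ∈ s, f i y) z = ∑ i ∈ s, extDeriv (f i) z := by
  simp only [extDeriv]
  rw [fderiv_fun_sum hf, alternatize_sum]

theorem IsMetricOn.contDiffOn_chernCurv (h : IsMetricOn U H) (a b : Fin r) :
    ContDiffOn ℝ ∞ (chernCurv H a b) U := by
  refine contDiffOn_alt fun v => ?_
  have h1 : ContDiffOn ℝ ∞ (fun y => curvF H y (v 0) (v 1) a b) U := by
    have := fun u v => contDiffOn_dM (ε := 1) h.isOpen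
      (contDiffOn_connM h.isOpen h.entries h.det_ne_zero v) u a b
    exact contDiffOn_const.mul ((this _ _).sub (this _ _))
  refine h1.congr fun y hy => ?_
  rw [← h.chernCurv_apply hy]
  congr 1
  exact eq_pair v

theorem IsMetricOn.contDiffOn_trSq (h : IsMetricOn U H) :
    ContDiffOn ℝ ∞ (trSq (chernCurv H)) U := by
  unfold trSq
  exact ContDiffOn.sum fun a _ => ContDiffOn.sum fun b _ =>
    ContDiffOn.wedge (h.contDiffOn_chernCurv a b) (h.contDiffOn_chernCurv b a)

theorem extDeriv_trSq_of {F : Fin r → Fin r → C3 → Alt 2}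
    (hF : ∀ a b, DifferentiableAt ℝ (F a b) z) (hF' : ∀ a b, extDeriv (F a b) z = 0) :
    extDeriv (trSq F) z = 0 := by
  have hw := fun a b => differentiableAt_wedge (hF a b) (hF b a)
  have e : trSq F = fun y => ∑ a, ∑ b, (wedge (F a b y) (F b a y) : Alt 4) := rfl
  rw [e, extDeriv_sum _ fun a _ => DifferentiableAt.fun_sum fun b _ => hw a b]
  refine Finset.sum_eq_zero fun a _ => ?_
  refine (extDeriv_sum _ fun b _ => hw a b).trans ?_
  exact Finset.sum_eq_zero fun b _ =>
    extDeriv_wedge_eq_zero (hF a b) (hF b a) (hF' a b) (hF' b a)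

/-- In `d(dA + A ∧ A)` the first term vanishes because `d² = 0`, and each part of the second
contains an undifferentiated factor `A`, which vanishes at `z`. -/
theorem IsMetricOn.extDeriv_chernCurv (h : IsMetricOn U H) (hz : z ∈ U)
    (hA : ∀ v, connM (fun y => of (H y)) v z = 0) (a b : Fin r) :
    extDeriv (chernCurv H a b) z = 0 := by
  have h1 : ∀ a b, ContDiffAt ℝ ∞ (chernConn H a b) z := fun a b =>
    (h.contDiffOn_chernConn a b).contDiffAt (h.isOpen.mem_nhds hz)
  have h2 : ∀ a b, DifferentiableAt ℝ (chernConn H a b) z := fun a b =>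
    (h1 a b).differentiableAt (by simp)
  have h0 : ∀ a b, chernConn H a b z = 0 := fun a b => by
    ext w
    rw [chernConn_apply, hA]; rfl
  have h3 : DifferentiableAt ℝ (extDeriv (chernConn H a b)) z :=
    (contDiffAt_extDeriv (n := 1) ((h1 a b).of_le (by norm_cast))).differentiableAt (by norm_num)
  have h4 : ∀ c, DifferentiableAt ℝ
      (fun y => (wedge (chernConn H a c y) (chernConn H c b y) : Alt 2)) z := fun c =>
    differentiableAt_wedge (h2 a c) (h2 c b)
  have h5 : DifferentiableAt ℝ
      (fun y => ∑ c, (wedge (chernConn H a c y) (chernConn H c b y) : Alt 2)) z :=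
    DifferentiableAt.fun_sum fun c _ => h4 c
  have h6 : ∀ c, extDeriv
      (fun y => (wedge (chernConn H a c y) (chernConn H c b y) : Alt 2)) z = 0 := by
    intro c
    have : fderiv ℝ (fun y => (wedge (chernConn H a c y) (chernConn H c b y) : Alt 2)) z = 0 := by
      ext u : 1
      refine (fderiv_wedge (h2 a c) (h2 c b) u).trans ?_
      rw [h0, h0, wedge_zero_left, wedge_zero_right, add_zero]
      rfl
    rw [extDeriv, this, alternatize_zero]
  have hD := ((h3.hasFDerivAt.add h5.hasFDerivAt).const_smul Complex.I).fderiv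
  have h7 : extDeriv (chernCurv H a b) z = Complex.I • (extDeriv (extDeriv (chernConn H a b)) z +
      extDeriv (fun y => ∑ c, (wedge (chernConn H a c y) (chernConn H c b y) : Alt 2)) z) := by
    refine (congrArg alternatizeUncurryFin hD).trans ?_
    rw [alternatizeUncurryFin_smul, alternatizeUncurryFin_add]
    rfl
  rw [h7, extDeriv_extDeriv_apply ((h1 a b).of_le (m := 2) (by norm_cast)) (by simp), extDeriv_sum _ fun c _ => h4 c,
    Finset.sum_eq_zero fun c _ => h6 c]
  simp

theorem posDef_gauge {A g : Matrix (Fin r) (Fin r) ℂ} (hA : A.PosDef) (hg : g.det ≠ 0) :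
    (gᴴ * A * g).PosDef :=
  hA.conjTranspose_mul_mul_same (mulVec_injective_iff_isUnit.2
    ((isUnit_iff_isUnit_det g).2 (isUnit_iff_ne_zero.2 hg)))

/-- `Tr F∧F` is independent of the holomorphic frame, so near `z` it may be computed in a frame
whose connection form vanishes at `z`. There `dF = 0` at `z`, and the Leibniz rule finishes. -/
theorem IsMetricOn.extDeriv_trSq (h : IsMetricOn U H) (hz : z ∈ U) :
    extDeriv (trSq (chernCurv H)) z = 0 := by
  set A : Fin 3 → Matrix (Fin r) (Fin r) ℂ := fun j => connM (fun y => of (H y)) (bas j) z with hA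
  -- An affine change of frame with `g(z) = 1` and `∂g(z) = -A(z)`; by the gauge law the new
  -- connection at `z` is `A + ∂g = 0`.
  let g : C3 → Matrix (Fin r) (Fin r) ℂ := fun y => 1 - ∑ j, (y j - z j) • A j
  have hga : ∀ a b, ContDiff ℂ ω (fun y => g y a b) := by
    intro a b
    simp only [g, Matrix.sub_apply, Matrix.sum_apply, Matrix.smul_apply, smul_eq_mul]
    refine contDiff_const.sub (ContDiff.sum fun j _ => ContDiff.mul ?_ contDiff_const)
    exact (contDiff_apply ℂ ℂ j).sub contDiff_const
  have hgr : ∀ a b, ContDiff ℝ ∞ (fun y => g y a b) := fun a b =>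
    ((hga a b).restrict_scalars ℝ).of_le le_top
  have hgc : Continuous fun y => (g y).det :=
    Continuous.matrix_det (continuous_matrix fun a b => (hgr a b).continuous)
  have hg1 : g z = 1 := by simp [g]
  -- The new frame is only a frame where `g` is invertible, which holds near `z`.
  let U' : Set C3 := U ∩ {y | (g y).det ≠ 0}
  have hU' : IsOpen U' := h.isOpen.inter (isOpen_ne_fun hgc continuous_const)
  have hz' : z ∈ U' := ⟨hz, by simp [hg1]⟩
  let H' : C3 → Fin r → Fin r → ℂ := fun y => (g y)ᴴ * of (H y) * g y
  have hH' : IsMetricOn U' H' := by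
    refine ⟨hU', ?_, fun y hy => posDef_gauge (h.posDef y hy.1) hy.2⟩
    have h1 : ∀ a b, ContDiffOn ℝ ∞ (fun y => of (H y) a b) U' := fun a b =>
      (h.entries a b).mono Set.inter_subset_left
    have h2 : ∀ a b, ContDiffOn ℝ ∞ (fun y => g y a b) U' := fun a b => (hgr a b).contDiffOn
    have h3 : ∀ a b, ContDiffOn ℝ ∞ (fun y => (g y)ᴴ a b) U' := fun a b =>
      (Complex.conjCLE : ℂ →L[ℝ] ℂ).contDiff.comp_contDiffOn (h2 b a)
    exact contDiffOn_pi.2 fun a => contDiffOn_pi.2 fun b =>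
      contDiffOn_matrix_mul (contDiffOn_matrix_mul h3 h1) h2 a b
  have hG : ∀ y ∈ U', IsGauge y id g H H' := by
    intro y hy
    refine ⟨.of_forall fun x => contDiffAt_id, .of_forall fun x a b => (hga a b).contDiffAt,
      ?_, .of_forall fun x => rfl⟩
    filter_upwards [hU'.mem_nhds hy] with x hx using hx.2
  have hT : trSq (chernCurv H) =ᶠ[𝓝 z] trSq (chernCurv H') := by
    filter_upwards [hU'.mem_nhds hz'] with y hy
    rw [(hG y hy).trSq_eq h hy.1 hH' hy, fderiv_id]
    rfl
  rw [hT.extDeriv_eq]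
  have hg0 : ∀ a b, DifferentiableAt ℂ (fun y => g y a b) z := fun a b =>
    (hga a b).contDiffAt.differentiableAt (by simp)
  have hdg : ∀ v, dM (-1) g z v = -connM (fun y => of (H y)) v z := by
    intro v
    rw [connM_eq_sum]
    ext a b
    rw [dM, of_apply, dEps_neg_one_of_holomorphic (hg0 a b)]
    have e : (fun y => g y a b) = fun y => (1 : Matrix (Fin r) (Fin r) ℂ) a b
        - ∑ j, (y j - z j) * A j a b := by
      funext y
      simp only [g, Matrix.sub_apply, Matrix.sum_apply, Matrix.smul_apply, smul_eq_mul]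
    have hj : ∀ j, HasFDerivAt (fun y : C3 => (y j - z j) * A j a b)
        (A j a b • (ContinuousLinearMap.proj j : C3 →L[ℂ] ℂ)) z := fun j =>
      (((ContinuousLinearMap.proj j : C3 →L[ℂ] ℂ).hasFDerivAt (x := z)).sub_const (z j)).mul_const _
    have hs := (HasFDerivAt.fun_sum fun j (_ : j ∈ Finset.univ) => hj j).const_sub
      ((1 : Matrix (Fin r) (Fin r) ℂ) a b)
    rw [e, hs.fderiv]
    simp only [_root_.neg_apply, _root_.sum_apply, _root_.smul_apply,
      ContinuousLinearMap.proj_apply, smul_eq_mul, Matrix.neg_apply, Matrix.sum_apply,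
      Matrix.smul_apply]
    congr 1
    exact Finset.sum_congr rfl fun j _ => mul_comm _ _
  have hA0 : ∀ v, connM (fun y => of (H' y)) v z = 0 := by
    intro v
    have := connM_gauge (M := fun y => of (H y)) (T := id) (N := fun y => of (H' y))
      differentiableAt_id (differentiableAt_of_contDiffOn h.isOpen hz h.entries) hg0
      (h.det_ne_zero z hz) hz'.2 (.of_forall fun x => rfl) v
    rw [this, hdg, hg1, fderiv_id]
    simp
  exact extDeriv_trSq_of (fun a b => ((hH'.contDiffOn_chernCurv a b).contDiffAt
    (hU'.mem_nhds hz')).differentiableAt (by simp)) (hH'.extDeriv_chernCurv hz' hA0)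

/-! ### The curvature of a Hermitian metric on the tangent bundle -/

variable {w w' : C3 → Alt 2} {U' : Set C3} {T : C3 → C3}

/-- `w` is a smooth family of positive `(1,1)`-forms on the open set `U`. -/
structure IsPosOn (U : Set C3) (w : C3 → Alt 2) : Prop where
  isOpen : IsOpen U
  smooth : ContDiffOn ℝ ∞ w U
  pos : ∀ y ∈ U, IsPos11 (w y)

theorem IsPosOn.isMetricOn (h : IsPosOn U w) : IsMetricOn U fun y k j => gram (w y) k j :=
  ⟨h.isOpen, contDiffOn_pi.2 fun k => contDiffOn_pi.2 fun j => contDiffOn_coeff11 h.smooth k j,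
    fun y hy => (isPos11_iff.1 (h.pos y hy)).2⟩

theorem IsPosOn.type (h : IsPosOn U w) (hz : z ∈ U) : ∀ᶠ y in 𝓝 z, IsRealOfType 1 1 (w y) := by
  filter_upwards [h.isOpen.mem_nhds hz] with y hy using (h.pos y hy).1

theorem IsPosOn.contDiffAt (h : IsPosOn U w) (hz : z ∈ U) : ContDiffAt ℝ ∞ w z :=
  h.smooth.contDiffAt (h.isOpen.mem_nhds hz)

theorem contDiffAt_jac (hT : ContDiffAt ℂ ω T z) (i j : Fin 3) :
    ContDiffAt ℂ ω (fun y => jac (fderiv ℂ T y) i j) z := by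
  have h : ContDiffAt ℂ ω (fderiv ℂ T) z := hT.fderiv_right (m := ω) le_top
  have h1 := h.clm_apply (contDiffAt_const (c := (Pi.single j 1 : C3)))
  exact contDiffAt_pi.1 h1 i

/-- On the tangent bundle the Jacobian plays both roles: it transforms the coordinates and the
coordinate frame. Thus all results on gauge changes apply to `R`. -/
theorem isGauge_gram (hT : ∀ᶠ y in 𝓝 z, ContDiffAt ℂ ω T y)
    (hd : ∀ᶠ y in 𝓝 z, (jac (fderiv ℂ T y)).det ≠ 0)
    (hw' : ∀ᶠ y in 𝓝 z, IsOfType 1 1 (w' (T y)))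
    (he : ∀ᶠ y in 𝓝 z, w y = pullC (fderiv ℂ T y) (w' (T y))) :
    IsGauge z T (fun y => jac (fderiv ℂ T y)) (fun y k j => gram (w' y) k j)
      (fun y k j => gram (w y) k j) := by
  refine ⟨hT, ?_, hd, ?_⟩
  · filter_upwards [hT] with y hy a b using contDiffAt_jac hy a b
  · filter_upwards [hw', he] with y h1 h2
    rw [h2]
    exact gram_pullC _ h1

/-! ### The right-hand sides -/

theorem IsPosOn.extDeriv_ddbar (h : IsPosOn U w) (hz : z ∈ U) :
    extDeriv (fun y => (Complex.I • del (dbar w) y : Alt 4)) z = 0 :=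
  extDeriv_del_dbar ((h.contDiffAt hz).of_le (by norm_cast))

theorem IsPosOn.contDiffAt_ddbar (h : IsPosOn U w) (hz : z ∈ U) :
    ContDiffAt ℝ ∞ (fun y => (Complex.I • del (dbar w) y : Alt 4)) z := by
  have h1 : ContDiffAt ℝ ∞ (dbar w) z := contDiffAt_dbar (n := ∞) (h.contDiffAt hz)
  exact (contDiffAt_clm_fderiv (delL 3) (n := ∞) h1).const_smul _

theorem extDeriv_combination {a b c : C3 → Alt 4} (α : ℝ) (ha : DifferentiableAt ℝ a z)
    (hb : DifferentiableAt ℝ b z) (hc : DifferentiableAt ℝ c z) (ha' : extDeriv a z = 0)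
    (hb' : extDeriv b z = 0) (hc' : extDeriv c z = 0) :
    extDeriv (fun y => a y + α • (b y - c y)) z = 0 := by
  have hD := (ha.hasFDerivAt.add ((hb.hasFDerivAt.sub hc.hasFDerivAt).const_smul α)).fderiv
  refine (congrArg alternatizeUncurryFin hD).trans ?_
  rw [alternatizeUncurryFin_add, alternatizeUncurryFin_smul, alternatize_sub]
  change extDeriv a z + α • (extDeriv b z - extDeriv c z) = 0
  rw [ha', hb', hc']
  simp

theorem IsPosOn.extDeriv_rhsX (h : IsPosOn U w) (hz : z ∈ U) (α : ℝ) {Φ : C3 → Alt 4}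
    (hΦ : DifferentiableAt ℝ Φ z) (hΦ' : extDeriv Φ z = 0) : extDeriv (rhsX α Φ w) z = 0 :=
  extDeriv_combination α ((h.contDiffAt_ddbar hz).differentiableAt (by simp))
    ((h.isMetricOn.contDiffOn_trSq.contDiffAt (h.isOpen.mem_nhds hz)).differentiableAt (by simp))
    hΦ (h.extDeriv_ddbar hz) (h.isMetricOn.extDeriv_trSq hz) hΦ'

theorem IsPosOn.extDeriv_rhsXE (h : IsPosOn U w) (hz : z ∈ U) (α : ℝ) (hH : IsMetricOn U' H)
    (hz' : z ∈ U') : extDeriv (rhsXE α w H) z = 0 :=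
  extDeriv_combination α ((h.contDiffAt_ddbar hz).differentiableAt (by simp))
    ((h.isMetricOn.contDiffOn_trSq.contDiffAt (h.isOpen.mem_nhds hz)).differentiableAt (by simp))
    ((hH.contDiffOn_trSq.contDiffAt (hH.isOpen.mem_nhds hz')).differentiableAt (by simp))
    (h.extDeriv_ddbar hz) (h.isMetricOn.extDeriv_trSq hz) (hH.extDeriv_trSq hz')

theorem IsPosOn.contDiffOn_rhsX (h : IsPosOn U w) (α : ℝ) {Φ : C3 → Alt 4}
    (hΦ : ContDiffOn ℝ ∞ Φ U) : ContDiffOn ℝ ∞ (rhsX α Φ w) U :=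
  ContDiffOn.add (fun _ hz => (h.contDiffAt_ddbar hz).contDiffWithinAt)
    ((h.isMetricOn.contDiffOn_trSq.sub hΦ).const_smul α)

theorem IsPosOn.contDiffOn_rhsXE (h : IsPosOn U w) (α : ℝ) (hH : IsMetricOn U' H) :
    ContDiffOn ℝ ∞ (rhsXE α w H) (U ∩ U') :=
  ContDiffOn.add (fun _ hz => (h.contDiffAt_ddbar hz.1).contDiffWithinAt)
    (((h.isMetricOn.contDiffOn_trSq.mono Set.inter_subset_left).sub
      (hH.contDiffOn_trSq.mono Set.inter_subset_right)).const_smul α)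

theorem isRealOfType_combination {a b c : Alt 4} (α : ℝ) (ha : IsRealOfType 2 2 a)
    (hb : IsRealOfType 2 2 b) (hc : IsRealOfType 2 2 c) : IsRealOfType 2 2 (a + α • (b - c)) :=
  (realOfType 4 2 2).add_mem ha ((realOfType 4 2 2).smul_mem α ((realOfType 4 2 2).sub_mem hb hc))

theorem IsPosOn.isRealOfType_rhsX (h : IsPosOn U w) (hz : z ∈ U) (α : ℝ) {Φ : C3 → Alt 4}
    (hΦ : IsRealOfType 2 2 (Φ z)) : IsRealOfType 2 2 (rhsX α Φ w z) :=
  isRealOfType_combination α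
    (isRealOfType_del_dbar ((h.contDiffAt hz).of_le (by norm_cast)) (h.type hz))
    (h.isMetricOn.isRealOfType_trSq hz) hΦ

theorem IsPosOn.isRealOfType_rhsXE (h : IsPosOn U w) (hz : z ∈ U) (α : ℝ) (hH : IsMetricOn U' H)
    (hz' : z ∈ U') : IsRealOfType 2 2 (rhsXE α w H z) :=
  isRealOfType_combination α
    (isRealOfType_del_dbar ((h.contDiffAt hz).of_le (by norm_cast)) (h.type hz))
    (h.isMetricOn.isRealOfType_trSq hz) (hH.isRealOfType_trSq hz')

/-- The data for comparing forms in two charts: `w = T^* w'` near `z`. -/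
structure IsPullback (z : C3) (T : C3 → C3) (w w' : C3 → Alt 2) : Prop where
  hT : ∀ᶠ y in 𝓝 z, ContDiffAt ℂ ω T y
  hd : ∀ᶠ y in 𝓝 z, (jac (fderiv ℂ T y)).det ≠ 0
  he : ∀ᶠ y in 𝓝 z, w y = pullC (fderiv ℂ T y) (w' (T y))

theorem IsPullback.ddbar_eq (h : IsPullback z T w w') (hw : IsPosOn U w) (hz : z ∈ U)
    (hw' : IsPosOn U' w') (hz' : T z ∈ U') :
    (Complex.I • del (dbar w) z : Alt 4) =
      pullC (fderiv ℂ T z) (Complex.I • del (dbar w') (T z) : Alt 4) :=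
  del_dbar_pullback h.hT.self_of_nhds ((hw.contDiffAt hz).of_le (by norm_cast))
    ((hw'.contDiffAt hz').of_le (by norm_cast)) ((hw'.type hz').mono fun _ h => h.2) h.he

theorem IsPullback.isGauge (h : IsPullback z T w w') (hw' : IsPosOn U' w') (hz' : T z ∈ U') :
    IsGauge z T (fun y => jac (fderiv ℂ T y)) (fun y k j => gram (w' y) k j)
      (fun y k j => gram (w y) k j) :=
  isGauge_gram h.hT h.hd (h.hT.self_of_nhds.continuousAt.eventually
    ((hw'.type hz').mono fun _ h => h.2)) h.he

theorem IsPullback.rhsX_eq (h : IsPullback z T w w') (hw : IsPosOn U w) (hz : z ∈ U)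
    (hw' : IsPosOn U' w') (hz' : T z ∈ U') (α : ℝ) {Φ Φ' : C3 → Alt 4}
    (hΦ : Φ z = pullC (fderiv ℂ T z) (Φ' (T z))) :
    rhsX α Φ w z = pullC (fderiv ℂ T z) (rhsX α Φ' w' (T z)) := by
  have h1 := h.ddbar_eq hw hz hw' hz'
  have h2 : trSq (metricCurv w) z = _ :=
    (h.isGauge hw' hz').trSq_eq hw'.isMetricOn hz' hw.isMetricOn hz
  rw [rhsX, h1, h2, hΦ]
  rfl

theorem IsPullback.rhsXE_eq {g : C3 → Matrix (Fin r) (Fin r) ℂ} {V V' : Set C3}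
    (h : IsPullback z T w w') (hw : IsPosOn U w) (hz : z ∈ U)
    (hw' : IsPosOn U' w') (hz' : T z ∈ U') (α : ℝ) (hg : IsGauge z T g H' H)
    (hH : IsMetricOn V H) (hzV : z ∈ V) (hH' : IsMetricOn V' H') (hzV' : T z ∈ V') :
    rhsXE α w H z = pullC (fderiv ℂ T z) (rhsXE α w' H' (T z)) := by
  have h1 := h.ddbar_eq hw hz hw' hz'
  have h2 : trSq (metricCurv w) z = _ :=
    (h.isGauge hw' hz').trSq_eq hw'.isMetricOn hz' hw.isMetricOn hz
  have h3 := hg.trSq_eq hH' hzV' hH hzV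
  rw [rhsXE, h1, h2, h3]
  rfl

end ChernWeil

/-! ### Smoothness of holomorphic functions of several variables -/

section Osgood

open _root_.Metric MeasureTheory Set

variable {E : Type*} [NormedAddCommGroup E] [NormedSpace ℂ E] {f : E → ℂ} {U : Set E}

/-- The Cauchy estimate for the derivative of a holomorphic function of several variables. -/
theorem norm_fderiv_le_of_closedBall {y : E} {δ M : ℝ} (hδ : 0 < δ)
    (hf : ∀ x ∈ closedBall y δ, DifferentiableAt ℂ f x) (hM : ∀ x ∈ closedBall y δ, ‖f x‖ ≤ M) :
    ‖fderiv ℂ f y‖ ≤ M / δ := by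
  have hM0 : 0 ≤ M := (norm_nonneg _).trans (hM y (mem_closedBall_self hδ.le))
  refine ContinuousLinearMap.opNorm_le_bound _ (by positivity) fun w => ?_
  by_cases hw : w = 0
  · simp [hw]
  have hw' : 0 < ‖w‖ := norm_pos_iff.2 hw
  have hR : 0 < δ / ‖w‖ := by positivity
  -- Restricting to the complex line `y + ζ w` reduces the estimate to the Cauchy estimate in one
  -- variable; the disc of radius `δ / ‖w‖` is the largest that stays in the ball.
  have hmem : ∀ ζ ∈ closedBall (0 : ℂ) (δ / ‖w‖), y + ζ • w ∈ closedBall y δ := by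
    intro ζ hζ
    rw [mem_closedBall_zero_iff] at hζ
    rw [mem_closedBall, dist_eq_norm, add_sub_cancel_left, norm_smul]
    calc ‖ζ‖ * ‖w‖ ≤ δ / ‖w‖ * ‖w‖ := by gcongr
      _ = δ := by field_simp
  have hl : ∀ ζ : ℂ, HasDerivAt (fun ζ : ℂ => y + ζ • w) w ζ := fun ζ => by
    simpa using ((hasDerivAt_id ζ).smul_const w).const_add y
  have hd : ∀ ζ ∈ closedBall (0 : ℂ) (δ / ‖w‖),
      HasDerivAt (fun ζ : ℂ => f (y + ζ • w)) (fderiv ℂ f (y + ζ • w) w) ζ := fun ζ hζ =>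
    (hf _ (hmem ζ hζ)).hasFDerivAt.comp_hasDerivAt ζ (hl ζ)
  have h1 := Complex.norm_deriv_le_of_forall_mem_sphere_norm_le (c := 0)
    (f := fun ζ : ℂ => f (y + ζ • w)) (C := M) hR
    (DifferentiableOn.diffContOnCl fun ζ hζ => (hd ζ (closure_ball_subset_closedBall
      hζ)).differentiableAt.differentiableWithinAt)
    fun ζ hζ => hM _ (hmem ζ (sphere_subset_closedBall hζ))
  rw [(hd 0 (mem_closedBall_self hR.le)).deriv] at h1
  simp only [zero_smul, add_zero] at h1
  calc ‖fderiv ℂ f y w‖ ≤ M / (δ / ‖w‖) := h1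
    _ = M / δ * ‖w‖ := by field_simp

variable [FiniteDimensional ℂ E]

/-- Cauchy's formula on the complex line through `x` in direction `v` writes `f'(x) v` as an
integral of `f` over a circle. This integral may be differentiated in `x` under the integral sign,
the derivative of the integrand being bounded by the Cauchy estimate. -/
theorem differentiableAt_fderiv_apply_of_holomorphic (hU : IsOpen U)
    (hf : DifferentiableOn ℂ f U) (v : E) {z : E} (hz : z ∈ U) :
    DifferentiableAt ℂ (fun y => fderiv ℂ f y v) z := by
  have : ProperSpace E := FiniteDimensional.proper ℂ E
  have hfd : ∀ x ∈ U, DifferentiableAt ℂ f x := fun x hx =>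
    (hf x hx).differentiableAt (hU.mem_nhds hx)
  obtain ⟨δ', hδ', hsub'⟩ := _root_.Metric.isOpen_iff.1 hU z hz
  -- Three nested balls: `f` is bounded on radius `3δ`, hence `f'` on radius `2δ`; the point `x`
  -- stays within `δ` and the circle adds at most another `δ`.
  set δ := δ' / 4 with hδdef
  have hδ : 0 < δ := by positivity
  have hsub : closedBall z (3 * δ) ⊆ U :=
    (closedBall_subset_ball (by rw [hδdef]; linarith)).trans hsub'
  obtain ⟨M, hM⟩ := (isCompact_closedBall z (3 * δ)).exists_bound_of_continuousOn
    (hf.continuousOn.mono hsub)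
  have hfb : ∀ y ∈ closedBall z (2 * δ), ‖fderiv ℂ f y‖ ≤ M / δ := by
    intro y hy
    have h : closedBall y δ ⊆ closedBall z (3 * δ) := by
      refine closedBall_subset_closedBall' ?_
      rw [mem_closedBall] at hy
      linarith
    exact norm_fderiv_le_of_closedBall hδ (fun x hx => hfd x (hsub (h hx)))
      fun x hx => hM x (h hx)
  -- The summand 1 covers `v = 0` and keeps `ρ ‖v‖ ≤ δ`.
  set ρ := δ / (‖v‖ + 1) with hρdef
  have hρ : 0 < ρ := by positivity
  have hρv : ρ * ‖v‖ ≤ δ := by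
    rw [hρdef, div_mul_eq_mul_div, div_le_iff₀ (by positivity)]
    nlinarith [norm_nonneg v]
  have hmem : ∀ x ∈ ball z δ, ∀ ζ ∈ closedBall (0 : ℂ) ρ, x + ζ • v ∈ closedBall z (2 * δ) := by
    intro x hx ζ hζ
    rw [mem_closedBall_zero_iff] at hζ
    rw [mem_ball, dist_eq_norm] at hx
    rw [mem_closedBall, dist_eq_norm]
    have e : x + ζ • v - z = (x - z) + ζ • v := by abel
    rw [e]
    refine (norm_add_le _ _).trans ?_
    rw [norm_smul]
    nlinarith [norm_nonneg v]
  have hsub2 : closedBall z (2 * δ) ⊆ U :=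
    (closedBall_subset_closedBall (by linarith)).trans hsub
  have hl : ∀ (x : E) (ζ : ℂ), HasDerivAt (fun ζ : ℂ => x + ζ • v) v ζ := fun x ζ => by
    simpa using ((hasDerivAt_id ζ).smul_const v).const_add x
  have hd : ∀ x ∈ ball z δ, ∀ ζ ∈ closedBall (0 : ℂ) ρ,
      HasDerivAt (fun ζ : ℂ => f (x + ζ • v)) (fderiv ℂ f (x + ζ • v) v) ζ := fun x hx ζ hζ =>
    (hfd _ (hsub2 (hmem x hx ζ hζ))).hasFDerivAt.comp_hasDerivAt ζ (hl x ζ)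
  have hcirc : ∀ θ : ℝ, circleMap 0 ρ θ ∈ closedBall (0 : ℂ) ρ := fun θ =>
    circleMap_mem_closedBall 0 hρ.le θ
  let c : ℝ → ℂ := fun θ => deriv (circleMap 0 ρ) θ * (1 / (circleMap 0 ρ θ - 0) ^ 2)
  have hc : Continuous c := by
    have h0 : ∀ θ, (circleMap 0 ρ θ - 0) ^ 2 ≠ 0 := fun θ => by
      rw [sub_zero]
      exact pow_ne_zero 2 (circleMap_ne_center hρ.ne')
    have h1 : Continuous (deriv (circleMap 0 ρ)) := by
      have : deriv (circleMap 0 ρ) = fun θ => circleMap 0 ρ θ * Complex.I := by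
        funext θ
        exact deriv_circleMap 0 ρ θ
      rw [this]
      exact (continuous_circleMap 0 ρ).mul continuous_const
    exact h1.mul (continuous_const.div (((continuous_circleMap 0 ρ).sub continuous_const).pow 2) h0)
  have hcauchy : ∀ x ∈ ball z δ, ∫ θ in (0 : ℝ)..2 * Real.pi, c θ * f (x + circleMap 0 ρ θ • v) =
      (2 * Real.pi * Complex.I) * fderiv ℂ f x v := by
    intro x hx
    have h := DifferentiableOn.deriv_eq_smul_circleIntegral (c := 0)
      (f := fun ζ : ℂ => f (x + ζ • v)) hρ
      fun ζ hζ => (hd x hx ζ hζ).differentiableAt.differentiableWithinAt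
    rw [(hd x hx 0 (mem_closedBall_self hρ.le)).deriv] at h
    simp only [zero_smul, add_zero, smul_eq_mul] at h
    rw [← h, circleIntegral]
    refine intervalIntegral.integral_congr fun θ _ => ?_
    simp only [c, smul_eq_mul, mul_assoc]
  have hcont : ∀ x ∈ ball z δ, Continuous fun θ : ℝ => c θ * f (x + circleMap 0 ρ θ • v) := by
    intro x hx
    refine hc.mul ?_
    refine hf.continuousOn.comp_continuous
      (continuous_const.add ((continuous_circleMap 0 ρ).smul continuous_const)) fun θ => ?_
    exact hsub2 (hmem x hx _ (hcirc θ))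
  let : MeasurableSpace E := borel E
  have : BorelSpace E := ⟨rfl⟩
  -- Continuity of the derivative is not yet known here; measurability is enough for the dominated
  -- differentiation.
  have hmeas : Measurable fun θ : ℝ => c θ • fderiv ℂ f (z + circleMap 0 ρ θ • v) := by
    refine hc.measurable.smul ((measurable_fderiv ℂ f).comp ?_)
    exact (continuous_const.add ((continuous_circleMap 0 ρ).smul continuous_const)).measurable
  have hF := intervalIntegral.hasFDerivAt_integral_of_dominated_of_fderiv_le (𝕜 := ℂ)
    (μ := volume) (a := 0) (b := 2 * Real.pi) (x₀ := z) (s := ball z δ)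
    (F := fun x θ => c θ * f (x + circleMap 0 ρ θ • v))
    (F' := fun x θ => c θ • fderiv ℂ f (x + circleMap 0 ρ θ • v))
    (bound := fun θ => ‖c θ‖ * (M / δ)) (ball_mem_nhds z hδ)
    (by
      filter_upwards [ball_mem_nhds z hδ] with x hx
      exact (hcont x hx).aestronglyMeasurable)
    ((hcont z (mem_ball_self hδ)).intervalIntegrable _ _)
    hmeas.aestronglyMeasurable
    (.of_forall fun θ _ x hx => by
      rw [norm_smul]
      exact mul_le_mul_of_nonneg_left (hfb _ (hmem x hx _ (hcirc θ))) (norm_nonneg _))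
    ((hc.norm.mul continuous_const).intervalIntegrable _ _)
    (.of_forall fun θ _ x hx => by
      have h1 := (hfd _ (hsub2 (hmem x hx _ (hcirc θ)))).hasFDerivAt
      have h2 : HasFDerivAt (fun x => x + circleMap 0 ρ θ • v) (ContinuousLinearMap.id ℂ E) x :=
        (hasFDerivAt_id x).add_const _
      exact (h1.comp x h2).const_mul (c θ))
  have hpi : (2 * Real.pi * Complex.I : ℂ) ≠ 0 := Complex.two_pi_I_ne_zero
  have he : (fun y => fderiv ℂ f y v) =ᶠ[𝓝 z] fun x => (2 * Real.pi * Complex.I : ℂ)⁻¹ *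
      ∫ θ in (0 : ℝ)..2 * Real.pi, c θ * f (x + circleMap 0 ρ θ • v) := by
    filter_upwards [ball_mem_nhds z hδ] with x hx
    rw [hcauchy x hx, ← mul_assoc, inv_mul_cancel₀ hpi, one_mul]
  exact (hF.differentiableAt.const_mul _).congr_of_eventuallyEq he

/-- Holomorphic functions of several variables are smooth. -/
theorem contDiffOn_of_differentiableOn_complex (hU : IsOpen U) (hf : DifferentiableOn ℂ f U) :
    ContDiffOn ℂ ∞ f U := by
  rw [contDiffOn_infty]
  intro n
  induction n generalizing f with
  | zero => exact contDiffOn_zero.2 hf.continuousOn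
  | succ n ih =>
    push_cast
    rw [contDiffOn_succ_iff_fderiv_of_isOpen hU]
    -- The components of the derivative are again holomorphic, so the induction hypothesis, which is
    -- about all `f`, applies to them.
    refine ⟨hf, fun h => absurd h (by simp), contDiffOn_clm_apply.2 fun v => ih fun z hz => ?_⟩
    exact (differentiableAt_fderiv_apply_of_holomorphic hU hf v hz).differentiableWithinAt

end Osgood

/-! ### Forms in holomorphic charts, gluing of local expressions, and the volume form -/

section Charts

open Matrix Filter

attribute [local irreducible] wedge

variable {X : Type*} [TopologicalSpace X]

/-- The change of coordinates from the chart `e` to the chart `e'`. -/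
noncomputable def trans (e e' : OpenPartialHomeomorph X C3) (z : C3) : C3 := e' (e.symm z)

variable {e e' e'' : OpenPartialHomeomorph X C3} {z : C3} {k : ℕ}

theorem eventually_mem (hz : z ∈ e.target) (hz' : e.symm z ∈ e'.source) :
    ∀ᶠ y in 𝓝 z, y ∈ e.target ∧ e.symm y ∈ e'.source :=
  (e.isOpen_inter_preimage_symm e'.open_source).mem_nhds ⟨hz, hz'⟩

theorem trans_mem_target (hz' : e.symm z ∈ e'.source) : trans e e' z ∈ e'.target :=
  e'.map_source hz'

theorem symm_trans (hz' : e.symm z ∈ e'.source) : e'.symm (trans e e' z) = e.symm z :=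
  e'.left_inv hz'

theorem trans_trans (hz : z ∈ e.target) (hz' : e.symm z ∈ e'.source) :
    trans e e'' =ᶠ[𝓝 z] fun y => trans e' e'' (trans e e' y) := by
  filter_upwards [eventually_mem hz hz'] with y hy
  simp only [trans]
  rw [e'.left_inv hy.2]

theorem trans_self (hz : z ∈ e.target) : trans e e =ᶠ[𝓝 z] id := by
  filter_upwards [e.open_target.mem_nhds hz] with y hy
  exact e.right_inv hy

theorem fderiv_trans_self (hz : z ∈ e.target) :
    fderiv ℂ (trans e e) z = ContinuousLinearMap.id ℂ C3 := by
  rw [(trans_self hz).fderiv_eq, fderiv_id]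

variable [ChartedSpace C3 X] [IsManifold 𝓘(ℂ, C3) ω X]

theorem contDiffAt_trans (he : e ∈ atlas C3 X) (he' : e' ∈ atlas C3 X) (hz : z ∈ e.target)
    (hz' : e.symm z ∈ e'.source) : ContDiffAt ℂ ω (trans e e') z := by
  have h1 := contMDiffOn_of_mem_contDiffGroupoid
    ((contDiffGroupoid ω 𝓘(ℂ, C3)).compatible he he')
  have h2 := contMDiffOn_iff_contDiffOn.1 h1
  have hm : z ∈ (e.symm.trans e').source := by
    rw [OpenPartialHomeomorph.trans_source]
    exact ⟨hz, hz'⟩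
  exact h2.contDiffAt ((e.symm.trans e').open_source.mem_nhds hm)

theorem fderiv_trans_trans (he : e ∈ atlas C3 X) (he' : e' ∈ atlas C3 X) (he'' : e'' ∈ atlas C3 X)
    (hz : z ∈ e.target) (hz' : e.symm z ∈ e'.source) (hz'' : e.symm z ∈ e''.source) :
    fderiv ℂ (trans e e'') z =
      (fderiv ℂ (trans e' e'') (trans e e' z)).comp (fderiv ℂ (trans e e') z) := by
  rw [(trans_trans hz hz').fderiv_eq]
  have h1 := (contDiffAt_trans he he' hz hz').differentiableAt (by simp)
  have h2 := (contDiffAt_trans he' he'' (trans_mem_target hz')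
    (by rwa [symm_trans hz'])).differentiableAt (by simp)
  exact fderiv_comp z h2 h1

theorem fderiv_trans_comp_symm (he : e ∈ atlas C3 X) (he' : e' ∈ atlas C3 X)
    (hz : z ∈ e.target) (hz' : e.symm z ∈ e'.source) :
    (fderiv ℂ (trans e' e) (trans e e' z)).comp (fderiv ℂ (trans e e') z) =
      ContinuousLinearMap.id ℂ C3 := by
  rw [← fderiv_trans_trans he he' he hz hz' (e.map_target hz), fderiv_trans_self hz]

theorem det_jac_ne_zero_of_comp {S T : C3 →L[ℂ] C3} (h : S.comp T = ContinuousLinearMap.id ℂ C3) :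
    (jac T).det ≠ 0 := by
  have h1 : jac S * jac T = 1 := by
    have e : jac S * jac T = jac (S.comp T) := (LinearMap.toMatrix'_comp _ _).symm
    rw [e, h]
    exact LinearMap.toMatrix'_id
  intro h0
  have := congrArg det h1
  rw [det_mul, h0, mul_zero, det_one] at this
  exact zero_ne_one this

/-- The inverse coordinate change supplies a left inverse of the Jacobian. -/
theorem det_jac_trans_ne_zero (he : e ∈ atlas C3 X) (he' : e' ∈ atlas C3 X)
    (hz : z ∈ e.target) (hz' : e.symm z ∈ e'.source) : (jac (fderiv ℂ (trans e e') z)).det ≠ 0 :=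
  det_jac_ne_zero_of_comp (fderiv_trans_comp_symm he he' hz hz')

/-- The expression in a chart in terms of the value at the point. -/
theorem rep_eq (he : e ∈ atlas C3 X) (hz : z ∈ e.target) (a : DForm X k) :
    rep e a z = pullC (fderiv ℂ (trans e (chartAt C3 (e.symm z))) z) (DForm.at a (e.symm z)) := by
  have hs : e.symm z ∈ (chartAt C3 (e.symm z)).source := mem_chart_source C3 _
  have hT := contDiffAt_trans he (chart_mem_atlas C3 (e.symm z)) hz hs
  have hd : DifferentiableAt ℝ (trans e (chartAt C3 (e.symm z))) z :=
    (hT.differentiableAt (by simp)).restrictScalars ℝ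
  have hm : MDifferentiableAt 𝓘(ℝ, C3) 𝓘(ℝ, C3) e.symm z := by
    refine mdifferentiableAt_iff _ _ |>.2 ⟨e.continuousAt_symm hz, ?_⟩
    exact hd.differentiableWithinAt
  have hf : (mfderiv 𝓘(ℝ, C3) 𝓘(ℝ, C3) e.symm z : C3 →L[ℝ] C3) =
      (fderiv ℂ (trans e (chartAt C3 (e.symm z))) z).restrictScalars ℝ := by
    rw [← (hT.differentiableAt (by simp)).fderiv_restrictScalars ℝ]
    refine hm.mfderiv.trans ?_
    change fderivWithin ℝ (trans e (chartAt C3 (e.symm z))) (Set.range 𝓘(ℝ, C3)) z = _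
    rw [modelWithCornersSelf_coe, Set.range_id, fderivWithin_univ]
  exact congrArg (fun L : C3 →L[ℝ] C3 =>
    (DForm.at a (e.symm z)).compContinuousLinearMap L) hf

theorem pullC_comp (S T : C3 →L[ℂ] C3) (a : Alt k) : pullC T (pullC S a) = pullC (S.comp T) a := rfl

theorem pullC_id (a : Alt k) : pullC (ContinuousLinearMap.id ℂ C3) a = a := by
  ext v; rfl

/-- The change of the expression of a form under a change of coordinates. -/
theorem rep_trans (he : e ∈ atlas C3 X) (he' : e' ∈ atlas C3 X) (hz : z ∈ e.target)
    (hz' : e.symm z ∈ e'.source) (a : DForm X k) :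
    rep e a z = pullC (fderiv ℂ (trans e e') z) (rep e' a (trans e e' z)) := by
  rw [rep_eq he hz, rep_eq he' (trans_mem_target hz'), symm_trans hz', pullC_comp,
    ← fderiv_trans_trans he he' (chart_mem_atlas C3 _) hz hz' (mem_chart_source C3 _)]

theorem rep_chartAt (x : X) (a : DForm X k) :
    rep (chartAt C3 x) a (chartAt C3 x x) = DForm.at a x := by
  have hx := mem_chart_source C3 x
  have ht : chartAt C3 x x ∈ (chartAt C3 x).target := (chartAt C3 x).map_source hx
  have hx' : (chartAt C3 x).symm (chartAt C3 x x) = x := (chartAt C3 x).left_inv hx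
  rw [rep_eq (chart_mem_atlas C3 x) ht, hx', fderiv_trans_self ht, pullC_id]

theorem form_ext {a b : DForm X k}
    (h : ∀ e ∈ atlas C3 X, ∀ z ∈ e.target, rep e a z = rep e b z) : a = b := by
  funext x
  have := h _ (chart_mem_atlas C3 x) _ ((chartAt C3 x).map_source (mem_chart_source C3 x))
  rw [rep_chartAt, rep_chartAt] at this
  exact this

/-- Local expressions that transform like a form. -/
def IsCompatible (a : OpenPartialHomeomorph X C3 → C3 → Alt k) : Prop :=
  ∀ e ∈ atlas C3 X, ∀ e' ∈ atlas C3 X, ∀ z ∈ e.target, e.symm z ∈ e'.source →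
    a e z = pullC (fderiv ℂ (trans e e') z) (a e' (trans e e' z))

/-- The form with given local expressions. -/
noncomputable def glue (a : OpenPartialHomeomorph X C3 → C3 → Alt k) : DForm X k :=
  fun x => a (chartAt C3 x) (chartAt C3 x x)

omit [IsManifold 𝓘(ℂ, C3) ω X] in
theorem at_glue (a : OpenPartialHomeomorph X C3 → C3 → Alt k) (x : X) :
    DForm.at (glue a) x = a (chartAt C3 x) (chartAt C3 x x) := rfl

/-- The glued form is defined at each point by the preferred chart there; compatibility transports
it to any other chart. -/
theorem rep_glue {a : OpenPartialHomeomorph X C3 → C3 → Alt k} (h : IsCompatible a)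
    (he : e ∈ atlas C3 X) (hz : z ∈ e.target) : rep e (glue a) z = a e z := by
  rw [rep_eq he hz, at_glue, h e he _ (chart_mem_atlas C3 (e.symm z)) z hz (mem_chart_source C3 _)]
  rfl

/-! ### Pointwise properties in charts -/

theorem IsRealOfType.pullC {p q : ℕ} {a : Alt k} (h : IsRealOfType p q a) (T : C3 →L[ℂ] C3) :
    IsRealOfType p q (pullC T a) := ⟨h.1.comp _, h.2.pullC T⟩

omit [IsManifold 𝓘(ℂ, C3) ω X] in
theorem injective_of_det_ne_zero {T : C3 →L[ℂ] C3} (hT : (jac T).det ≠ 0) :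
    Function.Injective T := by
  intro u v h
  rw [← jac_mulVec, ← jac_mulVec] at h
  exact mulVec_injective_iff_isUnit.2 ((isUnit_iff_isUnit_det _).2 (isUnit_iff_ne_zero.2 hT)) h

theorem IsPos11.pullC {a : Alt 2} (h : IsPos11 a) {T : C3 →L[ℂ] C3} (hT : (jac T).det ≠ 0) :
    IsPos11 (pullC T a) := by
  refine ⟨h.1.pullC T, fun v hv => ?_⟩
  rw [pullC_pair, mulI_apply, map_smul, ← mulI_apply]
  exact h.2 _ fun h0 => hv (injective_of_det_ne_zero hT (h0.trans (map_zero T).symm))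

theorem rep_isRealOfType {p q : ℕ} (he : e ∈ atlas C3 X) (hz : z ∈ e.target) {a : DForm X k}
    (h : ∀ x, IsRealOfType p q (DForm.at a x)) : IsRealOfType p q (rep e a z) := by
  rw [rep_eq he hz]
  exact (h _).pullC _

theorem rep_isOfType {p q : ℕ} (he : e ∈ atlas C3 X) (hz : z ∈ e.target) {a : DForm X k}
    (h : ∀ x, IsOfType p q (DForm.at a x)) : IsOfType p q (rep e a z) := by
  rw [rep_eq he hz]
  exact (h _).pullC _

theorem rep_isPos11 (he : e ∈ atlas C3 X) (hz : z ∈ e.target) {a : DForm X 2}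
    (h : ∀ x, IsPos11 (DForm.at a x)) : IsPos11 (rep e a z) := by
  rw [rep_eq he hz]
  exact (h _).pullC (det_jac_trans_ne_zero he (chart_mem_atlas C3 _) hz (mem_chart_source C3 _))

theorem Metric.isPosOn (w : Metric X) (he : e ∈ atlas C3 X) : IsPosOn e.target (rep e w.form) :=
  ⟨e.open_target, w.smooth e he, fun _ hy => rep_isPos11 he hy w.pos⟩

theorem Metric.isPullback (w : Metric X) (he : e ∈ atlas C3 X) (he' : e' ∈ atlas C3 X)
    (hz : z ∈ e.target) (hz' : e.symm z ∈ e'.source) :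
    IsPullback z (trans e e') (rep e w.form) (rep e' w.form) := by
  have h := eventually_mem hz hz'
  exact ⟨h.mono fun y hy => contDiffAt_trans he he' hy.1 hy.2,
    h.mono fun y hy => det_jac_trans_ne_zero he he' hy.1 hy.2,
    h.mono fun y hy => rep_trans he he' hy.1 hy.2 _⟩

/-! ### The holomorphic volume form -/

variable {O : DForm X 3}

/-- The coefficient `|Ω₁₂₃|` in a chart. -/
noncomputable def volN (O : DForm X 3) (e : OpenPartialHomeomorph X C3) (z : C3) : ℝ :=
  ‖rep e O z bas‖

omit [IsManifold 𝓘(ℂ, C3) ω X] in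
theorem volN_pos (hO : IsHolomorphicVolume O) (he : e ∈ atlas C3 X) (hz : z ∈ e.target) :
    0 < volN O e z := norm_pos_iff.2 ((hO.2 e he).2 z hz)

-- The coefficient of `Ω` is smooth because it is holomorphic, and its absolute value is smooth
-- because it has no zeros.
omit [IsManifold 𝓘(ℂ, C3) ω X] in
theorem contDiffOn_volN (hO : IsHolomorphicVolume O) (he : e ∈ atlas C3 X) :
    ContDiffOn ℝ ∞ (volN O e) e.target := by
  have h : ContDiffOn ℝ ∞ (fun z => rep e O z bas) e.target :=
    (contDiffOn_of_differentiableOn_complex e.open_target (hO.2 e he).1).restrict_scalars ℝ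
  exact h.norm ℝ (hO.2 e he).2

theorem at_bas_ne_zero (hO : IsHolomorphicVolume O) (x : X) : DForm.at O x bas ≠ 0 := by
  have h := (hO.2 _ (chart_mem_atlas C3 x)).2 _
    ((chartAt C3 x).map_source (mem_chart_source C3 x))
  rwa [rep_chartAt] at h

/-- `Psi` is defined pointwise in preferred charts; by `psi_pullC` the same formula holds in every
chart of the atlas. -/
theorem rep_Psi (hO : IsHolomorphicVolume O) (he : e ∈ atlas C3 X) (hz : z ∈ e.target)
    {w : DForm X 2} (hw : ∀ x, IsPos11 (DForm.at w x)) :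
    rep e (Psi O w) z = psiN (volN O e z) (rep e w z) := by
  rw [volN, ← psi_eq_psiN, rep_eq he hz, rep_eq he hz, rep_eq he hz]
  exact (psi_pullC (hO.1 _) (hw _) _
    (det_jac_trans_ne_zero he (chart_mem_atlas C3 _) hz (mem_chart_source C3 _))).symm

end Charts

/-! ### Sesquilinear forms on the bundle in local frames -/

section Frames

set_option linter.unusedSectionVars false

open Matrix Filter

attribute [local irreducible] wedge

variable {X : Type*} [TopologicalSpace X] {r : ℕ}
  {V : X → Type*} [∀ x, AddCommGroup (V x)] [∀ x, Module ℂ (V x)]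
  [∀ x, TopologicalSpace (V x)] [TopologicalSpace (Bundle.TotalSpace (Fin r → ℂ) V)]
  [FiberBundle (Fin r → ℂ) V]
  {τ τ' : Bundle.Trivialization (Fin r → ℂ) (π (Fin r → ℂ) V)} {x : X}

/-- The local frame of a trivialization. -/
noncomputable def frame (τ : Bundle.Trivialization (Fin r → ℂ) (π (Fin r → ℂ) V)) (x : X)
    (b : Fin r) : V x := τ.symm x (Pi.single b 1)

/-- The change of frame between two trivializations. -/
noncomputable def frameChange (τ τ' : Bundle.Trivialization (Fin r → ℂ) (π (Fin r → ℂ) V))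
    [τ.IsLinear ℂ] [τ'.IsLinear ℂ] (x : X) : Matrix (Fin r) (Fin r) ℂ :=
  of fun c b => τ.coordChangeL ℂ τ' x (Pi.single b 1) c

section

variable [τ.IsLinear ℂ] [τ'.IsLinear ℂ]

theorem symm_eq_sum (hx : x ∈ τ.baseSet) (y : Fin r → ℂ) :
    τ.symm x y = ∑ c, y c • frame τ x c := by
  have h : y = ∑ c, y c • Pi.single (M := fun _ : Fin r => ℂ) c (1 : ℂ) := by
    simpa using (pi_eq_sum_univ' y)
  rw [← τ.symmₗ_apply (R := ℂ) hx]
  conv_lhs => rw [h]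
  rw [map_sum]
  refine Finset.sum_congr rfl fun c _ => ?_
  rw [map_smul, τ.symmₗ_apply (R := ℂ) hx, frame]

theorem eq_sum_frame (hx : x ∈ τ.baseSet) (u : V x) :
    u = ∑ c, τ.linearMapAt ℂ x u c • frame τ x c := by
  rw [← symm_eq_sum hx, ← τ.symmₗ_apply (R := ℂ) hx, τ.symmₗ_linearMapAt hx]

theorem linearMapAt_frame (hx : x ∈ τ.baseSet) (hx' : x ∈ τ'.baseSet) (b c : Fin r) :
    τ'.linearMapAt ℂ x (frame τ x b) c = frameChange τ τ' x c b := by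
  rw [frameChange, of_apply, τ.coordChangeL_apply τ' ⟨hx, hx'⟩, frame, τ'.linearMapAt_def_of_mem hx']
  rfl

theorem frame_eq_sum (hx : x ∈ τ.baseSet) (hx' : x ∈ τ'.baseSet) (b : Fin r) :
    frame τ x b = ∑ c, frameChange τ τ' x c b • frame τ' x c := by
  simp_rw [← linearMapAt_frame hx hx']
  exact eq_sum_frame hx' _

theorem frameChange_mul (hx : x ∈ τ.baseSet) (hx' : x ∈ τ'.baseSet) :
    frameChange τ' τ x * frameChange τ τ' x = 1 := by
  have e : ∀ σ σ' : Bundle.Trivialization (Fin r → ℂ) (π (Fin r → ℂ) V), ∀ [σ.IsLinear ℂ]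
      [σ'.IsLinear ℂ], frameChange σ σ' x =
        LinearMap.toMatrix' (σ.coordChangeL ℂ σ' x).toLinearEquiv.toLinearMap := by
    intro σ σ' _ _
    ext c b
    rw [LinearMap.toMatrix'_apply]
    rfl
  rw [e, e, ← LinearMap.toMatrix'_comp, ← τ.symm_coordChangeL τ' ⟨hx', hx⟩]
  convert LinearMap.toMatrix'_id
  ext : 2
  simp

theorem det_frameChange_ne_zero (hx : x ∈ τ.baseSet) (hx' : x ∈ τ'.baseSet) :
    (frameChange τ τ' x).det ≠ 0 := by
  intro h0
  have := congrArg det (frameChange_mul (τ := τ) (τ' := τ') hx hx')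
  rw [det_mul, h0, mul_zero, det_one] at this
  exact zero_ne_one this

end

variable [ChartedSpace C3 X] {e e' : OpenPartialHomeomorph X C3} {z : C3}

theorem isOpen_dom : IsOpen (dom e τ) := e.isOpen_inter_preimage_symm τ.open_baseSet

/-- The frame change in the chart `e`. -/
noncomputable def gaugeOf (e : OpenPartialHomeomorph X C3)
    (τ τ' : Bundle.Trivialization (Fin r → ℂ) (π (Fin r → ℂ) V))
    [τ.IsLinear ℂ] [τ'.IsLinear ℂ] (z : C3) : Matrix (Fin r) (Fin r) ℂ :=
  frameChange τ τ' (e.symm z)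

theorem hrep_frame (H : SesqForm V) (a b : Fin r) :
    hrep e τ H z a b = H (e.symm z) (frame τ (e.symm z) a) (frame τ (e.symm z) b) := rfl

theorem sesq_frameChange [τ.IsLinear ℂ] [τ'.IsLinear ℂ] (H : SesqForm V) (hx : x ∈ τ.baseSet)
    (hx' : x ∈ τ'.baseSet) :
    of (fun a b => H x (frame τ x a) (frame τ x b)) = (frameChange τ τ' x)ᴴ *
      of (fun a b => H x (frame τ' x a) (frame τ' x b)) * frameChange τ τ' x := by
  ext a b
  rw [of_apply, frame_eq_sum hx hx' a, frame_eq_sum hx hx' b, map_sum]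
  simp only [map_sum, LinearMap.sum_apply, LinearMap.map_smulₛₗ, LinearMap.smul_apply, mul_apply,
    conjTranspose_apply, of_apply, Finset.sum_mul, Finset.mul_sum, smul_eq_mul, RingHom.id_apply]
  refine Finset.sum_congr rfl fun c _ => Finset.sum_congr rfl fun d _ => ?_
  simp only [starRingEnd_apply]
  ring

/-- The law `H ↦ g* H g`, with the chart changed at the same time; this is what `IsGauge` asks for.
-/
theorem hrep_trans [τ.IsLinear ℂ] [τ'.IsLinear ℂ] (H : SesqForm V) (hz : z ∈ dom e τ)
    (hz' : e.symm z ∈ e'.source) (hx' : e.symm z ∈ τ'.baseSet) :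
    of (hrep e τ H z) = (gaugeOf e τ τ' z)ᴴ * of (hrep e' τ' H (trans e e' z)) *
      gaugeOf e τ τ' z := by
  have h := sesq_frameChange (τ := τ) (τ' := τ') H hz.2 hx'
  have e1 : of (hrep e' τ' H (trans e e' z)) =
      of (fun a b => H (e.symm z) (frame τ' (e.symm z) a) (frame τ' (e.symm z) b)) := by
    ext a b
    rw [of_apply, of_apply, hrep_frame, symm_trans hz']
  rw [e1]
  exact h

section

variable [VectorBundle ℂ (Fin r → ℂ) V] [IsManifold 𝓘(ℂ, C3) ω X]
  [ContMDiffVectorBundle ω (Fin r → ℂ) V 𝓘(ℂ, C3)]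
  [MemTrivializationAtlas τ] [MemTrivializationAtlas τ']

/-- Holomorphy of the bundle enters here, through the complex analytic coordinate changes of its
trivializations. -/
theorem contDiffAt_gaugeOf (he : e ∈ atlas C3 X) (hz : z ∈ dom e τ)
    (hx' : e.symm z ∈ τ'.baseSet) (a b : Fin r) :
    ContDiffAt ℂ ω (fun y => gaugeOf e τ τ' y a b) z := by
  have h1 : ContMDiffAt 𝓘(ℂ, C3) 𝓘(ℂ, C3) ω e.symm z :=
    (contMDiffOn_symm_of_mem_maximalAtlas (IsManifold.subset_maximalAtlas he)).contMDiffAt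
      (e.open_target.mem_nhds hz.1)
  have h2 := (h1.coordChangeL (𝕜 := ℂ) (F := Fin r → ℂ) (E := V) (e := τ) (e' := τ') hz.2
    hx').contDiffAt
  have h3 := contDiffAt_pi.1 (h2.clm_apply
    (contDiffAt_const (c := (Pi.single b 1 : Fin r → ℂ)))) a
  exact h3

theorem isGauge_hrep (H : SesqForm V) (he : e ∈ atlas C3 X) (he' : e' ∈ atlas C3 X)
    (hz : z ∈ dom e τ) (hz' : e.symm z ∈ e'.source) (hx' : e.symm z ∈ τ'.baseSet) :
    IsGauge z (trans e e') (gaugeOf e τ τ') (hrep e' τ' H) (hrep e τ H) := by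
  have h : ∀ᶠ y in 𝓝 z, y ∈ dom e τ ∧ e.symm y ∈ e'.source ∧ e.symm y ∈ τ'.baseSet := by
    have h1 := isOpen_dom.mem_nhds hz
    have h2 : ∀ᶠ y in 𝓝 z, _ := (e.isOpen_inter_preimage_symm e'.open_source).mem_nhds ⟨hz.1, hz'⟩
    have h3 : ∀ᶠ y in 𝓝 z, _ := (e.isOpen_inter_preimage_symm τ'.open_baseSet).mem_nhds ⟨hz.1, hx'⟩
    filter_upwards [h1, h2, h3] with y k1 k2 k3
    exact ⟨k1, k2.2, k3.2⟩
  exact ⟨h.mono fun y hy => contDiffAt_trans he he' hy.1.1 hy.2.1,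
    h.mono fun y hy a b => contDiffAt_gaugeOf he hy.1 hy.2.2 a b,
    h.mono fun y hy => det_frameChange_ne_zero hy.1.2 hy.2.2,
    h.mono fun y hy => hrep_trans H hy.1 hy.2.1 hy.2.2⟩

end

variable [VectorBundle ℂ (Fin r → ℂ) V]

theorem mem_dom_trivializationAt (hz : z ∈ e.target) :
    z ∈ dom e (trivializationAt (Fin r → ℂ) V (e.symm z)) :=
  ⟨hz, mem_baseSet_trivializationAt (Fin r → ℂ) V (e.symm z)⟩

theorem mem_dom_chartAt (x : X) :
    chartAt C3 x x ∈ dom (chartAt C3 x) (trivializationAt (Fin r → ℂ) V x) := by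
  have hx' : (chartAt C3 x).symm (chartAt C3 x x) = x :=
    (chartAt C3 x).left_inv (mem_chart_source C3 x)
  refine ⟨(chartAt C3 x).map_source (mem_chart_source C3 x), ?_⟩
  rw [Set.mem_preimage, hx']
  exact mem_baseSet_trivializationAt (Fin r → ℂ) V x

theorem hrep_chartAt (x : X) (H : SesqForm V) (a b : Fin r) :
    hrep (chartAt C3 x) (trivializationAt (Fin r → ℂ) V x) H (chartAt C3 x x) a b =
      H x (frame (trivializationAt (Fin r → ℂ) V x) x a)
        (frame (trivializationAt (Fin r → ℂ) V x) x b) := by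
  rw [hrep_frame, (chartAt C3 x).left_inv (mem_chart_source C3 x)]

theorem sesq_apply [τ.IsLinear ℂ] (H : SesqForm V) (hx : x ∈ τ.baseSet) (u v : V x) :
    H x u v = star (τ.linearMapAt ℂ x u) ⬝ᵥ
      of (fun a b => H x (frame τ x a) (frame τ x b)) *ᵥ τ.linearMapAt ℂ x v := by
  conv_lhs => rw [eq_sum_frame hx u, eq_sum_frame hx v]
  simp only [map_sum, LinearMap.sum_apply, LinearMap.map_smulₛₗ, LinearMap.smul_apply, dotProduct,
    mulVec, of_apply, Finset.mul_sum, smul_eq_mul, RingHom.id_apply, Pi.star_apply]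
  rw [Finset.sum_comm]
  refine Finset.sum_congr rfl fun c _ => Finset.sum_congr rfl fun d _ => ?_
  simp only [starRingEnd_apply]
  ring

theorem sesq_ext {H K : SesqForm V}
    (h : ∀ e ∈ atlas C3 X, ∀ τ : Bundle.Trivialization (Fin r → ℂ) (π (Fin r → ℂ) V),
      MemTrivializationAtlas τ → ∀ z ∈ dom e τ, hrep e τ H z = hrep e τ K z) : H = K := by
  funext x
  have h1 := h _ (chart_mem_atlas C3 x) _ (inferInstance) _ (mem_dom_chartAt (r := r) (V := V) x)
  have hx := mem_baseSet_trivializationAt (Fin r → ℂ) V x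
  ext u v
  rw [sesq_apply H hx, sesq_apply K hx]
  simp_rw [← hrep_chartAt, h1]

/-- Local matrix expressions that transform like a sesquilinear form. -/
def IsSesqCompatible (K : OpenPartialHomeomorph X C3 →
    Bundle.Trivialization (Fin r → ℂ) (π (Fin r → ℂ) V) → C3 → Matrix (Fin r) (Fin r) ℂ) : Prop :=
  ∀ e ∈ atlas C3 X, ∀ e' ∈ atlas C3 X,
    ∀ τ τ' : Bundle.Trivialization (Fin r → ℂ) (π (Fin r → ℂ) V),
    ∀ [MemTrivializationAtlas τ] [MemTrivializationAtlas τ'], ∀ z ∈ dom e τ,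
      e.symm z ∈ e'.source → e.symm z ∈ τ'.baseSet →
      K e τ z = (gaugeOf e τ τ' z)ᴴ * K e' τ' (trans e e' z) * gaugeOf e τ τ' z

/-- The sesquilinear form of a matrix in a frame. -/
noncomputable def sesqOfMatrix (τ : Bundle.Trivialization (Fin r → ℂ) (π (Fin r → ℂ) V))
    [τ.IsLinear ℂ] (x : X) (M : Matrix (Fin r) (Fin r) ℂ) : V x →ₗ⋆[ℂ] V x →ₗ[ℂ] ℂ :=
  LinearMap.mk₂'ₛₗ (starRingEnd ℂ) (RingHom.id ℂ)
    (fun u v => star (τ.linearMapAt ℂ x u) ⬝ᵥ M *ᵥ τ.linearMapAt ℂ x v)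
    (fun u u' v => by rw [map_add, star_add, add_dotProduct])
    (fun c u v => by rw [map_smul, star_smul, smul_dotProduct]; rfl)
    (fun u v v' => by rw [map_add, mulVec_add, dotProduct_add])
    (fun c u v => by rw [map_smul, mulVec_smul, dotProduct_smul]; rfl)

theorem sesqOfMatrix_apply [τ.IsLinear ℂ] (M : Matrix (Fin r) (Fin r) ℂ) (u v : V x) :
    sesqOfMatrix τ x M u v = star (τ.linearMapAt ℂ x u) ⬝ᵥ M *ᵥ τ.linearMapAt ℂ x v := rfl

/-- The sesquilinear form with given local expressions. -/
noncomputable def sesqGlue (K : OpenPartialHomeomorph X C3 →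
    Bundle.Trivialization (Fin r → ℂ) (π (Fin r → ℂ) V) → C3 → Matrix (Fin r) (Fin r) ℂ) :
    SesqForm V := fun x =>
  sesqOfMatrix (trivializationAt (Fin r → ℂ) V x) x
    (K (chartAt C3 x) (trivializationAt (Fin r → ℂ) V x) (chartAt C3 x x))

theorem hrep_sesqGlue {K : OpenPartialHomeomorph X C3 →
    Bundle.Trivialization (Fin r → ℂ) (π (Fin r → ℂ) V) → C3 → Matrix (Fin r) (Fin r) ℂ}
    (h : IsSesqCompatible K) (he : e ∈ atlas C3 X) [MemTrivializationAtlas τ] (hz : z ∈ dom e τ) :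
    of (hrep e τ (sesqGlue K) z) = K e τ z := by
  have hx := mem_baseSet_trivializationAt (Fin r → ℂ) V (e.symm z)
  rw [h e he _ (chart_mem_atlas C3 (e.symm z)) τ (trivializationAt (Fin r → ℂ) V (e.symm z)) z hz
    (mem_chart_source C3 _) hx]
  ext a b
  rw [of_apply, hrep_frame, sesqGlue, sesqOfMatrix_apply]
  have e1 : ∀ b, (trivializationAt (Fin r → ℂ) V (e.symm z)).linearMapAt ℂ (e.symm z)
      (frame τ (e.symm z) b) =
      fun c => gaugeOf e τ (trivializationAt (Fin r → ℂ) V (e.symm z)) z c b := fun b =>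
    funext fun c => linearMapAt_frame hz.2 hx b c
  rw [e1, e1, Matrix.mul_assoc]
  rfl

/-! ### Hermitian forms in frames -/

theorem isHermitian_hrep {H : SesqForm V} (h : ∀ x u v, conj (H x u v) = H x v u) :
    (of (hrep e τ H z)).IsHermitian := by
  ext a b
  rw [conjTranspose_apply, of_apply, of_apply, hrep_frame, hrep_frame]
  exact h _ _ _

/-- The quadratic form of the matrix at `ξ` is `H` on the vector with coordinates `ξ`, which is
nonzero with `ξ`. -/
theorem posDef_hrep [τ.IsLinear ℂ] (H : HermMetric r V) (hz : z ∈ dom e τ) :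
    (of (hrep e τ H.form z)).PosDef := by
  refine PosDef.of_dotProduct_mulVec_pos (isHermitian_hrep H.herm) fun ξ hξ => ?_
  have h1 := sesq_apply H.form hz.2 (τ.symm (e.symm z) ξ) (τ.symm (e.symm z) ξ)
  have h2 : τ.linearMapAt ℂ (e.symm z) (τ.symm (e.symm z) ξ) = ξ := by
    rw [← τ.symmₗ_apply (R := ℂ) hz.2, τ.linearMapAt_symmₗ hz.2]
  rw [h2] at h1
  have h3 : τ.symm (e.symm z) ξ ≠ 0 := by
    intro h0
    rw [h0, map_zero] at h2
    exact hξ h2.symm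
  have h4 := H.pos _ _ h3
  have h5 := H.herm (e.symm z) (τ.symm (e.symm z) ξ) (τ.symm (e.symm z) ξ)
  change 0 < star ξ ⬝ᵥ of (fun a b => H.form (e.symm z) (frame τ (e.symm z) a)
    (frame τ (e.symm z) b)) *ᵥ ξ
  rw [← h1, Complex.pos_iff]
  exact ⟨h4, (Complex.conj_eq_iff_im.1 h5).symm⟩

theorem HermMetric.isMetricOn [MemTrivializationAtlas τ] (H : HermMetric r V)
    (he : e ∈ atlas C3 X) : IsMetricOn (dom e τ) (hrep e τ H.form) :=
  ⟨isOpen_dom, H.smooth e he τ inferInstance, fun _ hy => posDef_hrep H hy⟩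

theorem herm_of_hrep {H : SesqForm V}
    (h : ∀ x, (of (hrep (chartAt C3 x) (trivializationAt (Fin r → ℂ) V x) H
      (chartAt C3 x x))).IsHermitian) (x : X) (u v : V x) : conj (H x u v) = H x v u := by
  have hx := mem_baseSet_trivializationAt (Fin r → ℂ) V x
  have h1 := h x
  have e1 : of (hrep (chartAt C3 x) (trivializationAt (Fin r → ℂ) V x) H (chartAt C3 x x)) =
      of fun a b => H x (frame (trivializationAt (Fin r → ℂ) V x) x a)
        (frame (trivializationAt (Fin r → ℂ) V x) x b) := by
    ext a b
    exact hrep_chartAt x H a b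
  rw [e1] at h1
  rw [sesq_apply H hx u v, sesq_apply H hx v u, starRingEnd_apply, ← star_dotProduct,
    star_mulVec, h1.eq, dotProduct_mulVec]

theorem HermForm.ext' {K K' : HermForm r V} (h : K.form = K'.form) : K = K' := by
  cases K; cases K'; cases h; rfl

theorem HermMetric.ext' {K K' : HermMetric r V} (h : K.form = K'.form) : K = K' := by
  cases K; cases K'; cases h; rfl

end Frames

/-! ### Jets -/

section Jets

open Filter

variable {A B C D : Type*} [NormedAddCommGroup A] [NormedSpace ℝ A] [NormedAddCommGroup B]
  [NormedSpace ℝ B] [NormedAddCommGroup C] [NormedSpace ℝ C] [NormedAddCommGroup D]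
  [NormedSpace ℝ D] {s : Set D} {z : C3}

/-- The action of a linear map on jets. -/
noncomputable def mapJet (L : A →L[ℝ] B) (j : Jet2 A) : Jet2 B :=
  (L j.1, L.comp j.2.1, (ContinuousLinearMap.compL ℝ C3 A B L).comp j.2.2)

theorem contDiffOn_mapJet (L : A →L[ℝ] B) {j : D → Jet2 A} (hj : ContDiffOn ℝ ∞ j s) :
    ContDiffOn ℝ ∞ (fun x => mapJet L (j x)) s :=
  (L.contDiff.comp_contDiffOn hj.fst).prodMk ((contDiffOn_const.clm_comp hj.snd.fst).prodMk
    (contDiffOn_const.clm_comp hj.snd.snd))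

theorem jet2_clm_comp (L : A →L[ℝ] B) {f : C3 → A} (hf : ContDiffAt ℝ 2 f z) :
    jet2 (fun y => L (f y)) z = mapJet L (jet2 f z) := by
  have h1 : ∀ᶠ y in 𝓝 z, ContDiffAt ℝ 2 f y := hf.eventually (by simp)
  have h2 : fderiv ℝ (fun y => L (f y)) =ᶠ[𝓝 z] fun y =>
      ContinuousLinearMap.compL ℝ C3 A B L (fderiv ℝ f y) := by
    filter_upwards [h1] with y hy
    exact fderiv_clm_comp L (hy.differentiableAt (by simp))
  refine Prod.ext rfl (Prod.ext h2.self_of_nhds ?_)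
  change fderiv ℝ (fderiv ℝ (fun y => L (f y))) z = _
  rw [h2.fderiv_eq]
  exact fderiv_clm_comp _ (differentiableAt_fderiv hf)

/-- The jet of `y ↦ Q (y, f y)` in terms of the jet of `f`. -/
noncomputable def compJet (Q : C3 × A → B) (p : C3 × Jet2 A) : Jet2 B :=
  (Q (p.1, p.2.1),
    (fderiv ℝ Q (p.1, p.2.1)).comp ((ContinuousLinearMap.id ℝ C3).prod p.2.2.1),
    (ContinuousLinearMap.compL ℝ C3 (C3 × A) B (fderiv ℝ Q (p.1, p.2.1))).comp
        ((ContinuousLinearMap.compL ℝ C3 A (C3 × A) (ContinuousLinearMap.inr ℝ C3 A)).comp p.2.2.2)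
      + ((ContinuousLinearMap.compL ℝ C3 (C3 × A) B).flip
          ((ContinuousLinearMap.id ℝ C3).prod p.2.2.1)).comp
        ((fderiv ℝ (fderiv ℝ Q) (p.1, p.2.1)).comp
          ((ContinuousLinearMap.id ℝ C3).prod p.2.2.1)))

theorem id_prod_eq (L : C3 →L[ℝ] A) : (ContinuousLinearMap.id ℝ C3).prod L =
    ContinuousLinearMap.inl ℝ C3 A + (ContinuousLinearMap.inr ℝ C3 A).comp L := by
  ext x <;> simp

/-- Chain rule to second order. The derivative of `y ↦ (y, f y)` is `id.prod (f'(y))`, and the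
second derivative has one term from `f''` and one from the second derivative of `Q`. -/
theorem jet2_comp {Q : C3 × A → B} {f : C3 → A} (hQ : ContDiffAt ℝ 2 Q (z, f z))
    (hf : ContDiffAt ℝ 2 f z) :
    jet2 (fun y => Q (y, f y)) z = compJet Q (z, jet2 f z) := by
  have h1 : ∀ᶠ y in 𝓝 z, ContDiffAt ℝ 2 f y := hf.eventually (by simp)
  have hc : ContinuousAt (fun y => (y, f y)) z := continuousAt_id.prodMk hf.continuousAt
  have h2 : ∀ᶠ y in 𝓝 z, ContDiffAt ℝ 2 Q (y, f y) := hc.eventually (hQ.eventually (by simp))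
  have hp : ∀ y, ContDiffAt ℝ 2 f y → HasFDerivAt (fun y => (y, f y))
      ((ContinuousLinearMap.id ℝ C3).prod (fderiv ℝ f y)) y := fun y hy =>
    (hasFDerivAt_id y).prodMk (hy.differentiableAt (by simp)).hasFDerivAt
  have h3 : fderiv ℝ (fun y => Q (y, f y)) =ᶠ[𝓝 z] fun y =>
      (fderiv ℝ Q (y, f y)).comp ((ContinuousLinearMap.id ℝ C3).prod (fderiv ℝ f y)) := by
    filter_upwards [h1, h2] with y hy hy'
    exact ((hy'.differentiableAt (by simp)).hasFDerivAt.comp y (hp y hy)).fderiv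
  refine Prod.ext rfl (Prod.ext h3.self_of_nhds ?_)
  change fderiv ℝ (fderiv ℝ (fun y => Q (y, f y))) z = _
  rw [h3.fderiv_eq]
  have hQ' : DifferentiableAt ℝ (fderiv ℝ Q) (z, f z) :=
    (hQ.fderiv_right (m := 1) (by norm_num)).differentiableAt (by norm_num)
  have hc' := hQ'.hasFDerivAt.comp z (hp z hf)
  have hd : HasFDerivAt (fun y => (ContinuousLinearMap.id ℝ C3).prod (fderiv ℝ f y))
      ((ContinuousLinearMap.compL ℝ C3 A (C3 × A) (ContinuousLinearMap.inr ℝ C3 A)).comp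
        (fderiv ℝ (fderiv ℝ f) z)) z := by
    simp only [id_prod_eq]
    exact ((ContinuousLinearMap.compL ℝ C3 A (C3 × A)
      (ContinuousLinearMap.inr ℝ C3 A)).hasFDerivAt.comp z
        (differentiableAt_fderiv hf).hasFDerivAt).const_add _
  exact (hc'.clm_comp hd).fderiv

theorem contDiffOn_compJet {Q : C3 × A → B} {U : Set (C3 × A)} (hU : IsOpen U)
    (hQ : ContDiffOn ℝ ∞ Q U) {p : D → C3 × Jet2 A} (hp : ContDiffOn ℝ ∞ p s)
    (h : ∀ x ∈ s, ((p x).1, (p x).2.1) ∈ U) :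
    ContDiffOn ℝ ∞ (fun x => compJet Q (p x)) s := by
  have h1 : ContDiffOn ℝ ∞ (fderiv ℝ Q) U := hQ.fderiv_of_isOpen hU (by simp)
  have h2 : ContDiffOn ℝ ∞ (fderiv ℝ (fderiv ℝ Q)) U := h1.fderiv_of_isOpen hU (by simp)
  have hm : ContDiffOn ℝ ∞ (fun x => ((p x).1, (p x).2.1)) s := hp.fst.prodMk hp.snd.fst
  have k0 : ContDiffOn ℝ ∞ (fun x => Q ((p x).1, (p x).2.1)) s := hQ.comp hm h
  have k1 : ContDiffOn ℝ ∞ (fun x => fderiv ℝ Q ((p x).1, (p x).2.1)) s := h1.comp hm h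
  have k2 : ContDiffOn ℝ ∞ (fun x => fderiv ℝ (fderiv ℝ Q) ((p x).1, (p x).2.1)) s := h2.comp hm h
  have kd : ContDiffOn ℝ ∞ (fun x => (ContinuousLinearMap.id ℝ C3).prod (p x).2.2.1) s := by
    simp only [id_prod_eq]
    exact contDiffOn_const.add (contDiffOn_const.clm_comp hp.snd.snd.fst)
  refine k0.prodMk ((k1.clm_comp kd).prodMk (ContDiffOn.add ?_ ?_))
  · exact ((ContinuousLinearMap.contDiff _).comp_contDiffOn k1).clm_comp
      (contDiffOn_const.clm_comp hp.snd.snd.snd)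
  · exact ((ContinuousLinearMap.contDiff _).comp_contDiffOn kd).clm_comp (k2.clm_comp kd)

theorem contDiffOn_jet_apply {j : D → Jet2 A} (hj : ContDiffOn ℝ ∞ j s) (u v : C3) :
    ContDiffOn ℝ ∞ (fun x => (j x).2.2 u v) s :=
  (hj.snd.snd.clm_apply contDiffOn_const).clm_apply contDiffOn_const

/-- Convergence of the derivatives up to order two is convergence of jets. -/
theorem TendstoC2.tendsto_jet2 {f : ℝ → C3 → A} {g : C3 → A} {U : Set C3} (h : TendstoC2 f g U)
    (hz : z ∈ U) : Tendsto (fun t => jet2 (f t) z) atTop (𝓝 (jet2 g z)) := by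
  have hm : ∀ m ≤ 2, Tendsto (fun t => iteratedFDeriv ℝ m (f t) z) atTop
      (𝓝 (iteratedFDeriv ℝ m g z)) := fun m hm => (h m hm).tendsto_at hz
  have h0 : Tendsto (fun t => f t z) atTop (𝓝 (g z)) := by
    have := ((continuousMultilinearCurryFin0 ℝ C3 A).continuous.tendsto _).comp (hm 0 (by norm_num))
    simpa [Function.comp_def] using this
  have e1 : ∀ u : C3 → A, fderiv ℝ u z =
      continuousMultilinearCurryFin1 ℝ C3 A (iteratedFDeriv ℝ 1 u z) := by
    intro u
    ext v
    simp [iteratedFDeriv_one_apply]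
  have h1 : Tendsto (fun t => fderiv ℝ (f t) z) atTop (𝓝 (fderiv ℝ g z)) := by
    simp only [e1]
    exact ((continuousMultilinearCurryFin1 ℝ C3 A).continuous.tendsto _).comp (hm 1 (by norm_num))
  -- The iterated second derivative and the derivative of the derivative correspond under currying,
  -- which is continuous, so convergence passes from one to the other.
  have e2 : ∀ u : C3 → A, fderiv ℝ (fderiv ℝ u) z =
      ((continuousMultilinearCurryFin1 ℝ C3 A).toContinuousLinearEquiv :
        (C3 [×1]→L[ℝ] A) →L[ℝ] (C3 →L[ℝ] A)).comp
      (continuousMultilinearCurryLeftEquiv ℝ (fun _ : Fin 2 => C3) A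
        (iteratedFDeriv ℝ 2 u z)) := by
    intro u
    ext v v'
    have := iteratedFDeriv_two_apply (𝕜 := ℝ) u z ![v, v']
    simp only [Matrix.cons_val_zero, Matrix.cons_val_one] at this
    rw [← this]
    change _ = iteratedFDeriv ℝ 2 u z (Fin.cons v (Fin.snoc 0 v'))
    congr 1
    funext i
    fin_cases i <;> rfl
  have h2 : Tendsto (fun t => fderiv ℝ (fderiv ℝ (f t)) z) atTop (𝓝 (fderiv ℝ (fderiv ℝ g) z)) := by
    simp only [e2]
    have hc : Continuous fun M : C3 [×2]→L[ℝ] A =>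
        ((continuousMultilinearCurryFin1 ℝ C3 A).toContinuousLinearEquiv :
        (C3 [×1]→L[ℝ] A) →L[ℝ] (C3 →L[ℝ] A)).comp
      (continuousMultilinearCurryLeftEquiv ℝ (fun _ : Fin 2 => C3) A M) :=
      continuous_const.clm_comp (LinearIsometryEquiv.continuous _)
    exact (hc.tendsto _).comp (hm 2 le_rfl)
  exact h0.prodMk_nhds (h1.prodMk_nhds h2)

end Jets

/-! ### Curvature in terms of jets -/

section CurvatureJets

open Matrix

attribute [local irreducible] wedge

variable {r : ℕ} {D : Type*} [NormedAddCommGroup D] [NormedSpace ℝ D] {s : Set D} {z : C3}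
  {U : Set C3} {H : C3 → Fin r → Fin r → ℂ}

/-- First derivatives `∂` and `∂̄` of matrix entries. -/
noncomputable def dJet (ε : ℂ) (L : C3 →L[ℝ] (Fin r → Fin r → ℂ)) (u : C3) :
    Matrix (Fin r) (Fin r) ℂ :=
  of fun a b => (1 / 2 : ℂ) * (L u a b + ε * Complex.I * L (mulI u) a b)

/-- The mixed second derivatives `∂̄_u ∂_v` of matrix entries. -/
noncomputable def ddJet (B : C3 →L[ℝ] C3 →L[ℝ] (Fin r → Fin r → ℂ)) (u v : C3) :
    Matrix (Fin r) (Fin r) ℂ :=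
  of fun a b => (1 / 4 : ℂ) * (B u v a b - Complex.I * B u (mulI v) a b
      + Complex.I * B (mulI u) v a b + B (mulI u) (mulI v) a b)

/-- The curvature `∂̄_u (H⁻¹ ∂_v H)` in terms of the jet of `H`. -/
noncomputable def curvJet (j : Jet2 (Fin r → Fin r → ℂ)) (u v : C3) : Matrix (Fin r) (Fin r) ℂ :=
  (of j.1)⁻¹ * (ddJet j.2.2 u v - dJet 1 j.2.1 u * (of j.1)⁻¹ * dJet (-1) j.2.1 v)

/-- The curvature form in terms of the jet of `H`. -/
noncomputable def chernJet (j : Jet2 (Fin r → Fin r → ℂ)) (a b : Fin r) : Alt 2 :=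
  form11 (of fun k l => -curvJet j (bas k) (bas l) a b)

theorem fderiv_entry {f : C3 → Fin r → Fin r → ℂ} (hf : DifferentiableAt ℝ f z) (a b : Fin r)
    (u : C3) : fderiv ℝ (fun y => f y a b) z u = fderiv ℝ f z u a b :=
  DFunLike.congr_fun (fderiv_clm_comp (((ContinuousLinearMap.proj b : (Fin r → ℂ) →L[ℝ] ℂ)).comp
    (ContinuousLinearMap.proj a : (Fin r → Fin r → ℂ) →L[ℝ] (Fin r → ℂ))) hf) u

theorem fderiv_fderiv_entry {f : C3 → Fin r → Fin r → ℂ} (hf : ContDiffAt ℝ 2 f z) (a b : Fin r)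
    (u v : C3) :
    fderiv ℝ (fderiv ℝ (fun y => f y a b)) z u v = fderiv ℝ (fderiv ℝ f) z u v a b := by
  have h := jet2_clm_comp (((ContinuousLinearMap.proj b : (Fin r → ℂ) →L[ℝ] ℂ)).comp
    (ContinuousLinearMap.proj a : (Fin r → Fin r → ℂ) →L[ℝ] (Fin r → ℂ))) hf
  have h2 := congrArg (fun j : Jet2 ℂ => j.2.2 u v) h
  exact h2

theorem IsMetricOn.contDiffAt (h : IsMetricOn U H) (hz : z ∈ U) : ContDiffAt ℝ 2 H z :=
  (h.smooth.contDiffAt (h.isOpen.mem_nhds hz)).of_le (by norm_cast)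

/-- Solve `mul_curvM` for the curvature and express the Wirtinger derivatives of the entries by the
jet. -/
theorem IsMetricOn.curvM_eq_curvJet (h : IsMetricOn U H) (hz : z ∈ U) (u v : C3) :
    curvM (fun y => of (H y)) z u v = curvJet (jet2 H z) u v := by
  refine eq_inv_mul_of_mul_eq (h.det_ne_zero z hz) ?_
  refine (mul_curvM h.isOpen hz h.entries h.det_ne_zero u v).trans ?_
  have hd := (h.contDiffAt hz).differentiableAt (by simp)
  have e1 : ∀ ε w, dM ε (fun y => of (H y)) z w = dJet ε (fderiv ℝ H z) w := by
    intro ε w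
    ext a b
    change dEps ε (fun y => H y a b) z w = _
    simp only [dEps, dJet, of_apply, fderiv_entry hd]
  have e2 : dM 1 (fun y => dM (-1) (fun y => of (H y)) y v) z u =
      ddJet (fderiv ℝ (fderiv ℝ H) z) u v := by
    ext a b
    refine (dEps_dEps (contDiffAt_two_of_contDiffOn h.isOpen hz h.entries a b) u v).trans ?_
    change (1 / 4 : ℂ) * (fderiv ℝ (fderiv ℝ (fun y => H y a b)) z u v
      + (-1) * Complex.I * fderiv ℝ (fderiv ℝ (fun y => H y a b)) z u (mulI v)
      + 1 * Complex.I * fderiv ℝ (fderiv ℝ (fun y => H y a b)) z (mulI u) v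
      - 1 * (-1) * fderiv ℝ (fderiv ℝ (fun y => H y a b)) z (mulI u) (mulI v)) = _
    simp only [ddJet, of_apply, fderiv_fderiv_entry (h.contDiffAt hz)]
    ring
  rw [e1, e1, e2]
  rfl

theorem IsMetricOn.chernCurv_eq_chernJet (h : IsMetricOn U H) (hz : z ∈ U) (a b : Fin r) :
    chernCurv H a b z = chernJet (jet2 H z) a b := by
  rw [(h.chernCurv_type hz a b).eq_form11, chernJet]
  congr 1
  ext k l
  rw [gram, of_apply, of_apply, h.coeff11_chernCurv hz, h.curvM_eq_curvJet hz]

variable {j : D → Jet2 (Fin r → Fin r → ℂ)}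

theorem contDiffOn_curvJet (hj : ContDiffOn ℝ ∞ j s) (hd : ∀ x ∈ s, (of (j x).1).det ≠ 0)
    (u v : C3) (a b : Fin r) : ContDiffOn ℝ ∞ (fun x => curvJet (j x) u v a b) s := by
  have h0 : ∀ a b, ContDiffOn ℝ ∞ (fun x => of (j x).1 a b) s := fun a b =>
    contDiffOn_pi.1 (contDiffOn_pi.1 hj.fst a) b
  have h1 : ∀ u a b, ContDiffOn ℝ ∞ (fun x => (j x).2.1 u a b) s := fun u a b =>
    contDiffOn_pi.1 (contDiffOn_pi.1 (hj.snd.fst.clm_apply contDiffOn_const) a) b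
  have h2 : ∀ u v a b, ContDiffOn ℝ ∞ (fun x => (j x).2.2 u v a b) s := fun u v a b =>
    contDiffOn_pi.1 (contDiffOn_pi.1
      ((hj.snd.snd.clm_apply contDiffOn_const).clm_apply contDiffOn_const) a) b
  have hi := contDiffOn_matrix_inv h0 hd
  have hdJ : ∀ ε u a b, ContDiffOn ℝ ∞ (fun x => dJet ε (j x).2.1 u a b) s := fun ε u a b =>
    contDiffOn_const.mul ((h1 _ _ _).add (contDiffOn_const.mul (h1 _ _ _)))
  have hddJ : ∀ u v a b, ContDiffOn ℝ ∞ (fun x => ddJet (j x).2.2 u v a b) s := fun u v a b =>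
    contDiffOn_const.mul ((((h2 _ _ _ _).sub (contDiffOn_const.mul (h2 _ _ _ _))).add
      (contDiffOn_const.mul (h2 _ _ _ _))).add (h2 _ _ _ _))
  refine contDiffOn_matrix_mul hi (fun a b => ?_) a b
  exact (hddJ u v a b).sub (contDiffOn_matrix_mul (contDiffOn_matrix_mul (hdJ _ _) hi) (hdJ _ _) a b)

theorem contDiffOn_chernJet (hj : ContDiffOn ℝ ∞ j s) (hd : ∀ x ∈ s, (of (j x).1).det ≠ 0)
    (a b : Fin r) : ContDiffOn ℝ ∞ (fun x => chernJet (j x) a b) s :=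
  contDiffOn_form11 fun _ _ => (contDiffOn_curvJet hj hd _ _ a b).neg

/-- `Tr (F ∧ F)` in terms of the jet of `H`. -/
noncomputable def trSqJet (j : Jet2 (Fin r → Fin r → ℂ)) : Alt 4 :=
  ∑ a, ∑ b, wedge (chernJet j a b) (chernJet j b a)

theorem contDiffOn_trSqJet (hj : ContDiffOn ℝ ∞ j s) (hd : ∀ x ∈ s, (of (j x).1).det ≠ 0) :
    ContDiffOn ℝ ∞ (fun x => trSqJet (j x)) s :=
  ContDiffOn.sum fun a _ => ContDiffOn.sum fun b _ =>
    ContDiffOn.wedge (contDiffOn_chernJet hj hd a b) (contDiffOn_chernJet hj hd b a)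

theorem IsMetricOn.trSq_eq_trSqJet (h : IsMetricOn U H) (hz : z ∈ U) :
    trSq (chernCurv H) z = trSqJet (jet2 H z) := by
  simp only [trSq, trSqJet, h.chernCurv_eq_chernJet hz]

theorem IsMetricOn.contract_eq_chernJet (h : IsMetricOn U H) (hz : z ∈ U) (w : Alt 2) :
    contract w (fun a b => chernCurv H a b z) = contract w (chernJet (jet2 H z)) := by
  simp only [h.chernCurv_eq_chernJet hz]

theorem contDiffOn_contract_chernJet {w : D → Alt 2} (hw : ContDiffOn ℝ ∞ w s)
    (hd' : ∀ x ∈ s, (gram (w x)).det ≠ 0) (hj : ContDiffOn ℝ ∞ j s)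
    (hd : ∀ x ∈ s, (of (j x).1).det ≠ 0) (a b : Fin r) :
    ContDiffOn ℝ ∞ (fun x => contract (w x) (chernJet (j x)) a b) s := by
  have hi := contDiffOn_matrix_inv (M := fun x => gram (w x)) (contDiffOn_coeff11 hw) hd'
  have hc := contDiffOn_coeff11 (contDiffOn_chernJet hj hd a b)
  simp only [contract, of_apply]
  exact ContDiffOn.sum fun l _ => ContDiffOn.sum fun k _ => (hi l k).mul (hc k l)

/-- The linear map `ω ↦ (ω_{k̄j})`. -/
noncomputable def gramL : Alt 2 →L[ℝ] (Fin 3 → Fin 3 → ℂ) :=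
  LinearMap.toContinuousLinearMap
    { toFun := fun a k j => coeff11 a k j
      map_add' := fun a b => by
        funext k j
        simp only [coeff11, ContinuousAlternatingMap.add_apply, Pi.add_apply]
        ring
      map_smul' := fun c a => by
        funext k j
        simp only [coeff11, ContinuousAlternatingMap.smul_apply, Pi.smul_apply, RingHom.id_apply,
          Complex.real_smul]
        ring }

theorem of_mapJet_gramL (j : Jet2 (Alt 2)) : of (mapJet gramL j).1 = gram j.1 := rfl

/-- `∂∂̄ω` in terms of the second derivatives of `ω`. -/
noncomputable def ddbarJet (B : C3 →L[ℝ] C3 →L[ℝ] Alt 2) : Alt 4 :=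
  delL 3 ((dbarL 2).comp B)

theorem contDiffOn_ddbarJet {B : D → C3 →L[ℝ] C3 →L[ℝ] Alt 2}
    (h : ∀ u v w, ContDiffOn ℝ ∞ (fun x => B x u v w) s) :
    ContDiffOn ℝ ∞ (fun x => ddbarJet (B x)) s := by
  have h1 : ∀ u w, ContDiffOn ℝ ∞ (fun x => dbarL 2 (B x u) w) s := fun u w => by
    simp only [dbarL_apply]
    exact ContDiffOn.sum fun i _ => (contDiffOn_const.mul
      ((h _ _ _).add (contDiffOn_const.mul (h _ _ _)))).const_smul _
  refine contDiffOn_alt fun w => ?_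
  simp only [ddbarJet, delL_apply, ContinuousLinearMap.comp_apply]
  exact ContDiffOn.sum fun i _ => (contDiffOn_const.mul
    ((h1 _ _).sub (contDiffOn_const.mul (h1 _ _)))).const_smul _

/-- `i∂∂̄ω + α (Tr (R ∧ R) - φ)` in terms of the jet of `ω`. -/
noncomputable def rhsJet (α : ℝ) (φ : Alt 4) (j : Jet2 (Alt 2)) : Alt 4 :=
  Complex.I • ddbarJet j.2.2 + α • (trSqJet (mapJet gramL j) - φ)

theorem contDiffOn_rhsJet (α : ℝ) {φ : D → Alt 4} {j : D → Jet2 (Alt 2)}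
    (hφ : ContDiffOn ℝ ∞ φ s) (hj : ContDiffOn ℝ ∞ j s)
    (hd : ∀ x ∈ s, (gram (j x).1).det ≠ 0) :
    ContDiffOn ℝ ∞ (fun x => rhsJet α (φ x) (j x)) s := by
  have h1 : ContDiffOn ℝ ∞ (fun x => ddbarJet (j x).2.2) s :=
    contDiffOn_ddbarJet fun u v w => ContDiffOn.alt_apply (contDiffOn_jet_apply hj u v) w
  have hm : ContDiffOn ℝ ∞ (fun x => mapJet gramL (j x)) s := contDiffOn_mapJet gramL hj
  have h2 : ContDiffOn ℝ ∞ (fun x => trSqJet (mapJet gramL (j x))) s := by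
    refine contDiffOn_trSqJet hm fun x hx => ?_
    rw [of_mapJet_gramL]
    exact hd x hx
  exact (h1.const_smul Complex.I).add ((h2.sub hφ).const_smul α)

variable {w : C3 → Alt 2}

theorem IsPosOn.contDiffAt_two (h : IsPosOn U w) (hz : z ∈ U) : ContDiffAt ℝ 2 w z :=
  (h.contDiffAt hz).of_le (by norm_cast)

theorem IsPosOn.trSq_eq_trSqJet (h : IsPosOn U w) (hz : z ∈ U) :
    trSq (metricCurv w) z = trSqJet (mapJet gramL (jet2 w z)) := by
  rw [← jet2_clm_comp gramL (h.contDiffAt_two hz)]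
  exact h.isMetricOn.trSq_eq_trSqJet hz

theorem IsPosOn.rhsX_eq_rhsJet (h : IsPosOn U w) (hz : z ∈ U) (α : ℝ) (Φ : C3 → Alt 4) :
    rhsX α Φ w z = rhsJet α (Φ z) (jet2 w z) := by
  rw [rhsX, rhsJet, del_dbar (h.contDiffAt_two hz), h.trSq_eq_trSqJet hz]
  rfl

theorem IsPosOn.rhsXE_eq_rhsJet (h : IsPosOn U w) (hz : z ∈ U) (α : ℝ) {U' : Set C3}
    (hH : IsMetricOn U' H) (hz' : z ∈ U') :
    rhsXE α w H z = rhsJet α (trSqJet (jet2 H z)) (jet2 w z) := by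
  rw [rhsXE, rhsJet, del_dbar (h.contDiffAt_two hz), h.trSq_eq_trSqJet hz, hH.trSq_eq_trSqJet hz']
  rfl

end CurvatureJets

/-! ### Positivity is an open condition -/

section Openness

open Matrix Filter

attribute [local irreducible] wedge

variable {P : Type*} [TopologicalSpace P] {p₀ : P}

/-- On the compact unit sphere strict positivity of the quadratic form persists under small
perturbation; homogeneity extends it to all vectors. The Hermitian condition is a separate
hypothesis, as it is not open. -/
theorem eventually_posDef {r : ℕ} {M : P → Matrix (Fin r) (Fin r) ℂ}
    (hc : ∀ a b, ContinuousAt (fun p => M p a b) p₀) (hh : ∀ᶠ p in 𝓝 p₀, (M p).IsHermitian)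
    (h0 : (M p₀).PosDef) : ∀ᶠ p in 𝓝 p₀, (M p).PosDef := by
  have hK : IsCompact (Metric.sphere (0 : Fin r → ℂ) 1) := isCompact_sphere _ _
  have h1 : ∀ᶠ p in 𝓝 p₀, ∀ ξ ∈ Metric.sphere (0 : Fin r → ℂ) 1, 0 < (star ξ ⬝ᵥ M p *ᵥ ξ).re := by
    refine hK.eventually_forall_of_forall_eventually fun ξ hξ => ?_
    have hc' : ContinuousAt (fun q : P × (Fin r → ℂ) => (star q.2 ⬝ᵥ M q.1 *ᵥ q.2).re) (p₀, ξ) := by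
      refine Complex.continuous_re.continuousAt.comp ?_
      have e : (fun q : P × (Fin r → ℂ) => star q.2 ⬝ᵥ M q.1 *ᵥ q.2) = fun q =>
          ∑ a, star (q.2 a) * ∑ b, M q.1 a b * q.2 b := rfl
      rw [e]
      have h2 : ∀ a, ContinuousAt (fun q : P × (Fin r → ℂ) => q.2 a) (p₀, ξ) := fun a =>
        ((continuous_apply a).comp continuous_snd).continuousAt
      have h3 : ∀ a b, ContinuousAt (fun q : P × (Fin r → ℂ) => M q.1 a b) (p₀, ξ) := fun a b =>
        ContinuousAt.comp (f := Prod.fst) (g := fun p => M p a b) (hc a b) continuousAt_fst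
      exact tendsto_finsetSum _ fun a _ => (h2 a).star.mul
        (tendsto_finsetSum _ fun b _ => (h3 a b).mul (h2 b))
    refine hc'.eventually (lt_mem_nhds ?_)
    refine (Complex.pos_iff.1 (h0.dotProduct_mulVec_pos fun h => ?_)).1
    have h' : ξ = 0 := h
    rw [h'] at hξ
    simp at hξ
  filter_upwards [h1, hh] with p hp hp'
  refine PosDef.of_dotProduct_mulVec_pos hp' fun x hx => ?_
  have hn : (‖x‖ : ℝ) ≠ 0 := norm_ne_zero_iff.2 hx
  -- The norm on `Fin r → ℂ` is the supremum norm; any norm serves, since only rescaling is used.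
  have hs : (‖x‖⁻¹ : ℝ) • x ∈ Metric.sphere (0 : Fin r → ℂ) 1 := by
    rw [mem_sphere_zero_iff_norm, norm_smul, norm_inv, norm_norm, inv_mul_cancel₀ hn]
  have h2 := hp _ hs
  have e : star ((‖x‖⁻¹ : ℝ) • x) ⬝ᵥ M p *ᵥ ((‖x‖⁻¹ : ℝ) • x) =
      ((‖x‖⁻¹ ^ 2 : ℝ) : ℂ) * (star x ⬝ᵥ M p *ᵥ x) := by
    rw [star_smul, mulVec_smul, dotProduct_smul, smul_dotProduct, star_trivial, smul_smul, ← sq,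
      Complex.real_smul]
  rw [e, Complex.re_ofReal_mul] at h2
  refine Complex.pos_iff.2 ⟨pos_of_mul_pos_right h2 (by positivity), ?_⟩
  exact (hp'.im_star_dotProduct_mulVec_self x).symm

theorem continuousAt_coeff11 {a : P → Alt 2} (h : ContinuousAt a p₀) (k j : Fin 3) :
    ContinuousAt (fun p => coeff11 (a p) k j) p₀ := by
  have hc : Continuous fun x : Alt 2 => coeff11 x k j :=
    (contDiffOn_univ.1 (contDiffOn_coeff11 (n := 0) contDiffOn_id k j)).continuous
  exact ContinuousAt.comp (g := fun x : Alt 2 => coeff11 x k j) hc.continuousAt h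

theorem eventually_isPos11 {a : P → Alt 2} (h : ContinuousAt a p₀)
    (ht : ∀ᶠ p in 𝓝 p₀, IsRealOfType 1 1 (a p)) (h0 : IsPos11 (a p₀)) :
    ∀ᶠ p in 𝓝 p₀, IsPos11 (a p) := by
  have h1 := eventually_posDef (M := fun p => gram (a p)) (fun k j => continuousAt_coeff11 h k j)
    (ht.mono fun p hp => hp.1.gram_isHermitian hp.2) (isPos11_iff.1 h0).2
  filter_upwards [h1, ht] with p hp hp'
  exact isPos11_iff.2 ⟨hp'.2, hp⟩

theorem eventually_isPos22 {b : P → Alt 4} (h : ContinuousAt b p₀)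
    (ht : ∀ᶠ p in 𝓝 p₀, IsRealOfType 2 2 (b p)) (h0 : IsPos22 (b p₀)) :
    ∀ᶠ p in 𝓝 p₀, IsPos22 (b p) := by
  have h1 := eventually_posDef (M := fun p => dual (b p)) (fun k j => ?_)
    (ht.mono fun p hp => hp.1.dual_isHermitian) (isPos22_iff.1 h0).2
  · filter_upwards [h1, ht] with p hp hp'
    exact isPos22_iff.2 ⟨hp', hp⟩
  · have hc : Continuous fun x : Alt 4 => dual x k j := by
      simp only [dual_apply]
      have h2 : ContDiffOn ℝ 0 (fun x : Alt 4 =>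
          (wedge x (form11 (Matrix.single j k 1)) : Alt 6)) Set.univ :=
        ContDiffOn.wedge (k := 4) (l := 2) contDiffOn_id contDiffOn_const
      exact (contDiffOn_univ.1 (ContDiffOn.alt_apply h2 realFrame)).continuous
    exact ContinuousAt.comp (g := fun x : Alt 4 => dual x k j) hc.continuousAt h

end Openness

/-! ### The derivative of the inverse of `ω ↦ ‖Ω‖_ω ω²` -/

section Velocity

open Matrix Filter

attribute [local irreducible] wedge

/-- Difference quotients lie in the subspace, which is closed by finite dimensionality. -/
theorem HasDerivAt.mem_submodule {A : Type*} [NormedAddCommGroup A] [NormedSpace ℝ A]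
    [FiniteDimensional ℝ A] (S : Submodule ℝ A) {f : ℝ → A} {f' : A} {t : ℝ}
    (hf : HasDerivAt f f' t) (h : ∀ s, f s ∈ S) : f' ∈ S := by
  refine S.closed_of_finiteDimensional.mem_of_tendsto (hasDerivAt_iff_tendsto_slope.1 hf)
    (Eventually.of_forall fun s => ?_)
  exact S.smul_mem _ (S.sub_mem (h s) (h t))

theorem contDiff_psiInv_one : ContDiff ℝ ∞ (psiInv 1) :=
  contDiffOn_univ.1 (contDiffOn_psiInv contDiffOn_const contDiffOn_id fun _ _ => one_ne_zero)

/-- The point enters only through the scalar `n⁻²`, so one derivative, that of `psiInv 1`, serves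
for all charts and points. -/
theorem psiInv_eq_smul (n : ℝ) (b : Alt 4) : psiInv n b = (n ^ 2)⁻¹ • psiInv 1 b := by
  ext v
  rw [eq_pair v, ContinuousAlternatingMap.smul_apply, psiInv, psiInv, form11_apply, form11_apply]
  simp only [smul_mulVec, dotProduct_smul, smul_eq_mul, Complex.real_smul]
  push_cast
  simp only [one_pow, inv_one, one_mul]
  ring

/-- The derivative of `psiInv n` at `b` in the direction `c`. -/
noncomputable def dPsiInv (n : ℝ) (b c : Alt 4) : Alt 2 := (n ^ 2)⁻¹ • fderiv ℝ (psiInv 1) b c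

theorem contDiffOn_dPsiInv {D : Type*} [NormedAddCommGroup D] [NormedSpace ℝ D] {s : Set D}
    {n : D → ℝ} {b c : D → Alt 4} (hn : ContDiffOn ℝ ∞ n s) (hn' : ∀ x ∈ s, n x ≠ 0)
    (hb : ContDiffOn ℝ ∞ b s) (hc : ContDiffOn ℝ ∞ c s) :
    ContDiffOn ℝ ∞ (fun x => dPsiInv (n x) (b x) (c x)) s := by
  have h1 : ContDiff ℝ ∞ (fderiv ℝ (psiInv 1)) := contDiff_psiInv_one.fderiv_right (by simp)
  exact ((hn.pow 2).inv fun x hx => pow_ne_zero 2 (hn' x hx)).smul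
    ((h1.comp_contDiffOn hb).clm_apply hc)

variable {n : ℝ} {b c : Alt 4}

theorem hasDerivWithinAt_psiInv {J : Set ℝ} {t : ℝ} {f : ℝ → Alt 4} (hf : HasDerivWithinAt f c J t) :
    HasDerivWithinAt (fun s => psiInv n (f s)) (dPsiInv n (f t) c) J t := by
  simp only [psiInv_eq_smul n]
  have h := (contDiff_psiInv_one.differentiable (by simp) (f t)).hasFDerivAt.comp_hasDerivWithinAt t
    hf
  exact h.const_smul ((n ^ 2)⁻¹ : ℝ)

theorem hasDerivAt_line {A : Type*} [NormedAddCommGroup A] [NormedSpace ℝ A] (a a' : A) (t : ℝ) :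
    HasDerivAt (fun s : ℝ => a + s • a') a' t := by
  simpa using ((hasDerivAt_id t).smul_const a').const_add a

theorem add_zero_smul {k : ℕ} (a a' : Alt k) : a + (0 : ℝ) • a' = a := by
  ext v
  simp

theorem hasDerivAt_psiInv_line : HasDerivAt (fun s : ℝ => psiInv n (b + s • c)) (dPsiInv n b c) 0 := by
  have h := hasDerivWithinAt_psiInv (n := n) (hasDerivAt_line b c 0).hasDerivWithinAt (J := Set.univ)
  rw [add_zero_smul] at h
  exact h.hasDerivAt univ_mem

theorem isRealOfType_psiInv (n : ℝ) (hb : IsReal b) : IsRealOfType 1 1 (psiInv n b) := by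
  refine ⟨form11_isReal ?_, form11_type _⟩
  have h1 : ((16 : ℂ)⁻¹ • dual b).IsHermitian := by
    have := hb.dual_isHermitian
    rw [IsHermitian, conjTranspose_smul, this.eq]
    simp
  rw [IsHermitian, conjTranspose_smul, h1.adjugate.eq]
  simp

/-- Along the line `b + s c` the inverse map takes values in the real forms of type (1,1), and so
does its velocity. -/
theorem isRealOfType_dPsiInv (n : ℝ) (hb : IsRealOfType 2 2 b) (hc : IsRealOfType 2 2 c) :
    IsRealOfType 1 1 (dPsiInv n b c) :=
  HasDerivAt.mem_submodule (realOfType 2 1 1) (hasDerivAt_psiInv_line (n := n) (b := b) (c := c)) fun s =>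
    isRealOfType_psiInv n ((realOfType 4 2 2).add_mem hb ((realOfType 4 2 2).smul_mem s hc)).1

/-- Positivity is open among real forms of type (2,2), so the line stays in the domain where `psiN`
and `psiInv` are mutually inverse. -/
theorem continuousAt_line (hb : IsPos22 b) (hc : IsRealOfType 2 2 c) :
    ∀ᶠ s : ℝ in 𝓝 0, IsPos22 (b + s • c) := by
  refine eventually_isPos22 (hasDerivAt_line b c 0).continuousAt (Eventually.of_forall fun s =>
    (realOfType 4 2 2).add_mem hb.1 ((realOfType 4 2 2).smul_mem s hc)) ?_
  rwa [add_zero_smul]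

/-- Naturality of the inverse follows from that of `psi`; the positivity of the pull-back comes
along because it is the image of a positive (1,1)-form. -/
theorem psiInv_pullC {O : Alt 3} (hO : IsOfType 3 0 O) (hO' : O bas ≠ 0) (hb : IsPos22 b)
    {T : C3 →L[ℂ] C3} (hT : (jac T).det ≠ 0) :
    psiInv ‖pullC T O bas‖ (pullC T b) = pullC T (psiInv ‖O bas‖ b) ∧ IsPos22 (pullC T b) := by
  have ha := isPos11_psiInv (norm_pos_iff.2 hO') hb
  have h1 := psi_pullC hO ha T hT
  rw [psi_eq_psiN, psi_eq_psiN, psiN_psiInv (norm_pos_iff.2 hO') hb] at h1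
  have hp : 0 < ‖pullC T O bas‖ := by
    rw [pullC_bas hO]
    exact norm_pos_iff.2 (mul_ne_zero hT hO')
  rw [← h1]
  exact ⟨psiInv_psiN hp (ha.pullC hT), isPos22_psiN hp (ha.pullC hT)⟩

/-- The pull-back as a linear map. -/
noncomputable def pullL {k : ℕ} (T : C3 →L[ℂ] C3) : Alt k →L[ℝ] Alt k :=
  ContinuousAlternatingMap.compContinuousLinearMapCLM (T.restrictScalars ℝ)

theorem pullC_add_smul {k : ℕ} (T : C3 →L[ℂ] C3) (a a' : Alt k) (s : ℝ) :
    pullC T (a + s • a') = pullC T a + s • pullC T a' := rfl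

/-- Both sides are velocities of the same curve: differentiate `psiInv_pullC` along `b + s c`. -/
theorem dPsiInv_pullC {O : Alt 3} (hO : IsOfType 3 0 O) (hO' : O bas ≠ 0) (hb : IsPos22 b)
    (hc : IsRealOfType 2 2 c) {T : C3 →L[ℂ] C3} (hT : (jac T).det ≠ 0) :
    dPsiInv ‖pullC T O bas‖ (pullC T b) (pullC T c) = pullC T (dPsiInv ‖O bas‖ b c) := by
  have h1 := hasDerivAt_psiInv_line (n := ‖pullC T O bas‖) (b := pullC T b) (c := pullC T c)
  have h2 := (pullL T).hasFDerivAt.comp_hasDerivAt (0 : ℝ)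
    (hasDerivAt_psiInv_line (n := ‖O bas‖) (b := b) (c := c))
  refine h1.unique (h2.congr_of_eventuallyEq ?_)
  filter_upwards [continuousAt_line hb hc] with s hs
  rw [← pullC_add_smul, (psiInv_pullC hO hO' hs hT).1]
  rfl

theorem hasDerivWithinAt_psiN {J : Set ℝ} {t : ℝ} {f : ℝ → Alt 2} {f' : Alt 2}
    (hf : HasDerivWithinAt f f' J t) (hp : IsPos11 (f t)) :
    HasDerivWithinAt (fun s => psiN n (f s)) (fderiv ℝ (psiN n) (f t) f') J t := by
  have ho : IsOpen {a : Alt 2 | 0 < (gram a).det.re} := by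
    refine isOpen_lt continuous_const ?_
    exact (Complex.continuous_re.comp (contDiffOn_univ.1 (contDiffOn_det (n := 0)
      (f := fun a : Alt 2 => gram a) fun i j => contDiffOn_coeff11 contDiffOn_id i j)).continuous)
  have h1 : ContDiffOn ℝ ∞ (psiN n) {a : Alt 2 | 0 < (gram a).det.re} :=
    contDiffOn_psiN contDiffOn_const contDiffOn_id fun x hx => hx
  have hm : f t ∈ {a : Alt 2 | 0 < (gram a).det.re} :=
    (Complex.pos_iff.1 (isPos11_iff.1 hp).2.det_pos).1
  have h2 := ((h1.contDiffAt (ho.mem_nhds hm)).differentiableAt (by simp)).hasFDerivAt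
  exact h2.comp_hasDerivWithinAt t hf

/-- Differentiate `psiN (psiInv (b + s c)) = b + s c` at `s = 0`. -/
theorem fderiv_psiN_dPsiInv (hn : 0 < n) (hb : IsPos22 b) (hc : IsRealOfType 2 2 c) :
    fderiv ℝ (psiN n) (psiInv n b) (dPsiInv n b c) = c := by
  have h1 := hasDerivAt_psiInv_line (n := n) (b := b) (c := c)
  have hp : IsPos11 (psiInv n (b + (0 : ℝ) • c)) := by
    rw [add_zero_smul]
    exact isPos11_psiInv hn hb
  have h2 := (hasDerivWithinAt_psiN (n := n) (h1.hasDerivWithinAt (s := Set.univ)) hp).hasDerivAt univ_mem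
  rw [add_zero_smul] at h2
  refine h2.unique ((hasDerivAt_line b c 0).congr_of_eventuallyEq ?_)
  filter_upwards [continuousAt_line hb hc] with s hs
  exact psiN_psiInv hn hs

/-- The velocity of `‖Ω‖_ω ω²` determines the velocity of `ω`. -/
theorem derivWithin_psiN_eq_iff (hn : 0 < n) {J : Set ℝ} {t : ℝ} {f : ℝ → Alt 2}
    (hJ : UniqueDiffWithinAt ℝ J t) (ht : t ∈ J) (hf : DifferentiableWithinAt ℝ f J t)
    (hp : ∀ s ∈ J, IsPos11 (f s)) (hc : IsRealOfType 2 2 c) :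
    derivWithin (fun s => psiN n (f s)) J t = c ↔
      derivWithin f J t = dPsiInv n (psiN n (f t)) c := by
  have h1 := hasDerivWithinAt_psiN (n := n) hf.hasDerivWithinAt (hp t ht)
  constructor
  · intro h
    have h2 : HasDerivWithinAt (fun s => psiN n (f s)) c J t := by
      rw [← h]
      exact h1.differentiableWithinAt.hasDerivWithinAt
    -- On `J` the curve is recovered from its image by `psiInv`, so the chain rule gives its
    -- velocity. The converse uses that the derivatives are inverse to each other on real forms of
    -- type (2,2).
    have h3 := hasDerivWithinAt_psiInv (n := n) h2
    refine (h3.congr (fun s hs => (psiInv_psiN hn (hp s hs)).symm) ?_).derivWithin hJ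
    exact (psiInv_psiN hn (hp t ht)).symm
  · intro h
    rw [h1.derivWithin hJ, h]
    have h2 := fderiv_psiN_dPsiInv hn (isPos22_psiN hn (hp t ht)) hc
    rwa [psiInv_psiN hn (hp t ht)] at h2

end Velocity

/-! ### Metrics and positive `(2,2)`-forms -/

section MetricsAndForms

open Matrix Filter

set_option linter.unusedSectionVars false

attribute [local irreducible] wedge

variable {X : Type*} [TopologicalSpace X] [ChartedSpace C3 X]

theorem RealForm.ext' {k p q : ℕ} {a b : RealForm X k p q} (h : a.form = b.form) : a = b := by
  cases a; cases b; cases h; rfl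

theorem Metric.ext' {a b : Metric X} (h : a.form = b.form) : a = b := by
  cases a; cases b; cases h; rfl

theorem PosForm.ext' {a b : PosForm X} (h : a.form = b.form) : a = b := by
  cases a; cases b; cases h; rfl

variable [IsManifold 𝓘(ℂ, C3) ω X] {O : DForm X 3} (hO : IsHolomorphicVolume O)
  {e e' : OpenPartialHomeomorph X C3} {z : C3}

include hO

theorem isPos22_Psi {w : DForm X 2} (hw : ∀ x, IsPos11 (DForm.at w x)) (x : X) :
    IsPos22 (DForm.at (Psi O w) x) :=
  isPos22_psiN (norm_pos_iff.2 (at_bas_ne_zero hO x)) (hw x)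

/-- The positive `(2,2)`-form `‖Ω‖_ω ω²` of a metric. -/
noncomputable def posFormOf (w : Metric X) : PosForm X where
  form := Psi O w.form
  smooth := fun e he => by
    refine ContDiffOn.congr (contDiffOn_psiN (contDiffOn_volN hO he) (w.smooth e he) ?_)
      fun z hz => rep_Psi hO he hz w.pos
    intro z hz
    exact (Complex.pos_iff.1 (isPos11_iff.1 (rep_isPos11 he hz w.pos)).2.det_pos).1
  pos := isPos22_Psi hO w.pos

omit hO in
/-- The metric with `‖Ω‖_ω ω² = Ψ` as a form. -/
noncomputable def metricFormOf (O : DForm X 3) (P : DForm X 4) : DForm X 2 :=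
  fun x => psiInv ‖DForm.at O x bas‖ (DForm.at P x)

theorem rep_metricFormOf (he : e ∈ atlas C3 X) (hz : z ∈ e.target) {P : DForm X 4}
    (h : ∀ x, IsPos22 (DForm.at P x)) :
    rep e (metricFormOf O P) z = psiInv (volN O e z) (rep e P z) := by
  rw [volN, rep_eq he hz, rep_eq he hz, rep_eq he hz]
  exact (psiInv_pullC (hO.1 _) (at_bas_ne_zero hO _) (h _)
    (det_jac_trans_ne_zero he (chart_mem_atlas C3 _) hz (mem_chart_source C3 _))).1.symm

/-- The metric with `‖Ω‖_ω ω² = Ψ`. -/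
noncomputable def metricOf (P : PosForm X) : Metric X where
  form := metricFormOf O P.form
  smooth := fun e he => ContDiffOn.congr
    (contDiffOn_psiInv (contDiffOn_volN hO he) (P.smooth e he) fun _ hz => (volN_pos hO he hz).ne')
    fun _ hz => rep_metricFormOf hO he hz P.pos
  pos := fun x => isPos11_psiInv (norm_pos_iff.2 (at_bas_ne_zero hO x)) (P.pos x)

theorem Psi_metricOf (P : PosForm X) : Psi O (metricOf hO P).form = P.form :=
  funext fun x => psiN_psiInv (norm_pos_iff.2 (at_bas_ne_zero hO x)) (P.pos x)

theorem eq_metricOf {P : PosForm X} {w : Metric X} (h : P.form = Psi O w.form) :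
    w = metricOf hO P := by
  refine Metric.ext' (funext fun x => ?_)
  have h1 : DForm.at P.form x = psiN ‖DForm.at O x bas‖ (DForm.at w.form x) := congrFun h x
  have h2 := psiInv_psiN (norm_pos_iff.2 (at_bas_ne_zero hO x)) (w.pos x)
  rw [← h1] at h2
  exact h2.symm

/-- Metrics and positive `(2,2)`-forms determine each other. -/
theorem metric_posForm_bijection :
    (∀ w : Metric X, ∃! P : PosForm X, P.form = Psi O w.form) ∧
      (∀ P : PosForm X, ∃! w : Metric X, P.form = Psi O w.form) ∧
      (∀ e ∈ atlas C3 X, ∃ L : C3 × Alt 4 → Alt 2,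
        ContDiffOn ℝ ∞ L {p | p.1 ∈ e.target ∧ IsPos22 p.2} ∧
        ∀ w : Metric X, ∀ z ∈ e.target, rep e w.form z = L (z, rep e (Psi O w.form) z)) := by
  refine ⟨fun w => ⟨posFormOf hO w, rfl, fun P hP => PosForm.ext' hP⟩,
    fun P => ⟨metricOf hO P, (Psi_metricOf hO P).symm, fun w hw => eq_metricOf hO hw⟩,
    fun e he => ⟨fun p => psiInv (volN O e p.1) p.2, ?_, fun w z hz => ?_⟩⟩
  · exact contDiffOn_psiInv ((contDiffOn_volN hO he).comp contDiffOn_fst fun p hp => hp.1)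
      contDiffOn_snd fun p hp => (volN_pos hO he hp.1).ne'
  · rw [rep_Psi hO he hz w.pos]
    exact (psiInv_psiN (volN_pos hO he hz) (rep_isPos11 he hz w.pos)).symm

omit hO in
/-- The velocity of `ω` for a given velocity of `‖Ω‖_ω ω²`, as a form. -/
noncomputable def velocityFormOf (O : DForm X 3) (w : DForm X 2) (R : DForm X 4) : DForm X 2 :=
  fun x => dPsiInv ‖DForm.at O x bas‖ (DForm.at (Psi O w) x) (DForm.at R x)

theorem rep_velocityFormOf (he : e ∈ atlas C3 X) (hz : z ∈ e.target) {w : DForm X 2}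
    {R : DForm X 4} (hw : ∀ x, IsPos11 (DForm.at w x))
    (hR : ∀ x, IsRealOfType 2 2 (DForm.at R x)) :
    rep e (velocityFormOf O w R) z =
      dPsiInv (volN O e z) (psiN (volN O e z) (rep e w z)) (rep e R z) := by
  rw [← rep_Psi hO he hz hw, volN, rep_eq he hz, rep_eq he hz, rep_eq he hz, rep_eq he hz]
  exact (dPsiInv_pullC (hO.1 _) (at_bas_ne_zero hO _) (isPos22_Psi hO hw _) (hR _)
    (det_jac_trans_ne_zero he (chart_mem_atlas C3 _) hz (mem_chart_source C3 _))).symm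

/-- The velocity of `ω` for a given velocity of `‖Ω‖_ω ω²`. -/
noncomputable def velocityOf (w : Metric X) (R : RealForm X 4 2 2) : RealForm X 2 1 1 where
  form := velocityFormOf O w.form R.form
  smooth := fun e he => by
    have h := contDiffOn_dPsiInv (contDiffOn_volN hO he) (fun _ hz => (volN_pos hO he hz).ne')
      ((posFormOf hO w).smooth e he) (R.smooth e he)
    refine h.congr fun z hz => ?_
    rw [rep_velocityFormOf hO he hz w.pos R.type, ← rep_Psi hO he hz w.pos]
    rfl
  type := fun x => isRealOfType_dPsiInv _ (isPos22_Psi hO w.pos x).1 (R.type x)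

theorem rep_velocityOf (w : Metric X) (R : RealForm X 4 2 2) (he : e ∈ atlas C3 X)
    (hz : z ∈ e.target) :
    rep e (velocityOf hO w R).form z =
      dPsiInv (volN O e z) (psiN (volN O e z) (rep e w.form z)) (rep e R.form z) :=
  rep_velocityFormOf hO he hz w.pos R.type

end MetricsAndForms

/-! ### The right-hand sides as forms on the manifold -/

section RightHandSides

open Matrix Filter

set_option linter.unusedSectionVars false

attribute [local irreducible] wedge

variable {X : Type*} [TopologicalSpace X] [ChartedSpace C3 X] [IsManifold 𝓘(ℂ, C3) ω X]
  {e e' : OpenPartialHomeomorph X C3} {z : C3}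

theorem isCompatible_rhsX (α : ℝ) (Φ : DForm X 4) (w : Metric X) :
    IsCompatible fun e => rhsX α (rep e Φ) (rep e w.form) := by
  intro e he e' he' z hz hz'
  exact (w.isPullback he he' hz hz').rhsX_eq (w.isPosOn he) hz (w.isPosOn he')
    (trans_mem_target hz') α (rep_trans he he' hz hz' Φ)

theorem at_glue_type {k p q : ℕ} {a : OpenPartialHomeomorph X C3 → C3 → Alt k}
    (h : ∀ e ∈ atlas C3 X, ∀ z ∈ e.target, IsRealOfType p q (a e z)) (x : X) :
    IsRealOfType p q (DForm.at (glue a) x) :=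
  h _ (chart_mem_atlas C3 x) _ ((chartAt C3 x).map_source (mem_chart_source C3 x))

/-- The right-hand side of the flow on `X`. -/
noncomputable def rhsFormX (α : ℝ) (Φ : RealForm X 4 2 2) (w : Metric X) : RealForm X 4 2 2 where
  form := glue fun e => rhsX α (rep e Φ.form) (rep e w.form)
  smooth := fun e he => ((w.isPosOn he).contDiffOn_rhsX α (Φ.smooth e he)).congr fun z hz =>
    rep_glue (isCompatible_rhsX α Φ.form w) he hz
  type := at_glue_type fun e he z hz =>
    (w.isPosOn he).isRealOfType_rhsX hz α (rep_isRealOfType he hz Φ.type)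

theorem rep_rhsFormX (α : ℝ) (Φ : RealForm X 4 2 2) (w : Metric X) (he : e ∈ atlas C3 X)
    (hz : z ∈ e.target) :
    rep e (rhsFormX α Φ w).form z = rhsX α (rep e Φ.form) (rep e w.form) z :=
  rep_glue (isCompatible_rhsX α Φ.form w) he hz

variable {r : ℕ} {V : X → Type*} [∀ x, AddCommGroup (V x)] [∀ x, Module ℂ (V x)]
  [∀ x, TopologicalSpace (V x)] [TopologicalSpace (Bundle.TotalSpace (Fin r → ℂ) V)]
  [FiberBundle (Fin r → ℂ) V] [VectorBundle ℂ (Fin r → ℂ) V]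
  [ContMDiffVectorBundle ω (Fin r → ℂ) V 𝓘(ℂ, C3)]
  {τ τ' : Bundle.Trivialization (Fin r → ℂ) (π (Fin r → ℂ) V)}

theorem mem_dom_trans (hz' : e.symm z ∈ e'.source) (hx' : e.symm z ∈ τ'.baseSet) :
    trans e e' z ∈ dom e' τ' :=
  ⟨trans_mem_target hz', by rwa [Set.mem_preimage, symm_trans hz']⟩

theorem rhsXE_trans [MemTrivializationAtlas τ] [MemTrivializationAtlas τ'] (α : ℝ) (w : Metric X)
    (H : HermMetric r V) (he : e ∈ atlas C3 X) (he' : e' ∈ atlas C3 X) (hz : z ∈ dom e τ)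
    (hz' : e.symm z ∈ e'.source) (hx' : e.symm z ∈ τ'.baseSet) :
    rhsXE α (rep e w.form) (hrep e τ H.form) z = pullC (fderiv ℂ (trans e e') z)
      (rhsXE α (rep e' w.form) (hrep e' τ' H.form) (trans e e' z)) :=
  (w.isPullback he he' hz.1 hz').rhsXE_eq (w.isPosOn he) hz.1 (w.isPosOn he')
    (trans_mem_target hz') α (isGauge_hrep H.form he he' hz hz' hx') (H.isMetricOn he) hz
    (H.isMetricOn he') (mem_dom_trans hz' hx')

/-- The local expressions of the right-hand side of the flow of pairs. -/
noncomputable def rhsLocalXE (α : ℝ) (w : Metric X) (H : HermMetric r V)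
    (e : OpenPartialHomeomorph X C3) (z : C3) : Alt 4 :=
  rhsXE α (rep e w.form) (hrep e (trivializationAt (Fin r → ℂ) V (e.symm z)) H.form) z

/-- Independence of the trivialization: the transformation law with the chart unchanged has the
identity as coordinate change. -/
theorem rhsLocalXE_eq [MemTrivializationAtlas τ] (α : ℝ) (w : Metric X) (H : HermMetric r V)
    (he : e ∈ atlas C3 X) (hz : z ∈ dom e τ) :
    rhsLocalXE α w H e z = rhsXE α (rep e w.form) (hrep e τ H.form) z := by
  have h := rhsXE_trans (τ := trivializationAt (Fin r → ℂ) V (e.symm z)) (τ' := τ) α w H he he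
    (mem_dom_trivializationAt hz.1) (e.map_target hz.1) hz.2
  rw [rhsLocalXE, h, fderiv_trans_self hz.1, pullC_id, (trans_self hz.1).self_of_nhds]
  rfl

theorem isCompatible_rhsLocalXE (α : ℝ) (w : Metric X) (H : HermMetric r V) :
    IsCompatible (rhsLocalXE α w H) := by
  intro e he e' he' z hz hz'
  have hx := mem_baseSet_trivializationAt (Fin r → ℂ) V (e.symm z)
  rw [rhsLocalXE_eq (τ := trivializationAt (Fin r → ℂ) V (e.symm z)) α w H he'
    (mem_dom_trans hz' hx)]
  exact rhsXE_trans α w H he he' (mem_dom_trivializationAt hz) hz' hx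

/-- The right-hand side of the first equation of the flow of pairs. -/
noncomputable def rhsFormXE (α : ℝ) (w : Metric X) (H : HermMetric r V) : RealForm X 4 2 2 where
  form := glue (rhsLocalXE α w H)
  smooth := fun e he => by
    refine ContDiffOn.congr (f := rhsLocalXE α w H e) (fun z hz => ?_) fun z hz =>
      rep_glue (isCompatible_rhsLocalXE α w H) he hz
    -- The trivialization in `rhsLocalXE` varies with the point. Near `z` it can be replaced by the
    -- one at `z`, in which the expression is smooth.
    set τ := trivializationAt (Fin r → ℂ) V (e.symm z)
    have hd : z ∈ dom e τ := mem_dom_trivializationAt hz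
    have ho : IsOpen (dom e τ) := isOpen_dom
    have h1 := ((w.isPosOn he).contDiffOn_rhsXE α (H.isMetricOn (τ := τ) he)).contDiffAt
      ((e.open_target.inter ho).mem_nhds ⟨hz, hd⟩)
    refine (h1.congr_of_eventuallyEq ?_).contDiffWithinAt
    filter_upwards [ho.mem_nhds hd] with y hy
    exact rhsLocalXE_eq α w H he hy
  type := at_glue_type fun e he z hz =>
    (w.isPosOn he).isRealOfType_rhsXE hz α
      (H.isMetricOn (τ := trivializationAt (Fin r → ℂ) V (e.symm z)) he)
      (mem_dom_trivializationAt hz)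

theorem rep_rhsFormXE [MemTrivializationAtlas τ] (α : ℝ) (w : Metric X) (H : HermMetric r V)
    (he : e ∈ atlas C3 X) (hz : z ∈ dom e τ) :
    rep e (rhsFormXE α w H).form z = rhsXE α (rep e w.form) (hrep e τ H.form) z :=
  (rep_glue (isCompatible_rhsLocalXE α w H) he hz.1).trans (rhsLocalXE_eq α w H he hz)

/-- The local expressions `-H ΛF` of the velocity of the metric on the bundle. -/
noncomputable def heatLocal (w : Metric X) (H : HermMetric r V) (e : OpenPartialHomeomorph X C3)
    (τ : Bundle.Trivialization (Fin r → ℂ) (π (Fin r → ℂ) V)) (z : C3) :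
    Matrix (Fin r) (Fin r) ℂ :=
  -(of (hrep e τ H.form z) *
    contract (rep e w.form z) (fun a b => chernCurv (hrep e τ H.form) a b z))

/-- `H` becomes `g* H g` and `ΛF` becomes `g⁻¹ ΛF g`, so the product transforms like a sesquilinear
form. -/
theorem isSesqCompatible_heatLocal (w : Metric X) (H : HermMetric r V) :
    IsSesqCompatible (heatLocal w H) := by
  intro e he e' he' τ τ' _ _ z hz hz' hx'
  have hg := isGauge_hrep (τ := τ) (τ' := τ') H.form he he' hz hz' hx'
  have h1 := hg.contract_eq (H.isMetricOn he') (mem_dom_trans hz' hx') (H.isMetricOn he) hz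
    (rep_isOfType he' (trans_mem_target hz') fun x => (w.pos x).1.2)
    (det_jac_trans_ne_zero he he' hz.1 hz')
  have hd : (gaugeOf e τ τ' z).det ≠ 0 := det_frameChange_ne_zero hz.2 hx'
  have hgg : gaugeOf e τ τ' z * (gaugeOf e τ τ' z)⁻¹ = 1 :=
    mul_nonsing_inv _ (isUnit_iff_ne_zero.2 hd)
  rw [heatLocal, heatLocal, rep_trans he he' hz.1 hz' w.form, h1,
    hrep_trans (τ := τ) (τ' := τ') H.form hz hz' hx', Matrix.mul_neg, Matrix.neg_mul]
  congr 1
  simp only [Matrix.mul_assoc]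
  rw [← Matrix.mul_assoc (gaugeOf e τ τ' z), hgg, Matrix.one_mul]

/-- The velocity `-H ΛF` of the metric on the bundle. -/
noncomputable def heatForm (w : Metric X) (H : HermMetric r V) : HermForm r V where
  form := sesqGlue (heatLocal w H)
  smooth := fun e he τ hτ => by
    have hH := H.isMetricOn (τ := τ) he
    have hw : ContDiffOn ℝ ∞ (rep e w.form) (dom e τ) := (w.smooth e he).mono fun _ h => h.1
    have hi := contDiffOn_matrix_inv (M := fun z => gram (rep e w.form z)) (contDiffOn_coeff11 hw)
      fun z hz => ((isPos11_iff.1 (rep_isPos11 he hz.1 w.pos)).2.det_pos).ne'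
    have hc : ∀ a b, ContDiffOn ℝ ∞ (fun z => contract (rep e w.form z)
        (fun a b => chernCurv (hrep e τ H.form) a b z) a b) (dom e τ) := fun a b => by
      simp only [contract, of_apply]
      exact ContDiffOn.sum fun l _ => ContDiffOn.sum fun k _ => (hi l k).mul
        (contDiffOn_coeff11 (hH.contDiffOn_chernCurv a b) k l)
    refine contDiffOn_pi.2 fun a => contDiffOn_pi.2 fun b => ?_
    refine (contDiffOn_matrix_mul hH.entries hc a b).neg.congr fun z hz => ?_
    exact congrFun (congrFun (hrep_sesqGlue (isSesqCompatible_heatLocal w H) he hz) a) b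
  herm := by
    refine herm_of_hrep (r := r) fun x => ?_
    have hx := mem_dom_chartAt (r := r) (V := V) x
    rw [hrep_sesqGlue (isSesqCompatible_heatLocal w H) (chart_mem_atlas C3 x) hx, heatLocal]
    have h1 := (H.isMetricOn (τ := trivializationAt (Fin r → ℂ) V x)
      (chart_mem_atlas C3 x)).mul_contract_hermitian hx
      (w := rep (chartAt C3 x) w.form (chartAt C3 x x))
      (isPos11_iff.1 (rep_isPos11 (chart_mem_atlas C3 x) hx.1 w.pos)).2.isHermitian
    rw [IsHermitian, conjTranspose_neg, h1]

theorem hrep_heatForm [MemTrivializationAtlas τ] (w : Metric X) (H : HermMetric r V)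
    (he : e ∈ atlas C3 X) (hz : z ∈ dom e τ) :
    of (hrep e τ (heatForm w H).form z) = heatLocal w H e τ z :=
  hrep_sesqGlue (isSesqCompatible_heatLocal w H) he hz

end RightHandSides

/-! ### Time intervals -/

section Time

theorem convex_timeInterval (T : EReal) : Convex ℝ (timeInterval T) := by
  refine Set.OrdConnected.convex ⟨fun x hx y hy z hz => ?_⟩
  exact ⟨hx.1.trans hz.1, lt_of_le_of_lt (EReal.coe_le_coe_iff.2 hz.2) hy.2⟩

theorem zero_mem_timeInterval {T : EReal} {t : ℝ} (ht : t ∈ timeInterval T) :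
    (0 : ℝ) ∈ timeInterval T :=
  ⟨le_rfl, lt_of_le_of_lt (EReal.coe_le_coe_iff.2 ht.1) ht.2⟩

theorem uniqueDiffOn_timeInterval {T : EReal} {t : ℝ} (ht : t ∈ timeInterval T) :
    UniqueDiffOn ℝ (timeInterval T) ∧ ∀ s ∈ timeInterval T,
      s ∈ closure (interior (timeInterval T)) := by
  -- A real `s` with `t < s < T`, also when `T = ∞`, gives an open interval inside `[0, T)`. A
  -- convex set with interior points has unique derivatives, at the endpoint `0` as well.
  obtain ⟨s, h1, h2⟩ := EReal.lt_iff_exists_real_btwn.1 ht.2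
  have hi : (interior (timeInterval T)).Nonempty := by
    refine ⟨(t + s) / 2, mem_interior.2 ⟨Set.Ioo t s, fun x hx => ?_, isOpen_Ioo, ?_⟩⟩
    · exact ⟨ht.1.trans hx.1.le, (EReal.coe_lt_coe_iff.2 hx.2).trans h2⟩
    · have := EReal.coe_lt_coe_iff.1 h1
      constructor <;> linarith
  exact ⟨uniqueDiffOn_convex (convex_timeInterval T) hi, fun s hs => by
    rw [(convex_timeInterval T).closure_interior_eq_closure_of_nonempty_interior hi]
    exact subset_closure hs⟩

theorem mem_timeInterval_coe {T t : ℝ} : t ∈ timeInterval (T : EReal) ↔ 0 ≤ t ∧ t < T := by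
  simp [timeInterval]

end Time

/-! ### The vector fields of the flows, and their locality -/

section Flows

open Matrix Filter

set_option linter.unusedSectionVars false

attribute [local irreducible] wedge

variable {X : Type*} [TopologicalSpace X] [ChartedSpace C3 X] [IsManifold 𝓘(ℂ, C3) ω X]
  {O : DForm X 3} {e e' : OpenPartialHomeomorph X C3} {z : C3} {J : Set ℝ} {t : ℝ}

theorem IsSmoothCurve.differentiableWithinAt {k : ℕ} {a : ℝ → DForm X k} (h : IsSmoothCurve J a)
    (he : e ∈ atlas C3 X) (hz : z ∈ e.target) (ht : t ∈ J) :
    DifferentiableWithinAt ℝ (fun s => rep e (a s) z) J t := by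
  have h1 := (h e he).comp (contDiffOn_id.prodMk contDiffOn_const : ContDiffOn ℝ ∞
    (fun s : ℝ => (s, z)) J) fun s hs => ⟨hs, hz⟩
  exact (h1 t ht).differentiableWithinAt (by simp)

/-- The velocity of `‖Ω‖_ω ω²` is prescribed exactly if the velocity of `ω` is. -/
theorem derivWithin_Psi_eq_iff (hO : IsHolomorphicVolume O) {w : ℝ → Metric X}
    (hw : IsSmoothCurve J fun s => (w s).form) (hJ : UniqueDiffOn ℝ J) (ht : t ∈ J)
    (R : RealForm X 4 2 2) (he : e ∈ atlas C3 X) (hz : z ∈ e.target) :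
    derivWithin (fun s => rep e (Psi O (w s).form) z) J t = rep e R.form z ↔
      derivWithin (fun s => rep e (w s).form z) J t = rep e (velocityOf hO (w t) R).form z := by
  rw [rep_velocityOf hO (w t) R he hz]
  simp only [fun s => rep_Psi hO he hz (w s).pos]
  exact derivWithin_psiN_eq_iff (volN_pos hO he hz) (hJ t ht) ht (hw.differentiableWithinAt he hz ht)
    (fun s _ => rep_isPos11 he hz (w s).pos) (rep_isRealOfType he hz R.type)

/-- The equation prescribes the velocity of `Ψ`; the field is the image of this velocity under the
derivative of `Ψ ↦ ω`, and `derivWithin_Psi_eq_iff` gives both implications. -/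
theorem isFlowFieldX (hO : IsHolomorphicVolume O) (α : ℝ) (Φ : RealForm X 4 2 2) :
    IsFlowFieldX O α Φ.form fun w => velocityOf hO w (rhsFormX α Φ w) := by
  intro T w hw t ht
  have hJ := (uniqueDiffOn_timeInterval ht).1
  refine forall₂_congr fun e he => forall₂_congr fun z hz => ?_
  rw [← rep_rhsFormX α Φ (w t) he hz]
  exact derivWithin_Psi_eq_iff hO hw hJ ht _ he hz

theorem isFormFlowFieldX (hO : IsHolomorphicVolume O) (α : ℝ) (Φ : RealForm X 4 2 2) :
    IsFormFlowFieldX O α Φ.form fun P => rhsFormX α Φ (metricOf hO P) := by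
  intro T w P hw hP t ht
  refine forall₂_congr fun e he => forall₂_congr fun z hz => ?_
  rw [rep_rhsFormX α Φ _ he hz, ← eq_metricOf hO (hP t ht),
    derivWithin_congr (f := fun s => rep e (P s).form z)
      (f₁ := fun s => rep e (Psi O (w s).form) z)
      (fun s hs => by beta_reduce; rw [hP s hs]) (by rw [hP t ht])]

variable {r : ℕ} {V : X → Type*} [∀ x, AddCommGroup (V x)] [∀ x, Module ℂ (V x)]
  [∀ x, TopologicalSpace (V x)] [TopologicalSpace (Bundle.TotalSpace (Fin r → ℂ) V)]
  [FiberBundle (Fin r → ℂ) V] [VectorBundle ℂ (Fin r → ℂ) V]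
  [ContMDiffVectorBundle ω (Fin r → ℂ) V 𝓘(ℂ, C3)]
  {τ : Bundle.Trivialization (Fin r → ℂ) (π (Fin r → ℂ) V)}

theorem inv_mul_eq_neg_iff {M D C : Matrix (Fin r) (Fin r) ℂ} (hM : M.det ≠ 0) :
    M⁻¹ * D = -C ↔ D = -(M * C) := by
  have hu := isUnit_iff_ne_zero.2 hM
  constructor
  · intro h
    rw [← Matrix.mul_neg, ← h, ← Matrix.mul_assoc, mul_nonsing_inv _ hu, Matrix.one_mul]
  · intro h
    rw [h, Matrix.mul_neg, ← Matrix.mul_assoc, nonsing_inv_mul _ hu, Matrix.one_mul]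

/-- The two equations of the flow of pairs prescribe the velocities of `‖Ω‖_ω ω²` and of `H`. -/
theorem flowEqXE_iff (α : ℝ) {w : ℝ → Metric X} {H : ℝ → HermMetric r V} :
    FlowEqXE r O α J (fun s => (w s).form) (fun s => (H s).form) t ↔
      (∀ e ∈ atlas C3 X, ∀ z ∈ e.target, derivWithin (fun s => rep e (Psi O (w s).form) z) J t =
        rep e (rhsFormXE α (w t) (H t)).form z) ∧
      HasSesqVelocity r J (fun s => (H s).form) t (heatForm (w t) (H t)).form := by
  have h2 : ∀ e ∈ atlas C3 X, ∀ τ : Bundle.Trivialization (Fin r → ℂ) (π (Fin r → ℂ) V),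
      MemTrivializationAtlas τ → ∀ z ∈ dom e τ,
      ((Matrix.of (hrep e τ (H t).form z))⁻¹
          * Matrix.of (derivWithin (fun s => hrep e τ (H s).form z) J t)
        = -contract (rep e (w t).form z) (fun a b => chernCurv (hrep e τ (H t).form) a b z) ↔
      derivWithin (fun s => hrep e τ (H s).form z) J t =
        hrep e τ (heatForm (w t) (H t)).form z) := by
    intro e he τ hτ z hz
    rw [inv_mul_eq_neg_iff (posDef_hrep (H t) hz).det_pos.ne']
    change _ = heatLocal (w t) (H t) e τ z ↔ _
    rw [← hrep_heatForm (w t) (H t) he hz]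
    exact of.injective.eq_iff
  constructor
  · intro h
    refine ⟨fun e he z hz => ?_, fun e he τ hτ z hz => (h2 e he τ hτ z hz).1 (h e he τ hτ z hz).2⟩
    have hd : z ∈ dom e (trivializationAt (Fin r → ℂ) V (e.symm z)) := mem_dom_trivializationAt hz
    rw [rep_rhsFormXE α (w t) (H t) he hd]
    exact (h e he _ inferInstance z hd).1
  · rintro ⟨h, h'⟩ e he τ hτ z hz
    refine ⟨?_, (h2 e he τ hτ z hz).2 (h' e he τ hτ z hz)⟩
    rw [← rep_rhsFormXE α (w t) (H t) he hz]
    exact h e he z hz.1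

theorem isFlowFieldXE (hO : IsHolomorphicVolume O) (α : ℝ) :
    IsFlowFieldXE (r := r) (V := V) O α fun m =>
      (velocityOf hO m.1 (rhsFormXE α m.1 m.2), heatForm m.1 m.2) := by
  intro T w H hw _ t ht
  have hJ := (uniqueDiffOn_timeInterval ht).1
  rw [flowEqXE_iff]
  refine and_congr_left' (forall₂_congr fun e he => forall₂_congr fun z hz => ?_)
  exact derivWithin_Psi_eq_iff hO hw hJ ht _ he hz

theorem isFormFlowFieldXE (hO : IsHolomorphicVolume O) (α : ℝ) :
    IsFormFlowFieldXE (r := r) (V := V) O α fun m =>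
      (rhsFormXE α (metricOf hO m.1) m.2, heatForm (metricOf hO m.1) m.2) := by
  intro T w P H hw _ hP t ht
  rw [flowEqXE_iff]
  simp only [← eq_metricOf hO (hP t ht)]
  refine and_congr_left' (forall₂_congr fun e he => forall₂_congr fun z hz => ?_)
  rw [derivWithin_congr (f := fun s => rep e (P s).form z)
      (f₁ := fun s => rep e (Psi O (w s).form) z)
      (fun s hs => by beta_reduce; rw [hP s hs]) (by rw [hP t ht])]

/-! ### Locality -/

theorem jet2_congr {A : Type*} [NormedAddCommGroup A] [NormedSpace ℝ A] {f g : C3 → A}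
    (h : f =ᶠ[𝓝 z] g) : jet2 f z = jet2 g z :=
  Prod.ext h.self_of_nhds (Prod.ext h.fderiv_eq h.fderiv.fderiv_eq)

theorem IsPos11.det_ne_zero {a : Alt 2} (h : IsPos11 a) : (gram a).det ≠ 0 :=
  (isPos11_iff.1 h).2.det_pos.ne'

theorem contDiffOn_velocity (hO : IsHolomorphicVolume O) (he : e ∈ atlas C3 X) {D : Type*}
    [NormedAddCommGroup D] [NormedSpace ℝ D] {s : Set D} {q : D → C3} {a : D → Alt 2}
    {c : D → Alt 4} (hq : ContDiffOn ℝ ∞ q s) (hqm : ∀ x ∈ s, q x ∈ e.target)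
    (ha : ContDiffOn ℝ ∞ a s) (hp : ∀ x ∈ s, IsPos11 (a x)) (hc : ContDiffOn ℝ ∞ c s) :
    ContDiffOn ℝ ∞ (fun x => dPsiInv (volN O e (q x)) (psiN (volN O e (q x)) (a x)) (c x)) s := by
  have hv : ContDiffOn ℝ ∞ (fun x => volN O e (q x)) s := (contDiffOn_volN hO he).comp hq hqm
  exact contDiffOn_dPsiInv hv (fun x hx => (volN_pos hO he (hqm x hx)).ne')
    (contDiffOn_psiN hv ha fun x hx =>
      (Complex.pos_iff.1 (isPos11_iff.1 (hp x hx)).2.det_pos).1) hc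

/-- The field is the composition of `dPsiInv`, smooth in its arguments, with the jet expression of
the right-hand side. -/
theorem isLocalFieldX (hO : IsHolomorphicVolume O) (α : ℝ) (Φ : RealForm X 4 2 2) :
    IsLocalFieldX fun w => velocityOf hO w (rhsFormX α Φ w) := by
  intro e he
  refine ⟨fun p => dPsiInv (volN O e p.1) (psiN (volN O e p.1) p.2.1)
    (rhsJet α (rep e Φ.form p.1) p.2), ?_, fun w z hz => ?_⟩
  · exact contDiffOn_velocity hO he contDiffOn_fst (fun p hp => hp.1) contDiffOn_snd.fst
      (fun p hp => hp.2) (contDiffOn_rhsJet α ((Φ.smooth e he).comp contDiffOn_fst fun p hp => hp.1)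
        contDiffOn_snd fun p hp => IsPos11.det_ne_zero hp.2)
  · beta_reduce
    rw [rep_velocityOf hO _ _ he hz, rep_rhsFormX α Φ w he hz,
      (w.isPosOn he).rhsX_eq_rhsJet hz]
    rfl

/-- The jet of `ω` in terms of the jet of `Ψ`. -/
noncomputable def metricJet (O : DForm X 3) (e : OpenPartialHomeomorph X C3) (z : C3)
    (j : Jet2 (Alt 4)) : Jet2 (Alt 2) :=
  compJet (fun q : C3 × Alt 4 => psiInv (volN O e q.1) q.2) (z, j)

theorem contDiffOn_psiInv_volN (hO : IsHolomorphicVolume O) (he : e ∈ atlas C3 X) :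
    ContDiffOn ℝ ∞ (fun q : C3 × Alt 4 => psiInv (volN O e q.1) q.2) (e.target ×ˢ Set.univ) :=
  contDiffOn_psiInv ((contDiffOn_volN hO he).comp contDiffOn_fst fun q hq => hq.1) contDiffOn_snd
    fun q hq => (volN_pos hO he hq.1).ne'

theorem contDiffOn_metricJet (hO : IsHolomorphicVolume O) (he : e ∈ atlas C3 X) {D : Type*}
    [NormedAddCommGroup D] [NormedSpace ℝ D] {s : Set D} {q : D → C3} {j : D → Jet2 (Alt 4)}
    (hq : ContDiffOn ℝ ∞ q s) (hqm : ∀ x ∈ s, q x ∈ e.target) (hj : ContDiffOn ℝ ∞ j s) :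
    ContDiffOn ℝ ∞ (fun x => metricJet O e (q x) (j x)) s :=
  contDiffOn_compJet (e.open_target.prod isOpen_univ) (contDiffOn_psiInv_volN hO he)
    (hq.prodMk hj) fun x hx => ⟨hqm x hx, Set.mem_univ _⟩

theorem metricJet_isPos11 (hO : IsHolomorphicVolume O) (he : e ∈ atlas C3 X) (hz : z ∈ e.target)
    {j : Jet2 (Alt 4)} (hj : IsPos22 j.1) : IsPos11 (metricJet O e z j).1 :=
  isPos11_psiInv (volN_pos hO he hz) hj

/-- Since `psiInv` involves no derivatives, the 2-jet of `ω` depends only on the 2-jet of `Ψ`. The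
field in terms of `Ψ` therefore still has order two. -/
theorem jet2_metricOf (hO : IsHolomorphicVolume O) (he : e ∈ atlas C3 X) (hz : z ∈ e.target)
    (P : PosForm X) :
    jet2 (rep e (metricOf hO P).form) z = metricJet O e z (jet2 (rep e P.form) z) := by
  have h1 : rep e (metricOf hO P).form =ᶠ[𝓝 z] fun y => psiInv (volN O e y) (rep e P.form y) := by
    filter_upwards [e.open_target.mem_nhds hz] with y hy
    exact rep_metricFormOf hO he hy P.pos
  rw [jet2_congr h1]
  exact jet2_comp (Q := fun q : C3 × Alt 4 => psiInv (volN O e q.1) q.2)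
    (((contDiffOn_psiInv_volN hO he).contDiffAt
      ((e.open_target.prod isOpen_univ).mem_nhds ⟨hz, Set.mem_univ _⟩)).of_le (by norm_cast))
    (((P.smooth e he).contDiffAt (e.open_target.mem_nhds hz)).of_le (by norm_cast))

theorem isLocalFormFieldX (hO : IsHolomorphicVolume O) (α : ℝ) (Φ : RealForm X 4 2 2) :
    IsLocalFormFieldX fun P => rhsFormX α Φ (metricOf hO P) := by
  intro e he
  refine ⟨fun p => rhsJet α (rep e Φ.form p.1) (metricJet O e p.1 p.2), ?_, fun P z hz => ?_⟩
  · exact contDiffOn_rhsJet α ((Φ.smooth e he).comp contDiffOn_fst fun p hp => hp.1)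
      (contDiffOn_metricJet hO he contDiffOn_fst (fun p hp => hp.1) contDiffOn_snd)
      fun p hp => (metricJet_isPos11 hO he hp.1 hp.2).det_ne_zero
  · beta_reduce
    rw [rep_rhsFormX α Φ _ he hz, ((metricOf hO P).isPosOn he).rhsX_eq_rhsJet hz,
      jet2_metricOf hO he hz]

/-- The components of the jet of a pair. -/
theorem jet2_pair {A B : Type*} [NormedAddCommGroup A] [NormedSpace ℝ A] [NormedAddCommGroup B]
    [NormedSpace ℝ B] {a : C3 → A} {b : C3 → B} (ha : ContDiffAt ℝ 2 a z)
    (hb : ContDiffAt ℝ 2 b z) :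
    mapJet (ContinuousLinearMap.fst ℝ A B) (jet2 (fun y => (a y, b y)) z) = jet2 a z ∧
      mapJet (ContinuousLinearMap.snd ℝ A B) (jet2 (fun y => (a y, b y)) z) = jet2 b z := by
  have h := ha.prodMk hb
  exact ⟨(jet2_clm_comp (ContinuousLinearMap.fst ℝ A B) h).symm,
    (jet2_clm_comp (ContinuousLinearMap.snd ℝ A B) h).symm⟩

/-- The local expression of `-H ΛF`. -/
noncomputable def heatJet (a : Alt 2) (j : Jet2 (Fin r → Fin r → ℂ)) : Fin r → Fin r → ℂ :=
  fun k l => (-(of j.1 * contract a (chernJet j))) k l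

theorem contDiffOn_heatJet {D : Type*} [NormedAddCommGroup D] [NormedSpace ℝ D] {s : Set D}
    {a : D → Alt 2} {j : D → Jet2 (Fin r → Fin r → ℂ)} (ha : ContDiffOn ℝ ∞ a s)
    (hp : ∀ x ∈ s, IsPos11 (a x)) (hj : ContDiffOn ℝ ∞ j s) (hd : ∀ x ∈ s, (of (j x).1).PosDef) :
    ContDiffOn ℝ ∞ (fun x => heatJet (a x) (j x)) s := by
  have hc := contDiffOn_contract_chernJet ha (fun x hx => (hp x hx).det_ne_zero) hj
    fun x hx => (hd x hx).det_pos.ne'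
  exact contDiffOn_pi.2 fun k => contDiffOn_pi.2 fun l => (contDiffOn_matrix_mul
    (fun k l => contDiffOn_pi.1 (contDiffOn_pi.1 hj.fst k) l) hc k l).neg

theorem hrep_heatForm_eq_heatJet [MemTrivializationAtlas τ] (w : Metric X) (H : HermMetric r V)
    (he : e ∈ atlas C3 X) (hz : z ∈ dom e τ) :
    hrep e τ (heatForm w H).form z = heatJet (rep e w.form z) (jet2 (hrep e τ H.form) z) := by
  refine of.injective ((hrep_heatForm w H he hz).trans ?_)
  rw [heatLocal, (H.isMetricOn he).contract_eq_chernJet hz]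
  rfl

theorem isLocalFieldXE (hO : IsHolomorphicVolume O) (α : ℝ) :
    IsLocalFieldXE (r := r) (V := V) fun m : Metric X × HermMetric r V =>
      (velocityOf hO m.1 (rhsFormXE α m.1 m.2), heatForm m.1 m.2) := by
  intro e he τ hτ
  let p1 := ContinuousLinearMap.fst ℝ (Alt 2) (Fin r → Fin r → ℂ)
  let p2 := ContinuousLinearMap.snd ℝ (Alt 2) (Fin r → Fin r → ℂ)
  refine ⟨fun p => (dPsiInv (volN O e p.1) (psiN (volN O e p.1) p.2.1.1)
    (rhsJet α (trSqJet (mapJet p2 p.2)) (mapJet p1 p.2)), heatJet p.2.1.1 (mapJet p2 p.2)), ?_,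
    fun m z hz => ?_⟩
  · have h1 := contDiffOn_mapJet (s := {p : C3 × Jet2 (Alt 2 × (Fin r → Fin r → ℂ)) |
      p.1 ∈ dom e τ ∧ p.2.1 ∈ {a : Alt 2 | IsPos11 a} ×ˢ posMatrices r}) p1 contDiffOn_snd
    have h2 := contDiffOn_mapJet (s := {p : C3 × Jet2 (Alt 2 × (Fin r → Fin r → ℂ)) |
      p.1 ∈ dom e τ ∧ p.2.1 ∈ {a : Alt 2 | IsPos11 a} ×ˢ posMatrices r}) p2 contDiffOn_snd
    refine ContDiffOn.prodMk (contDiffOn_velocity hO he contDiffOn_fst (fun p hp => hp.1.1) h1.fst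
      (fun p hp => hp.2.1) (contDiffOn_rhsJet α (contDiffOn_trSqJet h2 fun p hp =>
        (PosDef.det_pos hp.2.2).ne') h1 fun p hp => IsPos11.det_ne_zero hp.2.1))
      (contDiffOn_heatJet h1.fst (fun p hp => hp.2.1) h2 fun p hp => hp.2.2)
  · have hw := m.1.isPosOn he
    have hH := m.2.isMetricOn (τ := τ) he
    have hj := jet2_pair (hw.contDiffAt_two hz.1) (hH.contDiffAt hz)
    refine Prod.ext ?_ ?_
    · change rep e (velocityOf hO m.1 (rhsFormXE α m.1 m.2)).form z = dPsiInv _ _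
        (rhsJet α (trSqJet (mapJet p2 _)) (mapJet p1 _))
      rw [hj.1, hj.2, rep_velocityOf hO _ _ he hz.1, rep_rhsFormXE α m.1 m.2 he hz,
        hw.rhsXE_eq_rhsJet hz.1 α hH hz]
      rfl
    · change hrep e τ (heatForm m.1 m.2).form z = heatJet (rep e m.1.form z) (mapJet p2 _)
      rw [hj.2, hrep_heatForm_eq_heatJet m.1 m.2 he hz]

theorem isLocalFormFieldXE (hO : IsHolomorphicVolume O) (α : ℝ) :
    IsLocalFormFieldXE (r := r) (V := V) fun m : PosForm X × HermMetric r V =>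
      (rhsFormXE α (metricOf hO m.1) m.2, heatForm (metricOf hO m.1) m.2) := by
  intro e he τ hτ
  let p1 := ContinuousLinearMap.fst ℝ (Alt 4) (Fin r → Fin r → ℂ)
  let p2 := ContinuousLinearMap.snd ℝ (Alt 4) (Fin r → Fin r → ℂ)
  refine ⟨fun p => (rhsJet α (trSqJet (mapJet p2 p.2)) (metricJet O e p.1 (mapJet p1 p.2)),
    heatJet (metricJet O e p.1 (mapJet p1 p.2)).1 (mapJet p2 p.2)), ?_, fun m z hz => ?_⟩
  · have h1 := contDiffOn_mapJet (s := {p : C3 × Jet2 (Alt 4 × (Fin r → Fin r → ℂ)) |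
      p.1 ∈ dom e τ ∧ p.2.1 ∈ {a : Alt 4 | IsPos22 a} ×ˢ posMatrices r}) p1 contDiffOn_snd
    have h2 := contDiffOn_mapJet (s := {p : C3 × Jet2 (Alt 4 × (Fin r → Fin r → ℂ)) |
      p.1 ∈ dom e τ ∧ p.2.1 ∈ {a : Alt 4 | IsPos22 a} ×ˢ posMatrices r}) p2 contDiffOn_snd
    have h3 := contDiffOn_metricJet hO he contDiffOn_fst (fun p hp => hp.1.1) h1
    have h4 : ∀ p ∈ {p : C3 × Jet2 (Alt 4 × (Fin r → Fin r → ℂ)) |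
        p.1 ∈ dom e τ ∧ p.2.1 ∈ {a : Alt 4 | IsPos22 a} ×ˢ posMatrices r},
        IsPos11 (metricJet O e p.1 (mapJet p1 p.2)).1 := fun p hp =>
      metricJet_isPos11 (j := mapJet p1 p.2) hO he hp.1.1 hp.2.1
    exact (contDiffOn_rhsJet α (contDiffOn_trSqJet h2 fun p hp => (PosDef.det_pos hp.2.2).ne') h3
      fun p hp => (h4 p hp).det_ne_zero).prodMk
      (contDiffOn_heatJet h3.fst h4 h2 fun p hp => hp.2.2)
  · have hw := (metricOf hO m.1).isPosOn he
    have hH := m.2.isMetricOn (τ := τ) he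
    have hP : ContDiffAt ℝ 2 (rep e m.1.form) z :=
      ((m.1.smooth e he).contDiffAt (e.open_target.mem_nhds hz.1)).of_le (by norm_cast)
    have hj := jet2_pair hP (hH.contDiffAt hz)
    refine Prod.ext ?_ ?_
    · change rep e (rhsFormXE α (metricOf hO m.1) m.2).form z =
        rhsJet α (trSqJet (mapJet p2 _)) (metricJet O e z (mapJet p1 _))
      rw [hj.1, hj.2, rep_rhsFormXE α _ m.2 he hz, hw.rhsXE_eq_rhsJet hz.1 α hH hz,
        jet2_metricOf hO he hz.1]
    · change hrep e τ (heatForm (metricOf hO m.1) m.2).form z =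
        heatJet (metricJet O e z (mapJet p1 _)).1 (mapJet p2 _)
      rw [hj.1, hj.2, hrep_heatForm_eq_heatJet _ m.2 he hz, ← jet2_metricOf hO he hz.1]
      rfl

end Flows

/-! ### Curves with prescribed velocity and uniqueness of the vector fields -/

section Lines

open Matrix Filter

set_option linter.unusedSectionVars false

attribute [local irreducible] wedge

variable {X : Type*} [TopologicalSpace X] [ChartedSpace C3 X] [IsManifold 𝓘(ℂ, C3) ω X]
  {O : DForm X 3} {e e' : OpenPartialHomeomorph X C3} {z : C3} {J : Set ℝ}

/-- The line `a + t b` of forms. -/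
noncomputable def lineForm {k : ℕ} (a b : DForm X k) (t : ℝ) : DForm X k := fun x => a x + t • b x

theorem rep_lineForm {k : ℕ} (a b : DForm X k) (t : ℝ) :
    rep e (lineForm a b t) z = rep e a z + t • rep e b z := rfl

theorem contDiffOn_rep_lineForm {k : ℕ} {a b : DForm X k} (ha : IsSmoothForm a)
    (hb : IsSmoothForm b) (he : e ∈ atlas C3 X) :
    ContDiffOn ℝ ∞ (fun p : ℝ × C3 => rep e (lineForm a b p.1) p.2) (Set.univ ×ˢ e.target) := by
  have h1 := (ha e he).comp (s := (Set.univ : Set ℝ) ×ˢ e.target) contDiffOn_snd fun p hp => hp.2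
  have h2 := (hb e he).comp (s := (Set.univ : Set ℝ) ×ˢ e.target) contDiffOn_snd fun p hp => hp.2
  exact h1.add (contDiffOn_fst.smul h2)

theorem IsRealOfType.add_smul {k p q : ℕ} {a b : Alt k} (ha : IsRealOfType p q a)
    (hb : IsRealOfType p q b) (t : ℝ) : IsRealOfType p q (a + t • b) :=
  (realOfType k p q).add_mem ha ((realOfType k p q).smul_mem t hb)

/-- On a compact manifold the forms `ω + t v` are positive for small `t`. -/
theorem eventually_isPos11_lineForm [CompactSpace X] (w : Metric X) (v : RealForm X 2 1 1) :
    ∀ᶠ t in 𝓝 (0 : ℝ), ∀ x, IsPos11 (DForm.at (lineForm w.form v.form t) x) := by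
  have h := (isCompact_univ (X := X)).eventually_forall_of_forall_eventually (x₀ := (0 : ℝ))
    (P := fun t x => IsPos11 (DForm.at (lineForm w.form v.form t) x)) fun x₀ _ => by
      have he := chart_mem_atlas C3 x₀
      have hs := mem_chart_source C3 x₀
      set e := chartAt C3 x₀
      have hz : e x₀ ∈ e.target := e.map_source hs
      have hn : (Set.univ : Set ℝ) ×ˢ e.target ∈ 𝓝 ((0 : ℝ), e x₀) :=
        (isOpen_univ.prod e.open_target).mem_nhds ⟨Set.mem_univ _, hz⟩
      have h1 : ∀ᶠ p : ℝ × C3 in 𝓝 (0, e x₀),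
          IsPos11 (rep e (lineForm w.form v.form p.1) p.2) := by
        refine eventually_isPos11 ((contDiffOn_rep_lineForm w.smooth v.smooth he).contDiffAt
          hn).continuousAt ?_ ?_
        · filter_upwards [hn] with p hp
          rw [rep_lineForm]
          exact (rep_isPos11 he hp.2 w.pos).1.add_smul (rep_isRealOfType he hp.2 v.type) _
        · rw [rep_lineForm, add_zero_smul]
          exact rep_isPos11 he hz w.pos
      have hc : Tendsto (fun p : ℝ × X => (p.1, e p.2)) (𝓝 (0, x₀)) (𝓝 (0, e x₀)) :=
        continuousAt_fst.prodMk ((e.continuousAt hs).comp_of_eq continuousAt_snd rfl)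
      have h2 : ∀ᶠ p : ℝ × X in 𝓝 (0, x₀), p.2 ∈ e.source :=
        continuousAt_snd.eventually_mem (e.open_source.mem_nhds hs)
      filter_upwards [hc.eventually h1, h2] with p hp hp'
      have hx := mem_chart_source C3 p.2
      have hi : (chartAt C3 p.2).symm (chartAt C3 p.2 p.2) = p.2 := (chartAt C3 p.2).left_inv hx
      -- Positivity is known near `x₀` in the chart at `x₀`, but is required in the preferred chart
      -- of each nearby point; pull-back by the coordinate change transfers it.
      rw [← rep_chartAt, rep_trans (chart_mem_atlas C3 p.2) he ((chartAt C3 p.2).map_source hx)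
        (by rw [hi]; exact hp')]
      refine IsPos11.pullC ?_ (det_jac_trans_ne_zero (chart_mem_atlas C3 p.2) he
        ((chartAt C3 p.2).map_source hx) (by rw [hi]; exact hp'))
      have ht : trans (chartAt C3 p.2) e (chartAt C3 p.2 p.2) = e p.2 := by
        change e ((chartAt C3 p.2).symm (chartAt C3 p.2 p.2)) = _
        rw [hi]
      rw [ht]
      exact hp
  exact h.mono fun t ht x => ht x (Set.mem_univ x)

theorem derivWithin_line {A : Type*} [NormedAddCommGroup A] [NormedSpace ℝ A] {f : ℝ → A}
    {a b : A} {t : ℝ} (h : ∀ s ∈ J, f s = a + s • b) (ht : t ∈ J) (hJ : UniqueDiffWithinAt ℝ J t) :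
    derivWithin f J t = b :=
  ((hasDerivAt_line a b t).hasDerivWithinAt.congr h (h t ht)).derivWithin hJ

theorem zero_mem_uniqueDiff {T : ℝ} (hT : 0 < T) :
    (0 : ℝ) ∈ timeInterval T ∧ UniqueDiffWithinAt ℝ (timeInterval T) 0 := by
  have h : (0 : ℝ) ∈ timeInterval T := mem_timeInterval_coe.2 ⟨le_rfl, hT⟩
  exact ⟨h, (uniqueDiffOn_timeInterval h).1 0 h⟩

/-- Curves of metrics with prescribed initial value and velocity. -/
theorem exists_metric_curve [CompactSpace X] (w₀ : Metric X) (v : RealForm X 2 1 1) :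
    ∃ ε > 0, ∃ w : ℝ → Metric X, w 0 = w₀ ∧ ∀ T : ℝ, 0 < T → T ≤ ε →
      IsSmoothCurve (timeInterval T) (fun s => (w s).form) ∧
      HasVelocity (timeInterval T) (fun s => (w s).form) 0 v.form := by
  classical
  obtain ⟨ε, hε, h⟩ := Metric.eventually_nhds_iff.1 (eventually_isPos11_lineForm w₀ v)
  -- The line `ω₀ + t v` as long as it is positive; the value `w₀` elsewhere only makes `w` total
  -- and is not met on `[0, ε)`.
  let w : ℝ → Metric X := fun t =>
    if ht : ∀ x, IsPos11 (DForm.at (lineForm w₀.form v.form t) x) then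
      ⟨lineForm w₀.form v.form t, fun e he => (contDiffOn_rep_lineForm w₀.smooth v.smooth he).comp
        (contDiffOn_const.prodMk contDiffOn_id) fun z hz => ⟨Set.mem_univ t, hz⟩, ht⟩
    else w₀
  have hw : ∀ T ≤ ε, ∀ t ∈ timeInterval (T : ℝ), (w t).form = lineForm w₀.form v.form t := by
    intro T hT t ht
    rw [mem_timeInterval_coe] at ht
    have : ∀ x, IsPos11 (DForm.at (lineForm w₀.form v.form t) x) := h (by
      rw [Real.dist_eq, sub_zero, abs_of_nonneg ht.1]
      exact ht.2.trans_le hT)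
    simp only [w, dif_pos this]
  refine ⟨ε, hε, w, Metric.ext' ?_, fun T hT hT' => ⟨fun e he => ?_, fun e he z hz => ?_⟩⟩
  · rw [hw ε le_rfl 0 (zero_mem_uniqueDiff hε).1]
    funext x
    exact add_zero_smul (DForm.at w₀.form x) (DForm.at v.form x)
  · refine ((contDiffOn_rep_lineForm w₀.smooth v.smooth he).mono
      (Set.prod_mono (Set.subset_univ _) subset_rfl)).congr fun p hp => ?_
    beta_reduce
    rw [hw T hT' p.1 hp.1]
  · refine derivWithin_line (a := rep e w₀.form z) (fun s hs => ?_) (zero_mem_uniqueDiff hT).1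
      (zero_mem_uniqueDiff hT).2
    beta_reduce
    rw [hw T hT' s hs, rep_lineForm]

variable {r : ℕ} {V : X → Type*} [∀ x, AddCommGroup (V x)] [∀ x, Module ℂ (V x)]
  [∀ x, TopologicalSpace (V x)] [TopologicalSpace (Bundle.TotalSpace (Fin r → ℂ) V)]
  [FiberBundle (Fin r → ℂ) V] [VectorBundle ℂ (Fin r → ℂ) V]
  {τ : Bundle.Trivialization (Fin r → ℂ) (π (Fin r → ℂ) V)}

/-- The line `H + t K` of sesquilinear forms. -/
noncomputable def lineSesq (H K : SesqForm V) (t : ℝ) : SesqForm V :=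
  fun x => H x + (t : ℂ) • K x

theorem hrep_lineSesq (H K : SesqForm V) (t : ℝ) :
    hrep e τ (lineSesq H K t) z = hrep e τ H z + t • hrep e τ K z := by
  funext a b
  exact congrArg (hrep e τ H z a b + ·) (Complex.real_smul (x := t) (z := hrep e τ K z a b)).symm

theorem contDiffOn_hrep_lineSesq {H K : SesqForm V} (hH : IsSmoothSesq r H)
    (hK : IsSmoothSesq r K) (he : e ∈ atlas C3 X) (hτ : MemTrivializationAtlas τ) :
    ContDiffOn ℝ ∞ (fun p : ℝ × C3 => hrep e τ (lineSesq H K p.1) p.2)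
      (Set.univ ×ˢ dom e τ) := by
  have h1 := (hH e he τ hτ).comp (s := (Set.univ : Set ℝ) ×ˢ dom e τ) contDiffOn_snd
    fun p hp => hp.2
  have h2 := (hK e he τ hτ).comp (s := (Set.univ : Set ℝ) ×ˢ dom e τ) contDiffOn_snd
    fun p hp => hp.2
  simp only [hrep_lineSesq]
  exact h1.add (contDiffOn_fst.smul h2)

theorem herm_lineSesq {H K : SesqForm V} (hH : ∀ x u v, conj (H x u v) = H x v u)
    (hK : ∀ x u v, conj (K x u v) = K x v u) (t : ℝ) (x : X) (u v : V x) :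
    conj (lineSesq H K t x u v) = lineSesq H K t x v u := by
  change conj (H x u v + (t : ℂ) * K x u v) = H x v u + (t : ℂ) * K x v u
  rw [map_add, map_mul, hH, hK, Complex.conj_ofReal]

theorem pos_of_posDef_hrep [τ.IsLinear ℂ] {H : SesqForm V} (hz : z ∈ dom e τ)
    (h : (of (hrep e τ H z)).PosDef) (v : V (e.symm z)) (hv : v ≠ 0) :
    0 < (H (e.symm z) v v).re := by
  rw [sesq_apply H hz.2 v v]
  refine (Complex.pos_iff.1 (h.dotProduct_mulVec_pos fun h0 => hv ?_)).1
  rw [eq_sum_frame hz.2 v, h0]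
  simp

/-- On a compact manifold the forms `H + t K` are positive for small `t`. -/
theorem eventually_pos_lineSesq [CompactSpace X] (H : HermMetric r V) (K : HermForm r V) :
    ∀ᶠ t in 𝓝 (0 : ℝ), ∀ x, ∀ v : V x, v ≠ 0 → 0 < (lineSesq H.form K.form t x v v).re := by
  have h := (isCompact_univ (X := X)).eventually_forall_of_forall_eventually (x₀ := (0 : ℝ))
    (P := fun t x => ∀ v : V x, v ≠ 0 → 0 < (lineSesq H.form K.form t x v v).re) fun x₀ _ => by
      have he := chart_mem_atlas C3 x₀
      have hs := mem_chart_source C3 x₀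
      have hz := mem_dom_chartAt (r := r) (V := V) x₀
      have hτ : MemTrivializationAtlas (trivializationAt (Fin r → ℂ) V x₀) := inferInstance
      set e := chartAt C3 x₀
      set τ := trivializationAt (Fin r → ℂ) V x₀
      have hn : (Set.univ : Set ℝ) ×ˢ dom e τ ∈ 𝓝 ((0 : ℝ), e x₀) :=
        (isOpen_univ.prod isOpen_dom).mem_nhds ⟨Set.mem_univ _, hz⟩
      have h1 : ∀ᶠ p : ℝ × C3 in 𝓝 (0, e x₀),
          (of (hrep e τ (lineSesq H.form K.form p.1) p.2)).PosDef := by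
        refine eventually_posDef (fun a b => ?_) (Eventually.of_forall fun p =>
          isHermitian_hrep (herm_lineSesq H.herm K.herm p.1)) ?_
        · exact continuousAt_pi.1 (continuousAt_pi.1 ((contDiffOn_hrep_lineSesq H.smooth K.smooth
            he hτ).contDiffAt hn).continuousAt a) b
        · rw [hrep_lineSesq, zero_smul, add_zero]
          exact posDef_hrep H hz
      have hc : Tendsto (fun p : ℝ × X => (p.1, e p.2)) (𝓝 (0, x₀)) (𝓝 (0, e x₀)) :=
        continuousAt_fst.prodMk ((e.continuousAt hs).comp_of_eq continuousAt_snd rfl)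
      have h2 : ∀ᶠ p : ℝ × X in 𝓝 (0, x₀), p.2 ∈ e.source :=
        continuousAt_snd.eventually_mem (e.open_source.mem_nhds hs)
      filter_upwards [hc.eventually h1, hc.eventually hn, h2] with p hp hp' hps
      have h3 := pos_of_posDef_hrep hp'.2 hp
      rwa [e.left_inv hps] at h3
  exact h.mono fun t ht x => ht x (Set.mem_univ x)

/-- Curves of metrics on a bundle with prescribed initial value and velocity. -/
theorem exists_hermMetric_curve [CompactSpace X] (H₀ : HermMetric r V) (K : HermForm r V) :
    ∃ ε > 0, ∃ H : ℝ → HermMetric r V, H 0 = H₀ ∧ ∀ T : ℝ, 0 < T → T ≤ ε →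
      IsSmoothSesqCurve r (timeInterval T) (fun s => (H s).form) ∧
      HasSesqVelocity r (timeInterval T) (fun s => (H s).form) 0 K.form := by
  classical
  obtain ⟨ε, hε, h⟩ := Metric.eventually_nhds_iff.1 (eventually_pos_lineSesq H₀ K)
  let H : ℝ → HermMetric r V := fun t =>
    if ht : ∀ x, ∀ v : V x, v ≠ 0 → 0 < (lineSesq H₀.form K.form t x v v).re then
      ⟨lineSesq H₀.form K.form t, fun e he τ hτ =>
        (contDiffOn_hrep_lineSesq H₀.smooth K.smooth he hτ).comp
        (contDiffOn_const.prodMk contDiffOn_id) fun z hz => ⟨Set.mem_univ t, hz⟩,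
        herm_lineSesq H₀.herm K.herm t, ht⟩
    else H₀
  have hH : ∀ T ≤ ε, ∀ t ∈ timeInterval (T : ℝ), (H t).form = lineSesq H₀.form K.form t := by
    intro T hT t ht
    rw [mem_timeInterval_coe] at ht
    have : ∀ x, ∀ v : V x, v ≠ 0 → 0 < (lineSesq H₀.form K.form t x v v).re := h (by
      rw [Real.dist_eq, sub_zero, abs_of_nonneg ht.1]
      exact ht.2.trans_le hT)
    simp only [H, dif_pos this]
  refine ⟨ε, hε, H, HermMetric.ext' ?_, fun T hT hT' =>
    ⟨fun e he τ hτ => ?_, fun e he τ hτ z hz => ?_⟩⟩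
  · rw [hH ε le_rfl 0 (zero_mem_uniqueDiff hε).1]
    funext x
    rw [lineSesq, Complex.ofReal_zero, zero_smul, add_zero]
  · refine ((contDiffOn_hrep_lineSesq H₀.smooth K.smooth he hτ).mono
      (Set.prod_mono (Set.subset_univ _) subset_rfl)).congr fun p hp => ?_
    beta_reduce
    rw [hH T hT' p.1 hp.1]
  · refine derivWithin_line (a := hrep e τ H₀.form z) (fun s hs => ?_) (zero_mem_uniqueDiff hT).1
      (zero_mem_uniqueDiff hT).2
    beta_reduce
    rw [hH T hT' s hs, hrep_lineSesq]

theorem HasVelocity.unique {k p q : ℕ} {a : ℝ → DForm X k} {t : ℝ} {b b' : RealForm X k p q}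
    (h : HasVelocity J a t b.form) (h' : HasVelocity J a t b'.form) : b = b' :=
  RealForm.ext' (form_ext fun e he z hz => (h e he z hz).symm.trans (h' e he z hz))

theorem HasSesqVelocity.unique {H : ℝ → SesqForm V} {t : ℝ} {K K' : HermForm r V}
    (h : HasSesqVelocity r J H t K.form) (h' : HasSesqVelocity r J H t K'.form) : K = K' :=
  HermForm.ext' (sesq_ext fun e he τ hτ z hz =>
    (h e he τ hτ z hz).symm.trans (h' e he τ hτ z hz))

variable [CompactSpace X]

/-- A curve through `w₀` with velocity `v w₀` satisfies the flow equation at time `0` because `v`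
generates the flow; then `v'` must give the same velocity. -/
theorem IsFlowFieldX.unique {α : ℝ} {Φ : DForm X 4} {v v' : Metric X → RealForm X 2 1 1}
    (h : IsFlowFieldX O α Φ v) (h' : IsFlowFieldX O α Φ v') : v' = v := by
  funext w₀
  obtain ⟨ε, hε, w, h0, hw⟩ := exists_metric_curve w₀ (v w₀)
  obtain ⟨hs, hv⟩ := hw ε hε le_rfl
  have hm := (zero_mem_uniqueDiff hε).1
  rw [← h0] at hv ⊢
  exact HasVelocity.unique ((h' ε w hs 0 hm).1 ((h ε w hs 0 hm).2 hv)) hv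

/-- The test curve is again a curve of metrics, with the velocity that the flow prescribes at
`metricOf hO P`. It satisfies the equation at time `0`, so both fields equal the velocity of `Ψ`
there. -/
theorem IsFormFlowFieldX.unique (hO : IsHolomorphicVolume O) {α : ℝ} {Φ : RealForm X 4 2 2}
    {v : PosForm X → RealForm X 4 2 2} (h : IsFormFlowFieldX O α Φ.form v) :
    v = fun P => rhsFormX α Φ (metricOf hO P) := by
  funext P
  obtain ⟨ε, hε, w, h0, hw⟩ := exists_metric_curve (metricOf hO P)
    (velocityOf hO (metricOf hO P) (rhsFormX α Φ (metricOf hO P)))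
  obtain ⟨hs, hv⟩ := hw ε hε le_rfl
  have hm := (zero_mem_uniqueDiff hε).1
  rw [← h0] at hv
  have hF := (isFlowFieldX hO α Φ ε w hs 0 hm).2 hv
  have hP : posFormOf hO (w 0) = P := PosForm.ext' (by rw [h0]; exact Psi_metricOf hO P)
  have h1 := (h ε w (fun t => posFormOf hO (w t)) hs (fun _ _ => rfl) 0 hm).1 hF
  have h2 := (isFormFlowFieldX hO α Φ ε w (fun t => posFormOf hO (w t)) hs (fun _ _ => rfl) 0
    hm).1 hF
  have h3 := HasVelocity.unique h1 h2
  beta_reduce at h3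
  rwa [hP] at h3

variable [ContMDiffVectorBundle ω (Fin r → ℂ) V 𝓘(ℂ, C3)]

theorem IsFlowFieldXE.unique {α : ℝ}
    {v v' : Metric X × HermMetric r V → RealForm X 2 1 1 × HermForm r V}
    (h : IsFlowFieldXE O α v) (h' : IsFlowFieldXE O α v') : v' = v := by
  funext ⟨w₀, H₀⟩
  obtain ⟨ε, hε, w, h0, hw⟩ := exists_metric_curve w₀ (v (w₀, H₀)).1
  obtain ⟨δ, hδ, H, h0', hH⟩ := exists_hermMetric_curve H₀ (v (w₀, H₀)).2
  -- Both curves must be defined on a common time interval.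
  have hT : 0 < min ε δ := lt_min hε hδ
  obtain ⟨hs, hv⟩ := hw _ hT (min_le_left _ _)
  obtain ⟨hs', hv'⟩ := hH _ hT (min_le_right _ _)
  have hm := (zero_mem_uniqueDiff hT).1
  rw [← h0, ← h0'] at hv hv' ⊢
  have h1 := (h' _ w H hs hs' 0 hm).1 ((h _ w H hs hs' 0 hm).2 ⟨hv, hv'⟩)
  exact Prod.ext (h1.1.unique hv) (h1.2.unique hv')

theorem IsFormFlowFieldXE.unique (hO : IsHolomorphicVolume O) {α : ℝ}
    {v : PosForm X × HermMetric r V → RealForm X 4 2 2 × HermForm r V}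
    (h : IsFormFlowFieldXE O α v) :
    v = fun m => (rhsFormXE α (metricOf hO m.1) m.2, heatForm (metricOf hO m.1) m.2) := by
  funext ⟨P, H₀⟩
  obtain ⟨ε, hε, w, h0, hw⟩ := exists_metric_curve (metricOf hO P)
    (velocityOf hO (metricOf hO P) (rhsFormXE α (metricOf hO P) H₀))
  obtain ⟨δ, hδ, H, h0', hH⟩ := exists_hermMetric_curve H₀ (heatForm (metricOf hO P) H₀)
  have hT : 0 < min ε δ := lt_min hε hδ
  obtain ⟨hs, hv⟩ := hw _ hT (min_le_left _ _)
  obtain ⟨hs', hv'⟩ := hH _ hT (min_le_right _ _)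
  have hm := (zero_mem_uniqueDiff hT).1
  rw [← h0, ← h0'] at hv hv'
  have hF := (isFlowFieldXE hO α _ w H hs hs' 0 hm).2 ⟨hv, hv'⟩
  have hP : posFormOf hO (w 0) = P := PosForm.ext' (by rw [h0]; exact Psi_metricOf hO P)
  have h1 := (h _ w (fun t => posFormOf hO (w t)) H hs hs' (fun _ _ => rfl) 0 hm).1 hF
  have h2 := (isFormFlowFieldXE hO α _ w (fun t => posFormOf hO (w t)) H hs hs' (fun _ _ => rfl) 0
    hm).1 hF
  beta_reduce at h1 h2
  rw [hP, h0'] at h1 h2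
  exact Prod.ext (h1.1.unique h2.1) (h1.2.unique h2.2)

end Lines

/-! ### Exchange of the derivatives in time and in space -/

section Exchange

variable {E A : Type*} [NormedAddCommGroup E] [NormedSpace ℝ E] [NormedAddCommGroup A]
  [NormedSpace ℝ A] {f : ℝ × E → A} {J : Set ℝ} {U : Set E} {t : ℝ} {z : E}

/-- The space derivative of a function of time and space is differentiable in time, with derivative
the space derivative of the time derivative. -/
theorem hasDerivWithinAt_fderiv_slice (hf : ContDiffOn ℝ ∞ f (J ×ˢ U)) (hJ : UniqueDiffOn ℝ J)
    (hJ' : ∀ s ∈ J, s ∈ closure (interior J)) (hU : IsOpen U) (ht : t ∈ J) (hz : z ∈ U) :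
    HasDerivWithinAt (fun s => fderiv ℝ (fun y => f (s, y)) z)
      (fderiv ℝ (fun y => derivWithin (fun s => f (s, y)) J t) z) J t := by
  -- Time may be an endpoint of `J`, so derivatives on `J × U` are taken within the set; both slices
  -- are then recovered from the one derivative `D`.
  have hS : UniqueDiffOn ℝ (J ×ˢ U) := hJ.prod hU.uniqueDiffOn
  have hD : ContDiffOn ℝ ∞ (fderivWithin ℝ f (J ×ˢ U)) (J ×ˢ U) :=
    hf.fderivWithin hS (by simp)
  set D := fderivWithin ℝ f (J ×ˢ U) with hDdef
  have hfd : ∀ s ∈ J, ∀ y ∈ U, HasFDerivWithinAt f (D (s, y)) (J ×ˢ U) (s, y) := fun s hs y hy =>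
    ((hf (s, y) ⟨hs, hy⟩).differentiableWithinAt (by simp)).hasFDerivWithinAt
  have h1 : ∀ s ∈ J, fderiv ℝ (fun y => f (s, y)) z =
      (D (s, z)).comp (ContinuousLinearMap.inr ℝ ℝ E) := by
    intro s hs
    have := (hfd s hs z hz).comp (f := fun y => (s, y)) z (hasFDerivAt_prodMk_right s z).hasFDerivWithinAt
      (t := J ×ˢ U) (s := U) fun y hy => ⟨hs, hy⟩
    exact (this.hasFDerivAt (hU.mem_nhds hz)).fderiv
  have h2 : ∀ y ∈ U, derivWithin (fun s => f (s, y)) J t = D (t, y) (1, 0) := by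
    intro y hy
    have := (hfd t ht y hy).comp (f := fun s => (s, y)) t (hasFDerivAt_prodMk_left t y).hasFDerivWithinAt
      (t := J ×ˢ U) (s := J) fun s hs => ⟨hs, hy⟩
    simpa [Function.comp_def] using this.hasDerivWithinAt.derivWithin (hJ t ht)
  have hDd : HasFDerivWithinAt D (fderivWithin ℝ D (J ×ˢ U) (t, z)) (J ×ˢ U) (t, z) :=
    ((hD (t, z) ⟨ht, hz⟩).differentiableWithinAt (by simp)).hasFDerivWithinAt
  have h3 : HasDerivWithinAt (fun s => D (s, z)) (fderivWithin ℝ D (J ×ˢ U) (t, z) (1, 0)) J t := by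
    simpa using!
    (hDd.comp (f := fun s => (s, z)) t (hasFDerivAt_prodMk_left t z).hasFDerivWithinAt
      (t := J ×ˢ U) (s := J) fun s hs => ⟨hs, hz⟩).hasDerivWithinAt
  have h4 : HasFDerivAt (fun y => D (t, y))
      ((fderivWithin ℝ D (J ×ˢ U) (t, z)).comp (ContinuousLinearMap.inr ℝ ℝ E)) z :=
    (hDd.comp (f := fun y => (t, y)) z (hasFDerivAt_prodMk_right t z).hasFDerivWithinAt
      (t := J ×ˢ U) (s := U) fun y hy => ⟨ht, hy⟩).hasFDerivAt (hU.mem_nhds hz)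
  have h5 : HasFDerivAt (fun y => derivWithin (fun s => f (s, y)) J t)
      ((ContinuousLinearMap.apply ℝ A ((1 : ℝ), (0 : E))).comp
        ((fderivWithin ℝ D (J ×ˢ U) (t, z)).comp (ContinuousLinearMap.inr ℝ ℝ E))) z := by
    refine ((ContinuousLinearMap.apply ℝ A ((1 : ℝ), (0 : E))).hasFDerivAt.comp z
      h4).congr_of_eventuallyEq ?_
    filter_upwards [hU.mem_nhds hz] with y hy
    exact h2 y hy
  -- Symmetry of the second derivative at a boundary point holds by continuity from interior points,
  -- whence the hypothesis `hJ'`.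
  have hsymm : IsSymmSndFDerivWithinAt ℝ f (J ×ˢ U) (t, z) := by
    refine (hf (t, z) ⟨ht, hz⟩).isSymmSndFDerivWithinAt (n := ∞) ?_ hS ?_ ⟨ht, hz⟩
    · rw [minSmoothness_of_isRCLikeNormedField]
      norm_cast
    · rw [interior_prod_eq, closure_prod_eq, hU.interior_eq]
      exact ⟨hJ' t ht, subset_closure hz⟩
  have h6 := ((ContinuousLinearMap.compL ℝ E (ℝ × E) A).flip
    (ContinuousLinearMap.inr ℝ ℝ E)).hasFDerivAt.comp_hasDerivWithinAt t h3
  refine (h6.congr h1 (h1 t ht)).congr_deriv ?_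
  rw [h5.fderiv]
  ext v
  exact hsymm (1, 0) (0, v)

theorem HasDerivWithinAt.apply_clm {g : ℝ → E →L[ℝ] A} {g' : E →L[ℝ] A}
    (h : HasDerivWithinAt g g' J t) (u : E) : HasDerivWithinAt (fun s => g s u) (g' u) J t :=
  (ContinuousLinearMap.apply ℝ A u).hasFDerivAt.comp_hasDerivWithinAt t h

theorem tendsto_apply_clm {ι : Type*} {l : Filter ι} {g : ι → E →L[ℝ] A} {g' : E →L[ℝ] A}
    (h : Filter.Tendsto g l (𝓝 g')) (u : E) : Filter.Tendsto (fun s => g s u) l (𝓝 (g' u)) :=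
  ((ContinuousLinearMap.apply ℝ A u).continuous.tendsto g').comp h

end Exchange

/-! ### Closed right-hand sides and preservation of the balanced condition -/

section Balanced

open Matrix Filter

set_option linter.unusedSectionVars false

attribute [local irreducible] wedge

/-- A curve of forms with closed velocity that is closed at one time is closed. -/
theorem extDeriv_eq_zero_of_velocity {k : ℕ} {a : ℝ → C3 → Alt k} {J : Set ℝ} {U : Set C3} {z : C3}
    (ha : ContDiffOn ℝ ∞ (fun p : ℝ × C3 => a p.1 p.2) (J ×ˢ U)) (hJ : UniqueDiffOn ℝ J)
    (hJ' : ∀ s ∈ J, s ∈ closure (interior J)) (hc : Convex ℝ J) (hU : IsOpen U) (hz : z ∈ U)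
    (hv : ∀ t ∈ J, extDeriv (fun y => derivWithin (fun s => a s y) J t) z = 0)
    {t t₀ : ℝ} (ht₀ : t₀ ∈ J) (h₀ : extDeriv (a t₀) z = 0) (ht : t ∈ J) : extDeriv (a t) z = 0 := by
  ext v
  have h : ∀ s ∈ J, HasDerivWithinAt (fun s => extDeriv (a s) z v) 0 J s := by
    intro s hs
    -- By the exchange of derivatives, the time derivative of `d a` is `d` of the velocity, which
    -- vanishes by assumption.
    have h1 := hasDerivWithinAt_fderiv_slice ha hJ hJ' hU hs hz
    have h2 : ∀ i : Fin (k + 1), HasDerivWithinAt (fun s => (-1 : ℤ) ^ (i : ℕ) •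
        fderiv ℝ (a s) z (v i) (Fin.removeNth i v)) ((-1 : ℤ) ^ (i : ℕ) •
        fderiv ℝ (fun y => derivWithin (fun s => a s y) J s) z (v i) (Fin.removeNth i v)) J s :=
      fun i => ((ContinuousAlternatingMap.apply ℝ C3 ℂ
        (Fin.removeNth i v)).hasFDerivAt.comp_hasDerivWithinAt s
        (HasDerivWithinAt.apply_clm h1 (v i))).const_smul _
    refine (HasDerivWithinAt.fun_sum (u := Finset.univ) fun i _ => h2 i).congr_deriv ?_ |>.congr
      (fun t _ => ?_) ?_
    · rw [← ContinuousAlternatingMap.alternatizeUncurryFin_apply]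
      exact DFunLike.congr_fun (hv s hs) v
    · rw [extDeriv, ContinuousAlternatingMap.alternatizeUncurryFin_apply]
    · rw [extDeriv, ContinuousAlternatingMap.alternatizeUncurryFin_apply]
  -- The mean value inequality with constant zero: each component of `d a` at `z` is constant on the
  -- interval.
  have := hc.norm_image_sub_le_of_norm_hasDerivWithin_le (C := 0) h (by simp) ht₀ ht
  rw [zero_mul, norm_le_zero_iff, sub_eq_zero] at this
  exact this.trans (DFunLike.congr_fun h₀ v)

variable {X : Type*} [TopologicalSpace X] [ChartedSpace C3 X] [IsManifold 𝓘(ℂ, C3) ω X]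
  {O : DForm X 3} {e e' : OpenPartialHomeomorph X C3} {z : C3} {J : Set ℝ} {t : ℝ}

theorem IsSmoothCurve.psi (hO : IsHolomorphicVolume O) {w : ℝ → Metric X}
    (hw : IsSmoothCurve J fun s => (w s).form) : IsSmoothCurve J fun s => Psi O (w s).form := by
  intro e he
  refine ContDiffOn.congr (contDiffOn_psiN ((contDiffOn_volN hO he).comp contDiffOn_snd
    fun p hp => hp.2) (hw e he) ?_) fun p hp => rep_Psi hO he hp.2 (w p.1).pos
  intro p hp
  exact (Complex.pos_iff.1 (isPos11_iff.1 (rep_isPos11 he hp.2 (w p.1).pos)).2.det_pos).1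

theorem extDeriv_rhsX_eq_zero (α : ℝ) {Φ : RealForm X 4 2 2} (hΦ : IsClosedForm Φ.form)
    (w : Metric X) (he : e ∈ atlas C3 X) (hz : z ∈ e.target) :
    extDeriv (rhsX α (rep e Φ.form) (rep e w.form)) z = 0 :=
  (w.isPosOn he).extDeriv_rhsX hz α
    (((Φ.smooth e he).contDiffAt (e.open_target.mem_nhds hz)).differentiableAt (by simp))
    (hΦ e he z hz)

/-- A smooth curve of metrics for which the velocity of `‖Ω‖_ω ω²` is closed stays balanced. -/
theorem isClosedForm_Psi_of_velocity (hO : IsHolomorphicVolume O) {T : EReal} {w : ℝ → Metric X}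
    (hw : IsSmoothCurve (timeInterval T) fun s => (w s).form)
    (hv : ∀ t ∈ timeInterval T, ∀ e ∈ atlas C3 X, ∀ z ∈ e.target, extDeriv (fun y =>
      derivWithin (fun s => rep e (Psi O (w s).form) y) (timeInterval T) t) z = 0)
    (h₀ : IsClosedForm (Psi O (w 0).form)) (ht : t ∈ timeInterval T) :
    IsClosedForm (Psi O (w t).form) := by
  intro e he z hz
  obtain ⟨hJ, hJ'⟩ := uniqueDiffOn_timeInterval ht
  exact extDeriv_eq_zero_of_velocity (a := fun s => rep e (Psi O (w s).form)) (hw.psi hO e he) hJ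
    hJ' (convex_timeInterval T) e.open_target hz (fun s hs => hv s hs e he z hz)
    (zero_mem_timeInterval ht) (h₀ e he z hz) ht

theorem extDeriv_congr_of_mem {k : ℕ} {a b : C3 → Alt k} {U : Set C3} (hU : IsOpen U) (hz : z ∈ U)
    (h : ∀ y ∈ U, a y = b y) : extDeriv a z = extDeriv b z := by
  have h1 : a =ᶠ[𝓝 z] b := by
    filter_upwards [hU.mem_nhds hz] with y hy using h y hy
  rw [extDeriv, extDeriv, h1.fderiv_eq]

theorem IsSolutionX.isClosedForm_Psi (hO : IsHolomorphicVolume O) {α : ℝ} {Φ : RealForm X 4 2 2}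
    (hΦ : IsClosedForm Φ.form) {T : EReal} {w₀ : Metric X} {w : ℝ → Metric X}
    (h : IsSolutionX O α Φ.form (timeInterval T) w₀ w) (h₀ : IsClosedForm (Psi O w₀.form))
    (ht : t ∈ timeInterval T) : IsClosedForm (Psi O (w t).form) := by
  refine isClosedForm_Psi_of_velocity hO h.smooth (fun s hs e he z hz => ?_)
    (by rw [h.init]; exact h₀) ht
  rw [← extDeriv_rhsX_eq_zero α hΦ (w s) he hz]
  exact extDeriv_congr_of_mem e.open_target hz (h.eq s hs e he)

variable {r : ℕ} {V : X → Type*} [∀ x, AddCommGroup (V x)] [∀ x, Module ℂ (V x)]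
  [∀ x, TopologicalSpace (V x)] [TopologicalSpace (Bundle.TotalSpace (Fin r → ℂ) V)]
  [FiberBundle (Fin r → ℂ) V] [VectorBundle ℂ (Fin r → ℂ) V]
  {τ : Bundle.Trivialization (Fin r → ℂ) (π (Fin r → ℂ) V)}

theorem extDeriv_rhsXE_eq_zero [MemTrivializationAtlas τ] (α : ℝ) (w : Metric X)
    (H : HermMetric r V) (he : e ∈ atlas C3 X) (hz : z ∈ dom e τ) :
    extDeriv (rhsXE α (rep e w.form) (hrep e τ H.form)) z = 0 :=
  (w.isPosOn he).extDeriv_rhsXE hz.1 α (H.isMetricOn he) hz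

/-- A bundle frame is only local, but closedness is too: near each point the velocity is compared
with the right-hand side in one trivialization. -/
theorem IsSolutionXE.isClosedForm_Psi (hO : IsHolomorphicVolume O) {α : ℝ} {T : EReal}
    {w₀ : Metric X} {H₀ : HermMetric r V} {w : ℝ → Metric X} {H : ℝ → HermMetric r V}
    (h : IsSolutionXE O α (timeInterval T) w₀ H₀ w H) (h₀ : IsClosedForm (Psi O w₀.form))
    (ht : t ∈ timeInterval T) : IsClosedForm (Psi O (w t).form) := by
  refine isClosedForm_Psi_of_velocity hO h.smooth (fun s hs e he z hz => ?_)
    (by rw [h.init]; exact h₀) ht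
  have hd : z ∈ dom e (trivializationAt (Fin r → ℂ) V (e.symm z)) := mem_dom_trivializationAt hz
  rw [← extDeriv_rhsXE_eq_zero α (w s) (H s) he hd]
  exact extDeriv_congr_of_mem isOpen_dom hd fun y hy => (h.eq s hs e he _ inferInstance y hy).1

end Balanced

/-! ### Limits of flows -/

section Limits

open Matrix Filter

set_option linter.unusedSectionVars false

attribute [local irreducible] wedge

/-- A convergent curve whose velocity converges has velocity tending to zero. -/
theorem eq_zero_of_tendsto_velocity {A : Type*} [NormedAddCommGroup A] [NormedSpace ℝ A]
    {f g : ℝ → A} {l L : A} (hf : ∀ t ∈ Set.Ici (0 : ℝ), HasDerivWithinAt f (g t) (Set.Ici 0) t)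
    (hl : Tendsto f atTop (𝓝 l)) (hL : Tendsto g atTop (𝓝 L)) : L = 0 := by
  -- The increment over unit time tends to zero as `f` converges, while the mean value inequality
  -- applied to `f(s) - s L` shows that it is close to `L`.
  have h1 : Tendsto (fun t => f (t + 1) - f t) atTop (𝓝 0) := by
    simpa using (hl.comp (tendsto_atTop_add_const_right _ 1 tendsto_id)).sub hl
  refine norm_le_zero_iff.1 (le_of_forall_pos_le_add fun ε hε => ?_)
  obtain ⟨a, ha⟩ := eventually_atTop.1 ((Metric.tendsto_nhds.1 hL) (ε / 2) (half_pos hε))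
  obtain ⟨b, hb⟩ := eventually_atTop.1 ((Metric.tendsto_nhds.1 h1) (ε / 2) (half_pos hε))
  let t := max (max a b) 0
  have hat : a ≤ t := (le_max_left a b).trans (le_max_left _ _)
  have hbt : b ≤ t := (le_max_right a b).trans (le_max_left _ _)
  have ht : 0 ≤ t := le_max_right _ _
  have h2 : ∀ s ∈ Set.Icc t (t + 1), HasDerivWithinAt (fun s => f s - s • L) (g s - L)
      (Set.Icc t (t + 1)) s := by
    intro s hs
    have h3 : HasDerivAt (fun s : ℝ => s • L) L s := by
      simpa using (hasDerivAt_id s).smul_const L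
    exact ((hf s (ht.trans hs.1)).mono fun x hx => ht.trans hx.1).sub h3.hasDerivWithinAt
  have h4 := (convex_Icc t (t + 1)).norm_image_sub_le_of_norm_hasDerivWithin_le (C := ε / 2) h2
    (fun s hs => by rw [← dist_eq_norm]; exact (ha s (hat.trans hs.1)).le)
    (Set.left_mem_Icc.2 (by linarith)) (Set.right_mem_Icc.2 (by linarith))
  have h5 : ‖f (t + 1) - f t‖ ≤ ε / 2 := by
    have := (hb t hbt).le
    rwa [dist_zero_right] at this
  have h6 : L = (f (t + 1) - f t) - ((f (t + 1) - (t + 1) • L) - (f t - t • L)) := by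
    rw [_root_.add_smul, one_smul]; abel
  have h7 : ‖L‖ ≤ ‖f (t + 1) - f t‖ + ‖(f (t + 1) - (t + 1) • L) - (f t - t • L)‖ := by
    conv_lhs => rw [h6]
    exact norm_sub_le _ _
  rw [add_sub_cancel_left, norm_one, mul_one] at h4
  linarith

theorem timeInterval_top : timeInterval ⊤ = Set.Ici (0 : ℝ) := by
  ext t
  simp [timeInterval, EReal.coe_lt_top]

/-- Limits of continuous expressions. -/
theorem tendsto_of_contDiffOn {D B : Type*} [NormedAddCommGroup D] [NormedSpace ℝ D]
    [NormedAddCommGroup B] [NormedSpace ℝ B] {L : D → B} {S : Set D} (hL : ContDiffOn ℝ ∞ L S)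
    {j : ℝ → D} {j' : D} (h : Tendsto j atTop (𝓝 j')) (hj : ∀ t, j t ∈ S) (hj' : j' ∈ S) :
    Tendsto (fun t => L (j t)) atTop (𝓝 (L j')) :=
  (hL.continuousOn j' hj').tendsto.comp
    (tendsto_nhdsWithin_iff.2 ⟨h, Eventually.of_forall hj⟩)

/-- `psiN` contains a square root and is smooth only where the determinant is positive. This
condition is open in the space of all `2`-forms, whereas positivity of the form is open only among
real (1,1)-forms. -/
theorem isOpen_det_gram_pos {U : Set C3} (hU : IsOpen U) :
    IsOpen {q : C3 × Alt 2 | q.1 ∈ U ∧ 0 < (gram q.2).det.re} := by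
  have hc : Continuous fun q : C3 × Alt 2 => (gram q.2).det.re :=
    Complex.continuous_re.comp (Continuous.matrix_det (continuous_matrix fun k j =>
      continuous_iff_continuousAt.2 fun q => continuousAt_coeff11 continuousAt_snd k j))
  exact (hU.preimage continuous_fst).inter (isOpen_lt continuous_const hc)

theorem neg_smul_sub_comm {A : Type*} [AddCommGroup A] [Module ℝ A] (c : ℝ) (a b : A) :
    -(c • (a - b)) = c • (b - a) := by
  rw [← smul_neg, neg_sub]

theorem extDeriv_eq_zero_of_tendsto {k : ℕ} {a : ℝ → C3 → Alt k} {b : C3 → Alt k} {z : C3}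
    (h : Tendsto (fun t => fderiv ℝ (a t) z) atTop (𝓝 (fderiv ℝ b z)))
    (h₀ : ∀ t, 0 ≤ t → extDeriv (a t) z = 0) : extDeriv b z = 0 := by
  ext v
  have h2 : Tendsto (fun t => extDeriv (a t) z v) atTop (𝓝 (extDeriv b z v)) := by
    simp only [extDeriv, ContinuousAlternatingMap.alternatizeUncurryFin_apply]
    refine tendsto_finsetSum _ fun i _ => Tendsto.const_smul ?_ _
    exact ((ContinuousAlternatingMap.apply ℝ C3 ℂ (Fin.removeNth i v)).continuous.tendsto _).comp
      (tendsto_apply_clm h (v i))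
  refine tendsto_nhds_unique h2 (tendsto_const_nhds.congr' ?_)
  filter_upwards [eventually_ge_atTop 0] with t ht
  rw [h₀ t ht]

variable {X : Type*} [TopologicalSpace X] [ChartedSpace C3 X] [IsManifold 𝓘(ℂ, C3) ω X]
  {O : DForm X 3} {e e' : OpenPartialHomeomorph X C3} {z : C3} {w : ℝ → Metric X} {w' : Metric X}

theorem MetricTendsto.tendsto_jet2 (h : MetricTendsto w w') (he : e ∈ atlas C3 X)
    (hz : z ∈ e.target) :
    Tendsto (fun t => jet2 (rep e (w t).form) z) atTop (𝓝 (jet2 (rep e w'.form) z)) :=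
  (h e he).tendsto_jet2 hz

theorem Metric.det_gram_rep_pos (w : Metric X) (he : e ∈ atlas C3 X) (hz : z ∈ e.target) :
    0 < (gram (rep e w.form z)).det.re :=
  (Complex.pos_iff.1 (isPos11_iff.1 (rep_isPos11 he hz w.pos)).2.det_pos).1

theorem jet2_Psi (hO : IsHolomorphicVolume O) (w : Metric X) (he : e ∈ atlas C3 X)
    (hz : z ∈ e.target) : jet2 (rep e (Psi O w.form)) z =
      compJet (fun q : C3 × Alt 2 => psiN (volN O e q.1) q.2) (z, jet2 (rep e w.form) z) := by
  have h1 : rep e (Psi O w.form) =ᶠ[𝓝 z] fun y => psiN (volN O e y) (rep e w.form y) := by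
    filter_upwards [e.open_target.mem_nhds hz] with y hy
    exact rep_Psi hO he hy w.pos
  rw [jet2_congr h1]
  refine jet2_comp (Q := fun q : C3 × Alt 2 => psiN (volN O e q.1) q.2) (ContDiffAt.of_le
    ((contDiffOn_psiN ((contDiffOn_volN hO he).comp contDiffOn_fst fun q hq => hq.1) contDiffOn_snd
      fun q hq => hq.2).contDiffAt ((isOpen_det_gram_pos e.open_target).mem_nhds
        ⟨hz, w.det_gram_rep_pos he hz⟩)) (by norm_cast))
    (((w.smooth e he).contDiffAt (e.open_target.mem_nhds hz)).of_le (by norm_cast))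

theorem MetricTendsto.tendsto_jet2_Psi (hO : IsHolomorphicVolume O) (h : MetricTendsto w w')
    (he : e ∈ atlas C3 X) (hz : z ∈ e.target) :
    Tendsto (fun t => jet2 (rep e (Psi O (w t).form)) z) atTop
      (𝓝 (jet2 (rep e (Psi O w'.form)) z)) := by
  simp only [fun w => jet2_Psi hO w he hz]
  refine tendsto_of_contDiffOn (L := fun j => compJet (fun q : C3 × Alt 2 =>
    psiN (volN O e q.1) q.2) (z, j)) (S := {j | 0 < (gram j.1).det.re}) ?_ (h.tendsto_jet2 he hz)
    (fun t => (w t).det_gram_rep_pos he hz) (w'.det_gram_rep_pos he hz)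
  exact contDiffOn_compJet (isOpen_det_gram_pos e.open_target) (contDiffOn_psiN
    ((contDiffOn_volN hO he).comp contDiffOn_fst fun q hq => hq.1) contDiffOn_snd
    fun q hq => hq.2) (contDiffOn_const.prodMk contDiffOn_id) fun j hj => ⟨hz, hj⟩

/-- Limits of balanced metrics are balanced. -/
theorem MetricTendsto.isClosedForm_Psi (hO : IsHolomorphicVolume O) (h : MetricTendsto w w')
    (h₀ : ∀ t, 0 ≤ t → IsClosedForm (Psi O (w t).form)) : IsClosedForm (Psi O w'.form) :=
  fun e he z hz => extDeriv_eq_zero_of_tendsto (h.tendsto_jet2_Psi hO he hz).snd_nhds.fst_nhds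
    fun t ht => h₀ t ht e he z hz

/-- If `‖Ω‖_ω ω²` and its velocity converge, the limit of the velocity is zero. -/
theorem MetricTendsto.eq_zero_of_velocity (hO : IsHolomorphicVolume O) (h : MetricTendsto w w')
    (hw : IsSmoothCurve (timeInterval ⊤) fun s => (w s).form) (he : e ∈ atlas C3 X)
    (hz : z ∈ e.target) {g : ℝ → Alt 4} {L : Alt 4} (hg : ∀ t, 0 ≤ t →
      derivWithin (fun s => rep e (Psi O (w s).form) z) (timeInterval ⊤) t = g t)
    (hL : Tendsto g atTop (𝓝 L)) : L = 0 := by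
  refine eq_zero_of_tendsto_velocity (fun t ht => ?_) (h.tendsto_jet2_Psi hO he hz).fst_nhds hL
  rw [← hg t ht]
  rw [← timeInterval_top] at ht ⊢
  exact ((hw.psi hO).differentiableWithinAt he hz ht).hasDerivWithinAt

theorem contDiffOn_rhsJet_uncurry (α : ℝ) :
    ContDiffOn ℝ ∞ (fun q : Alt 4 × Jet2 (Alt 2) => rhsJet α q.1 q.2) {q | IsPos11 q.2.1} :=
  contDiffOn_rhsJet (D := Alt 4 × Jet2 (Alt 2)) α contDiffOn_fst contDiffOn_snd
    fun _ hq => IsPos11.det_ne_zero hq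

theorem isPos11_jet2 (w : Metric X) (he : e ∈ atlas C3 X) (hz : z ∈ e.target) :
    IsPos11 (jet2 (rep e w.form) z).1 := rep_isPos11 he hz w.pos

theorem tendsto_rhsJet (h : MetricTendsto w w') (he : e ∈ atlas C3 X) (hz : z ∈ e.target) (α : ℝ)
    {φ : ℝ → Alt 4} {φ' : Alt 4} (hφ : Tendsto φ atTop (𝓝 φ')) :
    Tendsto (fun t => rhsJet α (φ t) (jet2 (rep e (w t).form) z)) atTop
      (𝓝 (rhsJet α φ' (jet2 (rep e w'.form) z))) := by
  have h1 : Tendsto (fun t => (φ t, jet2 (rep e (w t).form) z)) atTop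
      (𝓝 (φ', jet2 (rep e w'.form) z)) := hφ.prodMk_nhds (h.tendsto_jet2 he hz)
  have h2 := tendsto_of_contDiffOn (contDiffOn_rhsJet_uncurry α) h1
    (fun t => isPos11_jet2 (w t) he hz) (isPos11_jet2 w' he hz)
  exact h2

/-- The right-hand side is a continuous function of the 2-jet of `ω`, so it converges along the
solution. It is also the velocity of the convergent curve `Ψ`, hence its limit is zero. -/
theorem IsSolutionX.isStationaryX (hO : IsHolomorphicVolume O) {α : ℝ} {Φ : RealForm X 4 2 2}
    (hΦ : IsClosedForm Φ.form) {w₀ : Metric X}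
    (h : IsSolutionX O α Φ.form (timeInterval ⊤) w₀ w) (h₀ : IsClosedForm (Psi O w₀.form))
    (hw : MetricTendsto w w') : IsStationaryX O α Φ.form w' where
  balanced := hw.isClosedForm_Psi hO fun t ht =>
    h.isClosedForm_Psi hO hΦ h₀ (by rw [timeInterval_top]; exact ht)
  anomaly := fun e he z hz => by
    have h1 := hw.eq_zero_of_velocity hO h.smooth he hz (g := fun t =>
      rhsJet α (rep e Φ.form z) (jet2 (rep e (w t).form) z)) (fun t ht => by
        rw [h.eq t (by rw [timeInterval_top]; exact ht) e he z hz,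
          ((w t).isPosOn he).rhsX_eq_rhsJet hz]) (tendsto_rhsJet hw he hz α tendsto_const_nhds)
    rw [← (w'.isPosOn he).rhsX_eq_rhsJet hz] at h1
    exact eq_neg_of_add_eq_zero_left h1

variable {r : ℕ} {V : X → Type*} [∀ x, AddCommGroup (V x)] [∀ x, Module ℂ (V x)]
  [∀ x, TopologicalSpace (V x)] [TopologicalSpace (Bundle.TotalSpace (Fin r → ℂ) V)]
  [FiberBundle (Fin r → ℂ) V] [VectorBundle ℂ (Fin r → ℂ) V]
  [ContMDiffVectorBundle ω (Fin r → ℂ) V 𝓘(ℂ, C3)]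
  {τ : Bundle.Trivialization (Fin r → ℂ) (π (Fin r → ℂ) V)}
  {H : ℝ → HermMetric r V} {H' : HermMetric r V}

theorem HermMetricTendsto.tendsto_jet2 (h : HermMetricTendsto H H') (he : e ∈ atlas C3 X)
    (hτ : MemTrivializationAtlas τ) (hz : z ∈ dom e τ) :
    Tendsto (fun t => jet2 (hrep e τ (H t).form) z) atTop (𝓝 (jet2 (hrep e τ H'.form) z)) :=
  (h e he τ hτ).tendsto_jet2 hz

theorem HermMetricTendsto.tendsto_trSqJet (h : HermMetricTendsto H H') (he : e ∈ atlas C3 X)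
    (hτ : MemTrivializationAtlas τ) (hz : z ∈ dom e τ) :
    Tendsto (fun t => trSqJet (jet2 (hrep e τ (H t).form) z)) atTop
      (𝓝 (trSqJet (jet2 (hrep e τ H'.form) z))) :=
  tendsto_of_contDiffOn (L := fun j : Jet2 (Fin r → Fin r → ℂ) => trSqJet j)
    (S := {j | (of j.1).det ≠ 0}) (contDiffOn_trSqJet contDiffOn_id fun _ hj => hj)
    (h.tendsto_jet2 he hτ hz) (fun t => (posDef_hrep (H t) hz).det_pos.ne')
    (posDef_hrep H' hz).det_pos.ne'

theorem contDiffOn_heatJet_uncurry : ContDiffOn ℝ ∞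
    (fun q : Alt 2 × Jet2 (Fin r → Fin r → ℂ) => heatJet q.1 q.2)
      {q | IsPos11 q.1 ∧ (of q.2.1).PosDef} :=
  contDiffOn_heatJet contDiffOn_fst (fun _ hq => hq.1) contDiffOn_snd fun _ hq => hq.2

theorem posDef_jet2 [τ.IsLinear ℂ] (H : HermMetric r V) (hz : z ∈ dom e τ) :
    (of (jet2 (hrep e τ H.form) z).1).PosDef := posDef_hrep H hz

theorem tendsto_heatJet (hw : MetricTendsto w w') (h : HermMetricTendsto H H')
    (he : e ∈ atlas C3 X) (hτ : MemTrivializationAtlas τ) (hz : z ∈ dom e τ) :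
    Tendsto (fun t => heatJet (rep e (w t).form z) (jet2 (hrep e τ (H t).form) z)) atTop
      (𝓝 (heatJet (rep e w'.form z) (jet2 (hrep e τ H'.form) z))) := by
  have h1 : Tendsto (fun t => (rep e (w t).form z, jet2 (hrep e τ (H t).form) z)) atTop
      (𝓝 (rep e w'.form z, jet2 (hrep e τ H'.form) z)) :=
    (hw.tendsto_jet2 he hz.1).fst_nhds.prodMk_nhds (h.tendsto_jet2 he hτ hz)
  have h2 := tendsto_of_contDiffOn contDiffOn_heatJet_uncurry h1
    (fun t => ⟨rep_isPos11 he hz.1 (w t).pos, posDef_jet2 (H t) hz⟩)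
    ⟨rep_isPos11 he hz.1 w'.pos, posDef_jet2 H' hz⟩
  exact h2

theorem IsSmoothSesqCurve.differentiableWithinAt {J : Set ℝ} {t : ℝ} {K : ℝ → SesqForm V}
    (h : IsSmoothSesqCurve r J K) (he : e ∈ atlas C3 X) (hτ : MemTrivializationAtlas τ)
    (hz : z ∈ dom e τ) (ht : t ∈ J) :
    DifferentiableWithinAt ℝ (fun s => hrep e τ (K s) z) J t := by
  have h1 := (h e he τ hτ).comp (contDiffOn_id.prodMk contDiffOn_const : ContDiffOn ℝ ∞
    (fun s : ℝ => (s, z)) J) fun s hs => ⟨hs, hz⟩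
  exact (h1 t ht).differentiableWithinAt (by simp)

/-- The velocity `-H ΛF` of the convergent curve `H` converges, hence to zero; the limit metric is
invertible, so `ΛF` itself vanishes in the limit. -/
theorem IsSolutionXE.contract_eq_zero {α : ℝ} {w₀ : Metric X} {H₀ : HermMetric r V}
    (h : IsSolutionXE O α (timeInterval ⊤) w₀ H₀ w H) (hw : MetricTendsto w w')
    (hH : HermMetricTendsto H H') (he : e ∈ atlas C3 X) (hτ : MemTrivializationAtlas τ)
    (hz : z ∈ dom e τ) :
    contract (rep e w'.form z) (fun a b => chernCurv (hrep e τ H'.form) a b z) = 0 := by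
  have h1 : heatJet (rep e w'.form z) (jet2 (hrep e τ H'.form) z) = 0 := by
    refine eq_zero_of_tendsto_velocity (f := fun s => hrep e τ (H s).form z) (fun t ht => ?_)
      (hH.tendsto_jet2 he hτ hz).fst_nhds (tendsto_heatJet hw hH he hτ hz)
    rw [← hrep_heatForm_eq_heatJet (w t) (H t) he hz]
    rw [← timeInterval_top] at ht ⊢
    rw [← ((flowEqXE_iff α).1 (h.eq t ht)).2 e he τ hτ z hz]
    exact (h.smooth'.differentiableWithinAt he hτ hz ht).hasDerivWithinAt
  have h2 : of (hrep e τ H'.form z) *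
      contract (rep e w'.form z) (chernJet (jet2 (hrep e τ H'.form) z)) = 0 := by
    ext a b
    exact neg_eq_zero.1 (congrFun (congrFun h1 a) b)
  have hu := isUnit_iff_ne_zero.2 (posDef_hrep H' hz).det_pos.ne'
  rw [(H'.isMetricOn he).contract_eq_chernJet hz, ← Matrix.one_mul (contract _ _),
    ← nonsing_inv_mul _ hu, Matrix.mul_assoc, h2, Matrix.mul_zero]

/-- The Yang–Mills equation is `ΛF = 0` rewritten by `wedge_wedge_self`, the anomaly equation is the
vanishing of the limiting velocity of `Ψ`, and the type condition is automatic. -/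
theorem IsSolutionXE.isStrominger (hO : IsHolomorphicVolume O) {α : ℝ} {w₀ : Metric X}
    {H₀ : HermMetric r V} (h : IsSolutionXE O α (timeInterval ⊤) w₀ H₀ w H)
    (h₀ : IsClosedForm (Psi O w₀.form)) (hw : MetricTendsto w w')
    (hH : HermMetricTendsto H H') : IsStrominger O α w' H' where
  balanced := hw.isClosedForm_Psi hO fun t ht =>
    h.isClosedForm_Psi hO h₀ (by rw [timeInterval_top]; exact ht)
  type := fun e he τ hτ z hz a b u v =>
    ⟨part20_eq_zero ((H'.isMetricOn he).chernCurv_type hz a b) u v,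
      part02_eq_zero ((H'.isMetricOn he).chernCurv_type hz a b) u v⟩
  yangMills := fun e he τ hτ z hz a b => by
    have hp := rep_isPos11 he hz.1 w'.pos
    refine wedge_wedge_self ((H'.isMetricOn he).chernCurv_type hz a b) hp.1.2 hp.det_ne_zero ?_
    rw [← contract_apply (rep e w'.form z) (fun a b => chernCurv (hrep e τ H'.form) a b z) a b,
      h.contract_eq_zero hw hH he hτ hz]
    rfl
  anomaly := fun e he τ hτ z hz => by
    have h1 := hw.eq_zero_of_velocity hO h.smooth he hz.1 (g := fun t =>
      rhsJet α (trSqJet (jet2 (hrep e τ (H t).form) z)) (jet2 (rep e (w t).form) z)) (fun t ht => by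
        rw [(h.eq t (by rw [timeInterval_top]; exact ht) e he τ hτ z hz).1,
          ((w t).isPosOn he).rhsXE_eq_rhsJet hz.1 α ((H t).isMetricOn he) hz])
      (tendsto_rhsJet hw he hz.1 α (hH.tendsto_trSqJet he hτ hz))
    rw [← (w'.isPosOn he).rhsXE_eq_rhsJet hz.1 α (H'.isMetricOn he) hz] at h1
    exact (eq_neg_of_add_eq_zero_left h1).trans (neg_smul_sub_comm α _ _)

end Limits

end AnomalyFlow

/-! ### The theorem -/

open AnomalyFlow
theorem theorem1 {X : Type*} [TopologicalSpace X] [T2Space X] [CompactSpace X]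
    [ChartedSpace C3 X] [IsManifold 𝓘(ℂ, C3) ω X]
    {r : ℕ} {V : X → Type*} [∀ x, AddCommGroup (V x)] [∀ x, Module ℂ (V x)]
    [∀ x, TopologicalSpace (V x)] [TopologicalSpace (Bundle.TotalSpace (Fin r → ℂ) V)]
    [FiberBundle (Fin r → ℂ) V] [VectorBundle ℂ (Fin r → ℂ) V]
    [ContMDiffVectorBundle ω (Fin r → ℂ) V 𝓘(ℂ, C3)]
    (O : DForm X 3) (hO : IsHolomorphicVolume O) (α : ℝ) (hα : 0 < α)
    (Φ : RealForm X 4 2 2) (hΦ : IsClosedForm Φ.form) :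
    -- the metric and the positive (2,2)-form determine each other, by local expressions
    ((∀ w : Metric X, ∃! P : PosForm X, P.form = Psi O w.form) ∧
      (∀ P : PosForm X, ∃! w : Metric X, P.form = Psi O w.form) ∧
      (∀ e ∈ atlas C3 X, ∃ L : C3 × Alt 4 → Alt 2,
        ContDiffOn ℝ ∞ L {p | p.1 ∈ e.target ∧ IsPos22 p.2} ∧
        ∀ w : Metric X, ∀ z ∈ e.target, rep e w.form z = L (z, rep e (Psi O w.form) z))) ∧
    -- the flows are the flows of unique vector fields, which are local
    ((∃ v : Metric X → RealForm X 2 1 1, IsFlowFieldX O α Φ.form v ∧ IsLocalFieldX v ∧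
        ∀ v', IsFlowFieldX O α Φ.form v' → v' = v) ∧
      (∃ v : PosForm X → RealForm X 4 2 2, IsFormFlowFieldX O α Φ.form v ∧
        IsLocalFormFieldX v ∧ ∀ v', IsFormFlowFieldX O α Φ.form v' → v' = v) ∧
      (∃ v : Metric X × HermMetric r V → RealForm X 2 1 1 × HermForm r V,
        IsFlowFieldXE O α v ∧ IsLocalFieldXE v ∧ ∀ v', IsFlowFieldXE O α v' → v' = v) ∧
      (∃ v : PosForm X × HermMetric r V → RealForm X 4 2 2 × HermForm r V,
        IsFormFlowFieldXE O α v ∧ IsLocalFormFieldXE v ∧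
        ∀ v', IsFormFlowFieldXE O α v' → v' = v)) ∧
    -- the right-hand sides are closed and the balanced condition is preserved
    ((∀ w : Metric X, ∀ e ∈ atlas C3 X, ∀ z ∈ e.target,
        extDeriv (rhsX α (rep e Φ.form) (rep e w.form)) z = 0) ∧
      (∀ (w : Metric X) (H : HermMetric r V), ∀ e ∈ atlas C3 X,
        ∀ τ : Bundle.Trivialization (Fin r → ℂ) (π (Fin r → ℂ) V), MemTrivializationAtlas τ →
          ∀ z ∈ dom e τ, extDeriv (rhsXE α (rep e w.form) (hrep e τ H.form)) z = 0) ∧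
      (∀ (T : EReal) (w₀ : Metric X) (w : ℝ → Metric X),
        IsSolutionX O α Φ.form (timeInterval T) w₀ w → IsClosedForm (Psi O w₀.form) →
        ∀ t ∈ timeInterval T, IsClosedForm (Psi O (w t).form)) ∧
      (∀ (T : EReal) (w₀ : Metric X) (H₀ : HermMetric r V) (w : ℝ → Metric X)
        (H : ℝ → HermMetric r V), IsSolutionXE O α (timeInterval T) w₀ H₀ w H →
        IsClosedForm (Psi O w₀.form) →
        ∀ t ∈ timeInterval T, IsClosedForm (Psi O (w t).form))) ∧
    -- limits of flows that exist for all time are stationary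
    ((∀ (w₀ : Metric X) (H₀ : HermMetric r V) (w : ℝ → Metric X) (H : ℝ → HermMetric r V)
        (w' : Metric X) (H' : HermMetric r V),
        IsSolutionXE O α (timeInterval ⊤) w₀ H₀ w H → IsClosedForm (Psi O w₀.form) →
        MetricTendsto w w' → HermMetricTendsto H H' → IsStrominger O α w' H') ∧
      (∀ (w₀ : Metric X) (w : ℝ → Metric X) (w' : Metric X),
        IsSolutionX O α Φ.form (timeInterval ⊤) w₀ w → IsClosedForm (Psi O w₀.form) →
        MetricTendsto w w' → IsStationaryX O α Φ.form w')) :=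
  ⟨metric_posForm_bijection hO,
    ⟨⟨_, isFlowFieldX hO α Φ, isLocalFieldX hO α Φ, fun _ h => (isFlowFieldX hO α Φ).unique h⟩,
      ⟨_, isFormFlowFieldX hO α Φ, isLocalFormFieldX hO α Φ, fun _ h => h.unique hO⟩,
      ⟨_, isFlowFieldXE hO α, isLocalFieldXE hO α, fun _ h => (isFlowFieldXE hO α).unique h⟩,
      ⟨_, isFormFlowFieldXE hO α, isLocalFormFieldXE hO α, fun _ h => h.unique hO⟩⟩,
    ⟨fun w _ he _ hz => extDeriv_rhsX_eq_zero α hΦ w he hz,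
      fun w H _ he _ _ _ hz => extDeriv_rhsXE_eq_zero α w H he hz,
      fun _ _ _ h h₀ _ ht => h.isClosedForm_Psi hO hΦ h₀ ht,
      fun _ _ _ _ _ h h₀ _ ht => h.isClosedForm_Psi hO h₀ ht⟩,
    fun _ _ _ _ _ _ h h₀ hw hH => h.isStrominger hO h₀ hw hH,
    fun _ _ _ h h₀ hw => h.isStationaryX hO hΦ h₀ hw⟩
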